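/- **Setting.** Fix an integer $M\ge 2$. For $j_{\max}\in\mathbb N$ put $N=M^{j_{\max}}$; all momenta below lie in $[-N,N]\subset\mathbb Z$ and operators act on $\mathcal H^\otimes=\mathcal H_1\otimes\dots\otimes\mathcal H_4$ with basis indexed by $n=(n_1,\dots,n_4)\in[-N,N]^4$, $\|n\|^2=\sum_c n_c^2$. Let $C$ be diagonal with entries $1/(\|n\|^2+1)$; for $j\ge1$ let $\mathbb 1_{\le j}$ be the diagonal projector on $1+\|n\|^2\le M^{2j}$, $\mathbb 1_{\le 0}=0$, and $C^{1/2}_{\le j}=\mathbb 1_{\le j}C^{1/2}$. For $\rho>0$ let $\mathrm{Card}_\rho=\{g\in\mathbb C:\ |\arg g|<\pi,\ |g|<\rho\cos^2(\tfrac12\arg g)\}$ and $\lambda=\sqrt g$ (principal root). Let $a_1(k)=\sum_{p\in\mathbb Z^3}\big(\tfrac1{k^2+p^2+1}-\tfrac1{p^2+1}\big)$, and let $A_1,A_2$ be the diagonal operators with entries $\sum_c a_1(n_c)$ and $\sum_c\big(a_2(n_c)+3\,a_2'(n_c)\big)$, where $$a_2(k)=\sum_{q\in\mathbb Z^3}\Big(\tfrac{a_1(k)}{(k^2+q^2+1)^2}-\tfrac{a_1(0)}{(q^2+1)^2}\Big),\qquad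 a_2'(k)=\sum_{q\in\mathbb Z^3}a_1(q_1)\Big(\tfrac1{(k^2+q^2+1)^2}-\tfrac1{(q^2+1)^2}\Big).$$ For Hermitian matrices $\vec\sigma=(\sigma_1,\dots,\sigma_4)$ indexed by $[-N,N]$ let $\sigma=\sum_c\sigma_c\otimes\mathbb 1_{\hat c}$, $\Sigma_{\le j}=i\lambda C_{\le j}^{1/2}\sigma C_{\le j}^{1/2}$, $B_1=i\lambda A_1$, $B_2=-i\lambda^3A_2$, $D_{k,\le j}=i\lambda C_{\le j}^{1/2}B_kC_{\le j}^{1/2}$ $(k=1,2)$, $U_{\le j}=\Sigma_{\le j}+D_{1,\le j}+D_{2,\le j}$. With $\log_3(1-x)=x+\tfrac{x^2}2+\log(1-x)$ and $\operatorname{Tr}\log(\mathbb 1-U)=-\int_0^1\operatorname{Tr}[U(\mathbb 1-tU)^{-1}]\,dt$, put $$V^{\ge3}_{\le j}=\operatorname{Tr}\log_3(\mathbb 1-U_{\le j})+\operatorname{Tr}[D_{1,\le j}\Sigma_{\le j}^2]+\operatorname{Tr}\big[\tfrac13D_{1,\le j}^3+D_{1,\le j}^2D_{2,\le j}+\tfrac14D_{1,\le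 j}^4\big].$$ Let $\lambda^2\,\vec\sigma\cdot Q_{\le j}\vec\sigma=-\operatorname{Tr}[\Sigma_{\le j}^2(\mathbb 1+2D_{1,\le j})]$, and let $Q_{0,\le j}$ be diagonal in the colour $c$ and the momenta $(m,n)$, with entry $\sum_{p\in[-N,N]^3}C_{\le j}(m,p)\,C_{\le j}(n,p)$; put $Q_{1,\le j}=Q_{\le j}-Q_{0,\le j}$. For each quantity $F_{\le j}$ write $F_j=F_{\le j}-F_{\le j-1}$. Let $d\nu_{\mathbb I}$ be the law of four independent GUE matrices of covariance $1$, i.e. $\mathbb E[(\sigma_c)_{mn}(\sigma_c)_{kl}]=\delta_{ml}\delta_{nk}$; for a quadratic form $F$ in $\vec\sigma$ let ${:}F{:}=F-\int F\,d\nu_{\mathbb I}$. Finally $$\widetilde V^{\le2}_j=\tfrac{\lambda^2}2{:}\vec\sigma\cdot Q_{1,j}\vec\sigma{:}-\big(\operatorname{Tr}[D_{2,\le j}\Sigma_{\le j}]-\operatorname{Tr}[D_{2,\le j-1}\Sigma_{\le j-1}]\big),\qquad V_j=V^{\ge3}_j+\tfrac{\lambda^2}2{:}\vec\sigma\cdot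 Q_{0,j}\vec\sigma{:}+\widetilde V^{\le2}_j .$$ A *block* $\mathcal B$ is a finite set of nodes carrying a tree with vertex set $\mathcal B$, parameters $w_\ell\in[0,1]$ on its edges, and pairwise distinct scales $j_a\in\{1,\dots,j_{\max}\}$, $a\in\mathcal B$. Let $X_{ab}(w)$ be the infimum of the $w_\ell$ along the path from $a$ to $b$ in the tree ($X_{aa}=1$), and let $d\nu_{\mathcal B}$ be the centred Gaussian law of the family of replicas $(\vec\sigma^a)_{a\in\mathcal B}$ with covariance $\mathbb I\otimes X(w)$. Put $\delta_{\mathcal N_2,\mathcal B}(w)=-\tfrac{\lambda^4}4\sum_{a,b\in\mathcal B}X_{ab}^2\operatorname{Tr}[Q_{0,j_a}Q_{0,j_b}]$ and, for $s\in\{1,-1\}$, $$I^{NP}_{\mathcal B}=\big|e^{\delta_{\mathcal N_2,\mathcal B}(w)}\big|\Big(\int d\nu_{\mathcal B}\prod_{a}e^{4|V^{\ge3}_{j_a}(\vec\sigma^a)|}\Big)^{\frac14}\Big(\int d\nu_{\mathcal B}\prod_ae^{2s\Re(\lambda^2)\,{:}\vec\sigma^a\cdot Q_{0,j_a}\vec\sigma^a{:}}\Big)^{\frac14}\Big(\int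 d\nu_{\mathcal B}\prod_ae^{-4\Re\widetilde V^{\le2}_{j_a}(\vec\sigma^a)}\Big)^{\frac14}.$$ **Theorem.** For every integer $M\ge2$ there are constants $\rho_0,K_1,K_2>0$ such that for all $0<\rho\le\rho_0$, all $g\in\mathrm{Card}_\rho$ and all $j_{\max}$: 1. for every block $\mathcal B$ with $|\mathcal B|\ge2$ (any tree, any parameters $w$, any distinct scales) and both signs $s$, the three integrals in $I^{NP}_{\mathcal B}$ converge and $$I^{NP}_{\mathcal B}\le K_1\,e^{K_2\rho^{3/2}|\mathcal B|};$$ 2. for a single isolated node $a$ of scale $j_a\in\{1,\dots,j_{\max}\}$, the function $e^{-V_{j_a}}-1$ is integrable with respect to $d\nu_{\mathbb I}$ and $$\Big|\int d\nu_{\mathbb I}(\vec\sigma)\,\big(e^{-V_{j_a}(\vec\sigma)}-1\big)\Big|\le K_1\rho^{3/2};$$ the same bound holds for $\int d\nu_{\mathbb I}\,\big(e^{\delta_a-V_{j_a}(\vec\sigma)}-1\big)$, with $\delta_a=-\tfrac{\lambda^4}4\operatorname{Tr}[Q_{0,j_a}^2]$. -/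

import Mathlib

open MeasureTheory ProbabilityTheory
open scoped Kronecker

noncomputable section

namespace TensorT44

/-! ### Momentum modes, propagator and sharp cutoffs -/

/-- One-strand momenta `m ∈ [-N, N]`. -/
abbrev Mode (N : ℕ) : Type := ↥(Finset.Icc (-(N : ℤ)) (N : ℤ))

/-- Four-strand momenta `n = (n₁, n₂, n₃, n₄)`, the basis of `H^⊗`. -/
abbrev MultiMode (N : ℕ) : Type := Fin 4 → Mode N

/-- Operators on `H^⊗` in the momentum basis. -/
abbrev Op (N : ℕ) : Type := Matrix (MultiMode N) (MultiMode N) ℂ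

/-- A collection `(σ₁, σ₂, σ₃, σ₄)` of matrices, one for each colour. -/
abbrev MatField (N : ℕ) : Type := Fin 4 → Matrix (Mode N) (Mode N) ℂ

/-- `‖n‖² = n₁² + n₂² + n₃² + n₄²`. -/
def sqNorm {N : ℕ} (n : MultiMode N) : ℝ := ∑ c, (((n c : ℤ)) : ℝ) ^ 2

/-- `p₁² + p₂² + p₃²`. -/
def sqNorm3 (p : Fin 3 → ℤ) : ℝ := ∑ i, ((p i : ℤ) : ℝ) ^ 2

/-- The cutoff `𝟙_{≤ j}` as a function of `s = ‖n‖²`: it is `1` if `1 + s ≤ M^{2j}` and `0`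
otherwise; by convention `𝟙_{≤ 0} = 0`, so that the first slice contains every `n` with
`1 + ‖n‖² ≤ M²`. -/
def cutoff (M j : ℕ) (s : ℝ) : ℝ := if 1 ≤ j ∧ 1 + s ≤ (M : ℝ) ^ (2 * j) then 1 else 0

/-- The cut propagator `C_{≤ j}` as a function of `s = ‖n‖²`. -/
def cutProp (M j : ℕ) (s : ℝ) : ℝ := cutoff M j s * (1 / (s + 1))

/-- The operator `C_{≤ j}^{1/2}`. -/
def sqrtC (N M j : ℕ) : Op N :=
  Matrix.diagonal fun n => ((Real.sqrt (cutProp M j (sqNorm n)) : ℝ) : ℂ)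

/-! ### Renormalized amplitudes of the two divergent two-point graphs -/

/-- `a₁(k) = ∑_{p ∈ ℤ⁴} (δ(p_c - k) - δ(p_c)) / (p² + 1)`, the sum over `p_c` being performed. -/
def a1 (k : ℤ) : ℝ :=
  ∑' p : Fin 3 → ℤ, (1 / ((k : ℝ) ^ 2 + sqNorm3 p + 1) - 1 / (sqNorm3 p + 1))

/-- `∑_{q ∈ ℤ⁴} a₁(q_c) (δ(q_c - k) - δ(q_c)) / (q² + 1)²`, the sum over `q_c` being performed:
the tadpole is inserted on the external strand. -/
def a2Same (k : ℤ) : ℝ :=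
  ∑' q : Fin 3 → ℤ, (a1 k / ((k : ℝ) ^ 2 + sqNorm3 q + 1) ^ 2 - a1 0 / (sqNorm3 q + 1) ^ 2)

/-- `∑_{q ∈ ℤ⁴} a₁(q_{c'}) (δ(q_c - k) - δ(q_c)) / (q² + 1)²` for `c' ≠ c` (it does not depend on
the choice of `c'`), the sum over `q_c` being performed. -/
def a2Other (k : ℤ) : ℝ :=
  ∑' q : Fin 3 → ℤ,
    a1 (q 0) * (1 / ((k : ℝ) ^ 2 + sqNorm3 q + 1) ^ 2 - 1 / (sqNorm3 q + 1) ^ 2)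

/-- The renormalized amplitude of the tadpole `𝓜₁`, an operator diagonal in the momentum basis. -/
def ampM1 (N : ℕ) : Op N := Matrix.diagonal fun n => ((∑ c, a1 (n c) : ℝ) : ℂ)

/-- The renormalized amplitude of `𝓜₂`, an operator diagonal in the momentum basis. -/
def ampM2 (N : ℕ) : Op N :=
  Matrix.diagonal fun n => ((∑ c, (a2Same (n c) + 3 * a2Other (n c)) : ℝ) : ℂ)

/-! ### Coupling constant and operators of the intermediate field representation -/

/-- The cardioid domain `|arg g| < π`, `|g| < ρ cos² (arg g / 2)`. -/
def cardioid (ρ : ℝ) : Set ℂ :=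
  {g | |g.arg| < Real.pi ∧ ‖g‖ < ρ * Real.cos (g.arg / 2) ^ 2}

/-- `λ`, the principal square root of `g`. -/
def lam (g : ℂ) : ℂ := g ^ (1 / 2 : ℂ)

/-- The operator `σ = ∑_c σ_c ⊗ 𝟙_{ĉ}` on `H^⊗`. -/
def sigmaOp {N : ℕ} (σ : MatField N) : Op N :=
  fun m n => ∑ c, if ∀ c', c' ≠ c → m c' = n c' then σ c (m c) (n c) else 0

/-- `Σ_{≤ j} = i λ C_{≤ j}^{1/2} σ C_{≤ j}^{1/2}`. -/
def Sig {N : ℕ} (M j : ℕ) (g : ℂ) (σ : MatField N) : Op N :=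
  (Complex.I * lam g) • (sqrtC N M j * sigmaOp σ * sqrtC N M j)

/-- `B₁ = i λ A^r_{𝓜₁}`. -/
def B1 (N : ℕ) (g : ℂ) : Op N := (Complex.I * lam g) • ampM1 N

/-- `B₂ = - i λ³ A^r_{𝓜₂}`. -/
def B2 (N : ℕ) (g : ℂ) : Op N := (-(Complex.I * lam g ^ 3)) • ampM2 N

/-- `D_{1, ≤ j} = i λ C_{≤ j}^{1/2} B₁ C_{≤ j}^{1/2}`. -/
def D1 (N M j : ℕ) (g : ℂ) : Op N :=
  (Complex.I * lam g) • (sqrtC N M j * B1 N g * sqrtC N M j)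

/-- `D_{2, ≤ j} = i λ C_{≤ j}^{1/2} B₂ C_{≤ j}^{1/2}`. -/
def D2 (N M j : ℕ) (g : ℂ) : Op N :=
  (Complex.I * lam g) • (sqrtC N M j * B2 N g * sqrtC N M j)

/-- `U_{≤ j} = Σ_{≤ j} + D_{1, ≤ j} + D_{2, ≤ j}`. -/
def U {N : ℕ} (M j : ℕ) (g : ℂ) (σ : MatField N) : Op N :=
  Sig M j g σ + D1 N M j g + D2 N M j g

/-- `Tr log (𝟙 - U) = - ∫₀¹ Tr [U (𝟙 - t U)⁻¹] dt` (the branch vanishing at `U = 0`). -/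
def trLogOneSub {N : ℕ} (A : Op N) : ℂ :=
  -∫ t in (0 : ℝ)..1, (A * (1 - (t : ℂ) • A)⁻¹).trace

/-- `Tr log₃ (𝟙 - U)`, where `log₃ (1 - x) = x + x² / 2 + log (1 - x)`. -/
def trLog3 {N : ℕ} (A : Op N) : ℂ := A.trace + (1 / 2) * (A ^ 2).trace + trLogOneSub A

/-! ### The interaction -/

/-- The vacuum counterterms `𝓔_{≤ j} = Tr (D₁³ / 3 + D₁² D₂ + D₁⁴ / 4)`. -/
def lastVac (N M j : ℕ) (g : ℂ) : ℂ :=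
  (1 / 3) * (D1 N M j g ^ 3).trace + (D1 N M j g ^ 2 * D2 N M j g).trace
    + (1 / 4) * (D1 N M j g ^ 4).trace

/-- `V^{≥ 3}_{≤ j}(σ) = Tr log₃ (𝟙 - U_{≤ j}) + Tr [D_{1, ≤ j} Σ_{≤ j}²] + 𝓔_{≤ j}`. -/
def VGe3Le {N : ℕ} (M j : ℕ) (g : ℂ) (σ : MatField N) : ℂ :=
  trLog3 (U M j g σ) + (D1 N M j g * Sig M j g σ ^ 2).trace + lastVac N M j g

/-- `V^{≥ 3}_j = V^{≥ 3}_{≤ j} - V^{≥ 3}_{≤ j - 1}`, for `j ≥ 1`. -/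
def VGe3 {N : ℕ} (M j : ℕ) (g : ℂ) (σ : MatField N) : ℂ :=
  VGe3Le M j g σ - VGe3Le M (j - 1) g σ

/-- `λ² σ·Q_{≤ j} σ`, with `Q_{≤ j}` defined by
`λ² σ·Q_{≤ j} σ = - Tr [Σ_{≤ j}² (𝟙 + 2 D_{1, ≤ j})]`. -/
def lamSqQLe {N : ℕ} (M j : ℕ) (g : ℂ) (σ : MatField N) : ℂ :=
  -(Sig M j g σ ^ 2 * (1 + 2 • D1 N M j g)).trace

/-- The diagonal coefficient of `Q_{0, ≤ j}` at colour `c` and momenta `(m, n)`; it is the same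
for the four colours. -/
def q0Le {N : ℕ} (M j : ℕ) (m n : Mode N) : ℝ :=
  ∑ p : Fin 3 → Mode N,
    cutProp M j (((m : ℤ) : ℝ) ^ 2 + sqNorm3 fun i => (p i : ℤ)) *
      cutProp M j (((n : ℤ) : ℝ) ^ 2 + sqNorm3 fun i => (p i : ℤ))

/-- The diagonal coefficient of `Q_{0, j} = Q_{0, ≤ j} - Q_{0, ≤ j - 1}`. -/
def q0 {N : ℕ} (M j : ℕ) (m n : Mode N) : ℝ := q0Le M j m n - q0Le M (j - 1) m n

/-- `σ·Q_{0, j} σ`. -/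
def quadQ0 {N : ℕ} (M j : ℕ) (σ : MatField N) : ℝ :=
  ∑ c, ∑ m, ∑ n, q0 M j m n * ‖σ c m n‖ ^ 2

/-- `λ² σ·Q_{1, j} σ`, where `Q_{1, j} = Q_j - Q_{0, j}` and `Q_j = Q_{≤ j} - Q_{≤ j - 1}`. -/
def lamSqQ1 {N : ℕ} (M j : ℕ) (g : ℂ) (σ : MatField N) : ℂ :=
  lamSqQLe M j g σ - lamSqQLe M (j - 1) g σ - lam g ^ 2 * (quadQ0 M j σ : ℂ)

/-- `Tr [Q_{0, j} Q_{0, k}]`, the trace being over colours and pairs of momenta. -/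
def traceQ0Q0 (N M j k : ℕ) : ℝ :=
  ∑ _c : Fin 4, ∑ m : Mode N, ∑ n : Mode N, q0 M j m n * q0 M k m n

/-! ### Gaussian measures -/

/-- Real orthonormal coordinates of four Hermitian matrices. -/
abbrev Coord (N : ℕ) : Type := Fin 4 × Mode N × Mode N

/-- The Hermitian matrices with coordinates `x`: if the `x (c, m, n)` are independent standard
real Gaussian variables, the `σ_c` are independent matrices with the GUE law of covariance `1`,
`𝔼 [(σ_c)_{mn} (σ_c)_{kl}] = δ_{ml} δ_{nk}`. -/
def toField {N : ℕ} (x : Coord N → ℝ) : MatField N :=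
  fun c => Matrix.of fun m n =>
    (1 + Complex.I) / 2 * (x (c, m, n) : ℂ) + (1 - Complex.I) / 2 * (x (c, n, m) : ℂ)

theorem toField_isHermitian {N : ℕ} (x : Coord N → ℝ) (c : Fin 4) :
    (toField x c).IsHermitian := by
  ext m n
  simp only [toField, Matrix.conjTranspose_apply, Matrix.of_apply, RCLike.star_def, map_add,
    map_mul, map_div₀, map_sub, map_one, Complex.conj_I, Complex.conj_ofReal, map_ofNat]
  ring

/-- The measure `dν_𝕀(σ)`, in coordinates. -/
def nuStd (N : ℕ) : Measure (EuclideanSpace ℝ (Coord N)) :=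
  stdGaussian (EuclideanSpace ℝ (Coord N))

/-- The matrix `X_{ab}(w)`: the infimum of the parameters `w_ℓ` over the edges `ℓ` of the unique
path from `a` to `b` in the tree `T`, and `1` if `a = b`. -/
def interpX {B : Type} {T : SimpleGraph B} (hT : T.IsTree) (w : Sym2 B → ℝ) : Matrix B B ℝ :=
  fun a b => ((hT.existsUnique_path a b).choose.edges.map w).foldr min 1

/-- The measure `dν_𝓑` on `(σ^a)_{a ∈ 𝓑}` with covariance `X ⊗ 𝕀`, in coordinates. -/
def nuBlock {B : Type} [Fintype B] [DecidableEq B] (N : ℕ) (X : Matrix B B ℝ) :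
    Measure (EuclideanSpace ℝ (B × Coord N)) :=
  multivariateGaussian 0 (X ⊗ₖ (1 : Matrix (Coord N) (Coord N) ℝ))

/-- The replica `σ^a`. -/
def replica {B : Type} {N : ℕ} (x : EuclideanSpace ℝ (B × Coord N)) (a : B) : MatField N :=
  toField fun s => x (a, s)

/-- Wick ordering `:F: = F - ∫ F dν_𝕀` of a quadratic form `F` in `σ`. -/
def wick {N : ℕ} {E : Type} [NormedAddCommGroup E] [NormedSpace ℝ E] (F : MatField N → E)
    (σ : MatField N) : E :=
  F σ - ∫ x, F (toField fun s => x s) ∂(nuStd N)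

/-- `Ṽ^{≤ 2}_j(σ) = (λ² / 2) :σ·Q_{1, j} σ: - (Tr [D_{2, ≤ j} Σ_{≤ j}] - Tr [D_{2, ≤ j - 1}
Σ_{≤ j - 1}])`. -/
def VTildeLe2 {N : ℕ} (M j : ℕ) (g : ℂ) (σ : MatField N) : ℂ :=
  (1 / 2) * wick (lamSqQ1 M j g) σ
    - ((D2 N M j g * Sig M j g σ).trace - (D2 N M (j - 1) g * Sig M (j - 1) g σ).trace)

/-- `V_j(σ) = V^{≥ 3}_j(σ) + (λ² / 2) :σ·Q_{0, j} σ: + Ṽ^{≤ 2}_j(σ)`. -/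
def V {N : ℕ} (M j : ℕ) (g : ℂ) (σ : MatField N) : ℂ :=
  VGe3 M j g σ + lam g ^ 2 / 2 * ((wick (quadQ0 M j) σ : ℝ) : ℂ) + VTildeLe2 M j g σ

/-! ### Non-perturbative factor of a block -/

section Block

variable {B : Type} [Fintype B]

/-- `δ_{𝓝₂, 𝓑}(w) = - (λ⁴ / 4) ∑_{a, b ∈ 𝓑} X_{ab}² Tr [Q_{0, j_a} Q_{0, j_b}]`. -/
def deltaN2 (N M : ℕ) (g : ℂ) (X : Matrix B B ℝ) (j : B → ℕ) : ℂ :=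
  -(lam g ^ 4 / 4) * ((∑ a, ∑ b, X a b ^ 2 * traceQ0Q0 N M (j a) (j b) : ℝ) : ℂ)

/-- `∏_a exp (4 |V^{≥ 3}_{j_a}(σ^a)|)`. -/
def expVGe3 {N : ℕ} (M : ℕ) (g : ℂ) (j : B → ℕ) (x : EuclideanSpace ℝ (B × Coord N)) : ℝ :=
  ∏ a, Real.exp (4 * ‖VGe3 M (j a) g (replica x a)‖)

/-- `∏_a exp (2 s Re (λ²) :σ^a·Q_{0, j_a} σ^a:)`. -/
def expQ0 {N : ℕ} (M : ℕ) (g : ℂ) (s : ℝ) (j : B → ℕ) (x : EuclideanSpace ℝ (B × Coord N)) : ℝ :=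
  ∏ a, Real.exp (2 * s * (lam g ^ 2).re * wick (quadQ0 M (j a)) (replica x a))

/-- `∏_a exp (- 4 Re Ṽ^{≤ 2}_{j_a}(σ^a))`. -/
def expVTilde {N : ℕ} (M : ℕ) (g : ℂ) (j : B → ℕ) (x : EuclideanSpace ℝ (B × Coord N)) : ℝ :=
  ∏ a, Real.exp (-4 * (VTildeLe2 M (j a) g (replica x a)).re)

/-- The non-perturbative factor `I^{NP}_𝓑`, with the sign `s` in front of `2 Re (λ²)`. -/
def INP [DecidableEq B] (N M : ℕ) (g : ℂ) (s : ℝ) (X : Matrix B B ℝ) (j : B → ℕ) : ℝ :=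
  ‖Complex.exp (deltaN2 N M g X j)‖
    * (∫ x, expVGe3 M g j x ∂(nuBlock N X)) ^ (1 / 4 : ℝ)
    * (∫ x, expQ0 M g s j x ∂(nuBlock N X)) ^ (1 / 4 : ℝ)
    * (∫ x, expVTilde M g j x ∂(nuBlock N X)) ^ (1 / 4 : ℝ)

end Block

end TensorT44

end

namespace TensorT44

open Finset hiding Icc
open Real
open Set (Icc)
open Function (update update_self update_of_ne)
open Filter (Eventually)
open Matrix (conjTranspose_apply diag_apply diagonal diagonal_add diagonal_apply_eq
  diagonal_apply_ne diagonal_conjTranspose diagonal_mul diagonal_mul_diagonal diagonal_one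
  diagonal_pow diagonal_smul isUnit_iff_isUnit_det mul_diagonal mul_nonsing_inv of_apply one_mulVec
  trace_add trace_diagonal trace_mul_comm trace_smul trace_sub transpose_apply)
open Complex (abs_re_le_norm div_ofNat_re norm_I norm_real ofReal_im ofReal_mul ofReal_one
  ofReal_pow ofReal_re ofReal_sub ofReal_sum re_le_norm re_mul_ofReal sub_re)

/-! ### One-dimensional sums -/

/-- The bracket `max 1 |m|` of an integer. -/
noncomputable def brk (m : ℤ) : ℝ := max 1 |(m : ℝ)|

theorem one_le_brk (m : ℤ) : 1 ≤ brk m := le_max_left _ _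

theorem brk_pos (m : ℤ) : 0 < brk m := zero_lt_one.trans_le (one_le_brk m)

theorem abs_le_brk (m : ℤ) : |(m : ℝ)| ≤ brk m := le_max_right _ _

theorem brk_sq_le (m : ℤ) : brk m ^ 2 ≤ 1 + (m : ℝ) ^ 2 := by
  unfold brk
  rcases max_cases 1 |(m : ℝ)| with h | h
  · rw [h.1]; nlinarith [sq_nonneg (m : ℝ)]
  · rw [h.1, sq_abs]; linarith

/-- A sum over integers of an even function in terms of natural numbers. -/
theorem sum_int_le_two_mul (f : ℕ → ℝ) (hf : ∀ n, 0 ≤ f n) (s : Finset ℤ) (t : Finset ℕ)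
    (hst : ∀ m ∈ s, m.natAbs ∈ t) : ∑ m ∈ s, f m.natAbs ≤ 2 * ∑ n ∈ t, f n := by
  classical
  have h1 : ∑ m ∈ s, f m.natAbs = ∑ n ∈ t, ∑ m ∈ s with m.natAbs = n, f m.natAbs :=
    (sum_fiberwise_of_maps_to hst _).symm
  rw [h1, mul_sum]
  refine sum_le_sum fun n _ => ?_
  have h2 : ∑ m ∈ s with m.natAbs = n, f m.natAbs = ∑ m ∈ s with m.natAbs = n, f n :=
    sum_congr rfl fun m hm => by rw [(mem_filter.1 hm).2]
  rw [h2, sum_const, nsmul_eq_mul]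
  refine mul_le_mul_of_nonneg_right ?_ (hf n)
  have h3 : (s.filter fun m => m.natAbs = n) ⊆ {(n : ℤ), -(n : ℤ)} := by
    intro m hm
    have := (mem_filter.1 hm).2
    simp only [mem_insert, mem_singleton]
    omega
  exact_mod_cast (card_le_card h3).trans card_le_two

theorem brk_eq_natAbs (m : ℤ) : brk m = max 1 (m.natAbs : ℝ) := by
  unfold brk; rw [Nat.cast_natAbs]; simp

/-- `∑_{n ≤ L} max(1, n)^{-α} ≤ K L^{1 - α}` for `0 ≤ α < 1`. -/
theorem exists_sum_range_rpow_le {α : ℝ} (h0 : 0 ≤ α) (h1 : α < 1) :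
    ∃ K : ℝ, 0 < K ∧ ∀ L : ℕ, 1 ≤ L →
      ∑ n ∈ range (L + 1), (max 1 (n : ℝ)) ^ (-α) ≤ K * (L : ℝ) ^ (1 - α) := by
  have hpos : (0 : ℝ) < 1 - α := by linarith
  refine ⟨2 / (1 - α), by positivity, fun L hL => ?_⟩
  induction L, hL using Nat.le_induction with
  | base =>
    norm_num [sum_range_succ]
    rw [le_div_iff₀ hpos]; linarith
  | succ L hL ih =>
    rw [sum_range_succ]
    have hL' : (1 : ℝ) ≤ L := by exact_mod_cast hL
    have hmax : max 1 ((L + 1 : ℕ) : ℝ) = (L : ℝ) + 1 := by push_cast; exact max_eq_right (by linarith)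
    rw [hmax]
    have key : (1 - α) * ((L : ℝ) + 1) ^ (-α) ≤ ((L : ℝ) + 1) ^ (1 - α) - (L : ℝ) ^ (1 - α) := by
      have hx : (0 : ℝ) < (L : ℝ) + 1 := by linarith
      have hb := rpow_one_add_le_one_add_mul_self (s := -1 / ((L : ℝ) + 1)) (p := 1 - α)
        (by rw [le_div_iff₀ hx]; linarith) hpos.le (by linarith)
      have e1 : (1 : ℝ) + -1 / ((L : ℝ) + 1) = L / ((L : ℝ) + 1) := by field_simp; ring
      rw [e1, div_rpow (by linarith) hx.le, div_le_iff₀ (by positivity)] at hb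
      have e2 : ((L : ℝ) + 1) ^ (1 - α) = ((L : ℝ) + 1) ^ (-α) * ((L : ℝ) + 1) := by
        rw [← rpow_add_one hx.ne']; ring_nf
      have e3 : (1 + (1 - α) * (-1 / ((L : ℝ) + 1))) * ((L : ℝ) + 1) ^ (1 - α)
          = ((L : ℝ) + 1) ^ (1 - α) - (1 - α) * ((L : ℝ) + 1) ^ (-α) := by
        rw [e2]; field_simp; ring
      linarith
    have hnn : 0 ≤ ((L : ℝ) + 1) ^ (-α) := by positivity
    have : ((L : ℝ) + 1) ^ (-α) ≤ 2 / (1 - α) * (((L : ℝ) + 1) ^ (1 - α) - (L : ℝ) ^ (1 - α)) := by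
      rw [div_mul_eq_mul_div, le_div_iff₀ hpos]; nlinarith
    push_cast
    linarith

theorem exists_sum_rpow_le_of_one_lt {α : ℝ} (h1 : 1 < α) :
    ∃ K : ℝ, 0 < K ∧ ∀ s : Finset ℕ, ∑ n ∈ s, (max 1 (n : ℝ)) ^ (-α) ≤ K := by
  have hs : Summable fun n : ℕ => (max 1 (n : ℝ)) ^ (-α) := by
    rw [← summable_nat_add_iff 1]
    have := (summable_nat_add_iff 1).2 (summable_nat_rpow.2 (show -α < -1 by linarith))
    refine this.congr fun n => ?_
    push_cast
    rw [max_eq_right (by linarith [Nat.cast_nonneg (α := ℝ) n])]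
  refine ⟨∑' n : ℕ, (max 1 (n : ℝ)) ^ (-α), ?_, fun s => hs.sum_le_tsum s fun i _ => by positivity⟩
  refine hs.tsum_pos (fun i => by positivity) 0 (by positivity)

/-- Tails: `∑_{n ≥ L} n^{-α} ≤ K L^{1-α}`, in finite form. -/
theorem exists_sum_Ico_rpow_le {α : ℝ} (h1 : 1 < α) (h2 : α ≤ 2) :
    ∃ K : ℝ, 0 < K ∧ ∀ L n : ℕ, 1 ≤ L → 
      ∑ n ∈ Ico (L + 1) n, (n : ℝ) ^ (-α) ≤ K * (L : ℝ) ^ (1 - α) := by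
  have hpos : (0 : ℝ) < α - 1 := by linarith
  refine ⟨1 / (α - 1), by positivity, fun L n hL => ?_⟩
  rcases le_or_gt n (L + 1) with hn | hn
  · rw [Ico_eq_empty (by omega)]; simp; positivity
  have hn' : L + 1 ≤ n := hn.le
  suffices h : ∑ n ∈ Ico (L + 1) n, (n : ℝ) ^ (-α)
      ≤ 1 / (α - 1) * ((L : ℝ) ^ (1 - α) - ((n : ℝ) - 1) ^ (1 - α)) by
    refine h.trans (mul_le_mul_of_nonneg_left ?_ (by positivity))
    have : (0 : ℝ) ≤ (n : ℝ) - 1 := by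
      have : (1 : ℝ) ≤ n := by exact_mod_cast (by omega : 1 ≤ n)
      linarith
    have := rpow_nonneg this (1 - α)
    linarith
  clear hn
  induction n, hn' using Nat.le_induction with
  | base => simp
  | succ n hn ih =>
    rw [sum_Ico_succ_top hn]
    have hn1 : (2 : ℝ) ≤ n := by exact_mod_cast (by omega : 2 ≤ n)
    have hx : (0 : ℝ) < (n : ℝ) - 1 := by linarith
    have hxn : (0 : ℝ) < (n : ℝ) := by linarith
    have key : (α - 1) * (n : ℝ) ^ (-α) ≤ ((n : ℝ) - 1) ^ (1 - α) - (n : ℝ) ^ (1 - α) := by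
      have hb := rpow_one_add_le_one_add_mul_self (s := -1 / (n : ℝ)) (p := α - 1)
        (by rw [le_div_iff₀ hxn]; linarith) hpos.le (by linarith)
      have e1 : (1 : ℝ) + -1 / (n : ℝ) = ((n : ℝ) - 1) / n := by field_simp; ring
      rw [e1, div_rpow hx.le hxn.le] at hb
      set A := ((n : ℝ) - 1) ^ (α - 1)
      set C := (n : ℝ) ^ (α - 1)
      have hA : 0 < A := by positivity
      have hC : 0 < C := by positivity
      have eA : ((n : ℝ) - 1) ^ (1 - α) = A⁻¹ := by rw [← rpow_neg hx.le]; ring_nf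
      have eC : (n : ℝ) ^ (1 - α) = C⁻¹ := by rw [← rpow_neg hxn.le]; ring_nf
      have eD : (n : ℝ) ^ (-α) = C⁻¹ / n := by
        rw [← eC, eq_div_iff hxn.ne', ← rpow_add_one hxn.ne']; ring_nf
      rw [eA, eC, eD]
      have hq : A / C * (1 + (α - 1) / n) ≤ 1 := by
        have : (0:ℝ) < 1 + (α - 1) / n := by positivity
        calc A / C * (1 + (α - 1) / n) ≤ (1 + (α - 1) * (-1 / n)) * (1 + (α - 1) / n) := by gcongr
          _ = 1 - ((α - 1) / n) ^ 2 := by ring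
          _ ≤ 1 := by nlinarith [sq_nonneg ((α - 1) / n)]
      have : C⁻¹ * (1 + (α - 1) / n) ≤ A⁻¹ := by
        rw [← one_div A, le_div_iff₀ hA]; calc _ = A / C * (1 + (α - 1) / n) := by ring
          _ ≤ 1 := hq
      have e : (α - 1) * (C⁻¹ / n) = C⁻¹ * (1 + (α - 1) / n) - C⁻¹ := by ring
      linarith
    have : (n : ℝ) ^ (-α) ≤ 1 / (α - 1) * (((n : ℝ) - 1) ^ (1 - α) - (n : ℝ) ^ (1 - α)) := by
      rw [div_mul_eq_mul_div, le_div_iff₀ hpos]; nlinarith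
    push_cast
    have e : (n : ℝ) + 1 - 1 = n := by ring
    rw [e]
    linarith

/-! ### Separable bounds for lattice sums -/

theorem sum_prod_le {ι : Type*} [Fintype ι] [DecidableEq ι] {α : Type*} [DecidableEq α]
    (f : ι → α → ℝ) (C : ι → ℝ) (hf : ∀ i a, 0 ≤ f i a)
    (hC : ∀ i (t : Finset α), ∑ a ∈ t, f i a ≤ C i) (s : Finset (ι → α)) :
    ∑ p ∈ s, ∏ i, f i (p i) ≤ ∏ i, C i := by
  have hsub : s ⊆ Fintype.piFinset fun i => s.image fun p => p i := by
    intro p hp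
    rw [Fintype.mem_piFinset]
    exact fun i => mem_image_of_mem _ hp
  calc ∑ p ∈ s, ∏ i, f i (p i)
      ≤ ∑ p ∈ Fintype.piFinset fun i => s.image fun p => p i, ∏ i, f i (p i) :=
        sum_le_sum_of_subset_of_nonneg hsub fun p _ _ => prod_nonneg fun i _ => hf i _
    _ = ∏ i, ∑ a ∈ s.image fun p => p i, f i a := (prod_univ_sum _ _).symm
    _ ≤ ∏ i, C i := prod_le_prod (fun i _ => sum_nonneg fun a _ => hf i a) fun i _ => hC i _

theorem abs_tsum_le_of_sum_le {α : Type*} {f : α → ℝ} {C : ℝ}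
    (h : ∀ s : Finset α, ∑ a ∈ s, |f a| ≤ C) : |∑' a, f a| ≤ C := by
  have hs : Summable fun a => |f a| := summable_of_sum_le (fun _ => abs_nonneg _) h
  have h1 : ‖∑' a, f a‖ ≤ ∑' a, ‖f a‖ := norm_tsum_le_tsum_norm hs
  exact h1.trans (hs.tsum_le_of_sum_le h)

/-- If `b_i² ≤ Y` for all `i`, then `Y^{-β} ≤ ∏ b_i^{-α_i}` when `∑ α_i = 2 β`. -/
theorem rpow_neg_le_prod {ι : Type*} (s : Finset ι) {Y β : ℝ} (b α : ι → ℝ) (hb : ∀ i, 1 ≤ b i)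
    (hbY : ∀ i, b i ^ 2 ≤ Y) (hY : 1 ≤ Y) (hα : ∀ i, 0 ≤ α i) (hs : ∑ i ∈ s, α i = 2 * β) :
    Y ^ (-β) ≤ ∏ i ∈ s, b i ^ (-α i) := by
  have hY0 : 0 < Y := by linarith
  have h1 : ∏ i ∈ s, Y ^ (-(α i / 2)) = Y ^ (-β) := by
    rw [← rpow_sum_of_pos hY0]
    congr 1
    rw [sum_neg_distrib, ← sum_div, hs]; ring
  rw [← h1]
  refine prod_le_prod (fun i _ => by positivity) fun i _ => ?_
  have hb0 : 0 < b i := by linarith [hb i]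
  have : b i ^ (-α i) = (b i ^ 2) ^ (-(α i / 2)) := by
    rw [← rpow_natCast, ← rpow_mul hb0.le]; congr 1; push_cast; ring
  rw [this]
  exact rpow_le_rpow_of_nonpos (by positivity) (hbY i) (by linarith [hα i])

theorem exists_sum_two_scale_le : ∃ K : ℝ, 0 < K ∧ ∀ (k : ℤ) (s : Finset ℤ),
    ∑ m ∈ s, brk m ^ (-(2 / 3) : ℝ) * (max (brk m) (brk k)) ^ (-(2 / 3) : ℝ)
      ≤ K * brk k ^ (-(1 / 3) : ℝ) := by
  obtain ⟨K1, hK1, h1⟩ := exists_sum_range_rpow_le (α := 2 / 3) (by norm_num) (by norm_num)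
  obtain ⟨K2, hK2, h2⟩ := exists_sum_Ico_rpow_le (α := 4 / 3) (by norm_num) (by norm_num)
  refine ⟨2 * (K1 + K2), by positivity, fun k s => ?_⟩
  set L : ℕ := max 1 k.natAbs with hL
  have hL1 : 1 ≤ L := le_max_left _ _
  have hkL : brk k = L := by rw [brk_eq_natAbs, hL]; push_cast; rfl
  have hL0 : (0 : ℝ) < L := by exact_mod_cast hL1
  set n : ℕ := L + 1 + ∑ m ∈ s, m.natAbs with hn
  have hf : ∀ m : ℤ, brk m ^ (-(2 / 3) : ℝ) * (max (brk m) (brk k)) ^ (-(2 / 3) : ℝ)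
      = (fun i : ℕ => (max 1 (i : ℝ)) ^ (-(2 / 3) : ℝ) *
        (max (max 1 (i : ℝ)) L) ^ (-(2 / 3) : ℝ)) m.natAbs := by
    intro m; rw [hkL, brk_eq_natAbs m]
  simp_rw [hf]
  have hsum := sum_int_le_two_mul (fun i : ℕ => (max 1 (i : ℝ)) ^ (-(2 / 3) : ℝ) *
        (max (max 1 (i : ℝ)) L) ^ (-(2 / 3) : ℝ)) (fun n => by positivity) s
        (range (n + 1)) (by
          intro m hm
          rw [mem_range, hn]
          have := single_le_sum (f := fun m : ℤ => m.natAbs) (fun _ _ => Nat.zero_le _) hm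
          omega)
  refine hsum.trans ?_
  rw [mul_assoc]
  refine mul_le_mul_of_nonneg_left ?_ (by norm_num)
  rw [← sum_range_add_sum_Ico _ (show L + 1 ≤ n + 1 by omega), add_mul, hkL]
  refine add_le_add ?_ ?_
  · calc _ ≤ ∑ i ∈ range (L + 1), (max 1 (i : ℝ)) ^ (-(2 / 3) : ℝ) * (L : ℝ) ^ (-(2 / 3) : ℝ) := by
          refine sum_le_sum fun i _ => ?_
          refine mul_le_mul_of_nonneg_left ?_ (by positivity)
          exact rpow_le_rpow_of_nonpos hL0 (le_max_right _ _) (by norm_num)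
      _ ≤ K1 * (L : ℝ) ^ (1 - 2 / 3 : ℝ) * (L : ℝ) ^ (-(2 / 3) : ℝ) := by
          rw [← sum_mul]
          exact mul_le_mul_of_nonneg_right (h1 L hL1) (by positivity)
      _ = _ := by rw [mul_assoc, ← rpow_add hL0]; norm_num
  · calc _ = ∑ i ∈ Ico (L + 1) (n + 1), (i : ℝ) ^ (-(4 / 3) : ℝ) := by
          refine sum_congr rfl fun i hi => ?_
          have hi' : L + 1 ≤ i := (mem_Ico.1 hi).1
          have hi1 : (1 : ℝ) ≤ i := by exact_mod_cast (by omega : 1 ≤ i)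
          have hiL : (L : ℝ) ≤ i := by exact_mod_cast (by omega : L ≤ i)
          rw [max_eq_right hi1, max_eq_left hiL, ← rpow_add (by linarith)]; norm_num
      _ ≤ _ := by
          refine (h2 L (n + 1) hL1).trans (le_of_eq ?_)
          norm_num

theorem brk_sq_le_sqNorm3 (p : Fin 3 → ℤ) (i : Fin 3) : brk (p i) ^ 2 ≤ sqNorm3 p + 1 := by
  have h := brk_sq_le (p i)
  have : ((p i : ℤ) : ℝ) ^ 2 ≤ sqNorm3 p :=
    single_le_sum (f := fun i => ((p i : ℤ) : ℝ) ^ 2) (fun _ _ => sq_nonneg _) (mem_univ i)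
  linarith

theorem sqNorm3_nonneg (p : Fin 3 → ℤ) : 0 ≤ sqNorm3 p := sum_nonneg fun _ _ => sq_nonneg _

theorem exists_sum_prop_prop_le : ∃ K : ℝ, 0 < K ∧ ∀ (k : ℤ) (s : Finset (Fin 3 → ℤ)),
    ∑ p ∈ s, 1 / (sqNorm3 p + 1) * (1 / ((k : ℝ) ^ 2 + sqNorm3 p + 1)) ≤ K * (brk k)⁻¹ := by
  classical
  obtain ⟨K, hK, h⟩ := exists_sum_two_scale_le
  refine ⟨K ^ 3, by positivity, fun k s => ?_⟩
  have hk0 := brk_pos k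
  have e : ∏ _i : Fin 3, K * brk k ^ (-(1 / 3) : ℝ) = K ^ 3 * (brk k)⁻¹ := by
    rw [prod_const, card_univ, Fintype.card_fin, mul_pow, ← rpow_natCast (_ ^ _), ← rpow_mul hk0.le]
    norm_num [rpow_neg_one]
  rw [← e]
  refine le_trans (sum_le_sum fun p _ => ?_)
    (sum_prod_le (fun _ m => brk m ^ (-(2 / 3) : ℝ) * (max (brk m) (brk k)) ^ (-(2 / 3) : ℝ)) _
      (fun _ m => by have := brk_pos m; positivity) (fun _ t => h k t) s)
  rw [prod_mul_distrib]
  have hp := sqNorm3_nonneg p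
  refine mul_le_mul ?_ ?_ (by positivity) (prod_nonneg fun i _ => by
    have := brk_pos (p i); positivity)
  · rw [one_div, ← rpow_neg_one]
    exact rpow_neg_le_prod _ _ (fun _ => 2 / 3) (fun i => one_le_brk (p i))
      (fun i => brk_sq_le_sqNorm3 p i) (by linarith) (fun _ => by norm_num) (by norm_num [sum_const])
  · rw [one_div, ← rpow_neg_one]
    refine rpow_neg_le_prod _ _ (fun _ => 2 / 3) (fun i => (one_le_brk (p i)).trans (le_max_left _ _))
      (fun i => ?_) (by nlinarith [sq_nonneg (k : ℝ)]) (fun _ => by norm_num) (by norm_num [sum_const])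
    rcases max_cases (brk (p i)) (brk k) with hm | hm
    · rw [hm.1]; have := brk_sq_le_sqNorm3 p i; nlinarith [sq_nonneg (k : ℝ)]
    · rw [hm.1]; have := brk_sq_le k; linarith

/-! ### Bounds on the renormalized amplitudes -/

theorem exists_abs_a1_le : ∃ K : ℝ, 0 < K ∧ ∀ k : ℤ, |a1 k| ≤ K * brk k := by
  obtain ⟨K, hK, h⟩ := exists_sum_prop_prop_le
  refine ⟨K, hK, fun k => abs_tsum_le_of_sum_le fun s => ?_⟩
  have hk0 := brk_pos k
  calc ∑ p ∈ s, |1 / ((k : ℝ) ^ 2 + sqNorm3 p + 1) - 1 / (sqNorm3 p + 1)|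
      ≤ ∑ p ∈ s, brk k ^ 2 * (1 / (sqNorm3 p + 1) * (1 / ((k : ℝ) ^ 2 + sqNorm3 p + 1))) := by
        refine sum_le_sum fun p _ => ?_
        have hp := sqNorm3_nonneg p
        have hX : 0 < (k : ℝ) ^ 2 + sqNorm3 p + 1 := by positivity
        have hY : 0 < sqNorm3 p + 1 := by positivity
        have e : 1 / ((k : ℝ) ^ 2 + sqNorm3 p + 1) - 1 / (sqNorm3 p + 1)
            = -((k : ℝ) ^ 2 * (1 / (sqNorm3 p + 1) * (1 / ((k : ℝ) ^ 2 + sqNorm3 p + 1)))) := by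
          field_simp; ring
        rw [e, abs_neg, abs_of_nonneg (by positivity)]
        refine mul_le_mul_of_nonneg_right ?_ (by positivity)
        rw [← sq_abs]
        exact pow_le_pow_left₀ (abs_nonneg _) (abs_le_brk k) 2
    _ ≤ brk k ^ 2 * (K * (brk k)⁻¹) := by
        rw [← mul_sum]; exact mul_le_mul_of_nonneg_left (h k s) (by positivity)
    _ = K * brk k := by field_simp

theorem a1_zero : a1 0 = 0 := by simp [a1]

theorem exists_abs_a2Same_le : ∃ K : ℝ, 0 < K ∧ ∀ k : ℤ, |a2Same k| ≤ K := by
  obtain ⟨K, hK, h⟩ := exists_sum_prop_prop_le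
  obtain ⟨K', hK', h'⟩ := exists_abs_a1_le
  refine ⟨K' * K, by positivity, fun k => abs_tsum_le_of_sum_le fun s => ?_⟩
  have hk0 := brk_pos k
  calc ∑ q ∈ s, |a1 k / ((k : ℝ) ^ 2 + sqNorm3 q + 1) ^ 2 - a1 0 / (sqNorm3 q + 1) ^ 2|
      ≤ ∑ q ∈ s, |a1 k| * (1 / (sqNorm3 q + 1) * (1 / ((k : ℝ) ^ 2 + sqNorm3 q + 1))) := by
        refine sum_le_sum fun q _ => ?_
        have hp := sqNorm3_nonneg q
        have hX : 0 < (k : ℝ) ^ 2 + sqNorm3 q + 1 := by positivity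
        have e1 : |a1 k| / ((k : ℝ) ^ 2 + sqNorm3 q + 1) ^ 2 = |a1 k| *
            (1 / ((k : ℝ) ^ 2 + sqNorm3 q + 1) * (1 / ((k : ℝ) ^ 2 + sqNorm3 q + 1))) := by
          field_simp
        rw [a1_zero, zero_div, sub_zero, abs_div, abs_of_pos (pow_pos hX 2), e1]
        refine mul_le_mul_of_nonneg_left ?_ (abs_nonneg _)
        refine mul_le_mul_of_nonneg_right ?_ (by positivity)
        exact one_div_le_one_div_of_le (by positivity) (by nlinarith [sq_nonneg (k : ℝ)])
    _ ≤ (K' * brk k) * (K * (brk k)⁻¹) := by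
        rw [← mul_sum]
        have h0 : 0 ≤ ∑ i ∈ s, 1 / (sqNorm3 i + 1) * (1 / ((k : ℝ) ^ 2 + sqNorm3 i + 1)) :=
          sum_nonneg fun i _ => by have := sqNorm3_nonneg i; positivity
        exact mul_le_mul (h' k) (h k s) h0 (by positivity)
    _ = K' * K := by field_simp

theorem exists_abs_a2Other_le : ∃ K : ℝ, 0 < K ∧ ∀ k : ℤ, |a2Other k| ≤ K * brk k ^ (1 / 4 : ℝ) := by
  classical
  obtain ⟨K', hK', h'⟩ := exists_abs_a1_le
  obtain ⟨K1, hK1, h1⟩ := exists_sum_rpow_le_of_one_lt (α := 9 / 8) (by norm_num)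
  obtain ⟨K2, hK2, h2⟩ := exists_sum_rpow_le_of_one_lt (α := 17 / 16) (by norm_num)
  have hint : ∀ {α C : ℝ}, (∀ s : Finset ℕ, ∑ n ∈ s, (max 1 (n : ℝ)) ^ (-α) ≤ C) →
      ∀ t : Finset ℤ, ∑ m ∈ t, brk m ^ (-α) ≤ 2 * C := by
    intro α C hC t
    simp_rw [brk_eq_natAbs]
    refine (sum_int_le_two_mul (fun n : ℕ => (max 1 (n : ℝ)) ^ (-α)) (fun _ => by positivity) t
      (t.image Int.natAbs) fun m hm => mem_image_of_mem _ hm).trans ?_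
    linarith [hC (t.image Int.natAbs)]
  set e : Fin 3 → ℝ := ![9 / 8, 17 / 16, 17 / 16] with he
  set C : Fin 3 → ℝ := ![2 * K1, 2 * K2, 2 * K2] with hC
  have hsep := sum_prod_le (fun i m => brk m ^ (-e i)) C (fun _ m => by have := brk_pos m; positivity)
    (fun i t => by fin_cases i <;> simp [he, hC] <;> apply hint <;> assumption)
  refine ⟨2 * K' * ∏ i, C i, by simp [hC, Fin.prod_univ_three]; positivity,
    fun k => abs_tsum_le_of_sum_le fun s => ?_⟩
  have hk0 := brk_pos k
  calc ∑ q ∈ s, |a1 (q 0) * (1 / ((k : ℝ) ^ 2 + sqNorm3 q + 1) ^ 2 - 1 / (sqNorm3 q + 1) ^ 2)|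
      ≤ ∑ q ∈ s, (2 * K' * brk k ^ (1 / 4 : ℝ)) * ∏ i, brk (q i) ^ (-e i) := by
        refine sum_le_sum fun q _ => ?_
        have hp := sqNorm3_nonneg q
        have hX : 0 < (k : ℝ) ^ 2 + sqNorm3 q + 1 := by positivity
        have hY : 0 < sqNorm3 q + 1 := by positivity
        set X := (k : ℝ) ^ 2 + sqNorm3 q + 1 with hXd
        set Y := sqNorm3 q + 1 with hYd
        have hXY : Y ≤ X := by nlinarith [sq_nonneg (k : ℝ)]
        have hXY2 : X - Y = (k : ℝ) ^ 2 := by rw [hXd, hYd]; ring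
        have hkb : (k : ℝ) ^ 2 ≤ brk k ^ 2 := by
          rw [← sq_abs]; exact pow_le_pow_left₀ (abs_nonneg _) (abs_le_brk k) 2
        have hmin : |1 / X ^ 2 - 1 / Y ^ 2| ≤ Y⁻¹ ^ 2 * (2 * brk k ^ 2 / Y) ^ (1 / 8 : ℝ) := by
          have e1 : 1 / X ^ 2 - 1 / Y ^ 2 = -(Y⁻¹ ^ 2 * (1 - Y ^ 2 / X ^ 2)) := by field_simp; ring
          have h01 : 0 ≤ 1 - Y ^ 2 / X ^ 2 := by
            rw [sub_nonneg, div_le_one (by positivity)]; exact pow_le_pow_left₀ hY.le hXY 2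
          rw [e1, abs_neg, abs_of_nonneg (by positivity)]
          refine mul_le_mul_of_nonneg_left ?_ (by positivity)
          rcases le_total (2 * brk k ^ 2 / Y) 1 with ht | ht
          · have : 1 - Y ^ 2 / X ^ 2 ≤ 2 * brk k ^ 2 / Y := by
              have : 1 - Y ^ 2 / X ^ 2 ≤ 2 * (k : ℝ) ^ 2 / Y := by
                rw [← hXY2, sub_le_iff_le_add, div_add_div _ _ hY.ne' (by positivity),
                  le_div_iff₀ (by positivity)]
                nlinarith [mul_nonneg (sub_nonneg.2 hXY) (sq_nonneg X), mul_nonneg (mul_nonneg hY.le (sub_nonneg.2 hXY)) hX.le, mul_nonneg (sq_nonneg (X - Y)) hX.le, mul_nonneg (sq_nonneg (X - Y)) hY.le]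
              exact this.trans (by gcongr)
            refine this.trans ?_
            conv_lhs => rw [← rpow_one (2 * brk k ^ 2 / Y)]
            exact rpow_le_rpow_of_exponent_ge (by positivity) ht (by norm_num)
          · refine le_trans ?_ (one_le_rpow ht (by norm_num))
            have : 0 ≤ Y ^ 2 / X ^ 2 := by positivity
            linarith
        have hprod : Y ^ (-(17 / 8) : ℝ) ≤ ∏ i, brk (q i) ^ (-(![17 / 8, 17 / 16, 17 / 16] i) : ℝ) :=
          rpow_neg_le_prod _ _ ![17 / 8, 17 / 16, 17 / 16] (fun i => one_le_brk (q i))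
            (fun i => brk_sq_le_sqNorm3 q i) (by linarith)
            (fun i => by fin_cases i <;> norm_num) (by simp [Fin.sum_univ_three]; norm_num)
        have e2 : Y⁻¹ ^ 2 * (2 * brk k ^ 2 / Y) ^ (1 / 8 : ℝ)
            ≤ 2 * brk k ^ (1 / 4 : ℝ) * Y ^ (-(17 / 8) : ℝ) := by
          rw [div_rpow (by positivity) hY.le, mul_rpow (by norm_num) (by positivity),
            ← rpow_natCast (brk k), ← rpow_mul hk0.le, inv_pow, ← rpow_natCast Y,
            ← rpow_neg hY.le, div_eq_mul_inv, ← rpow_neg hY.le]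
          have : Y ^ (-((2 : ℕ) : ℝ)) * Y ^ (-(1 / 8) : ℝ) = Y ^ (-(17 / 8) : ℝ) := by
            rw [← rpow_add hY]; norm_num
          rw [← this]
          have h28 : (2 : ℝ) ^ (1 / 8 : ℝ) ≤ 2 := by
            conv_rhs => rw [← rpow_one 2]
            exact rpow_le_rpow_of_exponent_le (by norm_num) (by norm_num)
          have e3 : ((2 : ℕ) : ℝ) * (1 / 8) = 1 / 4 := by norm_num
          rw [e3]
          calc _ = (2 : ℝ) ^ (1 / 8 : ℝ) * (brk k ^ (1 / 4 : ℝ) * (Y ^ (-((2 : ℕ) : ℝ)) * Y ^ (-(1 / 8) : ℝ))) := by ring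
            _ ≤ 2 * (brk k ^ (1 / 4 : ℝ) * (Y ^ (-((2 : ℕ) : ℝ)) * Y ^ (-(1 / 8) : ℝ))) := by gcongr
            _ = _ := by ring
        rw [abs_mul]
        have e4 : brk (q 0) * ∏ i, brk (q i) ^ (-(![17 / 8, 17 / 16, 17 / 16] i) : ℝ)
            = ∏ i, brk (q i) ^ (-e i) := by
          rw [Fin.prod_univ_three, Fin.prod_univ_three, ← mul_assoc, ← mul_assoc]
          congr 2
          conv_lhs => enter [1]; rw [← rpow_one (brk (q 0))]
          rw [← rpow_add (brk_pos _)]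
          simp [he]; norm_num
        calc |a1 (q 0)| * |1 / X ^ 2 - 1 / Y ^ 2|
            ≤ (K' * brk (q 0)) * (2 * brk k ^ (1 / 4 : ℝ) *
              ∏ i, brk (q i) ^ (-(![17 / 8, 17 / 16, 17 / 16] i) : ℝ)) := by
              refine mul_le_mul (h' _) (hmin.trans (e2.trans ?_)) (abs_nonneg _)
                (mul_nonneg hK'.le (brk_pos _).le)
              exact mul_le_mul_of_nonneg_left hprod (by positivity)
          _ = 2 * K' * brk k ^ (1 / 4 : ℝ) *
              (brk (q 0) * ∏ i, brk (q i) ^ (-(![17 / 8, 17 / 16, 17 / 16] i) : ℝ)) := by ring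
          _ = _ := by rw [e4]
    _ ≤ (2 * K' * brk k ^ (1 / 4 : ℝ)) * ∏ i, C i := by
        rw [← mul_sum]; exact mul_le_mul_of_nonneg_left (hsep s) (by positivity)
    _ = _ := by ring

/-! ### Weights on modes -/

/-- The weight `max(1,|a|)^{-α}` restricted to `|a| ≤ R`. -/
noncomputable def bw {N : ℕ} (R α : ℝ) (a : Mode N) : ℝ :=
  if |((a : ℤ) : ℝ)| ≤ R then brk a ^ (-α) else 0

section Weights

variable {N : ℕ} {R : ℝ}

theorem bw_nonneg (α : ℝ) (a : Mode N) : 0 ≤ bw R α a := by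
  unfold bw; have := brk_pos a; split_ifs <;> positivity

theorem bw_mul (α β : ℝ) (a : Mode N) : bw R α a * bw R β a = bw R (α + β) a := by
  unfold bw
  split_ifs
  · rw [← rpow_add (brk_pos _)]; congr 1; ring
  · simp

theorem bw_le_one {α : ℝ} (h : 0 ≤ α) (a : Mode N) : bw R α a ≤ 1 := by
  unfold bw
  split_ifs
  · exact rpow_le_one_of_one_le_of_nonpos (one_le_brk _) (by linarith)
  · exact zero_le_one

theorem sum_mode_le (f : ℕ → ℝ) (hf : ∀ n, 0 ≤ f n) (t : Finset ℕ) (s : Finset (Mode N))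
    (hst : ∀ a ∈ s, (a : ℤ).natAbs ∈ t) : ∑ a ∈ s, f (a : ℤ).natAbs ≤ 2 * ∑ n ∈ t, f n := by
  classical
  have := sum_int_le_two_mul f hf (s.map ⟨Subtype.val, Subtype.val_injective⟩) t (by
    intro m hm
    obtain ⟨a, ha, rfl⟩ := mem_map.1 hm
    exact hst a ha)
  rwa [sum_map] at this

theorem exists_sum_bw_le {α : ℝ} (h0 : 0 ≤ α) (h1 : α < 1) :
    ∃ K : ℝ, 0 < K ∧ ∀ (N : ℕ) (R : ℝ), 1 ≤ R → ∑ a : Mode N, bw R α a ≤ K * R ^ (1 - α) := by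
  obtain ⟨K, hK, h⟩ := exists_sum_range_rpow_le h0 h1
  refine ⟨2 * K, by positivity, fun N R hR => ?_⟩
  have hL : 1 ≤ ⌊R⌋₊ := Nat.one_le_floor_iff _ |>.2 hR
  have e : ∑ a : Mode N, bw R α a
      = ∑ a ∈ univ.filter (fun a : Mode N => |((a : ℤ) : ℝ)| ≤ R),
        (fun n : ℕ => (max 1 (n : ℝ)) ^ (-α)) (a : ℤ).natAbs := by
    rw [sum_filter]
    refine sum_congr rfl fun a _ => ?_
    unfold bw; rw [brk_eq_natAbs]
  rw [e]
  refine (sum_mode_le (fun n : ℕ => (max 1 (n : ℝ)) ^ (-α)) (fun n => by positivity) (range (⌊R⌋₊ + 1)) _ fun a ha => ?_).trans ?_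
  · have := (mem_filter.1 ha).2
    rw [mem_range, Nat.lt_succ_iff]
    refine Nat.le_floor ?_
    rw [Nat.cast_natAbs]; simpa using this
  · rw [mul_assoc]
    refine mul_le_mul_of_nonneg_left ((h _ hL).trans ?_) (by norm_num)
    refine mul_le_mul_of_nonneg_left ?_ hK.le
    exact rpow_le_rpow (by positivity) (Nat.floor_le (by linarith)) (by linarith)

theorem exists_sum_bw_le_of_one_lt {α : ℝ} (h1 : 1 < α) :
    ∃ K : ℝ, 0 < K ∧ ∀ (N : ℕ) (R : ℝ), ∑ a : Mode N, bw R α a ≤ K := by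
  classical
  obtain ⟨K, hK, h⟩ := exists_sum_rpow_le_of_one_lt h1
  refine ⟨2 * K, by positivity, fun N R => ?_⟩
  calc ∑ a : Mode N, bw R α a
      ≤ ∑ a : Mode N, (fun n : ℕ => (max 1 (n : ℝ)) ^ (-α)) (a : ℤ).natAbs := by
        refine sum_le_sum fun a _ => ?_
        unfold bw; rw [brk_eq_natAbs]; split_ifs <;> first | exact le_rfl | positivity
    _ ≤ 2 * ∑ n ∈ univ.image fun a : Mode N => (a : ℤ).natAbs, (max 1 (n : ℝ)) ^ (-α) :=
        sum_mode_le (fun n : ℕ => (max 1 (n : ℝ)) ^ (-α)) (fun n => by positivity) _ _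
          fun a ha => mem_image_of_mem (fun a : Mode N => (a : ℤ).natAbs) ha
    _ ≤ 2 * K := mul_le_mul_of_nonneg_left (h _) (by norm_num)

theorem sum_prod_bw (e : Fin 3 → ℝ) :
    ∑ p : Fin 3 → Mode N, ∏ i, bw R (e i) (p i) = ∏ i, ∑ a : Mode N, bw R (e i) a := by
  rw [prod_univ_sum, Fintype.piFinset_univ]

end Weights

/-! ### Bounds on the cut propagators -/

theorem sqNorm_nonneg {N : ℕ} (n : MultiMode N) : 0 ≤ sqNorm n := sum_nonneg fun _ _ => sq_nonneg _

theorem cutProp_nonneg (M j : ℕ) {s : ℝ} (hs : 0 ≤ s) : 0 ≤ cutProp M j s := by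
  unfold cutProp cutoff; split_ifs <;> simp; positivity

theorem cutProp_le (M j : ℕ) {s : ℝ} (hs : 0 ≤ s) : cutProp M j s ≤ 1 / (s + 1) := by
  have : 0 ≤ 1 / (s + 1) := by positivity
  unfold cutProp cutoff; split_ifs <;> simp; simpa using this

theorem cutProp_le_one (M j : ℕ) {s : ℝ} (hs : 0 ≤ s) : cutProp M j s ≤ 1 :=
  (cutProp_le M j hs).trans (by rw [div_le_one (by linarith)]; linarith)

theorem cutProp_mono {M : ℕ} (hM : 2 ≤ M) {i j : ℕ} (hij : i ≤ j) {s : ℝ} (hs : 0 ≤ s) :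
    cutProp M i s ≤ cutProp M j s := by
  have h0 : 0 ≤ 1 / (s + 1) := by positivity
  unfold cutProp
  refine mul_le_mul_of_nonneg_right ?_ h0
  unfold cutoff
  split_ifs with h1 h2 h2
  · exact le_rfl
  · exfalso; apply h2
    refine ⟨h1.1.trans hij, h1.2.trans ?_⟩
    exact pow_le_pow_right₀ (by exact_mod_cast (by omega : 1 ≤ M)) (by omega)
  · exact zero_le_one
  · exact le_rfl

theorem abs_le_of_cutoff {M j : ℕ} {s x : ℝ} (hx : x ^ 2 ≤ s) (h : 1 + s ≤ (M : ℝ) ^ (2 * j)) :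
    |x| ≤ (M : ℝ) ^ j := by
  apply abs_le_of_sq_le_sq
  · rw [← pow_mul, mul_comm j 2]; linarith
  · positivity

theorem sq_le_sqNorm {N : ℕ} (n : MultiMode N) (c : Fin 4) : (((n c : ℤ)) : ℝ) ^ 2 ≤ sqNorm n :=
  single_le_sum (f := fun c => (((n c : ℤ)) : ℝ) ^ 2) (fun _ _ => sq_nonneg _) (mem_univ c)

theorem cutProp_rpow_le {N M j : ℕ} {β : ℝ} (hβ : 0 < β) (α : Fin 4 → ℝ) (hα : ∀ c, 0 ≤ α c)
    (hs : ∑ c, α c = 2 * β) (n : MultiMode N) :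
    cutProp M j (sqNorm n) ^ β ≤ ∏ c, bw ((M : ℝ) ^ j) (α c) (n c) := by
  have hn := sqNorm_nonneg n
  by_cases h : 1 ≤ j ∧ 1 + sqNorm n ≤ (M : ℝ) ^ (2 * j)
  · have e : cutProp M j (sqNorm n) ^ β = (1 + sqNorm n) ^ (-β) := by
      rw [cutProp, cutoff, if_pos h, one_mul, one_div, inv_rpow (by linarith),
        rpow_neg (by linarith), add_comm]
    rw [e]
    refine (rpow_neg_le_prod univ (fun c => brk (n c)) α (fun c => one_le_brk _) (fun c => ?_)
      (by linarith) hα hs).trans (le_of_eq ?_)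
    · have := brk_sq_le (n c); have := sq_le_sqNorm n c; linarith
    · refine prod_congr rfl fun c _ => ?_
      rw [bw, if_pos (abs_le_of_cutoff (sq_le_sqNorm n c) h.2)]
  · rw [cutProp, cutoff, if_neg h, zero_mul, zero_rpow hβ.ne']
    exact prod_nonneg fun c _ => bw_nonneg _ _

/-- The slice propagator `C_j = C_{≤ j} - C_{≤ j - 1}` as a function of `s = ‖n‖²`. -/
noncomputable def dProp (M j : ℕ) (s : ℝ) : ℝ := cutProp M j s - cutProp M (j - 1) s

theorem dProp_nonneg {M : ℕ} (hM : 2 ≤ M) (j : ℕ) {s : ℝ} (hs : 0 ≤ s) : 0 ≤ dProp M j s :=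
  sub_nonneg.2 (cutProp_mono hM (Nat.sub_le j 1) hs)

theorem dProp_le_cutProp {M : ℕ} (j : ℕ) {s : ℝ} (hs : 0 ≤ s) : dProp M j s ≤ cutProp M j s :=
  sub_le_self _ (cutProp_nonneg _ _ hs)

theorem cutoff_sub_mem {M : ℕ} (hM : 2 ≤ M) (j : ℕ) (s : ℝ) :
    cutoff M j s - cutoff M (j - 1) s = 0 ∨
      (cutoff M j s - cutoff M (j - 1) s = 1 ∧ cutoff M j s = 1 ∧ cutoff M (j - 1) s = 0) := by
  have hmono : (M : ℝ) ^ (2 * (j - 1)) ≤ (M : ℝ) ^ (2 * j) :=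
    pow_le_pow_right₀ (by exact_mod_cast (by omega : 1 ≤ M)) (by omega)
  unfold cutoff
  by_cases h1 : 1 ≤ j ∧ 1 + s ≤ (M : ℝ) ^ (2 * j)
  · rw [if_pos h1]
    by_cases h2 : 1 ≤ j - 1 ∧ 1 + s ≤ (M : ℝ) ^ (2 * (j - 1))
    · rw [if_pos h2]; simp
    · rw [if_neg h2]; simp
  · have h2 : ¬(1 ≤ j - 1 ∧ 1 + s ≤ (M : ℝ) ^ (2 * (j - 1))) := fun h2 =>
      h1 ⟨by omega, h2.2.trans hmono⟩
    rw [if_neg h1, if_neg h2]; simp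

theorem dProp_le {M : ℕ} (hM : 2 ≤ M) {j : ℕ} {s : ℝ} (hs : 0 ≤ s) :
    dProp M j s ≤ (M : ℝ) ^ 2 * ((M : ℝ) ^ j)⁻¹ ^ 2 := by
  have hM0 : (0 : ℝ) < M := by exact_mod_cast (by omega : 0 < M)
  rcases cutoff_sub_mem hM j s with h | ⟨-, h1, h2⟩
  · have : dProp M j s = 0 := by unfold dProp cutProp; rw [← sub_mul, h, zero_mul]
    rw [this]; positivity
  · unfold cutoff at h1 h2
    have h1' : 1 ≤ j ∧ 1 + s ≤ (M : ℝ) ^ (2 * j) := by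
      by_contra hc; rw [if_neg hc] at h1; exact zero_ne_one h1
    have h2' : ¬(1 ≤ j - 1 ∧ 1 + s ≤ (M : ℝ) ^ (2 * (j - 1))) := by
      intro hc; rw [if_pos hc] at h2; exact one_ne_zero h2
    have hsl : (M : ℝ) ^ (2 * (j - 1)) ≤ s + 1 := by
      rcases Nat.lt_or_ge 1 j with hj | hj
      · by_contra hc; exact h2' ⟨by omega, by linarith⟩
      · have : j = 1 := by omega
        subst this; simp; linarith
    refine (dProp_le_cutProp j hs).trans ((cutProp_le M j hs).trans ?_)
    rw [div_le_iff₀ (by linarith)]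
    have e : (M : ℝ) ^ 2 * ((M : ℝ) ^ j)⁻¹ ^ 2 * (M : ℝ) ^ (2 * (j - 1)) = 1 := by
      have : (M : ℝ) ^ 2 * (M : ℝ) ^ (2 * (j - 1)) = ((M : ℝ) ^ j) ^ 2 := by
        rw [← pow_add, ← pow_mul]; congr 1; omega
      calc _ = ((M : ℝ) ^ 2 * (M : ℝ) ^ (2 * (j - 1))) * ((M : ℝ) ^ j)⁻¹ ^ 2 := by ring
        _ = 1 := by rw [this]; field_simp
    exact e.symm.le.trans (mul_le_mul_of_nonneg_left hsl (by positivity))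

theorem dProp_le_prod {N M : ℕ} (hM : 2 ≤ M) {j : ℕ} (n : MultiMode N) :
    dProp M j (sqNorm n) ≤ (M : ℝ) ^ 2 * ((M : ℝ) ^ j)⁻¹ ^ 2 * ∏ c, bw ((M : ℝ) ^ j) 0 (n c) := by
  have hn := sqNorm_nonneg n
  by_cases h : 1 ≤ j ∧ 1 + sqNorm n ≤ (M : ℝ) ^ (2 * j)
  · have : ∏ c, bw ((M : ℝ) ^ j) 0 (n c) = 1 := by
      refine prod_eq_one fun c _ => ?_
      rw [bw, if_pos (abs_le_of_cutoff (sq_le_sqNorm n c) h.2)]; simp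
    rw [this, mul_one]; exact dProp_le hM hn
  · have h0 : cutProp M j (sqNorm n) = 0 := by rw [cutProp, cutoff, if_neg h, zero_mul]
    have : dProp M j (sqNorm n) ≤ 0 := (dProp_le_cutProp j hn).trans h0.le
    refine this.trans ?_
    have : 0 ≤ ∏ c, bw ((M : ℝ) ^ j) 0 (n c) := prod_nonneg fun c _ => bw_nonneg _ _
    positivity

/-! ### Splitting off one strand -/

theorem sqNorm_insertNth {N : ℕ} (c : Fin 4) (a : Mode N) (p : Fin 3 → Mode N) :
    sqNorm (c.insertNth a p : MultiMode N) = ((a : ℤ) : ℝ) ^ 2 + sqNorm3 fun i => (p i : ℤ) := by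
  unfold sqNorm sqNorm3
  rw [Fin.sum_univ_succAbove _ c]
  simp

theorem sum_multiMode {N : ℕ} {A : Type*} [AddCommMonoid A] (c : Fin 4) (f : MultiMode N → A) :
    ∑ n, f n = ∑ a : Mode N, ∑ p : Fin 3 → Mode N, f (c.insertNth a p) := by
  rw [← Fintype.sum_prod_type']
  exact (Equiv.sum_comp (Fin.insertNthEquiv (fun _ : Fin 4 => Mode N) c) f).symm

theorem prod_insertNth {N : ℕ} (c : Fin 4) (f : Fin 4 → Mode N → ℝ) (a : Mode N)
    (p : Fin 3 → Mode N) :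
    ∏ c', f c' ((c.insertNth a p : MultiMode N) c') = f c a * ∏ i, f (c.succAbove i) (p i) := by
  rw [Fin.prod_univ_succAbove _ c]; simp

/-- `∑_p C(a, p)^β ≤ ∏ bw` with exponent `α` on `a` and the same exponent on the other strands. -/
theorem sum_cutProp_rpow_le {N M j : ℕ} {α e β : ℝ} (hβ : 0 < β) (hα : 0 ≤ α) (he : 0 ≤ e)
    (hs : α + 3 * e = 2 * β) (a : Mode N) :
    ∑ p : Fin 3 → Mode N, cutProp M j (((a : ℤ) : ℝ) ^ 2 + sqNorm3 fun i => (p i : ℤ)) ^ β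
      ≤ bw ((M : ℝ) ^ j) α a * (∑ b : Mode N, bw ((M : ℝ) ^ j) e b) ^ 3 := by
  have e1 : (∑ b : Mode N, bw ((M : ℝ) ^ j) e b) ^ 3
      = ∑ p : Fin 3 → Mode N, ∏ i, bw ((M : ℝ) ^ j) e (p i) := by
    rw [sum_prod_bw fun _ => e]; simp
  rw [e1, mul_sum]
  refine sum_le_sum fun p _ => ?_
  have := cutProp_rpow_le (M := M) (j := j) hβ (Fin.cons α fun _ => e)
    (fun c => by refine Fin.cases ?_ (fun i => ?_) c <;> simpa) (by simp [Fin.sum_univ_succ]; linarith)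
    ((0 : Fin 4).insertNth a p)
  rw [sqNorm_insertNth, prod_insertNth 0 (fun c b => bw ((M : ℝ) ^ j) ((Fin.cons α fun _ => e : Fin 4 → ℝ) c) b)] at this
  simpa using this

/-! ### The logarithm of an affine path -/

section Path

variable {𝔸 : Type*} [NormedRing 𝔸] [NormedAlgebra ℂ 𝔸] [CompleteSpace 𝔸]

theorem hasDerivAt_ringInverse_comp {f : ℝ → 𝔸} {f' : 𝔸} {s : ℝ} (hf : HasDerivAt f f' s)
    (hu : IsUnit (f s)) :
    HasDerivAt (fun s => Ring.inverse (f s))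
      (-(Ring.inverse (f s) * f' * Ring.inverse (f s))) s := by
  obtain ⟨u, hu⟩ := hu
  have h1 := hasFDerivAt_ringInverse (𝕜 := ℝ) u
  rw [hu] at h1
  have h2 := h1.comp_hasDerivAt s hf
  refine h2.congr_deriv ?_
  rw [← hu, Ring.inverse_unit]
  simp

/-- For an affine path `s ↦ A + s Δ` and a trace `τ`,
`∫₀¹ (τ (U₁ (1 - t U₁)⁻¹) - τ (U₀ (1 - t U₀)⁻¹)) dt = ∫₀¹ τ (Δ (1 - U_s)⁻¹) ds`. -/
theorem integral_resolvent_sub (τ : 𝔸 →L[ℂ] ℂ) (hτ : ∀ a b, τ (a * b) = τ (b * a)) (A Δ : 𝔸)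
    (hu : ∀ s ∈ Icc (0 : ℝ) 1, ∀ t ∈ Icc (0 : ℝ) 1, IsUnit (1 - (t : ℂ) • (A + (s : ℂ) • Δ))) :
    (∫ t in (0 : ℝ)..1, τ ((A + Δ) * Ring.inverse (1 - (t : ℂ) • (A + Δ))))
      - (∫ t in (0 : ℝ)..1, τ (A * Ring.inverse (1 - (t : ℂ) • A)))
      = ∫ s in (0 : ℝ)..1, τ (Δ * Ring.inverse (1 - (A + (s : ℂ) • Δ))) := by
  set U : ℝ → 𝔸 := fun s => A + (s : ℂ) • Δ with hU
  set X : ℝ → ℝ → 𝔸 := fun s t => 1 - (t : ℂ) • U s with hX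
  set Rr : ℝ → ℝ → 𝔸 := fun s t => Ring.inverse (X s t) with hR
  have hXc : Continuous fun q : ℝ × ℝ => X q.1 q.2 := by simp only [hX, hU]; fun_prop
  have hRc : ContinuousOn (fun q : ℝ × ℝ => Rr q.1 q.2) (Icc 0 1 ×ˢ Icc 0 1) := by
    intro q hq
    obtain ⟨u, hu'⟩ := hu q.1 hq.1 q.2 hq.2
    have h1 := NormedRing.inverse_continuousAt u
    rw [hu'] at h1
    exact (ContinuousAt.comp (f := fun q : ℝ × ℝ => X q.1 q.2) h1 hXc.continuousAt).continuousWithinAt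
  have hUd : ∀ s, HasDerivAt U Δ s := fun s => by
    have := ((Complex.ofRealCLM.hasDerivAt (x := s)).smul_const Δ).const_add A
    exact this.congr_deriv (by simp)
  have hXs : ∀ s t, HasDerivAt (fun s => X s t) (-((t : ℂ) • Δ)) s := fun s t => by
    have := ((hUd s).const_smul (t : ℂ)).const_sub 1
    exact this
  have hXt : ∀ s t, HasDerivAt (fun t => X s t) (-(U s)) t := fun s t => by
    have := ((Complex.ofRealCLM.hasDerivAt (x := t)).smul_const (U s)).const_sub 1
    exact this.congr_deriv (by simp)
  have hmul : ∀ s ∈ Icc (0 : ℝ) 1, ∀ t ∈ Icc (0 : ℝ) 1,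
      1 + (t : ℂ) • (U s * Rr s t) = Rr s t ∧ 1 + (t : ℂ) • (Rr s t * U s) = Rr s t := by
    intro s hs t ht
    have h1 : X s t * Rr s t = 1 := Ring.mul_inverse_cancel _ (hu s hs t ht)
    have h2 : Rr s t * X s t = 1 := Ring.inverse_mul_cancel _ (hu s hs t ht)
    constructor
    · rw [← smul_mul_assoc]
      have : (t : ℂ) • U s = 1 - X s t := by simp [hX]
      rw [this, sub_mul, h1, one_mul]; abel
    · rw [← mul_smul_comm]
      have : (t : ℂ) • U s = 1 - X s t := by simp [hX]
      rw [this, mul_sub, h2, mul_one]; abel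
  set F : ℝ → ℝ → ℂ := fun s t => τ (Rr s t * Δ * Rr s t) with hF
  have hGs : ∀ s ∈ Icc (0 : ℝ) 1, ∀ t ∈ Icc (0 : ℝ) 1,
      HasDerivAt (fun s => τ (U s * Rr s t)) (F s t) s := by
    intro s hs t ht
    have h1 := (hUd s).mul (hasDerivAt_ringInverse_comp (hXs s t) (hu s hs t ht))
    have h2 := (τ.restrictScalars ℝ).hasFDerivAt.comp_hasDerivAt s h1
    refine h2.congr_deriv ?_
    simp only [ContinuousLinearMap.coe_restrictScalars', hF]
    congr 1
    change Δ * Rr s t + U s * -(Rr s t * -((t : ℂ) • Δ) * Rr s t) = _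
    conv_rhs => enter [1, 1]; rw [← (hmul s hs t ht).1]
    simp only [mul_neg, neg_mul, neg_neg, add_mul, one_mul, mul_smul_comm, smul_mul_assoc, mul_assoc]
  have hKt : ∀ s ∈ Icc (0 : ℝ) 1, ∀ t ∈ Icc (0 : ℝ) 1,
      HasDerivAt (fun t : ℝ => (t : ℂ) * τ (Δ * Rr s t)) (F s t) t := by
    intro s hs t ht
    have h0 : HasDerivAt (fun t => Δ * Rr s t) (Δ * -(Rr s t * -(U s) * Rr s t)) t :=
      (hasDerivAt_ringInverse_comp (hXt s t) (hu s hs t ht)).const_mul Δ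
    have h2 := (τ.restrictScalars ℝ).hasFDerivAt.comp_hasDerivAt t h0
    have h3 := (Complex.ofRealCLM.hasDerivAt (x := t)).mul h2
    refine h3.congr_deriv ?_
    simp only [ContinuousLinearMap.coe_restrictScalars', hF, Function.comp, Complex.ofRealCLM_apply,
      ofReal_one, one_mul]
    have e : τ (Rr s t * Δ * Rr s t) = τ (Δ * Rr s t * (1 + (t : ℂ) • (U s * Rr s t))) := by
      rw [(hmul s hs t ht).1, mul_assoc, hτ]
    rw [e]
    simp only [mul_neg, neg_mul, neg_neg, mul_add, mul_smul_comm,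
      map_add, map_smul, smul_eq_mul, mul_one, mul_assoc]
  have hFc : ContinuousOn (fun q : ℝ × ℝ => F q.1 q.2) (Icc 0 1 ×ˢ Icc 0 1) :=
    τ.continuous.comp_continuousOn ((hRc.mul continuousOn_const).mul hRc)
  have e01 : Set.uIcc (0 : ℝ) 1 = Icc 0 1 := Set.uIcc_of_le zero_le_one
  have hFs : ∀ t ∈ Icc (0 : ℝ) 1, ContinuousOn (fun s => F s t) (Set.uIcc 0 1) := fun t ht => by
    rw [e01]
    exact hFc.comp (f := fun s : ℝ => (s, t)) (by fun_prop) fun s hs => ⟨hs, ht⟩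
  have hFt : ∀ s ∈ Icc (0 : ℝ) 1, ContinuousOn (fun t => F s t) (Set.uIcc 0 1) := fun s hs => by
    rw [e01]
    exact hFc.comp (f := fun t : ℝ => (s, t)) (by fun_prop) fun t ht => ⟨hs, ht⟩
  have hI1 : ∀ t ∈ Icc (0 : ℝ) 1,
      ∫ s in (0 : ℝ)..1, F s t = τ (U 1 * Rr 1 t) - τ (U 0 * Rr 0 t) := fun t ht =>
    intervalIntegral.integral_eq_sub_of_hasDerivAt (fun s hs => hGs s (e01 ▸ hs) t ht)
      (hFs t ht).intervalIntegrable
  have hI2 : ∀ s ∈ Icc (0 : ℝ) 1, ∫ t in (0 : ℝ)..1, F s t = τ (Δ * Rr s 1) := fun s hs => by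
    rw [intervalIntegral.integral_eq_sub_of_hasDerivAt (fun t ht => hKt s hs t (e01 ▸ ht))
      (hFt s hs).intervalIntegrable]
    simp
  have hU1 : U 1 = A + Δ := by simp [hU]
  have hU0 : U 0 = A := by simp [hU]
  have hGc : ∀ s ∈ Icc (0 : ℝ) 1,
      IntervalIntegrable (fun t => τ (U s * Rr s t)) volume 0 1 := fun s hs => by
    refine ContinuousOn.intervalIntegrable ?_
    rw [e01]
    refine τ.continuous.comp_continuousOn (continuousOn_const.mul ?_)
    exact hRc.comp (f := fun t : ℝ => (s, t)) (by fun_prop) fun t ht => ⟨hs, ht⟩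
  calc _ = ∫ t in (0 : ℝ)..1, (τ (U 1 * Rr 1 t) - τ (U 0 * Rr 0 t)) := by
        rw [intervalIntegral.integral_sub (hGc 1 (by simp)) (hGc 0 (by simp))]
        simp only [hR, hX, hU1, hU0]
    _ = ∫ t in (0 : ℝ)..1, ∫ s in (0 : ℝ)..1, F s t :=
        intervalIntegral.integral_congr fun t ht => (hI1 t (e01 ▸ ht)).symm
    _ = ∫ s in (0 : ℝ)..1, ∫ t in (0 : ℝ)..1, F s t := by
        refine (intervalIntegral_intervalIntegral_swap (F := F) ?_).symm
        refine IntegrableOn.mono_set (ContinuousOn.integrableOn_compact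
          (isCompact_Icc.prod isCompact_Icc) hFc) ?_
        rw [Set.uIoc_of_le zero_le_one]
        exact Set.prod_mono Set.Ioc_subset_Icc_self Set.Ioc_subset_Icc_self
    _ = ∫ s in (0 : ℝ)..1, τ (Δ * Rr s 1) :=
        intervalIntegral.integral_congr fun s hs => hI2 s (e01 ▸ hs)
    _ = _ := by simp only [hR, hX, hU, ofReal_one, one_smul]

/-- If `F` is a primitive of `s ↦ τ (Δ P_s)` along an affine path, the increment of
`F - ∫ τ(U (1 - tU)⁻¹) dt` is bounded by a bound of `τ (Δ P_s) - τ (Δ (1 - U_s)⁻¹)`. -/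
theorem norm_sub_integral_resolvent_le (τ : 𝔸 →L[ℂ] ℂ) (hτ : ∀ a b, τ (a * b) = τ (b * a)) (A Δ : 𝔸)
    (hu : ∀ s ∈ Icc (0 : ℝ) 1, ∀ t ∈ Icc (0 : ℝ) 1, IsUnit (1 - (t : ℂ) • (A + (s : ℂ) • Δ)))
    (F P : ℝ → ℂ) (hF : ∀ s ∈ Icc (0 : ℝ) 1, HasDerivAt F (P s) s)
    (hP : ContinuousOn P (Icc 0 1)) {C : ℝ}
    (hC : ∀ s ∈ Icc (0 : ℝ) 1, ‖P s - τ (Δ * Ring.inverse (1 - (A + (s : ℂ) • Δ)))‖ ≤ C) :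
    ‖(F 1 - ∫ t in (0 : ℝ)..1, τ ((A + Δ) * Ring.inverse (1 - (t : ℂ) • (A + Δ))))
      - (F 0 - ∫ t in (0 : ℝ)..1, τ (A * Ring.inverse (1 - (t : ℂ) • A)))‖ ≤ C := by
  have e01 : Set.uIcc (0 : ℝ) 1 = Icc 0 1 := Set.uIcc_of_le zero_le_one
  have h1 : ∫ s in (0 : ℝ)..1, P s = F 1 - F 0 :=
    intervalIntegral.integral_eq_sub_of_hasDerivAt (fun s hs => hF s (e01 ▸ hs))
      (ContinuousOn.intervalIntegrable (e01 ▸ hP))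
  have h2 := integral_resolvent_sub τ hτ A Δ hu
  have hRc : ContinuousOn (fun s : ℝ => τ (Δ * Ring.inverse (1 - (A + (s : ℂ) • Δ)))) (Icc 0 1) := by
    refine τ.continuous.comp_continuousOn (continuousOn_const.mul ?_)
    intro s hs
    obtain ⟨u, hu'⟩ := hu s hs 1 (by simp)
    have h1 := NormedRing.inverse_continuousAt u
    rw [hu', ofReal_one, one_smul] at h1
    refine (ContinuousAt.comp (f := fun s : ℝ => 1 - (A + (s : ℂ) • Δ)) h1 ?_).continuousWithinAt
    fun_prop
  have e : (F 1 - ∫ t in (0 : ℝ)..1, τ ((A + Δ) * Ring.inverse (1 - (t : ℂ) • (A + Δ))))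
      - (F 0 - ∫ t in (0 : ℝ)..1, τ (A * Ring.inverse (1 - (t : ℂ) • A)))
      = ∫ s in (0 : ℝ)..1, (P s - τ (Δ * Ring.inverse (1 - (A + (s : ℂ) • Δ)))) := by
    rw [intervalIntegral.integral_sub (ContinuousOn.intervalIntegrable (e01 ▸ hP))
      (ContinuousOn.intervalIntegrable (e01 ▸ hRc)), h1, ← h2]
    ring
  rw [e]
  have := intervalIntegral.norm_integral_le_of_norm_le_const (a := (0 : ℝ)) (b := 1) (C := C)
    (f := fun s => P s - τ (Δ * Ring.inverse (1 - (A + (s : ℂ) • Δ)))) (fun s hs => by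
      rw [Set.uIoc_of_le zero_le_one] at hs
      exact hC s (Set.Ioc_subset_Icc_self hs))
  simpa using this

theorem hasDerivAt_trace_pow (τ : 𝔸 →L[ℂ] ℂ) (hτ : ∀ a b, τ (a * b) = τ (b * a)) {f : ℝ → 𝔸}
    {f' : 𝔸} {s : ℝ} (hf : HasDerivAt f f' s) (k : ℕ) :
    HasDerivAt (fun s => τ (f s ^ (k + 1))) ((k + 1) * τ (f' * f s ^ k)) s := by
  have h1 : ∀ k : ℕ, HasDerivAt (fun s => f s ^ (k + 1))
      (∑ i ∈ range (k + 1), f s ^ i * f' * f s ^ (k - i)) s := by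
    intro k
    induction k with
    | zero => simpa using hf
    | succ k ih =>
      have h2 := ih.mul hf
      simp only [pow_succ (f _) (k + 1)]
      refine h2.congr_deriv ?_
      rw [sum_range_succ _ (k + 1), sum_mul]
      congr 1
      · refine sum_congr rfl fun i hi => ?_
        have : k + 1 - i = (k - i) + 1 := by have := mem_range.1 hi; omega
        rw [this, pow_succ (f s) (k - i)]; simp only [mul_assoc]
      · simp
  have h3 := (τ.restrictScalars ℝ).hasFDerivAt.comp_hasDerivAt s (h1 k)
  refine h3.congr_deriv ?_
  simp only [ContinuousLinearMap.coe_restrictScalars', map_sum]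
  have : ∀ i ∈ range (k + 1), τ (f s ^ i * f' * f s ^ (k - i)) = τ (f' * f s ^ k) :=
    fun i hi => by
      rw [mul_assoc, hτ, mul_assoc, ← pow_add]
      congr 3; have := mem_range.1 hi; omega
  rw [sum_congr rfl this]
  simp

end Path

/-! ### Hilbert–Schmidt norms and operator bounds -/

section HilbertSchmidt

variable {ι : Type*} [Fintype ι]

/-- The squared Hilbert–Schmidt norm. -/
noncomputable def fro (A : Matrix ι ι ℂ) : ℝ := ∑ i, ∑ j, ‖A i j‖ ^ 2

/-- `K` bounds the `ℓ²` operator norm of `X`. -/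
def OpBound (X : Matrix ι ι ℂ) (K : ℝ) : Prop :=
  ∀ v : ι → ℂ, ∑ i, ‖(X.mulVec v) i‖ ^ 2 ≤ K ^ 2 * ∑ i, ‖v i‖ ^ 2

theorem fro_nonneg (A : Matrix ι ι ℂ) : 0 ≤ fro A :=
  sum_nonneg fun _ _ => sum_nonneg fun _ _ => sq_nonneg _

theorem fro_le_of_norm_le {A B : Matrix ι ι ℂ} (h : ∀ i j, ‖A i j‖ ≤ ‖B i j‖) : fro A ≤ fro B :=
  sum_le_sum fun i _ => sum_le_sum fun j _ => pow_le_pow_left₀ (norm_nonneg _) (h i j) 2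

theorem fro_eq_of_norm_transpose {A B : Matrix ι ι ℂ} (h : ∀ i j, ‖A i j‖ = ‖B j i‖) :
    fro A = fro B := by
  unfold fro
  rw [sum_comm]
  simp_rw [h]

theorem norm_trace_mul_le (A B : Matrix ι ι ℂ) : ‖(A * B).trace‖ ≤ √(fro A) * √(fro B) := by
  have h1 : ‖(A * B).trace‖ ≤ ∑ q : ι × ι, ‖A q.1 q.2‖ * ‖B q.2 q.1‖ := by
    rw [Fintype.sum_prod_type, Matrix.trace]
    refine (norm_sum_le _ _).trans (sum_le_sum fun i _ => ?_)
    rw [diag_apply, Matrix.mul_apply]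
    refine (norm_sum_le _ _).trans (sum_le_sum fun j _ => ?_)
    rw [norm_mul]
  refine h1.trans ((sum_mul_le_sqrt_mul_sqrt _ _ _).trans (le_of_eq ?_))
  unfold fro
  rw [Fintype.sum_prod_type, Fintype.sum_prod_type]
  congr 2
  exact sum_comm

theorem fro_mul_le_of_opBound {X : Matrix ι ι ℂ} {K : ℝ} (hX : OpBound X K) (B : Matrix ι ι ℂ) :
    fro (X * B) ≤ K ^ 2 * fro B := by
  unfold fro
  rw [sum_comm, sum_comm (f := fun i j => ‖B i j‖ ^ 2), mul_sum]
  exact sum_le_sum fun j _ => hX fun i => B i j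

theorem norm_trace_mul_mul_le {X : Matrix ι ι ℂ} {K : ℝ} (hK : 0 ≤ K) (hX : OpBound X K)
    (A B : Matrix ι ι ℂ) : ‖(A * X * B).trace‖ ≤ K * (√(fro A) * √(fro B)) := by
  rw [mul_assoc]
  refine (norm_trace_mul_le _ _).trans ?_
  have : √(fro (X * B)) ≤ K * √(fro B) := by
    rw [← sqrt_sq hK, ← sqrt_mul (sq_nonneg K)]
    exact sqrt_le_sqrt (fro_mul_le_of_opBound hX B)
  calc _ ≤ √(fro A) * (K * √(fro B)) := mul_le_mul_of_nonneg_left this (sqrt_nonneg _)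
    _ = _ := by ring

theorem sqrt_sum_norm_add_le (v w : ι → ℂ) :
    √(∑ i, ‖v i + w i‖ ^ 2) ≤ √(∑ i, ‖v i‖ ^ 2) + √(∑ i, ‖w i‖ ^ 2) := by
  have := norm_add_le (WithLp.toLp 2 v : EuclideanSpace ℂ ι) (WithLp.toLp 2 w)
  simpa [EuclideanSpace.norm_eq] using this

theorem opBound_iff_sqrt {X : Matrix ι ι ℂ} {K : ℝ} (hK : 0 ≤ K) :
    OpBound X K ↔ ∀ v : ι → ℂ, √(∑ i, ‖(X.mulVec v) i‖ ^ 2) ≤ K * √(∑ i, ‖v i‖ ^ 2) := by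
  refine forall_congr' fun v => ?_
  have e : K * √(∑ i, ‖v i‖ ^ 2) = √(K ^ 2 * ∑ i, ‖v i‖ ^ 2) := by
    rw [sqrt_mul (sq_nonneg K), sqrt_sq hK]
  rw [e, sqrt_le_sqrt_iff (mul_nonneg (sq_nonneg K) (sum_nonneg fun _ _ => sq_nonneg _))]

variable [DecidableEq ι]

theorem OpBound.sub_one {X : Matrix ι ι ℂ} {K : ℝ} (hK : 0 ≤ K) (hX : OpBound X K) :
    OpBound (X - 1) (K + 1) := by
  rw [opBound_iff_sqrt (by linarith)]
  intro v
  have h1 := (opBound_iff_sqrt hK).1 hX v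
  have h2 := sqrt_sum_norm_add_le (X.mulVec v) (-v)
  rw [Matrix.sub_mulVec, one_mulVec]
  simp only [Pi.neg_apply, norm_neg, ← sub_eq_add_neg] at h2
  simp only [Pi.sub_apply]
  linarith

/-- Numerical range bound: `‖(1 - t (i λ H + D)) v‖ ≥ (cs - δ) ‖v‖`. -/
theorem le_norm_one_sub_mulVec {H : Matrix ι ι ℂ} (hH : H.IsHermitian) {d : ι → ℂ} {l : ℂ}
    {cs δ : ℝ} (hcs : cs ≤ 1) (hl : l.re = cs * ‖l‖) (hd : ∀ i, ‖d i‖ ≤ δ)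
    {t : ℝ} (ht : t ∈ Icc (0 : ℝ) 1) (v : ι → ℂ) :
    (cs - δ) * √(∑ i, ‖v i‖ ^ 2) ≤
      √(∑ i, ‖((1 - (t : ℂ) • ((Complex.I * l) • H + diagonal d)).mulVec v) i‖ ^ 2) := by
  set w := (1 - (t : ℂ) • ((Complex.I * l) • H + diagonal d)).mulVec v with hw
  set n2 := ∑ i, ‖v i‖ ^ 2 with hn2
  have hn0 : 0 ≤ n2 := sum_nonneg fun _ _ => sq_nonneg _
  set q := star v ⬝ᵥ H.mulVec v with hq
  have hqre : q.im = 0 := by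
    have := hH.im_star_dotProduct_mulVec_self v
    simpa using this
  set r := ∑ i, d i * (‖v i‖ : ℂ) ^ 2 with hr
  have hvv : star v ⬝ᵥ v = (n2 : ℂ) := by
    rw [dotProduct, hn2, ofReal_sum]
    refine sum_congr rfl fun i _ => ?_
    rw [Pi.star_apply, RCLike.star_def, Complex.conj_mul']; norm_cast
  have hdd : star v ⬝ᵥ (diagonal d).mulVec v = r := by
    rw [dotProduct, hr]
    refine sum_congr rfl fun i _ => ?_
    rw [Matrix.mulVec_diagonal, Pi.star_apply, RCLike.star_def, ← Complex.conj_mul']; ring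
  have hvw : star v ⬝ᵥ w = (n2 : ℂ) - t * (Complex.I * l * q) - t * r := by
    rw [hw, Matrix.sub_mulVec, one_mulVec, dotProduct_sub, hvv, Matrix.smul_mulVec,
      dotProduct_smul, Matrix.add_mulVec, dotProduct_add, Matrix.smul_mulVec, dotProduct_smul, hdd,
      smul_eq_mul, smul_eq_mul]
    ring
  have hrn : ‖r‖ ≤ δ * n2 := by
    rw [hr, hn2, mul_sum]
    refine (norm_sum_le _ _).trans (sum_le_sum fun i _ => ?_)
    rw [norm_mul, norm_pow, norm_real, norm_norm]
    exact mul_le_mul_of_nonneg_right (hd i) (sq_nonneg _)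
  have hmain : cs * n2 ≤ ‖(n2 : ℂ) - t * (Complex.I * l * q)‖ := by
    rcases eq_or_ne l 0 with rfl | hl0
    · simp only [mul_zero, zero_mul, sub_zero, norm_real, norm_eq_abs, abs_of_nonneg hn0]
      nlinarith
    · have hl1 : 0 < ‖l‖ := norm_pos_iff.2 hl0
      have hqr : q = (q.re : ℂ) := Complex.ext rfl (by simp [hqre])
      have e : (((n2 : ℂ) - t * (Complex.I * l * q)) * (starRingEnd ℂ) l).re = n2 * l.re := by
        rw [hqr]
        simp only [Complex.mul_re, sub_re, Complex.sub_im, Complex.mul_im, ofReal_re,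
          ofReal_im, Complex.I_re, Complex.I_im, Complex.conj_re, Complex.conj_im]
        ring
      have h1 := re_le_norm (((n2 : ℂ) - t * (Complex.I * l * q)) * (starRingEnd ℂ) l)
      rw [e, norm_mul, Complex.norm_conj, hl] at h1
      refine le_of_mul_le_mul_right ?_ hl1
      linarith
  have h2 : (cs - δ) * n2 ≤ ‖star v ⬝ᵥ w‖ := by
    rw [hvw]
    have h3 := norm_sub_norm_le ((n2 : ℂ) - t * (Complex.I * l * q)) (t * r)
    have h4 : ‖(t : ℂ) * r‖ ≤ δ * n2 := by
      rw [norm_mul, norm_real, norm_eq_abs, abs_of_nonneg ht.1]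
      exact (mul_le_of_le_one_left (norm_nonneg _) ht.2).trans hrn
    linarith
  have h5 : ‖star v ⬝ᵥ w‖ ≤ √n2 * √(∑ i, ‖w i‖ ^ 2) := by
    refine le_trans ?_ (sum_mul_le_sqrt_mul_sqrt univ (fun i => ‖v i‖) (fun i => ‖w i‖))
    rw [dotProduct]
    refine (norm_sum_le _ _).trans (sum_le_sum fun i _ => ?_)
    rw [norm_mul, Pi.star_apply, norm_star]
  rcases hn0.eq_or_lt with h0 | h0
  · rw [← h0, sqrt_zero, mul_zero]; exact sqrt_nonneg _
  · have hs : 0 < √n2 := sqrt_pos.2 h0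
    refine le_of_mul_le_mul_left ?_ hs
    calc √n2 * ((cs - δ) * √n2) = (cs - δ) * n2 := by
          rw [mul_comm, mul_assoc, mul_self_sqrt hn0]
      _ ≤ _ := h2.trans h5

theorem isUnit_and_opBound_resolvent {H : Matrix ι ι ℂ} (hH : H.IsHermitian) {d : ι → ℂ} {l : ℂ}
    {cs : ℝ} (hcs0 : 0 < cs) (hcs : cs ≤ 1) (hl : l.re = cs * ‖l‖) (hd : ∀ i, ‖d i‖ ≤ cs / 2)
    {t : ℝ} (ht : t ∈ Icc (0 : ℝ) 1) :
    IsUnit (1 - (t : ℂ) • ((Complex.I * l) • H + diagonal d)) ∧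
      OpBound (1 - (t : ℂ) • ((Complex.I * l) • H + diagonal d))⁻¹ (2 / cs) := by
  set X := 1 - (t : ℂ) • ((Complex.I * l) • H + diagonal d) with hX
  have key : ∀ v, cs / 2 * √(∑ i, ‖v i‖ ^ 2) ≤ √(∑ i, ‖(X.mulVec v) i‖ ^ 2) := fun v => by
    have := le_norm_one_sub_mulVec hH hcs hl hd ht v
    rw [← hX] at this
    convert this using 2; ring
  have hunit : IsUnit X := by
    rw [← Matrix.mulVec_injective_iff_isUnit]
    have hz : ∀ v, X.mulVec v = 0 → v = 0 := fun v hv => by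
      have h1 := key v
      rw [hv] at h1
      simp only [Pi.zero_apply, norm_zero, ne_eq, OfNat.ofNat_ne_zero, not_false_eq_true, zero_pow,
        sum_const_zero, sqrt_zero] at h1
      have h2 : √(∑ i, ‖v i‖ ^ 2) = 0 := le_antisymm (by nlinarith) (sqrt_nonneg _)
      have h3 := (sqrt_eq_zero (sum_nonneg fun _ _ => sq_nonneg _)).1 h2
      funext i
      have := (sum_eq_zero_iff_of_nonneg fun _ _ => sq_nonneg _).1 h3 i (mem_univ i)
      simpa using this
    intro v w hvw
    have := hz (v - w) (by rw [Matrix.mulVec_sub]; simpa [sub_eq_zero] using hvw)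
    exact sub_eq_zero.1 this
  refine ⟨hunit, (opBound_iff_sqrt (by positivity)).2 fun v => ?_⟩
  have h1 := key (X⁻¹.mulVec v)
  rw [Matrix.mulVec_mulVec, mul_nonsing_inv _ ((isUnit_iff_isUnit_det _).1 hunit), one_mulVec] at h1
  rw [div_mul_eq_mul_div, le_div_iff₀ hcs0]
  linarith

end HilbertSchmidt

/-! ### Increment of the logarithm between two consecutive cutoffs -/

section Slice

variable {N : ℕ}

/-- The 0/1 diagonal projector on a set of modes. -/
noncomputable def proj (sl : MultiMode N → Prop) [DecidablePred sl] : Op N :=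
  diagonal fun n => if sl n then 1 else 0

variable (sl : MultiMode N → Prop) [DecidablePred sl]

theorem proj_mul_self : proj sl * proj sl = proj sl := by
  rw [proj, diagonal_mul_diagonal]; congr 1; funext n; split_ifs <;> simp

theorem proj_mul_apply (A : Op N) (n m : MultiMode N) :
    (proj sl * A) n m = if sl n then A n m else 0 := by
  rw [proj, diagonal_mul]; split_ifs <;> simp

theorem mul_proj_apply (A : Op N) (n m : MultiMode N) :
    (A * proj sl) n m = if sl m then A n m else 0 := by
  rw [proj, mul_diagonal]; split_ifs <;> simp

/-- The increment `U - (1 - P) U (1 - P)`. -/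
noncomputable def incr (A : Op N) : Op N := proj sl * A + (1 - proj sl) * A * proj sl

/-- The interpolating path from `(1 - P) U (1 - P)` to `U`. -/
noncomputable def path (A : Op N) (s : ℝ) : Op N :=
  (1 - proj sl) * A * (1 - proj sl) + (s : ℂ) • incr sl A

theorem one_sub_proj_mul_mul_apply (A : Op N) (n m : MultiMode N) :
    ((1 - proj sl) * A * (1 - proj sl)) n m = if sl n ∨ sl m then 0 else A n m := by
  rw [mul_sub, mul_one, Matrix.sub_apply, mul_proj_apply, sub_mul, one_mul, Matrix.sub_apply,
    proj_mul_apply]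
  by_cases h1 : sl n <;> by_cases h2 : sl m <;> simp [h1, h2]

theorem incr_apply (A : Op N) (n m : MultiMode N) :
    incr sl A n m = if sl n ∨ sl m then A n m else 0 := by
  rw [incr, Matrix.add_apply, mul_proj_apply, sub_mul, one_mul, Matrix.sub_apply, proj_mul_apply]
  by_cases h1 : sl n <;> by_cases h2 : sl m <;> simp [h1, h2]

theorem path_apply (A : Op N) (s : ℝ) (n m : MultiMode N) :
    path sl A s n m = ((if sl n ∨ sl m then s else 1 : ℝ) : ℂ) * A n m := by
  rw [path, Matrix.add_apply, one_sub_proj_mul_mul_apply, Matrix.smul_apply, incr_apply]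
  split_ifs <;> simp

theorem path_one (A : Op N) : path sl A 1 = A := by ext n m; rw [path_apply]; split_ifs <;> simp

theorem path_add_incr (A : Op N) : (1 - proj sl) * A * (1 - proj sl) + incr sl A = A := by
  ext n m; rw [Matrix.add_apply, one_sub_proj_mul_mul_apply, incr_apply]; split_ifs <;> simp

theorem path_zero (A : Op N) : path sl A 0 = (1 - proj sl) * A * (1 - proj sl) := by simp [path]

theorem norm_path_apply_le (A : Op N) {s : ℝ} (hs : s ∈ Icc (0 : ℝ) 1) (n m : MultiMode N) :
    ‖path sl A s n m‖ ≤ ‖A n m‖ := by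
  rw [path_apply, norm_mul, norm_real, norm_eq_abs]
  refine mul_le_of_le_one_left (norm_nonneg _) ?_
  split_ifs
  · rw [abs_of_nonneg hs.1]; exact hs.2
  · simp

theorem path_add (A B : Op N) (s : ℝ) : path sl (A + B) s = path sl A s + path sl B s := by
  ext n m; simp only [path_apply, Matrix.add_apply, mul_add]

theorem path_smul (c : ℂ) (A : Op N) (s : ℝ) : path sl (c • A) s = c • path sl A s := by
  ext n m; simp only [path_apply, Matrix.smul_apply, smul_eq_mul]; ring

theorem path_isHermitian {H : Op N} (hH : H.IsHermitian) (s : ℝ) : (path sl H s).IsHermitian := by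
  ext n m
  rw [conjTranspose_apply, path_apply, path_apply, star_mul', ← conjTranspose_apply, hH]
  simp [or_comm]

theorem path_diagonal (d : MultiMode N → ℂ) (s : ℝ) :
    path sl (diagonal d) s = diagonal fun n => ((if sl n then s else 1 : ℝ) : ℂ) * d n := by
  ext n m
  rw [path_apply]
  by_cases h : n = m
  · subst h; simp
  · simp [h]

/-- `Tr log (1 - A)` minus its Taylor polynomial of order `3`. -/
noncomputable def trLog4 (A : Op N) : ℂ := trLog3 A + (1 / 3) * (A ^ 3).trace

/-- The trace as a continuous linear functional. -/
noncomputable def traceCLM (N : ℕ) : Op N →L[ℂ] ℂ :=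
  LinearMap.toContinuousLinearMap (Matrix.traceLinearMap (MultiMode N) ℂ ℂ)

theorem traceCLM_apply (A : Op N) : traceCLM N A = A.trace := rfl

theorem trLogOneSub_eq (A : Op N) :
    trLogOneSub A = -∫ t in (0 : ℝ)..1, traceCLM N (A * Ring.inverse (1 - (t : ℂ) • A)) := by
  simp only [trLogOneSub, traceCLM_apply, Matrix.nonsing_inv_eq_ringInverse]

theorem continuous_path (A : Op N) : Continuous (path sl A) := by unfold path; fun_prop

theorem hasDerivAt_trace_path_pow (A : Op N) (k : ℕ) (s : ℝ) :
    HasDerivAt (fun s => ((path sl A s) ^ (k + 1)).trace)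
      ((k + 1) * (incr sl A * path sl A s ^ k).trace) s := by
  let _ : NormedRing (Op N) := Matrix.linftyOpNormedRing
  let _ : NormedAlgebra ℂ (Op N) := Matrix.linftyOpNormedAlgebra
  have h0 : HasDerivAt (path sl A) (incr sl A) s := by
    have := ((Complex.ofRealCLM.hasDerivAt (x := s)).smul_const (incr sl A)).const_add
      ((1 - proj sl) * A * (1 - proj sl))
    exact this.congr_deriv (by simp)
  exact hasDerivAt_trace_pow (traceCLM N) (fun a b => trace_mul_comm a b) h0 k

theorem norm_sub_trLogOneSub_le (A Δ : Op N)
    (hu : ∀ s ∈ Icc (0 : ℝ) 1, ∀ t ∈ Icc (0 : ℝ) 1, IsUnit (1 - (t : ℂ) • (A + (s : ℂ) • Δ)))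
    (F P : ℝ → ℂ) (hF : ∀ s ∈ Icc (0 : ℝ) 1, HasDerivAt F (P s) s)
    (hP : ContinuousOn P (Icc 0 1)) {C : ℝ}
    (hC : ∀ s ∈ Icc (0 : ℝ) 1, ‖P s - (Δ * (1 - (A + (s : ℂ) • Δ))⁻¹).trace‖ ≤ C) :
    ‖(F 1 + trLogOneSub (A + Δ)) - (F 0 + trLogOneSub A)‖ ≤ C := by
  let _ : NormedRing (Op N) := Matrix.linftyOpNormedRing
  let _ : NormedAlgebra ℂ (Op N) := Matrix.linftyOpNormedAlgebra
  rw [trLogOneSub_eq, trLogOneSub_eq, ← sub_eq_add_neg, ← sub_eq_add_neg]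
  refine norm_sub_integral_resolvent_le (traceCLM N) (fun a b => trace_mul_comm a b)
    A Δ hu F P hF hP fun s hs => ?_
  have := hC s hs
  rw [Matrix.nonsing_inv_eq_ringInverse] at this
  exact this

variable {sl}

theorem isUnit_and_opBound_path {H : Op N} (hH : H.IsHermitian) {d : MultiMode N → ℂ} {l : ℂ}
    {cs : ℝ} (hcs0 : 0 < cs) (hcs : cs ≤ 1) (hl : l.re = cs * ‖l‖) (hd : ∀ i, ‖d i‖ ≤ cs / 2)
    {s t : ℝ} (hs : s ∈ Icc (0 : ℝ) 1) (ht : t ∈ Icc (0 : ℝ) 1) :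
    IsUnit (1 - (t : ℂ) • path sl ((Complex.I * l) • H + diagonal d) s) ∧
      OpBound (1 - (t : ℂ) • path sl ((Complex.I * l) • H + diagonal d) s)⁻¹ (2 / cs) := by
  rw [path_add, path_smul, path_diagonal]
  refine isUnit_and_opBound_resolvent (path_isHermitian sl hH s) hcs0 hcs hl (fun n => ?_) ht
  refine le_trans ?_ (hd n)
  rw [norm_mul, norm_real, norm_eq_abs]
  refine mul_le_of_le_one_left (norm_nonneg _) ?_
  split_ifs
  · rw [abs_of_nonneg hs.1]; exact hs.2
  · simp

/-- Increment of `trLog3` along the path. -/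
theorem norm_trLog3_sub_le {A : Op N}
    (hu : ∀ s ∈ Icc (0 : ℝ) 1, ∀ t ∈ Icc (0 : ℝ) 1, IsUnit (1 - (t : ℂ) • path sl A s))
    {C : ℝ} (hC : ∀ s ∈ Icc (0 : ℝ) 1,
      ‖(incr sl A * (path sl A s ^ 2 * (1 - path sl A s)⁻¹)).trace‖ ≤ C) :
    ‖trLog3 A - trLog3 ((1 - proj sl) * A * (1 - proj sl))‖ ≤ C := by
  have h := norm_sub_trLogOneSub_le ((1 - proj sl) * A * (1 - proj sl)) (incr sl A) hu
    (fun s => (path sl A s).trace + (1 / 2) * (path sl A s ^ 2).trace)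
    (fun s => (incr sl A).trace + (incr sl A * path sl A s).trace) (C := C)
    (fun s _ => by
      have h1 := hasDerivAt_trace_path_pow sl A 0 s
      have h2 := (hasDerivAt_trace_path_pow sl A 1 s).const_mul (1 / 2 : ℂ)
      have h3 := h1.add h2
      simp only [zero_add, pow_one] at h3
      refine h3.congr_deriv ?_
      push_cast
      simp only [pow_zero, mul_one]
      ring)
    (by
      refine Continuous.continuousOn (continuous_const.add ?_)
      exact (traceCLM N).continuous.comp (continuous_const.matrix_mul (continuous_path sl A)))
    (fun s hs => by
      change ‖_ - (incr sl A * (1 - path sl A s)⁻¹).trace‖ ≤ C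
      refine le_trans (le_of_eq ?_) (hC s hs)
      have hun : IsUnit (1 - path sl A s) := by simpa using hu s hs 1 (by simp)
      have hR : (1 - path sl A s) * (1 - path sl A s)⁻¹ = 1 :=
        mul_nonsing_inv _ ((isUnit_iff_isUnit_det _).1 hun)
      have e : path sl A s ^ 2 * (1 - path sl A s)⁻¹ = (1 - path sl A s)⁻¹ - 1 - path sl A s := by
        have : path sl A s ^ 2 = 1 - (1 + path sl A s) * (1 - path sl A s) := by noncomm_ring
        rw [this, sub_mul, mul_assoc, hR]; noncomm_ring
      rw [e, mul_sub, mul_sub, trace_sub, trace_sub, mul_one, ← norm_neg]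
      congr 1; ring)
  rw [path_add_incr, path_one, path_zero] at h
  unfold trLog3
  convert h using 2

/-- Increment of `trLog4` along the path. -/
theorem norm_trLog4_sub_le {A : Op N}
    (hu : ∀ s ∈ Icc (0 : ℝ) 1, ∀ t ∈ Icc (0 : ℝ) 1, IsUnit (1 - (t : ℂ) • path sl A s))
    {C : ℝ} (hC : ∀ s ∈ Icc (0 : ℝ) 1,
      ‖(incr sl A * (path sl A s ^ 3 * (1 - path sl A s)⁻¹)).trace‖ ≤ C) :
    ‖trLog4 A - trLog4 ((1 - proj sl) * A * (1 - proj sl))‖ ≤ C := by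
  have h := norm_sub_trLogOneSub_le ((1 - proj sl) * A * (1 - proj sl)) (incr sl A) hu
    (fun s => (path sl A s).trace + (1 / 2) * (path sl A s ^ 2).trace
      + (1 / 3) * (path sl A s ^ 3).trace)
    (fun s => (incr sl A).trace + (incr sl A * path sl A s).trace
      + (incr sl A * path sl A s ^ 2).trace) (C := C)
    (fun s _ => by
      have h1 := hasDerivAt_trace_path_pow sl A 0 s
      have h2 := (hasDerivAt_trace_path_pow sl A 1 s).const_mul (1 / 2 : ℂ)
      have h4 := (hasDerivAt_trace_path_pow sl A 2 s).const_mul (1 / 3 : ℂ)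
      have h3 := (h1.add h2).add h4
      simp only [zero_add, pow_one] at h3
      refine h3.congr_deriv ?_
      push_cast
      simp only [pow_zero, mul_one]
      ring)
    (by
      refine Continuous.continuousOn ((continuous_const.add ?_).add ?_)
      · exact (traceCLM N).continuous.comp (continuous_const.matrix_mul (continuous_path sl A))
      · exact (traceCLM N).continuous.comp (continuous_const.mul ((continuous_path sl A).pow 2)))
    (fun s hs => by
      change ‖_ - (incr sl A * (1 - path sl A s)⁻¹).trace‖ ≤ C
      refine le_trans (le_of_eq ?_) (hC s hs)
      have hun : IsUnit (1 - path sl A s) := by simpa using hu s hs 1 (by simp)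
      have hR : (1 - path sl A s) * (1 - path sl A s)⁻¹ = 1 :=
        mul_nonsing_inv _ ((isUnit_iff_isUnit_det _).1 hun)
      have e : path sl A s ^ 3 * (1 - path sl A s)⁻¹
          = (1 - path sl A s)⁻¹ - 1 - path sl A s - path sl A s ^ 2 := by
        have : path sl A s ^ 3 = 1 - (1 + path sl A s + path sl A s ^ 2) * (1 - path sl A s) := by
          noncomm_ring
        rw [this, sub_mul, mul_assoc, hR]; noncomm_ring
      rw [e, mul_sub, mul_sub, mul_sub, trace_sub, trace_sub, trace_sub, mul_one, ← norm_neg]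
      congr 1; ring)
  rw [path_add_incr, path_one, path_zero] at h
  unfold trLog4 trLog3
  convert h using 2
  ring

end Slice

/-! ### Trace bounds for the increments -/

section TraceBounds

variable {N : ℕ} (sl : MultiMode N → Prop) [DecidablePred sl]

/-- `∑_{n ∈ sl, m} (∑_l |A_{nl}| |A_{lm}|)²`. -/
noncomputable def quarticSum (A : Op N) : ℝ :=
  ∑ n, ∑ m, if sl n then (∑ l, ‖A n l‖ * ‖A l m‖) ^ 2 else 0

theorem mul_resolvent {A : Op N} (hu : IsUnit (1 - A)) : A * (1 - A)⁻¹ = (1 - A)⁻¹ - 1 := by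
  have := mul_nonsing_inv _ ((isUnit_iff_isUnit_det _).1 hu)
  rw [sub_mul, one_mul] at this
  exact (sub_eq_of_eq_add (sub_eq_iff_eq_add'.1 this)).symm

theorem resolvent_mul {A : Op N} (hu : IsUnit (1 - A)) : (1 - A)⁻¹ * A = (1 - A)⁻¹ - 1 := by
  have := Matrix.nonsing_inv_mul _ ((isUnit_iff_isUnit_det _).1 hu)
  rw [mul_sub, mul_one] at this
  exact (sub_eq_of_eq_add (sub_eq_iff_eq_add'.1 this)).symm

theorem resolvent_comm {A : Op N} (hu : IsUnit (1 - A)) : (1 - A)⁻¹ * A = A * (1 - A)⁻¹ := by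
  rw [mul_resolvent hu, resolvent_mul hu]

theorem fro_proj_mul_mul_le {A X Y : Op N} (hX : ∀ n m, ‖X n m‖ ≤ ‖A n m‖)
    (hY : ∀ n m, ‖Y n m‖ ≤ ‖A n m‖) : fro (proj sl * (X * Y)) ≤ quarticSum sl A := by
  refine sum_le_sum fun n _ => sum_le_sum fun m _ => ?_
  rw [proj_mul_apply]
  split_ifs
  · refine pow_le_pow_left₀ (norm_nonneg _) ?_ 2
    rw [Matrix.mul_apply]
    exact (norm_sum_le _ _).trans (sum_le_sum fun l _ => by
      rw [norm_mul]; exact mul_le_mul (hX _ _) (hY _ _) (norm_nonneg _) (norm_nonneg _))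
  · simp

theorem fro_mul_mul_proj_le {A X Y : Op N} (hA : ∀ n m, ‖A n m‖ = ‖A m n‖)
    (hX : ∀ n m, ‖X n m‖ ≤ ‖A n m‖) (hY : ∀ n m, ‖Y n m‖ ≤ ‖A n m‖) :
    fro (X * Y * proj sl) ≤ quarticSum sl A := by
  have : fro (X * Y * proj sl) = fro (proj sl * (Y.transpose * X.transpose)) := by
    refine fro_eq_of_norm_transpose fun i j => ?_
    rw [mul_proj_apply, proj_mul_apply, ← Matrix.transpose_mul, transpose_apply]
  rw [this]
  exact fro_proj_mul_mul_le sl (fun n m => by rw [transpose_apply, hA]; exact hY _ _)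
    fun n m => by rw [transpose_apply, hA]; exact hX _ _

theorem norm_one_sub_proj_mul_le (A : Op N) (n m : MultiMode N) :
    ‖((1 - proj sl) * A) n m‖ ≤ ‖A n m‖ := by
  rw [sub_mul, one_mul, Matrix.sub_apply, proj_mul_apply]; split_ifs <;> simp

/-- The third order increment is bounded by the quartic sum. -/
theorem norm_trace_incr_cube_le {A : Op N} (hA : ∀ n m, ‖A n m‖ = ‖A m n‖) {s K : ℝ}
    (hs : s ∈ Icc (0 : ℝ) 1) (hK : 0 ≤ K) (hu : IsUnit (1 - path sl A s))
    (hR : OpBound (1 - path sl A s)⁻¹ K) :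
    ‖(incr sl A * (path sl A s ^ 3 * (1 - path sl A s)⁻¹)).trace‖ ≤ 2 * K * quarticSum sl A := by
  set B := path sl A s with hB
  set R := (1 - B)⁻¹ with hRdef
  set P := proj sl with hP
  have hPP : P * P = P := proj_mul_self sl
  have hc : R * B = B * R := resolvent_comm hu
  have hq0 : 0 ≤ quarticSum sl A := (fro_nonneg _).trans
    (fro_proj_mul_mul_le sl (fun _ _ => le_rfl) fun _ _ => le_rfl)
  have hBn : ∀ n m, ‖B n m‖ ≤ ‖A n m‖ := norm_path_apply_le sl A hs
  have e1 : (P * A * (B ^ 3 * R)).trace = ((P * (A * B)) * R * (B * B * P)).trace := by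
    have : B ^ 3 * R = B * (R * (B * B)) := by
      have : B ^ 3 * R = B * (B * (B * R)) := by noncomm_ring
      rw [this, ← hc, ← mul_assoc B R B, ← hc, mul_assoc R]
    rw [this]
    calc (P * A * (B * (R * (B * B)))).trace = (P * (P * A * (B * (R * (B * B))))).trace := by
          rw [← mul_assoc P, ← mul_assoc P, hPP]
      _ = (P * A * (B * (R * (B * B))) * P).trace := trace_mul_comm _ _
      _ = _ := by simp only [mul_assoc]
  have e2 : ((1 - P) * A * P * (B ^ 3 * R)).trace
      = ((P * (B * B)) * R * (B * ((1 - P) * A) * P)).trace := by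
    have : B ^ 3 * R = B * B * (R * B) := by rw [hc]; noncomm_ring
    rw [this]
    calc ((1 - P) * A * P * (B * B * (R * B))).trace
        = (((1 - P) * A * P) * (P * (B * B * (R * B)))).trace := by
          rw [← mul_assoc _ P, mul_assoc _ P P, hPP]
      _ = ((P * (B * B * (R * B))) * ((1 - P) * A * P)).trace := trace_mul_comm _ _
      _ = _ := by simp only [mul_assoc]
  have b1 := norm_trace_mul_mul_le hK hR (P * (A * B)) (B * B * P)
  have b2 := norm_trace_mul_mul_le hK hR (P * (B * B)) (B * ((1 - P) * A) * P)
  have hf1 : √(fro (P * (A * B))) * √(fro (B * B * P)) ≤ quarticSum sl A := by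
    rw [← mul_self_sqrt hq0]
    exact mul_le_mul (sqrt_le_sqrt (fro_proj_mul_mul_le sl (fun _ _ => le_rfl) hBn))
      (sqrt_le_sqrt (fro_mul_mul_proj_le sl hA hBn hBn)) (sqrt_nonneg _)
      (sqrt_nonneg _)
  have hf2 : √(fro (P * (B * B))) * √(fro (B * ((1 - P) * A) * P)) ≤ quarticSum sl A := by
    rw [← mul_self_sqrt hq0]
    exact mul_le_mul (sqrt_le_sqrt (fro_proj_mul_mul_le sl hBn hBn))
      (sqrt_le_sqrt (fro_mul_mul_proj_le sl hA hBn (norm_one_sub_proj_mul_le sl A)))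
      (sqrt_nonneg _) (sqrt_nonneg _)
  rw [incr, add_mul, trace_add, e1, e2]
  calc _ ≤ _ := norm_add_le _ _
    _ ≤ K * quarticSum sl A + K * quarticSum sl A := by
      refine add_le_add (b1.trans ?_) (b2.trans ?_)
      · exact mul_le_mul_of_nonneg_left hf1 hK
      · exact mul_le_mul_of_nonneg_left hf2 hK
    _ = _ := by ring

theorem sqrt_fro_add_le (A B : Op N) : √(fro (A + B)) ≤ √(fro A) + √(fro B) := by
  have h := sqrt_sum_norm_add_le (fun q : MultiMode N × MultiMode N => A q.1 q.2) fun q => B q.1 q.2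
  simpa only [fro, Fintype.sum_prod_type, Matrix.add_apply] using h

theorem fro_mul_proj_eq {A : Op N} (hA : ∀ n m, ‖A n m‖ = ‖A m n‖) :
    fro (A * proj sl) = fro (proj sl * A) := by
  refine fro_eq_of_norm_transpose fun i j => ?_
  rw [mul_proj_apply, proj_mul_apply]; split_ifs <;> simp [hA i j]

theorem norm_path_symm {A : Op N} (hA : ∀ n m, ‖A n m‖ = ‖A m n‖) (s : ℝ) (n m : MultiMode N) :
    ‖path sl A s n m‖ = ‖path sl A s m n‖ := by
  simp only [path_apply, norm_mul, hA n m, or_comm]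

theorem norm_path_diagonal_le (d : MultiMode N → ℂ) {s : ℝ}
    (hs : s ∈ Icc (0 : ℝ) 1) (n : MultiMode N) :
    ‖((if sl n then s else 1 : ℝ) : ℂ) * d n‖ ≤ ‖d n‖ := by
  rw [norm_mul, norm_real, norm_eq_abs]
  refine mul_le_of_le_one_left (norm_nonneg _) ?_
  split_ifs
  · rw [abs_of_nonneg hs.1]; exact hs.2
  · simp

theorem proj_comm_diagonal (d : MultiMode N → ℂ) : proj sl * diagonal d = diagonal d * proj sl := by
  rw [proj, diagonal_mul_diagonal, diagonal_mul_diagonal]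
  congr 1; funext n; ring

/-- A crude bound of the second order increment. -/
theorem norm_trace_incr_sq_le {S : Op N} (hS : ∀ n m, ‖S n m‖ = ‖S m n‖) (d : MultiMode N → ℂ)
    {s K : ℝ} (hs : s ∈ Icc (0 : ℝ) 1) (hK : 0 ≤ K)
    (hu : IsUnit (1 - path sl (S + diagonal d) s))
    (hR : OpBound (1 - path sl (S + diagonal d) s)⁻¹ K) {h e k : ℝ}
    (hh : √(fro (proj sl * S)) ≤ h) (he : √(fro (proj sl * diagonal d)) ≤ e)
    (hk : √(fro (proj sl * (diagonal d * diagonal d))) ≤ k) :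
    ‖(incr sl (S + diagonal d) * (path sl (S + diagonal d) s ^ 2 *
      (1 - path sl (S + diagonal d) s)⁻¹)).trace‖
      ≤ (K + 1) * (2 * h ^ 2 + 3 * (h * e) + (h + e) * k) := by
  set D := diagonal d with hD
  set B := path sl (S + D) s with hB
  set R := (1 - B)⁻¹ with hRdef
  set P := proj sl with hP
  have hPP : P * P = P := proj_mul_self sl
  have hc : R * B = B * R := resolvent_comm hu
  have hE : OpBound (B * R) (K + 1) := by rw [hRdef, mul_resolvent hu]; exact hR.sub_one hK
  have hK1 : 0 ≤ K + 1 := by linarith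
  set S' := path sl S s with hS'
  set d' : MultiMode N → ℂ := fun n => ((if sl n then s else 1 : ℝ) : ℂ) * d n with hd'
  set D' := diagonal d' with hD'
  have hBsum : B = S' + D' := by rw [hB, path_add, hD, path_diagonal]
  have hD'D : ∀ n m, ‖D' n m‖ ≤ ‖D n m‖ := fun n m => by
    by_cases hnm : n = m
    · subst hnm; rw [hD', hD, diagonal_apply_eq, diagonal_apply_eq]
      exact norm_path_diagonal_le sl d hs n
    · rw [hD', hD, diagonal_apply_ne _ hnm, diagonal_apply_ne _ hnm]
  have mono : ∀ {X Y : Op N}, (∀ n m, ‖X n m‖ ≤ ‖Y n m‖) → fro (P * X) ≤ fro (P * Y) := by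
    intro X Y h
    refine fro_le_of_norm_le fun n m => ?_
    rw [proj_mul_apply, proj_mul_apply]; split_ifs <;> simp [h n m]
  have diagSymm : ∀ f : MultiMode N → ℂ, ∀ n m, ‖diagonal f n m‖ = ‖diagonal f m n‖ := by
    intro f n m
    by_cases hnm : n = m
    · rw [hnm]
    · rw [diagonal_apply_ne _ hnm, diagonal_apply_ne _ (Ne.symm hnm)]
  have hh0 : 0 ≤ h := (sqrt_nonneg _).trans hh
  have he0 : 0 ≤ e := (sqrt_nonneg _).trans he
  have hk0 : 0 ≤ k := (sqrt_nonneg _).trans hk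
  have fS' : √(fro (S' * P)) ≤ h := by
    rw [fro_mul_proj_eq sl (norm_path_symm sl hS s)]
    exact (sqrt_le_sqrt (mono (norm_path_apply_le sl S hs))).trans hh
  have fD' : √(fro (D' * P)) ≤ e := by
    rw [fro_mul_proj_eq sl (diagSymm d')]
    exact (sqrt_le_sqrt (mono hD'D)).trans he
  have fB : √(fro (P * B)) ≤ h + e := by
    rw [hBsum, mul_add]
    refine (sqrt_fro_add_le _ _).trans (add_le_add ?_ ?_)
    · exact (sqrt_le_sqrt (mono (norm_path_apply_le sl S hs))).trans hh
    · exact (sqrt_le_sqrt (mono hD'D)).trans he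
  have hB2 : B ^ 2 * R = B * R * B := by rw [mul_assoc, hc, sq, mul_assoc]
  -- the four contributions
  have t1 : ‖((P * S) * (B * R) * (S' * P)).trace‖ ≤ (K + 1) * (h * h) :=
    (norm_trace_mul_mul_le hK1 hE _ _).trans (mul_le_mul_of_nonneg_left
      (mul_le_mul hh fS' (sqrt_nonneg _) hh0) hK1)
  have t2 : ‖((P * S) * (B * R) * (D' * P)).trace‖ ≤ (K + 1) * (h * e) :=
    (norm_trace_mul_mul_le hK1 hE _ _).trans (mul_le_mul_of_nonneg_left
      (mul_le_mul hh fD' (sqrt_nonneg _) hh0) hK1)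
  have t3 : ‖((P * D) * (B * R) * (S' * P)).trace‖ ≤ (K + 1) * (e * h) :=
    (norm_trace_mul_mul_le hK1 hE _ _).trans (mul_le_mul_of_nonneg_left
      (mul_le_mul he fS' (sqrt_nonneg _) he0) hK1)
  have t4 : ‖((P * D) * (B * R) * (D' * P)).trace‖ ≤ (K + 1) * ((h + e) * k) := by
    have e4 : ((P * D) * (B * R) * (D' * P)).trace = ((P * B) * R * ((D' * D) * P)).trace := by
      calc ((P * D) * (B * R) * (D' * P)).trace = ((D * P) * ((B * R) * (D' * P))).trace := by
            rw [hD, proj_comm_diagonal, mul_assoc]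
        _ = ((P * ((B * R) * (D' * P))) * D).trace := by rw [mul_assoc D, trace_mul_comm]
        _ = _ := by
          have : D' * P * D = D' * D * P := by rw [mul_assoc, hD, proj_comm_diagonal, ← mul_assoc]
          simp only [mul_assoc] at this ⊢
          rw [this]
    rw [e4]
    refine (norm_trace_mul_mul_le hK hR _ _).trans ?_
    have : √(fro (D' * D * P)) ≤ k := by
      refine le_trans (sqrt_le_sqrt ?_) hk
      rw [hD', hD, diagonal_mul_diagonal, fro_mul_proj_eq sl (diagSymm _), diagonal_mul_diagonal]
      refine mono fun n m => ?_
      by_cases hnm : n = m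
      · subst hnm; rw [diagonal_apply_eq, diagonal_apply_eq, norm_mul, norm_mul (d n)]
        exact mul_le_mul_of_nonneg_right (norm_path_diagonal_le sl d hs n) (norm_nonneg _)
      · rw [diagonal_apply_ne _ hnm, diagonal_apply_ne _ hnm]
    refine mul_le_mul (by linarith) (mul_le_mul fB this (sqrt_nonneg _) (by linarith))
      (by positivity) hK1
  have t5 : ‖((P * B) * (B * R) * ((1 - P) * S * P)).trace‖ ≤ (K + 1) * ((h + e) * h) := by
    refine (norm_trace_mul_mul_le hK1 hE _ _).trans (mul_le_mul_of_nonneg_left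
      (mul_le_mul fB ?_ (sqrt_nonneg _) (by linarith)) hK1)
    refine le_trans (sqrt_le_sqrt ?_) hh
    rw [← fro_mul_proj_eq sl hS]
    refine fro_le_of_norm_le fun n m => ?_
    rw [mul_proj_apply, mul_proj_apply]
    split_ifs
    · exact norm_one_sub_proj_mul_le sl S n m
    · simp
  have e1 : (P * (S + D) * (B ^ 2 * R)).trace
      = ((P * S) * (B * R) * (S' * P)).trace + ((P * S) * (B * R) * (D' * P)).trace
        + (((P * D) * (B * R) * (S' * P)).trace + ((P * D) * (B * R) * (D' * P)).trace) := by
    calc (P * (S + D) * (B ^ 2 * R)).trace = (P * (P * (S + D) * (B * R * B))).trace := by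
          rw [hB2, ← mul_assoc P, ← mul_assoc P, hPP]
      _ = (P * (S + D) * (B * R * B) * P).trace := trace_mul_comm _ _
      _ = (P * (S + D) * (B * R * ((S' + D') * P))).trace := by rw [← hBsum]; simp only [mul_assoc]
      _ = _ := by
          simp only [mul_add, add_mul, trace_add, mul_assoc]
          ring
  have e2 : ((1 - P) * (S + D) * P * (B ^ 2 * R)).trace
      = ((P * B) * (B * R) * ((1 - P) * S * P)).trace := by
    have : (1 - P) * (S + D) * P = (1 - P) * S * P := by
      have : (1 - P) * D * P = 0 := by
        rw [mul_assoc, hD, ← proj_comm_diagonal, ← mul_assoc, sub_mul, one_mul, hPP, sub_self,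
          zero_mul]
      rw [mul_add, add_mul, this, add_zero]
    rw [this]
    have hB2' : B ^ 2 * R = B * (B * R) := by rw [sq, mul_assoc]
    calc ((1 - P) * S * P * (B ^ 2 * R)).trace
        = (((1 - P) * S * P) * (P * (B * (B * R)))).trace := by
          rw [hB2', ← mul_assoc _ P, mul_assoc _ P P, hPP]
      _ = ((P * (B * (B * R))) * ((1 - P) * S * P)).trace := trace_mul_comm _ _
      _ = _ := by simp only [mul_assoc]
  rw [incr, add_mul, trace_add, e1, e2]
  refine (norm_add_le _ _).trans ?_
  have n1 := norm_add_le (((P * S) * (B * R) * (S' * P)).trace + ((P * S) * (B * R) * (D' * P)).trace)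
    (((P * D) * (B * R) * (S' * P)).trace + ((P * D) * (B * R) * (D' * P)).trace)
  have n2 := norm_add_le ((P * S) * (B * R) * (S' * P)).trace ((P * S) * (B * R) * (D' * P)).trace
  have n3 := norm_add_le ((P * D) * (B * R) * (S' * P)).trace ((P * D) * (B * R) * (D' * P)).trace
  nlinarith

end TraceBounds

/-! ### Algebraic form of the slice of the interaction -/

section Algebra

variable {N : ℕ} (sl : MultiMode N → Prop) [DecidablePred sl]

/-- The compression of an operator to the complement of the slice. -/
noncomputable def compr (A : Op N) : Op N := (1 - proj sl) * A * (1 - proj sl)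

theorem compr_apply (A : Op N) (n m : MultiMode N) :
    compr sl A n m = if sl n ∨ sl m then 0 else A n m := one_sub_proj_mul_mul_apply sl A n m

theorem compr_add (A B : Op N) : compr sl (A + B) = compr sl A + compr sl B := by
  rw [compr, mul_add, add_mul]; rfl

theorem compr_diagonal (d : MultiMode N → ℂ) :
    compr sl (diagonal d) = diagonal fun n => if sl n then 0 else d n := by
  ext n m
  rw [compr_apply]
  by_cases h : n = m
  · subst h; simp
  · simp [h]

theorem trace_diagonal_mul_sq (d : MultiMode N → ℂ) (S : Op N) :
    (diagonal d * S ^ 2).trace = ∑ n, ∑ m, d n * (S n m * S m n) := by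
  simp only [Matrix.trace, diag_apply, diagonal_mul]
  simp only [sq, Matrix.mul_apply, mul_sum]

theorem trace_cube (S : Op N) : (S ^ 3).trace = ∑ n, ∑ m, ∑ l, S n m * (S m l * S l n) := by
  have : S ^ 3 = S * (S * S) := by noncomm_ring
  rw [this]
  simp only [Matrix.trace, diag_apply, Matrix.mul_apply, mul_sum]

theorem trace_mul_diagonal_sq (S : Op N) (d : MultiMode N → ℂ) :
    (S * diagonal d ^ 2).trace = ∑ n, S n n * d n ^ 2 := by
  rw [diagonal_pow]
  simp only [Matrix.trace, diag_apply, mul_diagonal, Pi.pow_apply]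

theorem trace_add_cube (S D : Op N) : ((S + D) ^ 3).trace
    = (S ^ 3).trace + 3 * (D * S ^ 2).trace + 3 * (S * D ^ 2).trace + (D ^ 3).trace := by
  have e : (S + D) ^ 3 = S ^ 3 + (D * S ^ 2 + S * D * S + S ^ 2 * D)
      + (S * D ^ 2 + D * S * D + D ^ 2 * S) + D ^ 3 := by noncomm_ring
  have h1 : (S * D * S).trace = (D * S ^ 2).trace := by
    rw [mul_assoc, trace_mul_comm, mul_assoc, sq]
  have h2 : (S ^ 2 * D).trace = (D * S ^ 2).trace := trace_mul_comm _ _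
  have h3 : (D * S * D).trace = (S * D ^ 2).trace := by
    rw [mul_assoc, trace_mul_comm, mul_assoc, sq]
  have h4 : (D ^ 2 * S).trace = (S * D ^ 2).trace := trace_mul_comm _ _
  rw [e]
  simp only [trace_add, h1, h2, h3, h4]
  ring

/-- `∑_{n ∈ sl} ∑_m |S_{nm}|² (w_n + w_m)`. -/
noncomputable def quadSum (S : Op N) (w : MultiMode N → ℝ) : ℝ :=
  ∑ n, ∑ m, if sl n then ‖S n m‖ ^ 2 * (w n + w m) else 0

/-- `∑_{n ∈ sl} ∑_{m, l} |S_{nm}| |S_{ml}| |S_{ln}|`. -/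
noncomputable def cubicSum (S : Op N) : ℝ :=
  ∑ n, ∑ m, ∑ l, if sl n then ‖S n m‖ * (‖S m l‖ * ‖S l n‖) else 0

theorem norm_trace_diagonal_mul_sq_sub_le {S : Op N} (hS : ∀ n m, ‖S n m‖ = ‖S m n‖)
    (d : MultiMode N → ℂ) :
    ‖(diagonal d * S ^ 2).trace
      - (compr sl (diagonal d) * compr sl S ^ 2).trace‖ ≤ quadSum sl S fun n => ‖d n‖ := by
  rw [compr_diagonal, trace_diagonal_mul_sq, trace_diagonal_mul_sq, ← sum_sub_distrib]
  simp only [← sum_sub_distrib]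
  have key : quadSum sl S (fun n => ‖d n‖)
      = ∑ n, ∑ m, ((if sl n then ‖S n m‖ ^ 2 * ‖d n‖ else 0)
        + if sl m then ‖S n m‖ ^ 2 * ‖d n‖ else 0) := by
    simp only [sum_add_distrib]
    rw [sum_comm (f := fun n m => if sl m then ‖S n m‖ ^ 2 * ‖d n‖ else 0)]
    simp only [← sum_add_distrib]
    refine sum_congr rfl fun n _ => sum_congr rfl fun m _ => ?_
    rw [hS m n]
    split_ifs <;> ring
  rw [key]
  refine (norm_sum_le _ _).trans (sum_le_sum fun n _ => ?_)
  refine (norm_sum_le _ _).trans (sum_le_sum fun m _ => ?_)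
  have h0 : ‖d n * (S n m * S m n)‖ = ‖S n m‖ ^ 2 * ‖d n‖ := by
    rw [norm_mul, norm_mul, hS m n]; ring
  have h1 : 0 ≤ ‖S n m‖ ^ 2 * ‖d n‖ := by positivity
  rw [compr_apply, compr_apply]
  by_cases hn : sl n <;> by_cases hm : sl m <;> simp only [hn, hm, if_true, if_false, or_true,
    or_false, mul_zero, sub_zero, sub_self, norm_zero, add_zero, zero_add, h0] <;> linarith

theorem norm_trace_cube_sub_le (S : Op N) :
    ‖(S ^ 3).trace - (compr sl S ^ 3).trace‖ ≤ 3 * cubicSum sl S := by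
  rw [trace_cube, trace_cube]
  simp only [← sum_sub_distrib]
  set F : MultiMode N → MultiMode N → MultiMode N → ℝ := fun n m l =>
    ‖S n m‖ * (‖S m l‖ * ‖S l n‖) with hF
  have c1 : cubicSum sl S = ∑ n, ∑ m, ∑ l, if sl m then F n m l else 0 := by
    have : ∑ n, ∑ m, ∑ l, (if sl m then F n m l else 0)
        = ∑ m, ∑ l, ∑ n, (if sl m then F n m l else 0) := by
      rw [sum_comm]
      exact sum_congr rfl fun m _ => sum_comm
    rw [this]
    refine sum_congr rfl fun n _ => sum_congr rfl fun m _ => sum_congr rfl fun l _ => ?_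
    simp only [hF]; split_ifs <;> ring
  have c2 : cubicSum sl S = ∑ n, ∑ m, ∑ l, if sl l then F n m l else 0 := by
    have : ∑ n, ∑ m, ∑ l, (if sl l then F n m l else 0)
        = ∑ l, ∑ n, ∑ m, (if sl l then F n m l else 0) := by
      rw [sum_comm (s := univ) (t := univ) (f := fun l n => ∑ m, if sl l then F n m l else 0)]
      exact sum_congr rfl fun n _ => sum_comm
    rw [this]
    refine sum_congr rfl fun n _ => sum_congr rfl fun m _ => sum_congr rfl fun l _ => ?_
    simp only [hF]; split_ifs <;> ring
  have key : 3 * cubicSum sl S = ∑ n, ∑ m, ∑ l, ((if sl n then F n m l else 0)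
      + (if sl m then F n m l else 0) + (if sl l then F n m l else 0)) := by
    simp only [sum_add_distrib]
    rw [← c1, ← c2]
    have : cubicSum sl S = ∑ n, ∑ m, ∑ l, if sl n then F n m l else 0 := rfl
    rw [← this]; ring
  rw [key]
  refine (norm_sum_le _ _).trans (sum_le_sum fun n _ => ?_)
  refine (norm_sum_le _ _).trans (sum_le_sum fun m _ => ?_)
  refine (norm_sum_le _ _).trans (sum_le_sum fun l _ => ?_)
  have h0 : ‖S n m * (S m l * S l n)‖ = F n m l := by rw [norm_mul, norm_mul]
  have h1 : 0 ≤ F n m l := by positivity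
  rw [compr_apply, compr_apply, compr_apply]
  by_cases hn : sl n <;> by_cases hm : sl m <;> by_cases hl : sl l <;>
    simp only [hn, hm, hl, if_true, if_false, or_true, or_false, or_self, zero_mul, mul_zero,
      sub_zero, sub_self, norm_zero, add_zero, zero_add, h0] <;> linarith

theorem norm_trace_mul_diagonal_sq_sub_le (S : Op N) (d : MultiMode N → ℂ) :
    ‖(S * diagonal d ^ 2).trace - (compr sl S * compr sl (diagonal d) ^ 2).trace‖
      ≤ ∑ n, if sl n then ‖S n n‖ * ‖d n‖ ^ 2 else 0 := by
  rw [compr_diagonal, trace_mul_diagonal_sq, trace_mul_diagonal_sq, ← sum_sub_distrib]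
  refine (norm_sum_le _ _).trans (sum_le_sum fun n _ => ?_)
  rw [compr_apply]
  by_cases hn : sl n <;> simp [hn]

/-- The interaction `V^{≥ 3}` as a function of its building blocks. -/
noncomputable def vAbs (S : Op N) (d₁ d₂ : MultiMode N → ℂ) : ℂ :=
  trLog3 (S + diagonal d₁ + diagonal d₂) + (diagonal d₁ * S ^ 2).trace
    + ((1 / 3) * (diagonal d₁ ^ 3).trace + (diagonal d₁ ^ 2 * diagonal d₂).trace
      + (1 / 4) * (diagonal d₁ ^ 4).trace)

theorem vAbs_vac (d₁ d₂ : MultiMode N → ℂ) :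
    ((1 / 3) * (diagonal d₁ ^ 3 : Op N).trace + (diagonal d₁ ^ 2 * diagonal d₂ : Op N).trace
      + (1 / 4) * (diagonal d₁ ^ 4 : Op N).trace)
      = ∑ n, ((1 / 3) * d₁ n ^ 3 + d₁ n ^ 2 * d₂ n + (1 / 4) * d₁ n ^ 4) := by
  simp only [diagonal_pow, diagonal_mul_diagonal, trace_diagonal,
    Pi.pow_apply, sum_add_distrib, mul_sum]

theorem sum_sub_sum_ite (f : ℂ → ℂ → ℂ) (hf : f 0 0 = 0) (d₁ d₂ : MultiMode N → ℂ) :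
    ∑ n, f (d₁ n) (d₂ n) - ∑ n, f (if sl n then 0 else d₁ n) (if sl n then 0 else d₂ n)
      = ∑ n, if sl n then f (d₁ n) (d₂ n) else 0 := by
  rw [← sum_sub_distrib]
  refine sum_congr rfl fun n _ => ?_
  split_ifs <;> simp [hf]

variable {sl}

theorem norm_vAbs_sub_le_crude {S : Op N} (hS : ∀ n m, ‖S n m‖ = ‖S m n‖)
    (d₁ d₂ : MultiMode N → ℂ) {K : ℝ} (hK : 0 ≤ K)
    (hu : ∀ s ∈ Icc (0 : ℝ) 1, ∀ t ∈ Icc (0 : ℝ) 1,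
      IsUnit (1 - (t : ℂ) • path sl (S + diagonal (fun n => d₁ n + d₂ n)) s) ∧
      OpBound (1 - (t : ℂ) • path sl (S + diagonal (fun n => d₁ n + d₂ n)) s)⁻¹ K)
    {h e k : ℝ} (hh : √(fro (proj sl * S)) ≤ h)
    (he : √(fro (proj sl * diagonal (fun n => d₁ n + d₂ n))) ≤ e)
    (hk : √(fro (proj sl * (diagonal (fun n => d₁ n + d₂ n)
      * diagonal (fun n => d₁ n + d₂ n)))) ≤ k) :
    ‖vAbs S d₁ d₂ - vAbs (compr sl S) (fun n => if sl n then 0 else d₁ n)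
        (fun n => if sl n then 0 else d₂ n)‖
      ≤ (K + 1) * (2 * h ^ 2 + 3 * (h * e) + (h + e) * k) + quadSum sl S (fun n => ‖d₁ n‖)
        + ∑ n, if sl n then ‖d₁ n‖ ^ 3 + ‖d₁ n‖ ^ 2 * ‖d₂ n‖ + ‖d₁ n‖ ^ 4 else 0 := by
  set D := diagonal (fun n => d₁ n + d₂ n) with hD
  have e1 : S + diagonal d₁ + diagonal d₂ = S + D := by rw [hD, add_assoc, diagonal_add]
  have e2 : compr sl S + (diagonal fun n => if sl n then 0 else d₁ n)
      + (diagonal fun n => if sl n then 0 else d₂ n) = compr sl (S + D) := by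
    rw [← compr_diagonal, ← compr_diagonal, ← compr_add, ← compr_add, e1]
  have h1 : ‖trLog3 (S + D) - trLog3 (compr sl (S + D))‖
      ≤ (K + 1) * (2 * h ^ 2 + 3 * (h * e) + (h + e) * k) := by
    refine norm_trLog3_sub_le (fun s hs t ht => (hu s hs t ht).1) fun s hs => ?_
    have := hu s hs 1 (by simp)
    simp only [ofReal_one, one_smul] at this
    exact norm_trace_incr_sq_le sl hS _ hs hK this.1 this.2 hh he hk
  have h2 := norm_trace_diagonal_mul_sq_sub_le sl hS d₁
  have h3 : ‖∑ n, (if sl n then ((1 / 3) * d₁ n ^ 3 + d₁ n ^ 2 * d₂ n + (1 / 4) * d₁ n ^ 4) else 0)‖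
      ≤ ∑ n, if sl n then ‖d₁ n‖ ^ 3 + ‖d₁ n‖ ^ 2 * ‖d₂ n‖ + ‖d₁ n‖ ^ 4 else 0 := by
    refine (norm_sum_le _ _).trans (sum_le_sum fun n _ => ?_)
    split_ifs
    · refine (norm_add₃_le).trans ?_
      simp only [norm_mul, norm_pow]
      have a1 : 0 ≤ ‖d₁ n‖ ^ 3 := by positivity
      have a2 : 0 ≤ ‖d₁ n‖ ^ 4 := by positivity
      norm_num
      linarith
    · simp
  have e3 := sum_sub_sum_ite sl (fun a b => (1 / 3) * a ^ 3 + a ^ 2 * b + (1 / 4) * a ^ 4) (by simp)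
    d₁ d₂
  unfold vAbs
  rw [e1, e2, vAbs_vac, vAbs_vac, ← compr_diagonal]
  rw [← e3] at h3
  refine le_trans (le_of_eq ?_) ((norm_add₃_le).trans (add_le_add (add_le_add h1 h2) h3))
  congr 1; ring

theorem norm_vAbs_sub_le_fine {S : Op N} (hS : ∀ n m, ‖S n m‖ = ‖S m n‖)
    (d₁ d₂ : MultiMode N → ℂ) {K : ℝ} (hK : 0 ≤ K)
    (hu : ∀ s ∈ Icc (0 : ℝ) 1, ∀ t ∈ Icc (0 : ℝ) 1,
      IsUnit (1 - (t : ℂ) • path sl (S + diagonal (fun n => d₁ n + d₂ n)) s) ∧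
      OpBound (1 - (t : ℂ) • path sl (S + diagonal (fun n => d₁ n + d₂ n)) s)⁻¹ K) :
    ‖vAbs S d₁ d₂ - vAbs (compr sl S) (fun n => if sl n then 0 else d₁ n)
        (fun n => if sl n then 0 else d₂ n)‖
      ≤ 2 * K * quarticSum sl (S + diagonal (fun n => d₁ n + d₂ n))
        + cubicSum sl S + quadSum sl S (fun n => ‖d₂ n‖)
        + (∑ n, if sl n then ‖S n n‖ * ‖d₁ n + d₂ n‖ ^ 2 else 0)
        + ∑ n, if sl n then ‖d₁ n‖ * ‖d₂ n‖ ^ 2 + ‖d₂ n‖ ^ 3 + ‖d₁ n‖ ^ 4 else 0 := by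
  set D := diagonal (fun n => d₁ n + d₂ n) with hD
  have e1 : S + diagonal d₁ + diagonal d₂ = S + D := by rw [hD, add_assoc, diagonal_add]
  have e2 : compr sl S + (diagonal fun n => if sl n then 0 else d₁ n)
      + (diagonal fun n => if sl n then 0 else d₂ n) = compr sl (S + D) := by
    rw [← compr_diagonal, ← compr_diagonal, ← compr_add, ← compr_add, e1]
  have hA : ∀ n m, ‖(S + D) n m‖ = ‖(S + D) m n‖ := fun n m => by
    by_cases hnm : n = m
    · rw [hnm]
    · rw [Matrix.add_apply, Matrix.add_apply, hD, diagonal_apply_ne _ hnm,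
        diagonal_apply_ne _ (Ne.symm hnm), add_zero, add_zero, hS]
  have h1 : ‖trLog4 (S + D) - trLog4 (compr sl (S + D))‖ ≤ 2 * K * quarticSum sl (S + D) := by
    refine norm_trLog4_sub_le (fun s hs t ht => (hu s hs t ht).1) fun s hs => ?_
    have := hu s hs 1 (by simp)
    simp only [ofReal_one, one_smul] at this
    exact norm_trace_incr_cube_le sl hA hs hK this.1 this.2
  have h2 : ‖-(1 / 3 : ℂ) * ((S ^ 3).trace - (compr sl S ^ 3).trace)‖ ≤ cubicSum sl S := by
    rw [norm_mul]
    have := norm_trace_cube_sub_le sl S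
    norm_num
    linarith
  have h3 : ‖-((diagonal d₂ * S ^ 2).trace - (compr sl (diagonal d₂) * compr sl S ^ 2).trace)‖
      ≤ quadSum sl S (fun n => ‖d₂ n‖) := by
    rw [norm_neg]; exact norm_trace_diagonal_mul_sq_sub_le sl hS d₂
  have h4 : ‖-((S * D ^ 2).trace - (compr sl S * compr sl D ^ 2).trace)‖
      ≤ ∑ n, if sl n then ‖S n n‖ * ‖d₁ n + d₂ n‖ ^ 2 else 0 := by
    rw [norm_neg]; exact norm_trace_mul_diagonal_sq_sub_le sl S _
  have h5 : ‖∑ n, (if sl n then (-(d₁ n * d₂ n ^ 2) - (1 / 3) * d₂ n ^ 3 + (1 / 4) * d₁ n ^ 4)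
        else 0)‖
      ≤ ∑ n, if sl n then ‖d₁ n‖ * ‖d₂ n‖ ^ 2 + ‖d₂ n‖ ^ 3 + ‖d₁ n‖ ^ 4 else 0 := by
    refine (norm_sum_le _ _).trans (sum_le_sum fun n _ => ?_)
    split_ifs
    · refine (norm_add_le _ _).trans ((add_le_add_left (norm_sub_le _ _) _).trans ?_)
      simp only [norm_mul, norm_pow, norm_neg]
      have a1 : 0 ≤ ‖d₂ n‖ ^ 3 := by positivity
      have a2 : 0 ≤ ‖d₁ n‖ ^ 4 := by positivity
      norm_num
      linarith
    · simp
  have e3 := sum_sub_sum_ite sl (fun a b => -(a * b ^ 2) - (1 / 3) * b ^ 3 + (1 / 4) * a ^ 4)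
    (by simp) d₁ d₂
  rw [← e3] at h5
  have tD : (D ^ 3).trace = ∑ n, (d₁ n + d₂ n) ^ 3 := by rw [hD, diagonal_pow, trace_diagonal]; rfl
  have tD' : (compr sl D ^ 3).trace
      = ∑ n, ((if sl n then 0 else d₁ n) + (if sl n then 0 else d₂ n)) ^ 3 := by
    rw [hD, compr_diagonal, diagonal_pow, trace_diagonal]
    refine sum_congr rfl fun n _ => ?_
    by_cases hn : sl n <;> simp [hn]
  have tDS : (D * S ^ 2).trace = (diagonal d₁ * S ^ 2).trace + (diagonal d₂ * S ^ 2).trace := by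
    rw [← trace_add, ← add_mul, diagonal_add]
  have tDS' : (compr sl D * compr sl S ^ 2).trace
      = (compr sl (diagonal d₁) * compr sl S ^ 2).trace
        + (compr sl (diagonal d₂) * compr sl S ^ 2).trace := by
    rw [← trace_add, ← add_mul, ← compr_add, diagonal_add]
  have l1 : trLog3 (S + D) = trLog4 (S + D) - (1 / 3) * ((S + D) ^ 3).trace := by rw [trLog4]; ring
  have l2 : trLog3 (compr sl (S + D)) = trLog4 (compr sl (S + D))
      - (1 / 3) * ((compr sl S + compr sl D) ^ 3).trace := by
    rw [trLog4, ← compr_add]; ring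
  unfold vAbs
  rw [e1, e2, vAbs_vac, vAbs_vac, ← compr_diagonal, l1, l2, trace_add_cube, trace_add_cube, tD, tD',
    tDS, tDS']
  refine le_trans (le_of_eq ?_) ((norm_add_le _ _).trans (add_le_add ((norm_add_le _ _).trans
    (add_le_add ((norm_add_le _ _).trans (add_le_add ((norm_add_le _ _).trans
      (add_le_add h1 h2)) h3)) h4)) h5))
  congr 1
  have s1 : ∀ f f' : MultiMode N → ℂ, ∑ n, (-(f n * f' n ^ 2) - 1 / 3 * f' n ^ 3 + 1 / 4 * f n ^ 4)
      = ∑ n, (1 / 3 * f n ^ 3 + f n ^ 2 * f' n + 1 / 4 * f n ^ 4)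
        - (1 / 3) * ∑ n, (f n + f' n) ^ 3 := by
    intro f f'
    rw [mul_sum, ← sum_sub_distrib]
    exact sum_congr rfl fun n _ => by ring
  rw [s1 d₁ d₂, s1 (fun n => if sl n then 0 else d₁ n) (fun n => if sl n then 0 else d₂ n)]
  ring

end Algebra

/-! ### One-colour hops and weighted sums over multi-indices -/

section Hop

variable {N : ℕ}

theorem prod_ite_one_color (c : Fin 4) (A B : ℝ) : ∏ x : Fin 4, (if x = c then A else B) = A * B ^ 3 := by
  rw [Fin.prod_univ_four]
  fin_cases c <;> simp <;> ring

theorem prod_ite_two_colors {c d : Fin 4} (h : c ≠ d) (A B C : ℝ) :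
    ∏ x : Fin 4, (if x = c then A else if x = d then B else C) = A * B * C ^ 2 := by
  rw [Fin.prod_univ_four]
  fin_cases c <;> fin_cases d <;> first | exact absurd rfl h | (simp; ring)

/-- Product of the weights of exponent `e` over the colours different from `c`. -/
noncomputable def rest1 (R e : ℝ) (c : Fin 4) (n : MultiMode N) : ℝ :=
  ∏ x, if x = c then 1 else bw R e (n x)

/-- Product of the weights of exponent `e` over the colours different from `c` and `d`. -/
noncomputable def rest2 (R e : ℝ) (c d : Fin 4) (n : MultiMode N) : ℝ :=
  ∏ x, if x = c then 1 else if x = d then 1 else bw R e (n x)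

theorem rest1_nonneg (R e : ℝ) (c : Fin 4) (n : MultiMode N) : 0 ≤ rest1 R e c n :=
  prod_nonneg fun x _ => by split_ifs; exacts [zero_le_one, bw_nonneg _ _]

theorem rest2_nonneg (R e : ℝ) (c d : Fin 4) (n : MultiMode N) : 0 ≤ rest2 R e c d n :=
  prod_nonneg fun x _ => by split_ifs; exacts [zero_le_one, zero_le_one, bw_nonneg _ _]

theorem rest1_mul (R e e' : ℝ) (c : Fin 4) (n : MultiMode N) :
    rest1 R e c n * rest1 R e' c n = rest1 R (e + e') c n := by
  unfold rest1
  rw [← prod_mul_distrib]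
  refine prod_congr rfl fun x _ => ?_
  split_ifs
  · simp
  · exact bw_mul _ _ _

theorem rest2_mul (R e e' : ℝ) (c d : Fin 4) (n : MultiMode N) :
    rest2 R e c d n * rest2 R e' c d n = rest2 R (e + e') c d n := by
  unfold rest2
  rw [← prod_mul_distrib]
  refine prod_congr rfl fun x _ => ?_
  split_ifs
  · simp
  · simp
  · exact bw_mul _ _ _

theorem rest1_update (R e : ℝ) (c : Fin 4) (n : MultiMode N) (b : Mode N) :
    rest1 R e c (update n c b) = rest1 R e c n := by
  unfold rest1
  refine prod_congr rfl fun x _ => ?_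
  split_ifs with h
  · rfl
  · rw [update_of_ne h]

theorem rest2_update_left (R e : ℝ) (c d : Fin 4) (n : MultiMode N) (b : Mode N) :
    rest2 R e c d (update n c b) = rest2 R e c d n := by
  unfold rest2
  refine prod_congr rfl fun x _ => ?_
  split_ifs with h h'
  · rfl
  · rfl
  · rw [update_of_ne h]

theorem rest2_update_right (R e : ℝ) (c d : Fin 4) (n : MultiMode N) (b : Mode N) :
    rest2 R e c d (update n d b) = rest2 R e c d n := by
  unfold rest2
  refine prod_congr rfl fun x _ => ?_
  split_ifs with h h'
  · rfl
  · rfl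
  · rw [update_of_ne h']

theorem eq_prod_ite (c : Fin 4) (f : Fin 4 → ℝ) : f c = ∏ x, if x = c then f x else 1 := by
  rw [prod_ite_eq' univ c f]; simp

theorem sum_mul_rest1 (R e : ℝ) (c : Fin 4) (φ : Mode N → ℝ) :
    ∑ n : MultiMode N, φ (n c) * rest1 R e c n = (∑ a, φ a) * (∑ a : Mode N, bw R e a) ^ 3 := by
  rw [← prod_ite_one_color c]
  have : ∀ x : Fin 4, (if x = c then ∑ a, φ a else ∑ a : Mode N, bw R e a)
      = ∑ a : Mode N, if x = c then φ a else bw R e a := fun x => by split_ifs <;> rfl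
  simp only [this]
  rw [prod_univ_sum, Fintype.piFinset_univ]
  refine sum_congr rfl fun n _ => ?_
  rw [eq_prod_ite c fun x => φ (n x), rest1, ← prod_mul_distrib]
  refine prod_congr rfl fun x _ => ?_
  split_ifs <;> simp

theorem sum_mul_rest2 (R e : ℝ) {c d : Fin 4} (hcd : c ≠ d) (φ ψ : Mode N → ℝ) :
    ∑ n : MultiMode N, φ (n c) * ψ (n d) * rest2 R e c d n
      = (∑ a, φ a) * (∑ a, ψ a) * (∑ a : Mode N, bw R e a) ^ 2 := by
  rw [← prod_ite_two_colors hcd]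
  have : ∀ x : Fin 4, (if x = c then ∑ a, φ a else if x = d then ∑ a, ψ a
      else ∑ a : Mode N, bw R e a)
      = ∑ a : Mode N, if x = c then φ a else if x = d then ψ a else bw R e a := fun x => by
    split_ifs <;> rfl
  simp only [this]
  rw [prod_univ_sum, Fintype.piFinset_univ]
  refine sum_congr rfl fun n _ => ?_
  rw [eq_prod_ite c fun x => φ (n x), eq_prod_ite d fun x => ψ (n x), rest2, ← prod_mul_distrib, ← prod_mul_distrib]
  refine prod_congr rfl fun x _ => ?_
  by_cases hc : x = c
  · have : x ≠ d := hc ▸ hcd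
    simp [hc, hcd]
  · by_cases hd : x = d <;> simp [hc, hd, hcd.symm]

theorem cutProp_rpow_le_rest1 {M j : ℕ} {β : ℝ} (hβ : 0 < β) {α e : ℝ} (hα : 0 ≤ α) (he : 0 ≤ e)
    (hs : α + 3 * e = 2 * β) (c : Fin 4) (n : MultiMode N) :
    cutProp M j (sqNorm n) ^ β ≤ bw ((M : ℝ) ^ j) α (n c) * rest1 ((M : ℝ) ^ j) e c n := by
  refine (cutProp_rpow_le hβ (fun x => if x = c then α else e) (fun x => by
    split_ifs <;> assumption) ?_ n).trans (le_of_eq ?_)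
  · rw [← hs, Fin.sum_univ_four]
    fin_cases c <;> simp <;> ring
  · rw [eq_prod_ite c fun x => bw ((M : ℝ) ^ j) α (n x), rest1, ← prod_mul_distrib]
    refine prod_congr rfl fun x _ => ?_
    split_ifs <;> simp

theorem cutProp_rpow_le_rest2 {M j : ℕ} {β : ℝ} (hβ : 0 < β) {α α' e : ℝ} (hα : 0 ≤ α)
    (hα' : 0 ≤ α') (he : 0 ≤ e) (hs : α + α' + 2 * e = 2 * β) {c d : Fin 4} (hcd : c ≠ d)
    (n : MultiMode N) : cutProp M j (sqNorm n) ^ β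
      ≤ bw ((M : ℝ) ^ j) α (n c) * bw ((M : ℝ) ^ j) α' (n d) * rest2 ((M : ℝ) ^ j) e c d n := by
  refine (cutProp_rpow_le hβ (fun x => if x = c then α else if x = d then α' else e) (fun x => by
    split_ifs <;> assumption) ?_ n).trans (le_of_eq ?_)
  · rw [← hs, Fin.sum_univ_four]
    fin_cases c <;> fin_cases d <;> first | exact absurd rfl hcd | (simp; ring)
  · rw [eq_prod_ite c fun x => bw ((M : ℝ) ^ j) α (n x),
      eq_prod_ite d fun x => bw ((M : ℝ) ^ j) α' (n x), rest2, ← prod_mul_distrib, ← prod_mul_distrib]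
    refine prod_congr rfl fun x _ => ?_
    by_cases hc : x = c
    · simp [hc, hcd]
    · by_cases hd : x = d <;> simp [hc, hd, hcd.symm]

/-- `n` and `m` agree outside the colour `c`. -/
def Agree (c : Fin 4) (n m : MultiMode N) : Prop := ∀ c', c' ≠ c → n c' = m c'

instance (c : Fin 4) (n m : MultiMode N) : Decidable (Agree c n m) := by
  unfold Agree; infer_instance

theorem Agree.symm {c : Fin 4} {n m : MultiMode N} (h : Agree c n m) : Agree c m n :=
  fun c' hc => (h c' hc).symm

theorem agree_iff {c : Fin 4} {n m : MultiMode N} : Agree c n m ↔ update n c (m c) = m := by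
  constructor
  · intro h
    funext x
    by_cases hx : x = c
    · subst hx; simp
    · rw [update_of_ne hx, h x hx]
  · intro h x hx
    rw [← h, update_of_ne hx]

theorem agree_update (c : Fin 4) (n : MultiMode N) (b : Mode N) : Agree c n (update n c b) :=
  fun _ hx => by rw [update_of_ne hx]

theorem sum_agree (c : Fin 4) (n : MultiMode N) (f : MultiMode N → ℝ) :
    ∑ m, (if Agree c n m then f m else 0) = ∑ b : Mode N, f (update n c b) := by
  rw [← sum_filter]
  refine sum_bij' (fun m _ => m c) (fun b _ => update n c b) (by simp)
    (fun b _ => by simp [agree_update]) ?_ (by simp) ?_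
  · intro m hm; exact agree_iff.1 (mem_filter.1 hm).2
  · intro m hm; rw [agree_iff.1 (mem_filter.1 hm).2]

/-- The modulus of the entry of `C^{1/2} σ_c C^{1/2}`, given the moduli of the entries of `σ_c`. -/
noncomputable def hop (M j : ℕ) (h : Fin 4 → Mode N → Mode N → ℝ) (c : Fin 4)
    (n m : MultiMode N) : ℝ :=
  if Agree c n m then √(cutProp M j (sqNorm n)) * √(cutProp M j (sqNorm m)) * h c (n c) (m c) else 0

theorem hop_nonneg {M j : ℕ} {h : Fin 4 → Mode N → Mode N → ℝ} (h0 : ∀ c a b, 0 ≤ h c a b)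
    (c : Fin 4) (n m : MultiMode N) : 0 ≤ hop M j h c n m := by
  have := h0 c (n c) (m c)
  unfold hop; split_ifs <;> positivity

theorem hop_symm {M j : ℕ} {h : Fin 4 → Mode N → Mode N → ℝ} (hs : ∀ c a b, h c a b = h c b a)
    (c : Fin 4) (n m : MultiMode N) : hop M j h c n m = hop M j h c m n := by
  unfold hop
  rw [hs c (n c)]
  by_cases hc : Agree c n m
  · rw [if_pos hc, if_pos hc.symm]; ring
  · rw [if_neg hc, if_neg fun h' => hc h'.symm]

theorem hop_sq (M j : ℕ) (h : Fin 4 → Mode N → Mode N → ℝ) (c : Fin 4) (n m : MultiMode N) :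
    hop M j h c n m ^ 2 = if Agree c n m then
      cutProp M j (sqNorm n) * cutProp M j (sqNorm m) * h c (n c) (m c) ^ 2 else 0 := by
  unfold hop
  split_ifs
  · rw [mul_pow, mul_pow, sq_sqrt (cutProp_nonneg _ _ (sqNorm_nonneg n)),
      sq_sqrt (cutProp_nonneg _ _ (sqNorm_nonneg m))]
  · simp

theorem hop_self (M j : ℕ) (h : Fin 4 → Mode N → Mode N → ℝ) (c : Fin 4) (n : MultiMode N) :
    hop M j h c n n = cutProp M j (sqNorm n) * h c (n c) (n c) := by
  rw [hop, if_pos (show Agree c n n from fun _ _ => rfl), mul_self_sqrt (cutProp_nonneg _ _ (sqNorm_nonneg n))]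

/-- Momenta in the slice of scale `j`. -/
def Slice (M j : ℕ) (n : MultiMode N) : Prop :=
  cutoff M j (sqNorm n) = 1 ∧ cutoff M (j - 1) (sqNorm n) = 0

noncomputable instance (M j : ℕ) : DecidablePred (Slice (N := N) M j) := Classical.decPred _

theorem dProp_le_bw {M : ℕ} (hM : 2 ≤ M) (j : ℕ) (n : MultiMode N) (c : Fin 4) :
    dProp M j (sqNorm n) ≤ (M : ℝ) ^ 2 * ((M : ℝ) ^ j)⁻¹ ^ 2 * bw ((M : ℝ) ^ j) 0 (n c) := by
  refine (dProp_le_prod hM n).trans (mul_le_mul_of_nonneg_left ?_ (by positivity))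
  rw [← mul_prod_erase univ _ (mem_univ c)]
  refine mul_le_of_le_one_right (bw_nonneg _ _) (prod_le_one (fun _ _ => bw_nonneg _ _)
    fun _ _ => bw_le_one le_rfl _)

theorem dProp_le_bw_two {M : ℕ} (hM : 2 ≤ M) (j : ℕ) (n : MultiMode N) {c d : Fin 4} (hcd : c ≠ d) :
    dProp M j (sqNorm n) ≤ (M : ℝ) ^ 2 * ((M : ℝ) ^ j)⁻¹ ^ 2 *
      (bw ((M : ℝ) ^ j) 0 (n c) * bw ((M : ℝ) ^ j) 0 (n d)) := by
  refine (dProp_le_prod hM n).trans (mul_le_mul_of_nonneg_left ?_ (by positivity))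
  rw [← mul_prod_erase univ _ (mem_univ c),
    ← mul_prod_erase _ _ (mem_erase.2 ⟨hcd.symm, mem_univ d⟩), ← mul_assoc]
  refine mul_le_of_le_one_right (mul_nonneg (bw_nonneg _ _) (bw_nonneg _ _))
    (prod_le_one (fun _ _ => bw_nonneg _ _) fun _ _ => bw_le_one le_rfl _)

end Hop

/-! ### Bounds by the two quadratic forms -/

section Forms

variable {N : ℕ}

/-- `∑_{a,b} ⟨b⟩^{-1/4} h_c(a,b)²`. -/
noncomputable def yCol (R : ℝ) (h : Fin 4 → Mode N → Mode N → ℝ) (c : Fin 4) : ℝ :=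
  ∑ a, ∑ b, bw R 0 a * bw R (1 / 4) b * h c a b ^ 2

/-- `∑_{a,b} ⟨a⟩^{-7/8} ⟨b⟩^{-7/8} h_c(a,b)²`. -/
noncomputable def gCol (R : ℝ) (h : Fin 4 → Mode N → Mode N → ℝ) (c : Fin 4) : ℝ :=
  ∑ a, ∑ b, bw R (7 / 8) a * bw R (7 / 8) b * h c a b ^ 2

/-- `∑_a h_c(a,a)²`. -/
noncomputable def dCol (R : ℝ) (h : Fin 4 → Mode N → Mode N → ℝ) (c : Fin 4) : ℝ :=
  ∑ a, bw R 0 a * h c a a ^ 2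

/-- The quadratic form of small operator norm. -/
noncomputable def yq (R : ℝ) (h : Fin 4 → Mode N → Mode N → ℝ) : ℝ :=
  R ^ (-(7 / 4) : ℝ) * ∑ c, yCol R h c

/-- The auxiliary quadratic form. -/
noncomputable def gq (R : ℝ) (h : Fin 4 → Mode N → Mode N → ℝ) : ℝ :=
  R ^ (-(1 / 4) : ℝ) * (∑ c, gCol R h c) + R⁻¹ * ∑ c, dCol R h c

variable {R : ℝ} (h : Fin 4 → Mode N → Mode N → ℝ)

theorem yCol_nonneg (c : Fin 4) : 0 ≤ yCol R h c :=
  sum_nonneg fun _ _ => sum_nonneg fun _ _ =>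
    mul_nonneg (mul_nonneg (bw_nonneg _ _) (bw_nonneg _ _)) (sq_nonneg _)

theorem gCol_nonneg (c : Fin 4) : 0 ≤ gCol R h c :=
  sum_nonneg fun _ _ => sum_nonneg fun _ _ =>
    mul_nonneg (mul_nonneg (bw_nonneg _ _) (bw_nonneg _ _)) (sq_nonneg _)

theorem dCol_nonneg (c : Fin 4) : 0 ≤ dCol R h c :=
  sum_nonneg fun _ _ => mul_nonneg (bw_nonneg _ _) (sq_nonneg _)

theorem yq_nonneg (hR : 1 ≤ R) : 0 ≤ yq R h :=
  mul_nonneg (rpow_nonneg (by linarith) _) (sum_nonneg fun c _ => yCol_nonneg h c)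

theorem gq_nonneg (hR : 1 ≤ R) : 0 ≤ gq R h :=
  add_nonneg (mul_nonneg (rpow_nonneg (by linarith) _) (sum_nonneg fun c _ => gCol_nonneg h c))
    (mul_nonneg (inv_nonneg.2 (by linarith)) (sum_nonneg fun c _ => dCol_nonneg h c))

theorem yCol_le (hR : 1 ≤ R) (c : Fin 4) : yCol R h c ≤ R ^ (7 / 4 : ℝ) * yq R h := by
  have h0 : 0 < R := by linarith
  rw [yq, ← mul_assoc, ← rpow_add h0]
  norm_num
  exact single_le_sum (fun c _ => yCol_nonneg h c) (mem_univ c)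

theorem gCol_le (hR : 1 ≤ R) (c : Fin 4) : gCol R h c ≤ R ^ (1 / 4 : ℝ) * gq R h := by
  have h0 : 0 < R := by linarith
  have h1 : gCol R h c ≤ R ^ (1 / 4 : ℝ) * (R ^ (-(1 / 4) : ℝ) * ∑ c, gCol R h c) := by
    rw [← mul_assoc, ← rpow_add h0]
    norm_num
    exact single_le_sum (fun c _ => gCol_nonneg h c) (mem_univ c)
  refine h1.trans (mul_le_mul_of_nonneg_left ?_ (by positivity))
  exact le_add_of_nonneg_right (mul_nonneg (inv_nonneg.2 h0.le)
    (sum_nonneg fun c _ => dCol_nonneg h c))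

theorem dCol_le (hR : 1 ≤ R) (c : Fin 4) : dCol R h c ≤ R * gq R h := by
  have h0 : 0 < R := by linarith
  have h1 : dCol R h c ≤ R * (R⁻¹ * ∑ c, dCol R h c) := by
    rw [← mul_assoc, mul_inv_cancel₀ h0.ne', one_mul]
    exact single_le_sum (fun c _ => dCol_nonneg h c) (mem_univ c)
  refine h1.trans (mul_le_mul_of_nonneg_left ?_ h0.le)
  exact le_add_of_nonneg_left (mul_nonneg (rpow_nonneg h0.le _)
    (sum_nonneg fun c _ => gCol_nonneg h c))

end Forms

section Edge

variable {N M : ℕ}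

theorem one_le_scale (hM : 2 ≤ M) (j : ℕ) : (1 : ℝ) ≤ (M : ℝ) ^ j :=
  one_le_pow₀ (by exact_mod_cast (by omega : 1 ≤ M))

theorem inv_scale_sq (hM : 2 ≤ M) (j : ℕ) : ((M : ℝ) ^ j)⁻¹ ^ 2 = ((M : ℝ) ^ j) ^ (-2 : ℝ) := by
  have h0 : 0 < (M : ℝ) ^ j := by linarith [one_le_scale hM j]
  rw [rpow_neg h0.le, inv_pow, rpow_two]

theorem cutProp_eq_dProp_of_slice {j : ℕ} {n : MultiMode N} (hn : Slice M j n) :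
    cutProp M j (sqNorm n) = dProp M j (sqNorm n) := by
  unfold dProp cutProp; rw [hn.1, hn.2]; ring

theorem cutProp_le_of_slice (hM : 2 ≤ M) {j : ℕ} {n : MultiMode N} (hn : Slice M j n) (c : Fin 4) :
    cutProp M j (sqNorm n) ≤ (M : ℝ) ^ 2 * ((M : ℝ) ^ j) ^ (-2 : ℝ) * bw ((M : ℝ) ^ j) 0 (n c) := by
  rw [cutProp_eq_dProp_of_slice hn, ← inv_scale_sq hM]
  exact dProp_le_bw hM j n c

theorem cutProp_le_of_slice_two (hM : 2 ≤ M) {j : ℕ} {n : MultiMode N} (hn : Slice M j n)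
    {c d : Fin 4} (hcd : c ≠ d) : cutProp M j (sqNorm n) ≤ (M : ℝ) ^ 2 * ((M : ℝ) ^ j) ^ (-2 : ℝ) *
      (bw ((M : ℝ) ^ j) 0 (n c) * bw ((M : ℝ) ^ j) 0 (n d)) := by
  rw [cutProp_eq_dProp_of_slice hn, ← inv_scale_sq hM]
  exact dProp_le_bw_two hM j n hcd

theorem cutProp_le_of_slice' (hM : 2 ≤ M) {j : ℕ} {n : MultiMode N} (hn : Slice M j n) :
    cutProp M j (sqNorm n) ≤ (M : ℝ) ^ 2 * ((M : ℝ) ^ j) ^ (-2 : ℝ) := by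
  refine (cutProp_le_of_slice hM hn 0).trans (mul_le_of_le_one_right ?_ (bw_le_one le_rfl _))
  have := one_le_scale hM j
  positivity

variable {h : Fin 4 → Mode N → Mode N → ℝ}

theorem sum_slice_hop_sq (j : ℕ) (c : Fin 4) (F : MultiMode N → MultiMode N → ℝ) (n : MultiMode N) :
    ∑ m, hop M j h c n m ^ 2 * F n m = ∑ b, cutProp M j (sqNorm n) *
      (cutProp M j (sqNorm (update n c b)) * F n (update n c b)) * h c (n c) b ^ 2 := by
  have := sum_agree c n fun m => cutProp M j (sqNorm n) * cutProp M j (sqNorm m) * h c (n c) (m c) ^ 2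
    * F n m
  simp only [update_self] at this
  calc _ = ∑ m, (if Agree c n m then cutProp M j (sqNorm n) * cutProp M j (sqNorm m)
        * h c (n c) (m c) ^ 2 * F n m else 0) := by
        refine sum_congr rfl fun m _ => ?_
        rw [hop_sq]; split_ifs <;> simp
    _ = _ := this.trans (sum_congr rfl fun b _ => by ring)

theorem edge_le {j : ℕ} {κ e : ℝ} (c : Fin 4) {F : MultiMode N → MultiMode N → ℝ}
    (hF : ∀ n b, Slice M j n → cutProp M j (sqNorm n) *
      (cutProp M j (sqNorm (update n c b)) * F n (update n c b))
      ≤ κ * (bw ((M : ℝ) ^ j) 0 (n c) * bw ((M : ℝ) ^ j) (1 / 4) b * rest1 ((M : ℝ) ^ j) e c n))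
    (hκ : 0 ≤ κ) :
    ∑ n, ∑ m, (if Slice M j n then hop M j h c n m ^ 2 * F n m else 0)
      ≤ κ * (yCol ((M : ℝ) ^ j) h c * (∑ a : Mode N, bw ((M : ℝ) ^ j) e a) ^ 3) := by
  have e1 := sum_mul_rest1 ((M : ℝ) ^ j) e c
    fun a => ∑ b, bw ((M : ℝ) ^ j) 0 a * bw ((M : ℝ) ^ j) (1 / 4) b * h c a b ^ 2
  rw [yCol, ← e1, mul_sum]
  refine sum_le_sum fun n _ => ?_
  by_cases hn : Slice M j n
  · simp only [if_pos hn]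
    rw [sum_slice_hop_sq, sum_mul, mul_sum]
    refine sum_le_sum fun b _ => ?_
    refine (mul_le_mul_of_nonneg_right (hF n b hn) (sq_nonneg _)).trans (le_of_eq (by ring))
  · simp only [if_neg hn, sum_const_zero]
    refine mul_nonneg hκ (mul_nonneg (sum_nonneg fun b _ => ?_) (rest1_nonneg _ _ _ _))
    exact mul_nonneg (mul_nonneg (bw_nonneg _ _) (bw_nonneg _ _)) (sq_nonneg _)

theorem cutProp_update_le_rest1 {j : ℕ} {α e : ℝ} (hα : 0 ≤ α) (he : 0 ≤ e)
    (hs : α + 3 * e = 2) (c : Fin 4) (n : MultiMode N) (b : Mode N) :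
    cutProp M j (sqNorm (update n c b)) ≤ bw ((M : ℝ) ^ j) α b * rest1 ((M : ℝ) ^ j) e c n := by
  have := cutProp_rpow_le_rest1 (M := M) (j := j) one_pos hα he (by linarith) c (update n c b)
  rwa [rpow_one, rest1_update, update_self] at this

theorem exists_edge_crude_le (hM : 2 ≤ M) : ∃ K : ℝ, 0 < K ∧
    ∀ (N j : ℕ) (h : Fin 4 → Mode N → Mode N → ℝ) (c : Fin 4),
      ∑ n, ∑ m, (if Slice M j n then hop M j h c n m ^ 2 else 0)
        ≤ K * ((M : ℝ) ^ j * yq ((M : ℝ) ^ j) h) := by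
  obtain ⟨K, hK, hb⟩ := exists_sum_bw_le (α := 7 / 12) (by norm_num) (by norm_num)
  refine ⟨(M : ℝ) ^ 2 * K ^ 3, by positivity, fun N j h c => ?_⟩
  have hR := one_le_scale hM j
  set R := (M : ℝ) ^ j with hRdef
  have hR0 : 0 < R := by linarith
  have := edge_le (h := h) (j := j) (M := M) (κ := (M : ℝ) ^ 2 * R ^ (-2 : ℝ)) (e := 7 / 12) c
    (F := fun _ _ => 1) (fun n b hn => by
      rw [mul_one]
      refine (mul_le_mul (cutProp_le_of_slice hM hn c) (cutProp_update_le_rest1 (α := 1 / 4)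
        (e := 7 / 12) (by norm_num) (by norm_num) (by norm_num) c n b)
        (cutProp_nonneg _ _ (sqNorm_nonneg _)) ?_).trans (le_of_eq (by ring))
      have := bw_nonneg (R := R) 0 (n c)
      positivity) (by positivity)
  simp only [mul_one] at this
  refine this.trans ?_
  have h3 : (∑ a : Mode N, bw R (7 / 12) a) ^ 3 ≤ (K * R ^ (1 - 7 / 12 : ℝ)) ^ 3 :=
    pow_le_pow_left₀ (sum_nonneg fun _ _ => bw_nonneg _ _) (hb N R hR) 3
  have h4 := yCol_le h hR c
  have hy := yq_nonneg h hR
  calc _ ≤ (M : ℝ) ^ 2 * R ^ (-2 : ℝ) * (R ^ (7 / 4 : ℝ) * yq R h * (K * R ^ (1 - 7 / 12 : ℝ)) ^ 3) := by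
        refine mul_le_mul_of_nonneg_left (mul_le_mul h4 h3 ?_ (by positivity)) (by positivity)
        exact pow_nonneg (sum_nonneg fun _ _ => bw_nonneg _ _) 3
    _ = (M : ℝ) ^ 2 * K ^ 3 * (R ^ (-2 : ℝ) * R ^ (7 / 4 : ℝ) * (R ^ (1 - 7 / 12 : ℝ)) ^ 3 * yq R h) := by
        ring
    _ = _ := by
        rw [← rpow_natCast (R ^ (1 - 7 / 12 : ℝ)), ← rpow_mul hR0.le, ← rpow_add hR0,
          ← rpow_add hR0]
        norm_num

theorem cutProp_le_one' (M j : ℕ) (n : MultiMode N) : cutProp M j (sqNorm n) ≤ 1 :=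
  cutProp_le_one M j (sqNorm_nonneg n)

theorem cutProp_nonneg' (M j : ℕ) (n : MultiMode N) : 0 ≤ cutProp M j (sqNorm n) :=
  cutProp_nonneg M j (sqNorm_nonneg n)

theorem exists_edge_fine_le (hM : 2 ≤ M) : ∃ K : ℝ, 0 < K ∧
    ∀ (N j : ℕ) (h : Fin 4 → Mode N → Mode N → ℝ) (c : Fin 4),
      ∑ n, ∑ m, (if Slice M j n then hop M j h c n m ^ 2 *
        (cutProp M j (sqNorm n) ^ (1 / 2 : ℝ) + cutProp M j (sqNorm m) ^ (1 / 2 : ℝ)) else 0)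
        ≤ K * yq ((M : ℝ) ^ j) h := by
  obtain ⟨K, hK, hb⟩ := exists_sum_bw_le (α := 7 / 12) (by norm_num) (by norm_num)
  obtain ⟨K', hK', hb'⟩ := exists_sum_bw_le (α := 11 / 12) (by norm_num) (by norm_num)
  refine ⟨((M : ℝ) ^ 2) ^ (3 / 2 : ℝ) * K ^ 3 + (M : ℝ) ^ 2 * K' ^ 3, by
    have : (0 : ℝ) < (M : ℝ) ^ 2 := by
      have : (0 : ℝ) < M := by exact_mod_cast (by omega : 0 < M)
      positivity
    positivity, fun N j h c => ?_⟩
  have hR := one_le_scale hM j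
  set R := (M : ℝ) ^ j with hRdef
  have hR0 : 0 < R := by linarith
  have hM0 : (0 : ℝ) < (M : ℝ) ^ 2 := by
    have : (0 : ℝ) < M := by exact_mod_cast (by omega : 0 < M)
    positivity
  have hy := yq_nonneg h hR
  have h4 := yCol_le h hR c
  have t1 := edge_le (h := h) (j := j) (M := M) (κ := ((M : ℝ) ^ 2) ^ (3 / 2 : ℝ) * R ^ (-3 : ℝ))
    (e := 7 / 12) c (F := fun n _ => cutProp M j (sqNorm n) ^ (1 / 2 : ℝ)) (fun n b hn => by
      have a1 := cutProp_update_le_rest1 (M := M) (j := j) (α := 1 / 4)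
        (e := 7 / 12) (by norm_num) (by norm_num) (by norm_num) c n b
      have a2 : cutProp M j (sqNorm n) ^ (1 / 2 : ℝ) ≤ ((M : ℝ) ^ 2 * R ^ (-2 : ℝ)) ^ (1 / 2 : ℝ) :=
        rpow_le_rpow (cutProp_nonneg' _ _ _) (cutProp_le_of_slice' hM hn) (by norm_num)
      have a3 := cutProp_le_of_slice hM hn c
      have b1 := bw_nonneg (R := R) 0 (n c)
      have b2 := bw_nonneg (R := R) (1 / 4) b
      have b3 := rest1_nonneg R (7 / 12) c n
      calc _ ≤ (M : ℝ) ^ 2 * R ^ (-2 : ℝ) * bw R 0 (n c) * (bw R (1 / 4) b * rest1 R (7 / 12) c n *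
            ((M : ℝ) ^ 2 * R ^ (-2 : ℝ)) ^ (1 / 2 : ℝ)) := by
            refine mul_le_mul a3 (mul_le_mul a1 a2 (rpow_nonneg (cutProp_nonneg' _ _ _) _)
              (by positivity)) (mul_nonneg (cutProp_nonneg' _ _ _)
                (rpow_nonneg (cutProp_nonneg' _ _ _) _)) (by positivity)
        _ = ((M : ℝ) ^ 2 * R ^ (-2 : ℝ)) * ((M : ℝ) ^ 2 * R ^ (-2 : ℝ)) ^ (1 / 2 : ℝ) *
            (bw R 0 (n c) * bw R (1 / 4) b * rest1 R (7 / 12) c n) := by ring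
        _ = _ := by
          rw [← rpow_one_add' (by positivity) (by norm_num), mul_rpow hM0.le (by positivity),
            ← rpow_mul hR0.le]
          norm_num
          exact Or.inl rfl) (by positivity)
  have t2 := edge_le (h := h) (j := j) (M := M) (κ := (M : ℝ) ^ 2 * R ^ (-2 : ℝ))
    (e := 11 / 12) c (F := fun _ m => cutProp M j (sqNorm m) ^ (1 / 2 : ℝ)) (fun n b hn => by
      have a1 := cutProp_rpow_le_rest1 (M := M) (j := j) (β := 3 / 2) (α := 1 / 4) (e := 11 / 12)
        (by norm_num) (by norm_num) (by norm_num) (by norm_num) c (update n c b)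
      rw [rest1_update, update_self] at a1
      have a3 := cutProp_le_of_slice hM hn c
      have b1 := bw_nonneg (R := R) 0 (n c)
      rw [← rpow_one_add' (cutProp_nonneg' _ _ _) (by norm_num),
        show (1 + 1 / 2 : ℝ) = 3 / 2 by norm_num]
      refine (mul_le_mul a3 a1 (rpow_nonneg (cutProp_nonneg' _ _ _) _) ?_).trans
        (le_of_eq (by rw [hRdef]; ring))
      positivity) (by positivity)
  have h3 : (∑ a : Mode N, bw R (7 / 12) a) ^ 3 ≤ (K * R ^ (1 - 7 / 12 : ℝ)) ^ 3 :=
    pow_le_pow_left₀ (sum_nonneg fun _ _ => bw_nonneg _ _) (hb N R hR) 3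
  have h3' : (∑ a : Mode N, bw R (11 / 12) a) ^ 3 ≤ (K' * R ^ (1 - 11 / 12 : ℝ)) ^ 3 :=
    pow_le_pow_left₀ (sum_nonneg fun _ _ => bw_nonneg _ _) (hb' N R hR) 3
  have u1 : ((M : ℝ) ^ 2) ^ (3 / 2 : ℝ) * R ^ (-3 : ℝ) * (yCol R h c *
      (∑ a : Mode N, bw R (7 / 12) a) ^ 3) ≤ ((M : ℝ) ^ 2) ^ (3 / 2 : ℝ) * K ^ 3 * yq R h := by
    calc _ ≤ ((M : ℝ) ^ 2) ^ (3 / 2 : ℝ) * R ^ (-3 : ℝ) * (R ^ (7 / 4 : ℝ) * yq R h *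
          (K * R ^ (1 - 7 / 12 : ℝ)) ^ 3) := by
          refine mul_le_mul_of_nonneg_left (mul_le_mul h4 h3 ?_ (by positivity)) (by positivity)
          exact pow_nonneg (sum_nonneg fun _ _ => bw_nonneg _ _) 3
      _ = ((M : ℝ) ^ 2) ^ (3 / 2 : ℝ) * K ^ 3 * yq R h *
          (R ^ (-3 : ℝ) * R ^ (7 / 4 : ℝ) * (R ^ (1 - 7 / 12 : ℝ)) ^ 3) := by
          ring
      _ ≤ _ := by
          refine mul_le_of_le_one_right (by positivity) ?_
          rw [← rpow_natCast (R ^ (1 - 7 / 12 : ℝ)), ← rpow_mul hR0.le, ← rpow_add hR0,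
            ← rpow_add hR0]
          exact rpow_le_one_of_one_le_of_nonpos hR (by norm_num)
  have u2 : (M : ℝ) ^ 2 * R ^ (-2 : ℝ) * (yCol R h c *
      (∑ a : Mode N, bw R (11 / 12) a) ^ 3) ≤ (M : ℝ) ^ 2 * K' ^ 3 * yq R h := by
    calc _ ≤ (M : ℝ) ^ 2 * R ^ (-2 : ℝ) * (R ^ (7 / 4 : ℝ) * yq R h * (K' * R ^ (1 - 11 / 12 : ℝ)) ^ 3) := by
          refine mul_le_mul_of_nonneg_left (mul_le_mul h4 h3' ?_ (by positivity)) (by positivity)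
          exact pow_nonneg (sum_nonneg fun _ _ => bw_nonneg _ _) 3
      _ = (M : ℝ) ^ 2 * K' ^ 3 * yq R h * (R ^ (-2 : ℝ) * R ^ (7 / 4 : ℝ) * (R ^ (1 - 11 / 12 : ℝ)) ^ 3) := by
          ring
      _ ≤ _ := by
          refine mul_le_of_le_one_right (by positivity) ?_
          rw [← rpow_natCast (R ^ (1 - 11 / 12 : ℝ)), ← rpow_mul hR0.le, ← rpow_add hR0,
            ← rpow_add hR0]
          exact rpow_le_one_of_one_le_of_nonpos hR (by norm_num)
  have := add_le_add (t1.trans u1) (t2.trans u2)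
  rw [← add_mul, ← sum_add_distrib] at this
  refine le_trans (le_of_eq ?_) this
  refine sum_congr rfl fun n _ => ?_
  rw [← sum_add_distrib]
  refine sum_congr rfl fun m _ => ?_
  split_ifs <;> ring

end Edge

/-! ### Quartic and cubic sums -/

section Chains

variable {N M : ℕ} {h : Fin 4 → Mode N → Mode N → ℝ}

theorem sum_hop_sq (j : ℕ) (c : Fin 4) (n : MultiMode N) :
    ∑ m, hop M j h c n m ^ 2 = ∑ b, cutProp M j (sqNorm n) *
      cutProp M j (sqNorm (update n c b)) * h c (n c) b ^ 2 := by
  have := sum_slice_hop_sq (M := M) (h := h) j c (fun _ _ => 1) n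
  simp only [mul_one] at this
  exact this

theorem sum_sq_same_color_le (j : ℕ) (c : Fin 4) (n : MultiMode N) :
    ∑ m, (∑ l, hop M j h c n l * hop M j h c l m) ^ 2
      ≤ (∑ l, hop M j h c n l ^ 2) * ∑ b, ∑ m, hop M j h c (update n c b) m ^ 2 := by
  have h1 : ∑ b, ∑ m, hop M j h c (update n c b) m ^ 2
      = ∑ m, ∑ l, (if Agree c n l then hop M j h c l m ^ 2 else 0) := by
    rw [sum_comm]
    exact sum_congr rfl fun m _ => (sum_agree c n fun l => hop M j h c l m ^ 2).symm
  rw [h1, mul_sum]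
  refine sum_le_sum fun m _ => ?_
  have h2 : ∑ l, hop M j h c n l * hop M j h c l m
      = ∑ l, hop M j h c n l * (if Agree c n l then hop M j h c l m else 0) := by
    refine sum_congr rfl fun l _ => ?_
    by_cases hl : Agree c n l
    · rw [if_pos hl]
    · rw [if_neg hl, hop, if_neg hl]; simp
  rw [h2]
  refine (sum_mul_sq_le_sq_mul_sq _ _ _).trans (le_of_eq ?_)
  congr 1
  refine sum_congr rfl fun l _ => ?_
  split_ifs <;> simp

theorem exists_quartic_same_le (hM : 2 ≤ M) : ∃ K : ℝ, 0 < K ∧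
    ∀ (N j : ℕ) (h : Fin 4 → Mode N → Mode N → ℝ) (c : Fin 4),
      ∑ n, ∑ m, (if Slice M j n then (∑ l, hop M j h c n l * hop M j h c l m) ^ 2 else 0)
        ≤ K * (yq ((M : ℝ) ^ j) h * gq ((M : ℝ) ^ j) h) := by
  obtain ⟨K, hK, hb⟩ := exists_sum_bw_le_of_one_lt (α := 4 / 3) (by norm_num)
  have hMpos : (0 : ℝ) < M := by exact_mod_cast (by omega : 0 < M)
  refine ⟨(M : ℝ) ^ 2 * K ^ 3, by positivity, fun N j h c => ?_⟩
  have hR := one_le_scale hM j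
  obtain ⟨R, hRdef⟩ : ∃ R, R = (M : ℝ) ^ j := ⟨_, rfl⟩
  rw [← hRdef] at hR ⊢
  have hR0 : 0 < R := by linarith
  have hy := yCol_le h hR c
  have hg := gCol_le h hR c
  have hy0 := yq_nonneg h hR
  have hg0 := gq_nonneg h hR
  have hyc := yCol_nonneg (R := R) h c
  have hgc := gCol_nonneg (R := R) h c
  have key : ∀ n : MultiMode N,
      ∑ m, (if Slice M j n then (∑ l, hop M j h c n l * hop M j h c l m) ^ 2 else 0)
      ≤ (M : ℝ) ^ 2 * R ^ (-2 : ℝ) * gCol R h c *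
        ((∑ b, bw R 0 (n c) * bw R (1 / 4) b * h c (n c) b ^ 2) * rest1 R (4 / 3) c n) := by
    intro n
    have p0 : 0 ≤ ∑ b, bw R 0 (n c) * bw R (1 / 4) b * h c (n c) b ^ 2 :=
      sum_nonneg fun b _ => mul_nonneg (mul_nonneg (bw_nonneg _ _) (bw_nonneg _ _)) (sq_nonneg _)
    by_cases hn : Slice M j n
    swap
    · simp only [if_neg hn, sum_const_zero]
      exact mul_nonneg (by positivity) (mul_nonneg p0 (rest1_nonneg _ _ _ _))
    simp only [if_pos hn]
    refine (sum_sq_same_color_le j c n).trans ?_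
    have a1 : ∑ l, hop M j h c n l ^ 2 ≤ (M : ℝ) ^ 2 * R ^ (-2 : ℝ) *
        ((∑ b, bw R 0 (n c) * bw R (1 / 4) b * h c (n c) b ^ 2) * rest1 R (7 / 12) c n) := by
      rw [sum_hop_sq, sum_mul, mul_sum]
      refine sum_le_sum fun b _ => ?_
      have c1 := cutProp_le_of_slice hM hn c
      have c2 := cutProp_update_le_rest1 (M := M) (j := j) (α := 1 / 4)
        (e := 7 / 12) (by norm_num) (by norm_num) (by norm_num) c n b
      rw [← hRdef] at c1 c2
      have b1 := bw_nonneg (R := R) 0 (n c)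
      refine (mul_le_mul_of_nonneg_right (mul_le_mul c1 c2 (cutProp_nonneg' _ _ _) (by positivity))
        (sq_nonneg _)).trans (le_of_eq (by ring))
    have a2 : ∑ b, ∑ m, hop M j h c (update n c b) m ^ 2 ≤ gCol R h c * rest1 R (3 / 4) c n := by
      rw [gCol, sum_mul]
      refine sum_le_sum fun b _ => ?_
      rw [sum_hop_sq, sum_mul]
      refine sum_le_sum fun b' _ => ?_
      have c2 := fun x => cutProp_update_le_rest1 (M := M) (j := j) (α := 7 / 8)
        (e := 3 / 8) (by norm_num) (by norm_num) (by norm_num) c n x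
      rw [← hRdef] at c2
      rw [Function.update_idem, update_self]
      have b1 := bw_nonneg (R := R) (7 / 8) b
      have b2 := rest1_nonneg R (3 / 8) c n
      refine (mul_le_mul_of_nonneg_right (mul_le_mul (c2 b) (c2 b') (cutProp_nonneg' _ _ _)
        (by positivity)) (sq_nonneg _)).trans (le_of_eq ?_)
      rw [show (3 / 4 : ℝ) = 3 / 8 + 3 / 8 by norm_num, ← rest1_mul]; ring
    refine (mul_le_mul a1 a2 (sum_nonneg fun _ _ => sum_nonneg fun _ _ => sq_nonneg _)
      ?_).trans (le_of_eq ?_)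
    · exact mul_nonneg (by positivity) (mul_nonneg p0 (rest1_nonneg _ _ _ _))
    · rw [show (4 / 3 : ℝ) = 7 / 12 + 3 / 4 by norm_num, ← rest1_mul]; ring
  refine (sum_le_sum fun n _ => key n).trans ?_
  rw [← mul_sum, sum_mul_rest1 R (4 / 3) c fun a => ∑ b, bw R 0 a * bw R (1 / 4) b * h c a b ^ 2]
  change (M : ℝ) ^ 2 * R ^ (-2 : ℝ) * gCol R h c * (yCol R h c * _) ≤ _
  have h3 : (∑ a : Mode N, bw R (4 / 3) a) ^ 3 ≤ K ^ 3 :=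
    pow_le_pow_left₀ (sum_nonneg fun _ _ => bw_nonneg _ _) (hb N R) 3
  calc _ ≤ (M : ℝ) ^ 2 * R ^ (-2 : ℝ) * (R ^ (1 / 4 : ℝ) * gq R h) *
        (R ^ (7 / 4 : ℝ) * yq R h * K ^ 3) := by
        refine mul_le_mul (mul_le_mul_of_nonneg_left hg (by positivity))
          (mul_le_mul hy h3 (pow_nonneg (sum_nonneg fun _ _ => bw_nonneg _ _) 3)
            (by positivity)) (mul_nonneg hyc (pow_nonneg (sum_nonneg fun _ _ => bw_nonneg _ _) 3))
          (by positivity)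
    _ = (M : ℝ) ^ 2 * K ^ 3 * (yq R h * gq R h) * (R ^ (-2 : ℝ) * R ^ (1 / 4 : ℝ) * R ^ (7 / 4 : ℝ)) := by
        ring
    _ = _ := by rw [← rpow_add hR0, ← rpow_add hR0]; norm_num

theorem hop_mul_hop_eq_zero {j : ℕ} {c d : Fin 4} (hcd : c ≠ d) (n m l : MultiMode N)
    (hl : l ≠ update n c (m c)) : hop M j h c n l * hop M j h d l m = 0 := by
  by_cases h1 : Agree c n l
  · by_cases h2 : Agree d l m
    · exact absurd ((agree_iff.1 h1).symm.trans (by rw [h2 c hcd])) hl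
    · rw [hop, hop, if_neg h2, mul_zero]
  · rw [hop, if_neg h1, zero_mul]

theorem sum_sq_diff_color_le (j : ℕ) {c d : Fin 4} (hcd : c ≠ d) (n : MultiMode N) :
    ∑ m, (∑ l, hop M j h c n l * hop M j h d l m) ^ 2
      ≤ ∑ l, hop M j h c n l ^ 2 * ∑ m, hop M j h d l m ^ 2 := by
  have h1 : ∑ l, hop M j h c n l ^ 2 * ∑ m, hop M j h d l m ^ 2
      = ∑ m, ∑ l, (hop M j h c n l * hop M j h d l m) ^ 2 := by
    rw [sum_comm]
    refine sum_congr rfl fun l _ => ?_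
    rw [mul_sum]
    exact sum_congr rfl fun m _ => by ring
  rw [h1]
  refine sum_le_sum fun m _ => ?_
  rw [sum_eq_single (update n c (m c)) (fun l _ hl => hop_mul_hop_eq_zero hcd n m l hl) (by simp)]
  exact single_le_sum (f := fun l => (hop M j h c n l * hop M j h d l m) ^ 2)
    (fun _ _ => sq_nonneg _) (mem_univ _)

theorem exists_quartic_diff_le (hM : 2 ≤ M) : ∃ K : ℝ, 0 < K ∧
    ∀ (N j : ℕ) (h : Fin 4 → Mode N → Mode N → ℝ) (c d : Fin 4), c ≠ d →
      ∑ n, ∑ m, (if Slice M j n then (∑ l, hop M j h c n l * hop M j h d l m) ^ 2 else 0)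
        ≤ K * (yq ((M : ℝ) ^ j) h * gq ((M : ℝ) ^ j) h) := by
  obtain ⟨K, hK, hb⟩ := exists_sum_bw_le_of_one_lt (α := 2) (by norm_num)
  have hMpos : (0 : ℝ) < M := by exact_mod_cast (by omega : 0 < M)
  refine ⟨(M : ℝ) ^ 2 * K ^ 2, by positivity, fun N j h c d hcd => ?_⟩
  have hR := one_le_scale hM j
  obtain ⟨R, hRdef⟩ : ∃ R, R = (M : ℝ) ^ j := ⟨_, rfl⟩
  rw [← hRdef] at hR ⊢
  have hR0 : 0 < R := by linarith
  have hy := yCol_le h hR c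
  have hg := gCol_le h hR d
  have hy0 := yq_nonneg h hR
  have hg0 := gq_nonneg h hR
  have hyc := yCol_nonneg (R := R) h c
  have hgc := gCol_nonneg (R := R) h d
  have key : ∀ n : MultiMode N,
      ∑ m, (if Slice M j n then (∑ l, hop M j h c n l * hop M j h d l m) ^ 2 else 0)
      ≤ (M : ℝ) ^ 2 * R ^ (-2 : ℝ) *
        ((∑ a', bw R 0 (n c) * bw R (1 / 4) a' * h c (n c) a' ^ 2) *
          (∑ b', bw R (7 / 8) (n d) * bw R (7 / 8) b' * h d (n d) b' ^ 2) * rest2 R 2 c d n) := by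
    intro n
    by_cases hn : Slice M j n
    swap
    · simp only [if_neg hn, sum_const_zero]
      refine mul_nonneg (by positivity) (mul_nonneg (mul_nonneg ?_ ?_) (rest2_nonneg _ _ _ _ _)) <;>
      exact sum_nonneg fun b _ =>
        mul_nonneg (mul_nonneg (bw_nonneg _ _) (bw_nonneg _ _)) (sq_nonneg _)
    simp only [if_pos hn]
    refine (sum_sq_diff_color_le j hcd n).trans ?_
    rw [sum_slice_hop_sq j c (fun _ l => ∑ m, hop M j h d l m ^ 2) n]
    rw [sum_mul_sum, sum_mul, mul_sum]
    refine sum_le_sum fun a' _ => ?_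
    rw [sum_hop_sq, mul_sum, mul_sum, sum_mul, sum_mul, mul_sum]
    refine sum_le_sum fun b' _ => ?_
    rw [update_of_ne hcd.symm]
    set l := update n c a' with hl
    have c1 := cutProp_le_of_slice hM hn c
    have c2 := cutProp_rpow_le_rest2 (M := M) (j := j) (β := 2) (α := 1 / 4) (α' := 7 / 8)
      (e := 23 / 16) (by norm_num) (by norm_num) (by norm_num) (by norm_num) (by norm_num) hcd l
    have c3 := cutProp_rpow_le_rest2 (M := M) (j := j) (β := 1) (α := 0) (α' := 7 / 8)
      (e := 9 / 16) (by norm_num) (by norm_num) (by norm_num) (by norm_num) (by norm_num) hcd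
      (update l d b')
    rw [rpow_two, hl, rest2_update_left, update_self, update_of_ne hcd.symm, ← hl] at c2
    rw [rpow_one, rest2_update_right, hl, rest2_update_left, update_self,
      update_of_ne hcd, update_self, ← hl] at c3
    rw [← hRdef] at c1 c2 c3
    have b1 := bw_nonneg (R := R) 0 (n c)
    have b2 := bw_nonneg (R := R) (1 / 4) a'
    have b3 := bw_nonneg (R := R) (7 / 8) (n d)
    have b4 := bw_nonneg (R := R) (7 / 8) b'
    have b5 := rest2_nonneg R (23 / 16) c d n
    have b6 := rest2_nonneg R (9 / 16) c d n
    have b7 := bw_le_one (R := R) le_rfl a'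
    have c3' : cutProp M j (sqNorm (update l d b')) ≤ bw R (7 / 8) b' * rest2 R (9 / 16) c d n :=
      c3.trans (mul_le_mul_of_nonneg_right (mul_le_of_le_one_left b4 b7) b6)
    have e : rest2 R 2 c d n = rest2 R (23 / 16) c d n * rest2 R (9 / 16) c d n := by
      rw [rest2_mul]; norm_num
    rw [e]
    calc _ = cutProp M j (sqNorm n) * (cutProp M j (sqNorm l) ^ 2 *
          cutProp M j (sqNorm (update l d b'))) * (h c (n c) a' ^ 2 * h d (n d) b' ^ 2) := by ring
      _ ≤ (M : ℝ) ^ 2 * R ^ (-2 : ℝ) * bw R 0 (n c) * ((bw R (1 / 4) a' * bw R (7 / 8) (n d) *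
          rest2 R (23 / 16) c d n) * (bw R (7 / 8) b' * rest2 R (9 / 16) c d n))
          * (h c (n c) a' ^ 2 * h d (n d) b' ^ 2) := by
          refine mul_le_mul_of_nonneg_right (mul_le_mul c1 (mul_le_mul c2 c3' (cutProp_nonneg' _ _ _)
            (by positivity)) (mul_nonneg (sq_nonneg _) (cutProp_nonneg' _ _ _)) (by positivity))
            (by positivity)
      _ = _ := by ring
  refine (sum_le_sum fun n _ => key n).trans ?_
  rw [← mul_sum, sum_mul_rest2 R 2 hcd (fun a => ∑ b, bw R 0 a * bw R (1 / 4) b * h c a b ^ 2)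
    (fun a => ∑ b, bw R (7 / 8) a * bw R (7 / 8) b * h d a b ^ 2)]
  change (M : ℝ) ^ 2 * R ^ (-2 : ℝ) * (yCol R h c * gCol R h d * _) ≤ _
  have h3 : (∑ a : Mode N, bw R 2 a) ^ 2 ≤ K ^ 2 :=
    pow_le_pow_left₀ (sum_nonneg fun _ _ => bw_nonneg _ _) (hb N R) 2
  calc _ ≤ (M : ℝ) ^ 2 * R ^ (-2 : ℝ) *
        ((R ^ (7 / 4 : ℝ) * yq R h) * (R ^ (1 / 4 : ℝ) * gq R h) * K ^ 2) := by
        refine mul_le_mul_of_nonneg_left (mul_le_mul (mul_le_mul hy hg hgc (by positivity)) h3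
          (sq_nonneg _) (by positivity)) (by positivity)
    _ = (M : ℝ) ^ 2 * K ^ 2 * (yq R h * gq R h) * (R ^ (-2 : ℝ) * R ^ (1 / 4 : ℝ) * R ^ (7 / 4 : ℝ)) := by
        ring
    _ = _ := by rw [← rpow_add hR0, ← rpow_add hR0]; norm_num

end Chains

/-! ### Cubic sums -/

section Cubic

variable {N M : ℕ} {h : Fin 4 → Mode N → Mode N → ℝ}

/-- Weighted triangle sum. -/
noncomputable def triSum (R : ℝ) (h : Fin 4 → Mode N → Mode N → ℝ) (c : Fin 4) : ℝ :=
  ∑ a, ∑ b, ∑ b', bw R 0 a * (bw R (9 / 16) b * bw R (9 / 16) b')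
    * (h c a b * (h c b b' * h c b' a))

theorem triSum_le {R : ℝ} (hs : ∀ c a b, h c a b = h c b a) (c : Fin 4) :
    triSum R h c ≤ √(gCol R h c) * yCol R h c := by
  set A : Mode N → ℝ := fun b => ∑ a, bw R 0 a * h c a b ^ 2 with hA
  set u : Mode N × Mode N → ℝ := fun q => bw R (7 / 16) q.1 * bw R (7 / 16) q.2 * h c q.1 q.2 with hu
  set v : Mode N × Mode N → ℝ := fun q => bw R (1 / 8) q.1 * bw R (1 / 8) q.2 *
    ∑ a, bw R 0 a * (h c a q.1 * h c a q.2) with hv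
  have bsplit : ∀ b : Mode N, bw R (9 / 16) b = bw R (7 / 16) b * bw R (1 / 8) b := fun b => by
    rw [bw_mul]; norm_num
  have e1 : triSum R h c = ∑ q, u q * v q := by
    rw [triSum, sum_comm, Fintype.sum_prod_type]
    refine sum_congr rfl fun b _ => ?_
    rw [sum_comm]
    refine sum_congr rfl fun b' _ => ?_
    simp only [hu, hv, mul_sum]
    refine sum_congr rfl fun a _ => ?_
    rw [bsplit b, bsplit b', hs c b' a]; ring
  have e2 : ∑ q, u q ^ 2 = gCol R h c := by
    rw [gCol, Fintype.sum_prod_type]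
    refine sum_congr rfl fun b _ => sum_congr rfl fun b' _ => ?_
    have k : ∀ x : Mode N, bw R (7 / 8) x = bw R (7 / 16) x * bw R (7 / 16) x := fun x => by
      rw [bw_mul]; norm_num
    simp only [hu]; rw [k, k]; ring
  have hA0 : ∀ b, 0 ≤ A b := fun b => sum_nonneg fun _ _ => mul_nonneg (bw_nonneg _ _) (sq_nonneg _)
  have e3 : ∑ q, v q ^ 2 ≤ yCol R h c ^ 2 := by
    have : yCol R h c ^ 2 = ∑ q : Mode N × Mode N,
        (bw R (1 / 4) q.1 * A q.1) * (bw R (1 / 4) q.2 * A q.2) := by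
      rw [sq, Fintype.sum_prod_type]
      simp only
      rw [← sum_mul_sum]
      have : yCol R h c = ∑ b, bw R (1 / 4) b * A b := by
        rw [yCol, sum_comm]
        refine sum_congr rfl fun b _ => ?_
        rw [hA, mul_sum]
        exact sum_congr rfl fun a _ => by ring
      rw [this]
    rw [this]
    refine sum_le_sum fun q _ => ?_
    have k : ∀ x : Mode N, bw R (1 / 4) x = bw R (1 / 8) x ^ 2 := fun x => by
      rw [sq, bw_mul]; norm_num
    have cs := sum_sq_le_sum_mul_sum_of_sq_le_mul univ
      (r := fun a => bw R 0 a * (h c a q.1 * h c a q.2)) (f := fun a => bw R 0 a * h c a q.1 ^ 2)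
      (g := fun a => bw R 0 a * h c a q.2 ^ 2)
      (fun _ _ => mul_nonneg (bw_nonneg _ _) (sq_nonneg _))
      (fun _ _ => mul_nonneg (bw_nonneg _ _) (sq_nonneg _)) (fun a _ => le_of_eq (by ring))
    have e : v q ^ 2 = bw R (1 / 8) q.1 ^ 2 * bw R (1 / 8) q.2 ^ 2 *
        (∑ a, bw R 0 a * (h c a q.1 * h c a q.2)) ^ 2 := by
      simp only [hv]; ring
    rw [e, k, k]
    refine (mul_le_mul_of_nonneg_left cs (by positivity)).trans (le_of_eq ?_)
    simp only [hA]; ring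
  rw [e1]
  refine le_trans (sum_mul_le_sqrt_mul_sqrt _ _ _) ?_
  rw [e2]
  refine mul_le_mul_of_nonneg_left ?_ (sqrt_nonneg _)
  exact (sqrt_le_sqrt e3).trans (le_of_eq (sqrt_sq (yCol_nonneg h c)))

/-- Contribution of three hops to the cubic sum. -/
noncomputable def triple (M j : ℕ) (h : Fin 4 → Mode N → Mode N → ℝ) (c₁ c₂ c₃ : Fin 4) : ℝ :=
  ∑ n, ∑ m, ∑ l, if Slice M j n then hop M j h c₁ n m * (hop M j h c₂ m l * hop M j h c₃ l n) else 0

theorem triple_same_inner (j : ℕ) (c : Fin 4) (n : MultiMode N) :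
    ∑ m, ∑ l, hop M j h c n m * (hop M j h c m l * hop M j h c l n)
      = ∑ b, ∑ b', cutProp M j (sqNorm n) * (cutProp M j (sqNorm (update n c b)) *
        cutProp M j (sqNorm (update n c b'))) * (h c (n c) b * (h c b b' * h c b' (n c))) := by
  have e1 : ∀ m l, hop M j h c n m * (hop M j h c m l * hop M j h c l n)
      = if Agree c n m then (if Agree c n l then cutProp M j (sqNorm n) * (cutProp M j (sqNorm m) *
        cutProp M j (sqNorm l)) * (h c (n c) (m c) * (h c (m c) (l c) * h c (l c) (n c))) else 0)
        else 0 := by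
    intro m l
    by_cases h1 : Agree c n m
    · by_cases h2 : Agree c n l
      · have h3 : Agree c m l := fun x hx => (h1 x hx).symm.trans (h2 x hx)
        rw [if_pos h1, if_pos h2, hop, hop, hop, if_pos h1, if_pos h3, if_pos h2.symm]
        have s1 := mul_self_sqrt (cutProp_nonneg' M j n)
        have s2 := mul_self_sqrt (cutProp_nonneg' M j m)
        have s3 := mul_self_sqrt (cutProp_nonneg' M j l)
        conv_rhs => rw [← s1, ← s2, ← s3]
        ring
      · rw [if_pos h1, if_neg h2]
        have : ¬ Agree c l n := fun h' => h2 h'.symm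
        unfold hop
        rw [if_neg this]; ring
    · rw [if_neg h1, hop, if_neg h1]; ring
  simp only [e1]
  have e2 : ∀ m, ∑ l, (if Agree c n m then (if Agree c n l then cutProp M j (sqNorm n) * (cutProp M j (sqNorm m) *
        cutProp M j (sqNorm l)) * (h c (n c) (m c) * (h c (m c) (l c) * h c (l c) (n c))) else 0)
        else 0) = if Agree c n m then ∑ b', cutProp M j (sqNorm n) * (cutProp M j (sqNorm m) *
        cutProp M j (sqNorm (update n c b'))) *
          (h c (n c) (m c) * (h c (m c) b' * h c b' (n c))) else 0 := by
    intro m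
    split_ifs with h1
    · have := sum_agree c n fun l => cutProp M j (sqNorm n) * (cutProp M j (sqNorm m) *
        cutProp M j (sqNorm l)) * (h c (n c) (m c) * (h c (m c) (l c) * h c (l c) (n c)))
      simp only [update_self] at this
      exact this
    · simp
  simp only [e2]
  have := sum_agree c n fun m => ∑ b', cutProp M j (sqNorm n) * (cutProp M j (sqNorm m) *
        cutProp M j (sqNorm (update n c b'))) * (h c (n c) (m c) * (h c (m c) b' * h c b' (n c)))
  simp only [update_self] at this
  exact this

theorem exists_triple_same_le (hM : 2 ≤ M) : ∃ K : ℝ, 0 < K ∧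
    ∀ (N j : ℕ) (h : Fin 4 → Mode N → Mode N → ℝ), (∀ c a b, 0 ≤ h c a b) →
      (∀ c a b, h c a b = h c b a) → ∀ c : Fin 4,
      triple M j h c c c ≤ K * (yq ((M : ℝ) ^ j) h * (1 + gq ((M : ℝ) ^ j) h)) := by
  obtain ⟨K, hK, hb⟩ := exists_sum_bw_le (α := 23 / 24) (by norm_num) (by norm_num)
  have hMpos : (0 : ℝ) < M := by exact_mod_cast (by omega : 0 < M)
  refine ⟨(M : ℝ) ^ 2 * K ^ 3, by positivity, fun N j h h0 hs c => ?_⟩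
  have hR := one_le_scale hM j
  obtain ⟨R, hRdef⟩ : ∃ R, R = (M : ℝ) ^ j := ⟨_, rfl⟩
  rw [← hRdef] at hR ⊢
  have hR0 : 0 < R := by linarith
  have hy := yCol_le h hR c
  have hg := gCol_le h hR c
  have hy0 := yq_nonneg h hR
  have hg0 := gq_nonneg h hR
  have hyc := yCol_nonneg (R := R) h c
  have hgc := gCol_nonneg (R := R) h c
  have key : ∀ n : MultiMode N, ∑ m, ∑ l, (if Slice M j n then
        hop M j h c n m * (hop M j h c m l * hop M j h c l n) else 0)
      ≤ (M : ℝ) ^ 2 * R ^ (-2 : ℝ) * ((∑ b, ∑ b', bw R 0 (n c) * (bw R (9 / 16) b * bw R (9 / 16) b')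
        * (h c (n c) b * (h c b b' * h c b' (n c)))) * rest1 R (23 / 24) c n) := by
    intro n
    have h3 : ∀ b b', 0 ≤ h c (n c) b * (h c b b' * h c b' (n c)) := fun b b' =>
      mul_nonneg (h0 _ _ _) (mul_nonneg (h0 _ _ _) (h0 _ _ _))
    by_cases hn : Slice M j n
    swap
    · simp only [if_neg hn, sum_const_zero]
      refine mul_nonneg (by positivity) (mul_nonneg (sum_nonneg fun b _ =>
        sum_nonneg fun b' _ => ?_) (rest1_nonneg _ _ _ _))
      exact mul_nonneg (mul_nonneg (bw_nonneg _ _) (mul_nonneg (bw_nonneg _ _) (bw_nonneg _ _))) (h3 b b')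
    simp only [if_pos hn]
    rw [triple_same_inner, sum_mul, mul_sum]
    refine sum_le_sum fun b _ => ?_
    rw [sum_mul, mul_sum]
    refine sum_le_sum fun b' _ => ?_
    have c1 := cutProp_le_of_slice hM hn c
    have c2 := fun x => cutProp_update_le_rest1 (M := M) (j := j) (α := 9 / 16)
      (e := 23 / 48) (by norm_num) (by norm_num) (by norm_num) c n x
    rw [← hRdef] at c1 c2
    have b1 := bw_nonneg (R := R) (9 / 16) b
    have b3 := bw_nonneg (R := R) 0 (n c)
    have b2 := rest1_nonneg R (23 / 48) c n
    refine (mul_le_mul_of_nonneg_right (mul_le_mul c1 (mul_le_mul (c2 b) (c2 b') (cutProp_nonneg' _ _ _)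
        (by positivity)) (mul_nonneg (cutProp_nonneg' _ _ _) (cutProp_nonneg' _ _ _)) (by positivity))
        (h3 b b')).trans (le_of_eq ?_)
    rw [show (23 / 24 : ℝ) = 23 / 48 + 23 / 48 by norm_num, ← rest1_mul]; ring
  refine (sum_le_sum fun n _ => key n).trans ?_
  rw [← mul_sum, sum_mul_rest1 R (23 / 24) c
    fun a => ∑ b, ∑ b', bw R 0 a * (bw R (9 / 16) b * bw R (9 / 16) b')
        * (h c a b * (h c b b' * h c b' a))]
  change (M : ℝ) ^ 2 * R ^ (-2 : ℝ) * (triSum R h c * _) ≤ _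
  have h3 : (∑ a : Mode N, bw R (23 / 24) a) ^ 3 ≤ (K * R ^ (1 - 23 / 24 : ℝ)) ^ 3 :=
    pow_le_pow_left₀ (sum_nonneg fun _ _ => bw_nonneg _ _) (hb N R hR) 3
  have hsq : √(gCol R h c) ≤ R ^ (1 / 8 : ℝ) * (1 + gq R h) := by
    apply sqrt_le_iff.2
    refine ⟨by positivity, hg.trans ?_⟩
    rw [mul_pow, ← rpow_natCast (R ^ (1 / 8 : ℝ)), ← rpow_mul hR0.le]
    norm_num
    refine mul_le_mul_of_nonneg_left ?_ (by positivity)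
    nlinarith
  have htri : triSum R h c ≤ R ^ (1 / 8 : ℝ) * (1 + gq R h) * (R ^ (7 / 4 : ℝ) * yq R h) :=
    (triSum_le hs c).trans (mul_le_mul hsq hy hyc (by positivity))
  calc _ ≤ (M : ℝ) ^ 2 * R ^ (-2 : ℝ) * (R ^ (1 / 8 : ℝ) * (1 + gq R h) * (R ^ (7 / 4 : ℝ) * yq R h)
        * (K * R ^ (1 - 23 / 24 : ℝ)) ^ 3) := by
        refine mul_le_mul_of_nonneg_left (mul_le_mul htri h3
          (pow_nonneg (sum_nonneg fun _ _ => bw_nonneg _ _) 3) (by positivity)) (by positivity)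
    _ = (M : ℝ) ^ 2 * K ^ 3 * (yq R h * (1 + gq R h)) *
        (R ^ (-2 : ℝ) * R ^ (1 / 8 : ℝ) * R ^ (7 / 4 : ℝ) * (R ^ (1 - 23 / 24 : ℝ)) ^ 3) := by
        ring
    _ = _ := by
        rw [← rpow_natCast (R ^ (1 - 23 / 24 : ℝ)), ← rpow_mul hR0.le, ← rpow_add hR0,
          ← rpow_add hR0, ← rpow_add hR0]
        norm_num

/-- Two hops of colour `d` with an insertion of colour `c` at one of the ends. -/
noncomputable def insSum (M j : ℕ) (h : Fin 4 → Mode N → Mode N → ℝ) (c d : Fin 4) : ℝ :=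
  ∑ n, ∑ m, if Slice M j n then (hop M j h c n n + hop M j h c m m) * hop M j h d n m ^ 2 else 0

theorem sum_mul_sq_le_insSum (h0 : ∀ c a b, 0 ≤ h c a b) (j : ℕ) (c d : Fin 4) :
    ∑ n, ∑ m, (if Slice M j n then hop M j h c n n * hop M j h d n m ^ 2 else 0) ≤ insSum M j h c d := by
  refine sum_le_sum fun n _ => sum_le_sum fun m _ => ?_
  split_ifs
  · refine mul_le_mul_of_nonneg_right (le_add_of_nonneg_right (hop_nonneg h0 _ _ _)) (sq_nonneg _)
  · exact le_rfl

theorem sum_mul_sq_le_insSum' (h0 : ∀ c a b, 0 ≤ h c a b) (j : ℕ) (c d : Fin 4) :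
    ∑ n, ∑ m, (if Slice M j n then hop M j h c m m * hop M j h d n m ^ 2 else 0) ≤ insSum M j h c d := by
  refine sum_le_sum fun n _ => sum_le_sum fun m _ => ?_
  split_ifs
  · refine mul_le_mul_of_nonneg_right (le_add_of_nonneg_left (hop_nonneg h0 _ _ _)) (sq_nonneg _)
  · exact le_rfl

/-- A hop whose colour differs from the colours of the two other hops of a triangle is trivial. -/
theorem triple_eq_zero {j : ℕ} {c₁ c₂ c₃ : Fin 4} (h2 : c₁ ≠ c₂) (h3 : c₁ ≠ c₃)
    {n m l : MultiMode N} (hnm : n ≠ m) :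
    hop M j h c₁ n m * (hop M j h c₂ m l * hop M j h c₃ l n) = 0 := by
  unfold hop
  by_cases a1 : Agree c₁ n m
  · by_cases a2 : Agree c₂ m l
    · by_cases a3 : Agree c₃ l n
      · refine absurd (funext fun x => ?_) hnm
        by_cases hx : x = c₁
        · subst hx; exact ((a2 _ h2).trans (a3 _ h3)).symm
        · exact a1 x hx
      · rw [if_neg a3]; ring
    · rw [if_neg a2]; ring
  · rw [if_neg a1]; ring

theorem triple_odd_first_le (h0 : ∀ c a b, 0 ≤ h c a b) (hs : ∀ c a b, h c a b = h c b a) (j : ℕ)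
    {c₁ c₂ c₃ : Fin 4} (h2 : c₁ ≠ c₂) (h3 : c₁ ≠ c₃) :
    triple M j h c₁ c₂ c₃ ≤ insSum M j h c₁ c₂ + insSum M j h c₁ c₃ := by
  refine le_trans ?_ (add_le_add (sum_mul_sq_le_insSum h0 j c₁ c₂) (sum_mul_sq_le_insSum h0 j c₁ c₃))
  rw [triple, ← sum_add_distrib]
  refine sum_le_sum fun n _ => ?_
  rw [sum_eq_single n (fun m _ hm => sum_eq_zero fun l _ => by
    rw [triple_eq_zero h2 h3 hm.symm]; simp) (by simp), ← sum_add_distrib]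
  refine sum_le_sum fun l _ => ?_
  split_ifs
  · rw [hop_symm hs c₃ l n, ← mul_add]
    refine mul_le_mul_of_nonneg_left ?_ (hop_nonneg h0 _ _ _)
    nlinarith [sq_nonneg (hop M j h c₂ n l - hop M j h c₃ n l), sq_nonneg (hop M j h c₂ n l),
      sq_nonneg (hop M j h c₃ n l)]
  · simp

theorem triple_odd_second_le (h0 : ∀ c a b, 0 ≤ h c a b) (hs : ∀ c a b, h c a b = h c b a) (j : ℕ)
    {c₁ c₂ c₃ : Fin 4} (h1 : c₂ ≠ c₁) (h3 : c₂ ≠ c₃) :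
    triple M j h c₁ c₂ c₃ ≤ insSum M j h c₂ c₁ + insSum M j h c₂ c₃ := by
  refine le_trans ?_ (add_le_add (sum_mul_sq_le_insSum' h0 j c₂ c₁) (sum_mul_sq_le_insSum' h0 j c₂ c₃))
  rw [triple, ← sum_add_distrib]
  refine sum_le_sum fun n _ => ?_
  rw [← sum_add_distrib]
  refine sum_le_sum fun m _ => ?_
  rw [sum_eq_single m (fun l _ hl => by
    have := triple_eq_zero (h := h) (M := M) (j := j) (l := n) h3 h1 hl.symm
    have e : hop M j h c₁ n m * (hop M j h c₂ m l * hop M j h c₃ l n) = 0 := by rw [← this]; ring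
    rw [e]; simp) (by simp)]
  split_ifs
  · rw [hop_symm hs c₃ m n, ← mul_add]
    have := hop_nonneg (M := M) (j := j) h0 c₂ m m
    have k : hop M j h c₁ n m * hop M j h c₃ n m ≤ hop M j h c₁ n m ^ 2 + hop M j h c₃ n m ^ 2 := by
      nlinarith [sq_nonneg (hop M j h c₁ n m - hop M j h c₃ n m), sq_nonneg (hop M j h c₁ n m),
        sq_nonneg (hop M j h c₃ n m)]
    calc _ = hop M j h c₂ m m * (hop M j h c₁ n m * hop M j h c₃ n m) := by ring
      _ ≤ _ := mul_le_mul_of_nonneg_left k this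
  · simp

theorem triple_odd_third_le (h0 : ∀ c a b, 0 ≤ h c a b) (hs : ∀ c a b, h c a b = h c b a) (j : ℕ)
    {c₁ c₂ c₃ : Fin 4} (h1 : c₃ ≠ c₁) (h2 : c₃ ≠ c₂) :
    triple M j h c₁ c₂ c₃ ≤ insSum M j h c₃ c₁ + insSum M j h c₃ c₂ := by
  refine le_trans ?_ (add_le_add (sum_mul_sq_le_insSum h0 j c₃ c₁) (sum_mul_sq_le_insSum h0 j c₃ c₂))
  rw [triple, ← sum_add_distrib]
  refine sum_le_sum fun n _ => ?_
  rw [← sum_add_distrib]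
  refine sum_le_sum fun m _ => ?_
  rw [sum_eq_single n (fun l _ hl => by
    have := triple_eq_zero (h := h) (M := M) (j := j) (l := m) h1 h2 hl
    have e : hop M j h c₁ n m * (hop M j h c₂ m l * hop M j h c₃ l n) = 0 := by rw [← this]; ring
    rw [e]; simp) (by simp)]
  split_ifs
  · rw [hop_symm hs c₂ m n, ← mul_add]
    have := hop_nonneg (M := M) (j := j) h0 c₃ n n
    have k : hop M j h c₁ n m * hop M j h c₂ n m ≤ hop M j h c₁ n m ^ 2 + hop M j h c₂ n m ^ 2 := by
      nlinarith [sq_nonneg (hop M j h c₁ n m - hop M j h c₂ n m), sq_nonneg (hop M j h c₁ n m),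
        sq_nonneg (hop M j h c₂ n m)]
    calc _ = hop M j h c₃ n n * (hop M j h c₁ n m * hop M j h c₂ n m) := by ring
      _ ≤ _ := mul_le_mul_of_nonneg_left k this
  · simp

set_option maxHeartbeats 800000 in
theorem exists_insSum_le (hM : 2 ≤ M) : ∃ K : ℝ, 0 < K ∧
    ∀ (N j : ℕ) (h : Fin 4 → Mode N → Mode N → ℝ), (∀ c a b, 0 ≤ h c a b) → ∀ c d : Fin 4, c ≠ d →
      insSum M j h c d ≤ K * (yq ((M : ℝ) ^ j) h * (1 + gq ((M : ℝ) ^ j) h)) := by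
  obtain ⟨K₁, hK₁, hb₁⟩ := exists_sum_bw_le (α := 7 / 8) (by norm_num) (by norm_num)
  obtain ⟨K₂, hK₂, hb₂⟩ := exists_sum_bw_le_of_one_lt (α := 5 / 4) (by norm_num)
  obtain ⟨K₃, hK₃, hb₃⟩ := exists_sum_bw_le (α := 0) le_rfl (by norm_num)
  obtain ⟨K₄, hK₄, hb₄⟩ := exists_sum_bw_le (α := 3 / 4) (by norm_num) (by norm_num)
  have hMpos : (0 : ℝ) < M := by exact_mod_cast (by omega : 0 < M)
  refine ⟨((M : ℝ) ^ 2) ^ 2 * (K₃ + 1) * K₁ ^ 2 + (M : ℝ) ^ 2 * (K₄ + 1) * K₂ ^ 2, by positivity,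
    fun N j h h0 c d hcd => ?_⟩
  have hR := one_le_scale hM j
  obtain ⟨R, hRdef⟩ : ∃ R, R = (M : ℝ) ^ j := ⟨_, rfl⟩
  rw [← hRdef] at hR ⊢
  have hR0 : 0 < R := by linarith
  have hy := yCol_le h hR d
  have hg := gCol_le h hR c
  have hd := dCol_le h hR c
  have hy0 := yq_nonneg h hR
  have hg0 := gq_nonneg h hR
  have hyc := yCol_nonneg (R := R) h d
  set Y : Mode N → ℝ := fun a => ∑ b, bw R 0 a * bw R (1 / 4) b * h d a b ^ 2 with hY
  set φ : Mode N → ℝ := fun e => bw R 0 e * (1 + h c e e ^ 2) with hφ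
  set ψ : Mode N → ℝ := fun e => bw R (3 / 4) e + bw R (7 / 4) e * h c e e ^ 2 with hψ
  have hY0 : ∀ a, 0 ≤ Y a := fun a => sum_nonneg fun b _ =>
    mul_nonneg (mul_nonneg (bw_nonneg _ _) (bw_nonneg _ _)) (sq_nonneg _)
  have hφ0 : ∀ a, 0 ≤ φ a := fun a => mul_nonneg (bw_nonneg _ _) (by positivity)
  have hψ0 : ∀ a, 0 ≤ ψ a := fun a =>
    add_nonneg (bw_nonneg _ _) (mul_nonneg (bw_nonneg _ _) (sq_nonneg _))
  have key : ∀ n : MultiMode N,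
      ∑ m, (if Slice M j n then (hop M j h c n n + hop M j h c m m) * hop M j h d n m ^ 2 else 0)
      ≤ ((M : ℝ) ^ 2 * R ^ (-2 : ℝ)) ^ 2 * (Y (n d) * φ (n c) * rest2 R (7 / 8) d c n)
        + (M : ℝ) ^ 2 * R ^ (-2 : ℝ) * (Y (n d) * ψ (n c) * rest2 R (5 / 4) d c n) := by
    intro n
    by_cases hn : Slice M j n
    swap
    · simp only [if_neg hn, sum_const_zero]
      refine add_nonneg (mul_nonneg (by positivity) (mul_nonneg (mul_nonneg (hY0 _) (hφ0 _))
        (rest2_nonneg _ _ _ _ _))) (mul_nonneg (by positivity) (mul_nonneg (mul_nonneg (hY0 _) (hψ0 _))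
        (rest2_nonneg _ _ _ _ _)))
    simp only [if_pos hn]
    have e := sum_slice_hop_sq (M := M) (h := h) j d (fun n m => hop M j h c n n + hop M j h c m m) n
    simp only [mul_comm (hop M j h d n _ ^ 2)] at e
    rw [e]
    simp only [hop_self, update_of_ne hcd]
    rw [hY]
    simp only [sum_mul, mul_sum]
    rw [← sum_add_distrib]
    refine sum_le_sum fun b _ => ?_
    have c1 := cutProp_le_of_slice_two hM hn hcd.symm
    have c2 := cutProp_rpow_le_rest2 (M := M) (j := j) (β := 1) (α := 1 / 4) (α' := 0)
      (e := 7 / 8) (by norm_num) (by norm_num) (by norm_num) (by norm_num) (by norm_num) hcd.symm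
      (update n d b)
    have c3 := cutProp_rpow_le_rest2 (M := M) (j := j) (β := 2) (α := 1 / 4) (α' := 5 / 4)
      (e := 5 / 4) (by norm_num) (by norm_num) (by norm_num) (by norm_num) (by norm_num) hcd.symm
      (update n d b)
    rw [rpow_one, rest2_update_left, update_self, update_of_ne hcd] at c2
    rw [rpow_two, rest2_update_left, update_self, update_of_ne hcd] at c3
    rw [← hRdef] at c1 c2 c3
    have q1 := cutProp_nonneg' M j n
    have q2 := cutProp_nonneg' M j (update n d b)
    have b1 := bw_nonneg (R := R) 0 (n d)
    have b1' := bw_nonneg (R := R) 0 (n c)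
    have b1'' := bw_le_one (R := R) le_rfl (n c)
    have b2 := bw_nonneg (R := R) (1 / 4) b
    have b3 := bw_nonneg (R := R) (5 / 4) (n c)
    have b5 := rest2_nonneg R (7 / 8) d c n
    have b6 := rest2_nonneg R (5 / 4) d c n
    have hh := h0 c (n c) (n c)
    have b0 : bw R 0 (n d) ^ 2 = bw R 0 (n d) := by rw [sq, bw_mul]; simp
    have b0' : bw R 0 (n c) ^ 2 = bw R 0 (n c) := by rw [sq, bw_mul]; simp
    have d1 : cutProp M j (sqNorm n) ^ 2 ≤ ((M : ℝ) ^ 2 * R ^ (-2 : ℝ)) ^ 2 * bw R 0 (n d) := by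
      calc _ ≤ ((M : ℝ) ^ 2 * R ^ (-2 : ℝ) * (bw R 0 (n d) * bw R 0 (n c))) ^ 2 :=
            pow_le_pow_left₀ q1 c1 2
        _ = ((M : ℝ) ^ 2 * R ^ (-2 : ℝ)) ^ 2 * bw R 0 (n d) * bw R 0 (n c) := by
            have : ∀ κ x y : ℝ, (κ * (x * y)) ^ 2 = κ ^ 2 * (x ^ 2 * y ^ 2) := fun κ x y => by ring
            rw [this, b0, b0']; ring
        _ ≤ _ := mul_le_of_le_one_right (by positivity) b1''
    have d2 : cutProp M j (sqNorm n) ≤ (M : ℝ) ^ 2 * R ^ (-2 : ℝ) * bw R 0 (n d) := by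
      refine c1.trans ?_
      rw [← mul_assoc]
      exact mul_le_of_le_one_right (by positivity) b1''
    have f1 : bw R 0 (n c) * h c (n c) (n c) ≤ φ (n c) := by
      simp only [hφ]
      refine mul_le_mul_of_nonneg_left ?_ b1'
      linarith only [sq_nonneg (h c (n c) (n c) - 1), sq_nonneg (h c (n c) (n c))]
    have f2 : bw R (5 / 4) (n c) * h c (n c) (n c) ≤ ψ (n c) := by
      simp only [hψ]
      have k1 : bw R (5 / 4) (n c) = bw R (3 / 8) (n c) * bw R (7 / 8) (n c) := by
        rw [bw_mul]; norm_num
      have k2 : bw R (3 / 4) (n c) = bw R (3 / 8) (n c) ^ 2 := by rw [sq, bw_mul]; norm_num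
      have k3 : bw R (7 / 4) (n c) = bw R (7 / 8) (n c) ^ 2 := by rw [sq, bw_mul]; norm_num
      rw [k1, k2, k3]
      linarith only [sq_nonneg (bw R (3 / 8) (n c) - bw R (7 / 8) (n c) * h c (n c) (n c)),
        sq_nonneg (bw R (3 / 8) (n c)), sq_nonneg (bw R (7 / 8) (n c) * h c (n c) (n c))]
    calc _ = (cutProp M j (sqNorm n) ^ 2 * (cutProp M j (sqNorm (update n d b))
            * h c (n c) (n c)) + cutProp M j (sqNorm n) *
            (cutProp M j (sqNorm (update n d b)) ^ 2 * h c (n c) (n c))) * h d (n d) b ^ 2 := by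
            ring
      _ ≤ (((M : ℝ) ^ 2 * R ^ (-2 : ℝ)) ^ 2 * bw R 0 (n d) *
            (bw R (1 / 4) b * φ (n c) * rest2 R (7 / 8) d c n) +
            (M : ℝ) ^ 2 * R ^ (-2 : ℝ) * bw R 0 (n d) *
            (bw R (1 / 4) b * ψ (n c) * rest2 R (5 / 4) d c n)) * h d (n d) b ^ 2 := by
            refine mul_le_mul_of_nonneg_right (add_le_add (mul_le_mul d1 ?_ (by positivity)
              (by positivity)) (mul_le_mul d2 ?_ (by positivity) (by positivity))) (sq_nonneg _)
            · calc _ ≤ bw R (1 / 4) b * bw R 0 (n c) * rest2 R (7 / 8) d c n * h c (n c) (n c) :=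
                  mul_le_mul_of_nonneg_right c2 hh
                _ = bw R (1 / 4) b * (bw R 0 (n c) * h c (n c) (n c)) * rest2 R (7 / 8) d c n := by ring
                _ ≤ _ := mul_le_mul_of_nonneg_right (mul_le_mul_of_nonneg_left f1 b2) b5
            · calc _ ≤ bw R (1 / 4) b * bw R (5 / 4) (n c) * rest2 R (5 / 4) d c n * h c (n c) (n c) :=
                  mul_le_mul_of_nonneg_right c3 hh
                _ = bw R (1 / 4) b * (bw R (5 / 4) (n c) * h c (n c) (n c)) * rest2 R (5 / 4) d c n := by
                  ring
                _ ≤ _ := mul_le_mul_of_nonneg_right (mul_le_mul_of_nonneg_left f2 b2) b6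
      _ = _ := by ring
  refine (sum_le_sum fun n _ => key n).trans ?_
  rw [sum_add_distrib, ← mul_sum, ← mul_sum, sum_mul_rest2 R _ hcd.symm, sum_mul_rest2 R _ hcd.symm]
  have hYs : ∑ a, Y a = yCol R h d := rfl
  have hφs : ∑ a, φ a ≤ R * ((K₃ + 1) * (1 + gq R h)) := by
    have : ∑ a, φ a = (∑ a : Mode N, bw R 0 a) + dCol R h c := by
      rw [dCol, ← sum_add_distrib]
      exact sum_congr rfl fun a _ => by simp only [hφ]; ring
    rw [this]
    have l2 := hb₃ N R hR
    rw [show (1 - 0 : ℝ) = 1 by norm_num, rpow_one] at l2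
    have q1 := mul_nonneg hR0.le hg0
    have q2 := mul_nonneg q1 hK₃.le
    linarith
  have hψs : ∑ a, ψ a ≤ R ^ (1 / 4 : ℝ) * ((K₄ + 1) * (1 + gq R h)) := by
    have l1 : ∑ a, bw R (7 / 4) a * h c a a ^ 2 ≤ gCol R h c := by
      refine sum_le_sum fun a _ => ?_
      refine le_trans (le_of_eq ?_) (single_le_sum (f := fun b => bw R (7 / 8) a *
        bw R (7 / 8) b * h c a b ^ 2) (fun b _ => mul_nonneg (mul_nonneg (bw_nonneg _ _)
          (bw_nonneg _ _)) (sq_nonneg _)) (mem_univ a))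
      rw [bw_mul, show (7 / 8 + 7 / 8 : ℝ) = 7 / 4 by norm_num]
    have l2 := hb₄ N R hR
    rw [show (1 - 3 / 4 : ℝ) = 1 / 4 by norm_num] at l2
    have l3 : ∑ a, ψ a = (∑ a, bw R (3 / 4) a) + ∑ a, bw R (7 / 4) a * h c a a ^ 2 :=
      sum_add_distrib
    rw [l3]
    have hr : 0 ≤ R ^ (1 / 4 : ℝ) := by positivity
    have q1 := mul_nonneg hr hg0
    have q2 := mul_nonneg q1 hK₄.le
    have q3 := mul_nonneg hr hK₄.le
    linarith
  have w1 : (∑ a : Mode N, bw R (7 / 8) a) ^ 2 ≤ (K₁ * R ^ (1 - 7 / 8 : ℝ)) ^ 2 :=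
    pow_le_pow_left₀ (sum_nonneg fun _ _ => bw_nonneg _ _) (hb₁ N R hR) 2
  have w2 : (∑ a : Mode N, bw R (5 / 4) a) ^ 2 ≤ K₂ ^ 2 :=
    pow_le_pow_left₀ (sum_nonneg fun _ _ => bw_nonneg _ _) (hb₂ N R) 2
  rw [hYs]
  have u1 : ((M : ℝ) ^ 2 * R ^ (-2 : ℝ)) ^ 2 * (yCol R h d * (∑ a, φ a) *
      (∑ a : Mode N, bw R (7 / 8) a) ^ 2)
      ≤ ((M : ℝ) ^ 2) ^ 2 * (K₃ + 1) * K₁ ^ 2 * (yq R h * (1 + gq R h)) := by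
    calc _ ≤ ((M : ℝ) ^ 2 * R ^ (-2 : ℝ)) ^ 2 * ((R ^ (7 / 4 : ℝ) * yq R h) *
          (R * ((K₃ + 1) * (1 + gq R h))) * (K₁ * R ^ (1 - 7 / 8 : ℝ)) ^ 2) := by
          refine mul_le_mul_of_nonneg_left (mul_le_mul (mul_le_mul hy hφs
            (sum_nonneg fun a _ => hφ0 a) (by positivity)) w1 (sq_nonneg _) (by positivity))
            (by positivity)
      _ = ((M : ℝ) ^ 2) ^ 2 * (K₃ + 1) * K₁ ^ 2 * (yq R h * (1 + gq R h)) *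
          ((R ^ (-2 : ℝ)) ^ 2 * R ^ (7 / 4 : ℝ) * R ^ (1 : ℝ) * (R ^ (1 - 7 / 8 : ℝ)) ^ 2) := by
          rw [rpow_one]; ring
      _ ≤ _ := by
          refine mul_le_of_le_one_right (by positivity) ?_
          rw [← rpow_natCast (R ^ (1 - 7 / 8 : ℝ)), ← rpow_natCast (R ^ (-2 : ℝ)),
            ← rpow_mul hR0.le, ← rpow_mul hR0.le, ← rpow_add hR0,
            ← rpow_add hR0, ← rpow_add hR0]
          exact rpow_le_one_of_one_le_of_nonpos hR (by norm_num)
  have u2 : (M : ℝ) ^ 2 * R ^ (-2 : ℝ) * (yCol R h d * (∑ a, ψ a) *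
      (∑ a : Mode N, bw R (5 / 4) a) ^ 2)
      ≤ (M : ℝ) ^ 2 * (K₄ + 1) * K₂ ^ 2 * (yq R h * (1 + gq R h)) := by
    calc _ ≤ (M : ℝ) ^ 2 * R ^ (-2 : ℝ) * ((R ^ (7 / 4 : ℝ) * yq R h) *
          (R ^ (1 / 4 : ℝ) * ((K₄ + 1) * (1 + gq R h))) * K₂ ^ 2) := by
          refine mul_le_mul_of_nonneg_left (mul_le_mul (mul_le_mul hy hψs
            (sum_nonneg fun a _ => hψ0 a) (by positivity)) w2 (sq_nonneg _) (by positivity))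
            (by positivity)
      _ = (M : ℝ) ^ 2 * (K₄ + 1) * K₂ ^ 2 * (yq R h * (1 + gq R h)) *
          (R ^ (-2 : ℝ) * R ^ (7 / 4 : ℝ) * R ^ (1 / 4 : ℝ)) := by
          ring
      _ ≤ _ := by
          refine mul_le_of_le_one_right (by positivity) ?_
          rw [← rpow_add hR0, ← rpow_add hR0]
          exact rpow_le_one_of_one_le_of_nonpos hR (by norm_num)
  calc _ ≤ _ := add_le_add u1 u2
    _ = _ := by ring

theorem exists_triple_le (hM : 2 ≤ M) : ∃ K : ℝ, 0 < K ∧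
    ∀ (N j : ℕ) (h : Fin 4 → Mode N → Mode N → ℝ), (∀ c a b, 0 ≤ h c a b) →
      (∀ c a b, h c a b = h c b a) → ∀ c₁ c₂ c₃ : Fin 4,
      triple M j h c₁ c₂ c₃ ≤ K * (yq ((M : ℝ) ^ j) h * (1 + gq ((M : ℝ) ^ j) h)) := by
  obtain ⟨K₁, hK₁, H₁⟩ := exists_triple_same_le hM
  obtain ⟨K₂, hK₂, H₂⟩ := exists_insSum_le hM
  refine ⟨K₁ + 2 * K₂, by positivity, fun N j h h0 hs c₁ c₂ c₃ => ?_⟩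
  have hR := one_le_scale hM j
  have hy0 := yq_nonneg h hR
  have hg0 := gq_nonneg h hR
  set Z := yq ((M : ℝ) ^ j) h * (1 + gq ((M : ℝ) ^ j) h) with hZ
  have hZ0 : 0 ≤ Z := by positivity
  have fin : ∀ x, x ≤ K₂ * Z + K₂ * Z → x ≤ (K₁ + 2 * K₂) * Z := fun x hx => by
    have : 0 ≤ K₁ * Z := by positivity
    linarith
  by_cases h12 : c₁ = c₂
  · by_cases h13 : c₁ = c₃
    · subst h12; subst h13
      have := H₁ N j h h0 hs c₁
      have h' : 0 ≤ K₂ * Z := by positivity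
      rw [← hZ] at this
      linarith
    · have a1 : c₃ ≠ c₁ := fun e => h13 e.symm
      have a2 : c₃ ≠ c₂ := h12 ▸ a1
      exact fin _ ((triple_odd_third_le h0 hs j a1 a2).trans
        (add_le_add (H₂ N j h h0 _ _ a1) (H₂ N j h h0 _ _ a2)))
  · by_cases h13 : c₁ = c₃
    · have a1 : c₂ ≠ c₁ := fun e => h12 e.symm
      have a2 : c₂ ≠ c₃ := h13 ▸ a1
      exact fin _ ((triple_odd_second_le h0 hs j a1 a2).trans
        (add_le_add (H₂ N j h h0 _ _ a1) (H₂ N j h h0 _ _ a2)))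
    · exact fin _ ((triple_odd_first_le h0 hs j h12 h13).trans
        (add_le_add (H₂ N j h h0 _ _ h12) (H₂ N j h h0 _ _ h13)))

end Cubic

/-! ### Entries of the operators -/

section Entries

variable {N M : ℕ}

/-- The entries of the diagonal operator `D₁`. -/
noncomputable def d1Fun (M j : ℕ) (g : ℂ) (n : MultiMode N) : ℂ :=
  -(lam g ^ 2) * ((cutProp M j (sqNorm n) * ∑ c, a1 (n c) : ℝ) : ℂ)

/-- The entries of the diagonal operator `D₂`. -/
noncomputable def d2Fun (M j : ℕ) (g : ℂ) (n : MultiMode N) : ℂ :=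
  lam g ^ 4 * ((cutProp M j (sqNorm n) * ∑ c, (a2Same (n c) + 3 * a2Other (n c)) : ℝ) : ℂ)

theorem sqrtC_mul_diagonal_mul_sqrtC (j : ℕ) (a : ℂ) (f : MultiMode N → ℂ) :
    a • (sqrtC N M j * diagonal f * sqrtC N M j)
      = diagonal fun n => a * f n * ((cutProp M j (sqNorm n) : ℝ) : ℂ) := by
  rw [sqrtC, diagonal_mul_diagonal, diagonal_mul_diagonal, ← diagonal_smul]
  congr 1
  funext n
  rw [← mul_self_sqrt (cutProp_nonneg' M j n), Pi.smul_apply, smul_eq_mul, ofReal_mul]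
  ring

theorem D1_eq (N M j : ℕ) (g : ℂ) : D1 N M j g = diagonal (d1Fun M j g) := by
  rw [D1, B1, ampM1, ← diagonal_smul, sqrtC_mul_diagonal_mul_sqrtC]
  congr 1
  funext n
  simp only [Pi.smul_apply, smul_eq_mul, d1Fun, ofReal_mul]
  linear_combination (lam g ^ 2 * ((cutProp M j (sqNorm n) : ℝ) : ℂ)
    * ((∑ c, a1 (n c) : ℝ) : ℂ)) * Complex.I_sq

theorem D2_eq (N M j : ℕ) (g : ℂ) : D2 N M j g = diagonal (d2Fun M j g) := by
  rw [D2, B2, ampM2, ← diagonal_smul, sqrtC_mul_diagonal_mul_sqrtC]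
  congr 1
  funext n
  simp only [Pi.smul_apply, smul_eq_mul, d2Fun, ofReal_mul]
  linear_combination (-lam g ^ 4 * ((cutProp M j (sqNorm n) : ℝ) : ℂ)
    * ((∑ c, (a2Same (n c) + 3 * a2Other (n c)) : ℝ) : ℂ)) * Complex.I_sq

theorem Sig_apply (j : ℕ) (g : ℂ) (σ : MatField N) (n m : MultiMode N) :
    Sig M j g σ n m = Complex.I * lam g * (((√(cutProp M j (sqNorm n)) : ℝ) : ℂ) * sigmaOp σ n m
      * ((√(cutProp M j (sqNorm m)) : ℝ) : ℂ)) := by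
  rw [Sig, sqrtC, Matrix.smul_apply, mul_diagonal, diagonal_mul, smul_eq_mul]

theorem cutProp_pred {M : ℕ} (hM : 2 ≤ M) (j : ℕ) (n : MultiMode N) :
    cutProp M (j - 1) (sqNorm n) = if Slice M j n then 0 else cutProp M j (sqNorm n) := by
  unfold cutProp
  rcases cutoff_sub_mem hM j (sqNorm n) with h | ⟨-, h1, h2⟩
  · have : ¬ Slice M j n := by rintro ⟨h1, h2⟩; rw [h1, h2] at h; norm_num at h
    rw [if_neg this, sub_eq_zero.1 h]
  · rw [if_pos ⟨h1, h2⟩, h2, zero_mul]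

theorem Sig_pred (hM : 2 ≤ M) (j : ℕ) (g : ℂ) (σ : MatField N) :
    Sig M (j - 1) g σ = compr (Slice M j) (Sig M j g σ) := by
  ext n m
  rw [compr_apply, Sig_apply, Sig_apply, cutProp_pred hM, cutProp_pred hM]
  by_cases h1 : Slice M j n <;> by_cases h2 : Slice M j m <;> simp [h1, h2]

theorem d1Fun_pred (hM : 2 ≤ M) (j : ℕ) (g : ℂ) :
    d1Fun (N := N) M (j - 1) g = fun n => if Slice M j n then 0 else d1Fun M j g n := by
  funext n
  rw [d1Fun, d1Fun, cutProp_pred hM]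
  split_ifs <;> simp

theorem d2Fun_pred (hM : 2 ≤ M) (j : ℕ) (g : ℂ) :
    d2Fun (N := N) M (j - 1) g = fun n => if Slice M j n then 0 else d2Fun M j g n := by
  funext n
  rw [d2Fun, d2Fun, cutProp_pred hM]
  split_ifs <;> simp

theorem VGe3Le_eq (j : ℕ) (g : ℂ) (σ : MatField N) :
    VGe3Le M j g σ = vAbs (Sig M j g σ) (d1Fun M j g) (d2Fun M j g) := by
  rw [VGe3Le, lastVac, U, vAbs, D1_eq, D2_eq]

theorem VGe3_eq (hM : 2 ≤ M) (j : ℕ) (g : ℂ) (σ : MatField N) :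
    VGe3 M j g σ = vAbs (Sig M j g σ) (d1Fun M j g) (d2Fun M j g)
      - vAbs (compr (Slice M j) (Sig M j g σ)) (fun n => if Slice M j n then 0 else d1Fun M j g n)
        (fun n => if Slice M j n then 0 else d2Fun M j g n) := by
  rw [VGe3, VGe3Le_eq, VGe3Le_eq, Sig_pred hM, d1Fun_pred hM, d2Fun_pred hM]

theorem sigmaOp_isHermitian {σ : MatField N} (hσ : ∀ c, (σ c).IsHermitian) :
    (sigmaOp σ).IsHermitian := by
  ext n m
  rw [conjTranspose_apply, sigmaOp, sigmaOp, star_sum]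
  refine sum_congr rfl fun c _ => ?_
  have : (∀ c', c' ≠ c → m c' = n c') ↔ ∀ c', c' ≠ c → n c' = m c' :=
    forall₂_congr fun _ _ => eq_comm
  simp only [this]
  split_ifs
  · exact (hσ c).apply _ _
  · simp

theorem sqrtC_sigmaOp_isHermitian (j : ℕ) {σ : MatField N} (hσ : ∀ c, (σ c).IsHermitian) :
    (sqrtC N M j * sigmaOp σ * sqrtC N M j).IsHermitian := by
  have hd : (sqrtC N M j).conjTranspose = sqrtC N M j := by
    rw [sqrtC, diagonal_conjTranspose]
    congr 1; funext n; simp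
  rw [Matrix.IsHermitian, Matrix.conjTranspose_mul, Matrix.conjTranspose_mul, hd,
    (sigmaOp_isHermitian hσ).eq, mul_assoc]

theorem norm_Sig_symm (j : ℕ) (g : ℂ) {σ : MatField N} (hσ : ∀ c, (σ c).IsHermitian)
    (n m : MultiMode N) : ‖Sig M j g σ n m‖ = ‖Sig M j g σ m n‖ := by
  rw [Sig, Matrix.smul_apply, Matrix.smul_apply, norm_smul, norm_smul,
    ← (sqrtC_sigmaOp_isHermitian j hσ).apply n m, norm_star]

theorem norm_Sig_le (j : ℕ) (g : ℂ) (σ : MatField N) (n m : MultiMode N) :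
    ‖Sig M j g σ n m‖ ≤ ‖lam g‖ * ∑ c, hop M j (fun c a b => ‖σ c a b‖) c n m := by
  rw [Sig_apply, norm_mul, norm_mul, norm_I, one_mul, norm_mul, norm_mul, norm_real,
    norm_real, norm_of_nonneg (sqrt_nonneg _),
    norm_of_nonneg (sqrt_nonneg _)]
  refine mul_le_mul_of_nonneg_left ?_ (norm_nonneg _)
  have h1 : ‖sigmaOp σ n m‖ ≤ ∑ c, if Agree c n m then ‖σ c (n c) (m c)‖ else 0 := by
    rw [sigmaOp]
    refine (norm_sum_le _ _).trans (le_of_eq (sum_congr rfl fun c _ => ?_))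
    by_cases ha : Agree c n m
    · rw [if_pos ha]; exact congrArg norm (if_pos ha)
    · rw [if_neg ha]; exact (congrArg norm (if_neg ha)).trans norm_zero
  calc _ ≤ √(cutProp M j (sqNorm n)) * (∑ c, if Agree c n m then ‖σ c (n c) (m c)‖ else 0)
        * √(cutProp M j (sqNorm m)) := by gcongr
    _ = _ := by
      rw [mul_sum, sum_mul]
      refine sum_congr rfl fun c _ => ?_
      unfold hop
      split_ifs <;> ring

theorem cutProp_mul_brk_le (j : ℕ) (n : MultiMode N) (c : Fin 4) :
    cutProp M j (sqNorm n) * brk (n c) ≤ cutProp M j (sqNorm n) ^ (1 / 2 : ℝ) ∧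
    cutProp M j (sqNorm n) * brk (n c) ^ (1 / 4 : ℝ) ≤ cutProp M j (sqNorm n) ^ (7 / 8 : ℝ) := by
  set C := cutProp M j (sqNorm n) with hC
  have hC0 : 0 ≤ C := cutProp_nonneg' M j n
  have hs := sqNorm_nonneg n
  have hb := brk_pos (n c)
  have hCb : C * brk (n c) ^ 2 ≤ 1 := by
    calc C * brk (n c) ^ 2 ≤ 1 / (sqNorm n + 1) * (sqNorm n + 1) :=
          mul_le_mul (cutProp_le M j hs) (by
            have := brk_sq_le (n c); have := sq_le_sqNorm n c; linarith) (by positivity) (by positivity)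
      _ = 1 := by field_simp
  have key : ∀ β : ℝ, 0 ≤ β → β < 1 → C * (brk (n c) ^ 2) ^ β ≤ C ^ (1 - β) := by
    intro β h0 h1
    rcases hC0.eq_or_lt with h | h
    · rw [← h, zero_mul]; exact rpow_nonneg le_rfl _
    · have e : C = C ^ (1 - β) * C ^ β := by rw [← rpow_add h]; norm_num
      calc C * (brk (n c) ^ 2) ^ β = C ^ (1 - β) * (C * brk (n c) ^ 2) ^ β := by
            conv_lhs => rw [e]
            rw [mul_rpow hC0 (by positivity)]; ring
        _ ≤ _ := mul_le_of_le_one_right (rpow_nonneg hC0 _) (rpow_le_one (by positivity) hCb h0)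
  have k1 := key (1 / 2) (by norm_num) (by norm_num)
  have k2 := key (1 / 8) (by norm_num) (by norm_num)
  have e1 : (brk (n c) ^ 2) ^ (1 / 2 : ℝ) = brk (n c) := by
    rw [← rpow_natCast, ← rpow_mul hb.le]; norm_num
  have e2 : (brk (n c) ^ 2) ^ (1 / 8 : ℝ) = brk (n c) ^ (1 / 4 : ℝ) := by
    rw [← rpow_natCast, ← rpow_mul hb.le]; norm_num
  rw [e1] at k1
  rw [e2] at k2
  norm_num at k1 k2 ⊢
  exact ⟨k1, k2⟩

theorem exists_norm_dFun_le : ∃ κ : ℝ, 0 < κ ∧ ∀ (N M j : ℕ) (g : ℂ) (n : MultiMode N),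
    ‖d1Fun M j g n‖ ≤ κ * ‖lam g‖ ^ 2 * cutProp M j (sqNorm n) ^ (1 / 2 : ℝ) ∧
    ‖d2Fun M j g n‖ ≤ κ * ‖lam g‖ ^ 4 * cutProp M j (sqNorm n) ^ (7 / 8 : ℝ) := by
  obtain ⟨K₁, hK₁, h1⟩ := exists_abs_a1_le
  obtain ⟨K₂, hK₂, h2⟩ := exists_abs_a2Same_le
  obtain ⟨K₃, hK₃, h3⟩ := exists_abs_a2Other_le
  refine ⟨4 * (K₁ + K₂ + 3 * K₃), by positivity, fun N M j g n => ?_⟩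
  have hC0 := cutProp_nonneg' M j n
  set C := cutProp M j (sqNorm n) with hC
  constructor
  · rw [d1Fun, norm_mul, norm_neg, norm_pow, norm_real, norm_eq_abs, abs_mul, abs_of_nonneg hC0]
    have : C * |∑ c, a1 (n c)| ≤ ∑ _c : Fin 4, K₁ * C ^ (1 / 2 : ℝ) := by
      refine (mul_le_mul_of_nonneg_left (abs_sum_le_sum_abs _ _) hC0).trans ?_
      rw [mul_sum]
      refine sum_le_sum fun c _ => ?_
      calc _ ≤ C * (K₁ * brk (n c)) := mul_le_mul_of_nonneg_left (h1 _) hC0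
        _ = K₁ * (C * brk (n c)) := by ring
        _ ≤ _ := mul_le_mul_of_nonneg_left (cutProp_mul_brk_le j n c).1 hK₁.le
    rw [sum_const, card_univ, Fintype.card_fin, nsmul_eq_mul] at this
    have hp : 0 ≤ C ^ (1 / 2 : ℝ) := rpow_nonneg hC0 _
    calc _ ≤ ‖lam g‖ ^ 2 * (((4 : ℕ) : ℝ) * (K₁ * C ^ (1 / 2 : ℝ))) :=
          mul_le_mul_of_nonneg_left this (by positivity)
      _ ≤ ‖lam g‖ ^ 2 * (4 * (K₁ + K₂ + 3 * K₃) * C ^ (1 / 2 : ℝ)) := by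
          refine mul_le_mul_of_nonneg_left ?_ (by positivity)
          push_cast
          nlinarith [mul_nonneg hK₂.le hp, mul_nonneg hK₃.le hp]
      _ = _ := by ring
  · rw [d2Fun, norm_mul, norm_pow, norm_real, norm_eq_abs, abs_mul, abs_of_nonneg hC0]
    have hp : 0 ≤ C ^ (7 / 8 : ℝ) := rpow_nonneg hC0 _
    have hC1 : C ≤ C ^ (7 / 8 : ℝ) := self_le_rpow_of_le_one hC0 (cutProp_le_one' M j n)
      (by norm_num)
    have : C * |∑ c, (a2Same (n c) + 3 * a2Other (n c))|
        ≤ ∑ _c : Fin 4, (K₂ + 3 * K₃) * C ^ (7 / 8 : ℝ) := by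
      refine (mul_le_mul_of_nonneg_left (abs_sum_le_sum_abs _ _) hC0).trans ?_
      rw [mul_sum]
      refine sum_le_sum fun c _ => ?_
      have hb := h3 (n c)
      calc _ ≤ C * (K₂ + 3 * (K₃ * brk (n c) ^ (1 / 4 : ℝ))) := by
            refine mul_le_mul_of_nonneg_left ((abs_add_le _ _).trans (add_le_add (h2 _) ?_)) hC0
            rw [abs_mul, abs_of_pos (by norm_num : (0 : ℝ) < 3)]
            linarith
        _ = K₂ * C + 3 * K₃ * (C * brk (n c) ^ (1 / 4 : ℝ)) := by ring
        _ ≤ K₂ * C ^ (7 / 8 : ℝ) + 3 * K₃ * C ^ (7 / 8 : ℝ) :=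
            add_le_add (mul_le_mul_of_nonneg_left hC1 hK₂.le)
              (mul_le_mul_of_nonneg_left (cutProp_mul_brk_le j n c).2 (by positivity))
        _ = _ := by ring
    rw [sum_const, card_univ, Fintype.card_fin, nsmul_eq_mul] at this
    calc _ ≤ ‖lam g‖ ^ 4 * (((4 : ℕ) : ℝ) * ((K₂ + 3 * K₃) * C ^ (7 / 8 : ℝ))) :=
          mul_le_mul_of_nonneg_left this (by positivity)
      _ ≤ ‖lam g‖ ^ 4 * (4 * (K₁ + K₂ + 3 * K₃) * C ^ (7 / 8 : ℝ)) := by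
          refine mul_le_mul_of_nonneg_left ?_ (by positivity)
          push_cast
          nlinarith [mul_nonneg hK₁.le hp]
      _ = _ := by ring

theorem cardioid_lam {ρ : ℝ} (hρ : 0 < ρ) {g : ℂ} (hg : g ∈ cardioid ρ) :
    ∃ cs : ℝ, 0 < cs ∧ cs ≤ 1 ∧ (lam g).re = cs * ‖lam g‖ ∧ ‖lam g‖ ^ 2 ≤ ρ * cs ^ 2 := by
  obtain ⟨h1, h2⟩ := hg
  refine ⟨cos (g.arg / 2), ?_, cos_le_one _, ?_, ?_⟩
  · rw [abs_lt] at h1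
    exact cos_pos_of_mem_Ioo ⟨by linarith [h1.1], by linarith [h1.2]⟩
  · by_cases h0 : g = 0
    · subst h0; simp [lam]
    · rw [lam, Complex.cpow_def_of_ne_zero h0, Complex.norm_exp, Complex.exp_re, mul_comm]
      congr 2
      simp [Complex.log_im]
      ring
  · by_cases h0 : g = 0
    · subst h0; simp [lam, hρ.le]
    · have : ‖lam g‖ ^ 2 = ‖g‖ := by
        rw [← norm_pow, lam, ← Complex.cpow_nat_mul]
        norm_num
      rw [this]; exact h2.le

end Entries

/-! ### Power sums over the slice -/

section SlicePower

variable {M : ℕ}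

theorem bw_zero_eq_one_of_slice {N j : ℕ} {n : MultiMode N} (hn : Slice M j n) (c : Fin 4) :
    bw ((M : ℝ) ^ j) 0 (n c) = 1 := by
  have h1 := hn.1
  unfold cutoff at h1
  by_cases h : 1 ≤ j ∧ 1 + sqNorm n ≤ (M : ℝ) ^ (2 * j)
  · rw [bw, if_pos (abs_le_of_cutoff (sq_le_sqNorm n c) h.2)]; simp
  · rw [if_neg h] at h1; norm_num at h1

theorem cutProp_rpow_le_of_slice (hM : 2 ≤ M) {N j : ℕ} {n : MultiMode N} (hn : Slice M j n) {β : ℝ}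
    (hβ : 0 ≤ β) : cutProp M j (sqNorm n) ^ β ≤ ((M : ℝ) ^ 2) ^ β * ((M : ℝ) ^ j) ^ (-2 * β) := by
  have hR := one_le_scale hM j
  refine (rpow_le_rpow (cutProp_nonneg' _ _ _) (cutProp_le_of_slice' hM hn) hβ).trans (le_of_eq ?_)
  rw [mul_rpow (by positivity) (by positivity), ← rpow_mul (by linarith)]

theorem exists_slice_sum_le (hM : 2 ≤ M) {β : ℝ} (hβ : 0 ≤ β) : ∃ K : ℝ, 0 < K ∧ ∀ N j : ℕ,
    ∑ n : MultiMode N, (if Slice M j n then cutProp M j (sqNorm n) ^ β else 0)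
      ≤ K * ((M : ℝ) ^ j) ^ (4 - 2 * β) := by
  obtain ⟨K, hK, hb⟩ := exists_sum_bw_le (α := 0) le_rfl (by norm_num)
  have hM0 : (0 : ℝ) < (M : ℝ) ^ 2 := by
    have : (0 : ℝ) < M := by exact_mod_cast (by omega : 0 < M)
    positivity
  refine ⟨((M : ℝ) ^ 2) ^ β * K ^ 4, by positivity, fun N j => ?_⟩
  have hR := one_le_scale hM j
  obtain ⟨R, hRdef⟩ : ∃ R, R = (M : ℝ) ^ j := ⟨_, rfl⟩
  rw [← hRdef] at hR ⊢
  have hR0 : 0 < R := by linarith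
  have hsum := sum_mul_rest1 R 0 (0 : Fin 4) (fun a : Mode N => bw R 0 a)
  have hw := hb N R hR
  rw [show (1 - 0 : ℝ) = 1 by norm_num, rpow_one] at hw
  have hw0 : 0 ≤ ∑ a : Mode N, bw R 0 a := sum_nonneg fun _ _ => bw_nonneg _ _
  calc _ ≤ ∑ n : MultiMode N, ((M : ℝ) ^ 2) ^ β * R ^ (-2 * β) * (bw R 0 (n 0) * rest1 R 0 0 n) := by
        refine sum_le_sum fun n _ => ?_
        split_ifs with hn
        · have e1 := bw_zero_eq_one_of_slice hn 0
          have e2 : rest1 R 0 0 n = 1 := by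
            rw [hRdef]
            exact prod_eq_one fun x _ => by
              split_ifs
              · rfl
              · exact bw_zero_eq_one_of_slice hn x
          rw [← hRdef] at e1
          rw [e1, e2, mul_one, mul_one, hRdef]
          exact cutProp_rpow_le_of_slice hM hn hβ
        · exact mul_nonneg (by positivity) (mul_nonneg (bw_nonneg _ _) (rest1_nonneg _ _ _ _))
    _ = ((M : ℝ) ^ 2) ^ β * R ^ (-2 * β) * (∑ a : Mode N, bw R 0 a) ^ 4 := by
        rw [← mul_sum, hsum]; ring
    _ ≤ ((M : ℝ) ^ 2) ^ β * R ^ (-2 * β) * (K * R) ^ 4 := by gcongr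
    _ = ((M : ℝ) ^ 2) ^ β * K ^ 4 * (R ^ (-2 * β) * R ^ (4 : ℝ)) := by
        rw [show (4 : ℝ) = ((4 : ℕ) : ℝ) by norm_num, rpow_natCast]; ring
    _ = _ := by rw [← rpow_add hR0]; congr 2; ring

theorem exists_slice_diag_le (hM : 2 ≤ M) : ∃ K : ℝ, 0 < K ∧
    ∀ (N j : ℕ) (h : Fin 4 → Mode N → Mode N → ℝ), (∀ c a b, 0 ≤ h c a b) → ∀ c : Fin 4,
    ∑ n, (if Slice M j n then hop M j h c n n * cutProp M j (sqNorm n) else 0)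
      ≤ K * (1 + gq ((M : ℝ) ^ j) h) := by
  obtain ⟨K, hK, hb⟩ := exists_sum_bw_le (α := 0) le_rfl (by norm_num)
  have hM0 : (0 : ℝ) < (M : ℝ) ^ 2 := by
    have : (0 : ℝ) < M := by exact_mod_cast (by omega : 0 < M)
    positivity
  refine ⟨((M : ℝ) ^ 2) ^ 2 * (K + 1) * K ^ 3, by positivity, fun N j h h0 c => ?_⟩
  have hR := one_le_scale hM j
  obtain ⟨R, hRdef⟩ : ∃ R, R = (M : ℝ) ^ j := ⟨_, rfl⟩
  rw [← hRdef] at hR ⊢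
  have hR0 : 0 < R := by linarith
  have hg0 := gq_nonneg h hR
  have hd := dCol_le h hR c
  have hsum := sum_mul_rest1 R 0 c (fun a : Mode N => bw R 0 a * (1 + h c a a ^ 2))
  have hw := hb N R hR
  rw [show (1 - 0 : ℝ) = 1 by norm_num, rpow_one] at hw
  have hw0 : 0 ≤ ∑ a : Mode N, bw R 0 a := sum_nonneg fun _ _ => bw_nonneg _ _
  have hφ : ∑ a : Mode N, bw R 0 a * (1 + h c a a ^ 2) ≤ R * ((K + 1) * (1 + gq R h)) := by
    have : ∑ a : Mode N, bw R 0 a * (1 + h c a a ^ 2) = (∑ a : Mode N, bw R 0 a) + dCol R h c := by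
      rw [dCol, ← sum_add_distrib]
      exact sum_congr rfl fun a _ => by ring
    rw [this]
    have q1 := mul_nonneg hR0.le hg0
    have q2 := mul_nonneg q1 hK.le
    linarith
  have hφ0 : 0 ≤ ∑ a : Mode N, bw R 0 a * (1 + h c a a ^ 2) :=
    sum_nonneg fun a _ => mul_nonneg (bw_nonneg _ _) (by positivity)
  calc _ ≤ ∑ n : MultiMode N, ((M : ℝ) ^ 2 * R ^ (-2 : ℝ)) ^ 2 *
        (bw R 0 (n c) * (1 + h c (n c) (n c) ^ 2) * rest1 R 0 c n) := by
        refine sum_le_sum fun n _ => ?_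
        split_ifs with hn
        · have e1 := bw_zero_eq_one_of_slice hn c
          have e2 : rest1 R 0 c n = 1 := by
            rw [hRdef]
            exact prod_eq_one fun x _ => by
              split_ifs
              · rfl
              · exact bw_zero_eq_one_of_slice hn x
          have c1 := cutProp_le_of_slice' hM hn
          rw [← hRdef] at e1 c1
          rw [e1, e2, one_mul, mul_one, hop_self]
          have hh := h0 c (n c) (n c)
          have : h c (n c) (n c) ≤ 1 + h c (n c) (n c) ^ 2 := by
            nlinarith [sq_nonneg (h c (n c) (n c) - 1)]
          calc _ = cutProp M j (sqNorm n) ^ 2 * h c (n c) (n c) := by ring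
            _ ≤ _ := mul_le_mul (pow_le_pow_left₀ (cutProp_nonneg' _ _ _) c1 2) this hh (by positivity)
        · exact mul_nonneg (by positivity) (mul_nonneg (mul_nonneg (bw_nonneg _ _) (by positivity))
            (rest1_nonneg _ _ _ _))
    _ = ((M : ℝ) ^ 2 * R ^ (-2 : ℝ)) ^ 2 * ((∑ a : Mode N, bw R 0 a * (1 + h c a a ^ 2)) *
        (∑ a : Mode N, bw R 0 a) ^ 3) := by
        rw [← mul_sum, hsum]
    _ ≤ ((M : ℝ) ^ 2 * R ^ (-2 : ℝ)) ^ 2 * (R * ((K + 1) * (1 + gq R h)) * (K * R) ^ 3) := by gcongr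
    _ = ((M : ℝ) ^ 2) ^ 2 * (K + 1) * K ^ 3 * (1 + gq R h) * ((R ^ (-2 : ℝ)) ^ 2 * R ^ (4 : ℝ)) := by
        rw [show (4 : ℝ) = ((4 : ℕ) : ℝ) by norm_num, rpow_natCast]; ring
    _ = _ := by
        rw [← rpow_natCast (R ^ (-2 : ℝ)), ← rpow_mul hR0.le, ← rpow_add hR0]
        norm_num

end SlicePower

/-! ### Deterministic bounds of the interaction -/

section Deterministic

variable {N M : ℕ}

theorem sum_four_sq_le (f : Fin 4 → ℝ) : (∑ c, f c) ^ 2 ≤ 4 * ∑ c, f c ^ 2 := by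
  have := sq_sum_le_card_mul_sum_sq (s := univ) (f := f)
  simpa using this

/-- Expansion of the quartic sum of a matrix dominated by one-colour hops and a diagonal. -/
theorem quarticSum_le {A : Op N} {j : ℕ} {h : Fin 4 → Mode N → Mode N → ℝ}
    (h0 : ∀ c a b, 0 ≤ h c a b) {l : ℝ} (hl : 0 ≤ l) {δ : MultiMode N → ℝ} (hδ : ∀ n, 0 ≤ δ n)
    (hA : ∀ n m, ‖A n m‖ ≤ l * (∑ c, hop M j h c n m) + if n = m then δ n else 0) :
    quarticSum (Slice M j) A ≤
      48 * l ^ 4 * (∑ c, ∑ d, ∑ n, ∑ m,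
        if Slice M j n then (∑ k, hop M j h c n k * hop M j h d k m) ^ 2 else 0)
      + 24 * l ^ 2 * (∑ c, ∑ n, ∑ m,
        if Slice M j n then hop M j h c n m ^ 2 * (δ n ^ 2 + δ m ^ 2) else 0)
      + 3 * ∑ n, if Slice M j n then δ n ^ 4 else 0 := by
  have hH0 : ∀ n m, 0 ≤ ∑ c, hop M j h c n m := fun n m => sum_nonneg fun c _ => hop_nonneg h0 c n m
  have key : ∀ n m, (∑ k, ‖A n k‖ * ‖A k m‖) ^ 2 ≤
      48 * l ^ 4 * (∑ c, ∑ d, (∑ k, hop M j h c n k * hop M j h d k m) ^ 2)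
      + 24 * l ^ 2 * (∑ c, hop M j h c n m ^ 2 * (δ n ^ 2 + δ m ^ 2))
      + 3 * (if n = m then δ n ^ 4 else 0) := by
    intro n m
    set X := ∑ c, ∑ d, ∑ k, hop M j h c n k * hop M j h d k m with hX
    set Y := (∑ c, hop M j h c n m) * (δ n + δ m) with hY
    set Z := if n = m then δ n ^ 2 else 0 with hZ
    have s1 : ∑ k, ‖A n k‖ * ‖A k m‖ ≤ l ^ 2 * X + l * Y + Z := by
      calc _ ≤ ∑ k, (l * (∑ c, hop M j h c n k) + if n = k then δ n else 0) *
            (l * (∑ c, hop M j h c k m) + if k = m then δ k else 0) := by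
            refine sum_le_sum fun k _ => mul_le_mul (hA n k) (hA k m) (norm_nonneg _) ?_
            refine add_nonneg (mul_nonneg hl (hH0 _ _)) ?_
            split_ifs
            · exact hδ _
            · exact le_rfl
        _ = l ^ 2 * (∑ k, (∑ c, hop M j h c n k) * (∑ c, hop M j h c k m))
            + ((∑ k, if n = k then l * δ n * (∑ c, hop M j h c k m) else 0)
            + ∑ k, if k = m then l * δ k * (∑ c, hop M j h c n k) else 0)
            + ∑ k, (if n = k then (if k = m then δ n * δ k else 0) else 0) := by
            rw [mul_sum, ← sum_add_distrib, ← sum_add_distrib, ← sum_add_distrib]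
            refine sum_congr rfl fun k _ => ?_
            split_ifs <;> ring
        _ = _ := by
            rw [sum_ite_eq, if_pos (mem_univ _), sum_ite_eq',
              if_pos (mem_univ _), sum_ite_eq, if_pos (mem_univ _)]
            have e1 : ∑ k, (∑ c, hop M j h c n k) * (∑ c, hop M j h c k m) = X := by
              rw [hX]
              simp only [sum_mul_sum]
              rw [sum_comm]
              exact sum_congr rfl fun c _ => sum_comm
            have e2 : (if n = m then δ n * δ n else 0) = Z := by rw [hZ]; split_ifs <;> ring
            rw [e1, e2, hY]; ring
    have p1 : (∑ k, ‖A n k‖ * ‖A k m‖) ^ 2 ≤ (l ^ 2 * X + l * Y + Z) ^ 2 :=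
      pow_le_pow_left₀ (sum_nonneg fun _ _ => mul_nonneg (norm_nonneg _) (norm_nonneg _)) s1 2
    have p2 : X ^ 2 ≤ 16 * ∑ c, ∑ d, (∑ k, hop M j h c n k * hop M j h d k m) ^ 2 := by
      refine (sum_four_sq_le _).trans ?_
      have : ∑ c, (∑ d, ∑ k, hop M j h c n k * hop M j h d k m) ^ 2
          ≤ ∑ c, 4 * ∑ d, (∑ k, hop M j h c n k * hop M j h d k m) ^ 2 :=
        sum_le_sum fun c _ => sum_four_sq_le _
      rw [← mul_sum] at this
      linarith
    have p3 : Y ^ 2 ≤ 8 * ∑ c, hop M j h c n m ^ 2 * (δ n ^ 2 + δ m ^ 2) := by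
      rw [hY, mul_pow, ← sum_mul]
      have q1 := sum_four_sq_le fun c => hop M j h c n m
      have q2 : (δ n + δ m) ^ 2 ≤ 2 * (δ n ^ 2 + δ m ^ 2) := by nlinarith [sq_nonneg (δ n - δ m)]
      calc _ ≤ (4 * ∑ c, hop M j h c n m ^ 2) * (2 * (δ n ^ 2 + δ m ^ 2)) :=
            mul_le_mul q1 q2 (sq_nonneg _) (mul_nonneg (by norm_num)
              (sum_nonneg fun _ _ => sq_nonneg _))
        _ = _ := by ring
    have p4 : Z ^ 2 = if n = m then δ n ^ 4 else 0 := by rw [hZ]; split_ifs <;> ring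
    have p5 : (l ^ 2 * X + l * Y + Z) ^ 2 ≤ 3 * (l ^ 4 * X ^ 2 + l ^ 2 * Y ^ 2 + Z ^ 2) := by
      nlinarith [sq_nonneg (l ^ 2 * X - l * Y), sq_nonneg (l ^ 2 * X - Z), sq_nonneg (l * Y - Z)]
    have p6 := mul_le_mul_of_nonneg_left p2 (by positivity : 0 ≤ l ^ 4)
    have p7 := mul_le_mul_of_nonneg_left p3 (by positivity : 0 ≤ l ^ 2)
    rw [← p4]
    linarith
  have e1 : (∑ c, ∑ d, ∑ n, ∑ m,
        if Slice M j n then (∑ k, hop M j h c n k * hop M j h d k m) ^ 2 else 0)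
      = ∑ n, ∑ m, if Slice M j n then
        ∑ c, ∑ d, (∑ k, hop M j h c n k * hop M j h d k m) ^ 2 else 0 := by
    have : ∀ c, (∑ d, ∑ n, ∑ m,
        if Slice M j n then (∑ k, hop M j h c n k * hop M j h d k m) ^ 2 else 0)
        = ∑ n, ∑ m, ∑ d, if Slice M j n then (∑ k, hop M j h c n k * hop M j h d k m) ^ 2 else 0 := by
      intro c
      rw [sum_comm]
      exact sum_congr rfl fun n _ => sum_comm
    simp only [this]
    rw [sum_comm]
    refine sum_congr rfl fun n _ => ?_
    rw [sum_comm]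
    refine sum_congr rfl fun m _ => ?_
    split_ifs <;> simp
  have e2 : (∑ c, ∑ n, ∑ m, if Slice M j n then hop M j h c n m ^ 2 * (δ n ^ 2 + δ m ^ 2) else 0)
      = ∑ n, ∑ m, if Slice M j n then ∑ c, hop M j h c n m ^ 2 * (δ n ^ 2 + δ m ^ 2) else 0 := by
    rw [sum_comm]
    refine sum_congr rfl fun n _ => ?_
    rw [sum_comm]
    refine sum_congr rfl fun m _ => ?_
    split_ifs <;> simp
  have e3 : (∑ n, if Slice M j n then δ n ^ 4 else 0)
      = ∑ n, ∑ m, if Slice M j n then (if n = m then δ n ^ 4 else 0) else 0 := by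
    refine sum_congr rfl fun n _ => ?_
    split_ifs <;> simp
  rw [e1, e2, e3]
  simp only [mul_sum]
  rw [← sum_add_distrib, ← sum_add_distrib, quarticSum]
  refine sum_le_sum fun n _ => ?_
  rw [← sum_add_distrib, ← sum_add_distrib]
  refine sum_le_sum fun m _ => ?_
  by_cases hn : Slice M j n
  · simp only [if_pos hn]
    have := key n m
    simp only [mul_sum] at this ⊢
    exact this
  · simp only [if_neg hn]; simp

theorem quadSum_le {S : Op N} {j : ℕ} {h : Fin 4 → Mode N → Mode N → ℝ} {l : ℝ}
    (hS : ∀ n m, ‖S n m‖ ≤ l * ∑ c, hop M j h c n m) {w w' : MultiMode N → ℝ} (hw0 : ∀ n, 0 ≤ w n)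
    (hw : ∀ n, w n ≤ w' n) :
    quadSum (Slice M j) S w ≤ 4 * l ^ 2 * ∑ c, ∑ n, ∑ m,
      if Slice M j n then hop M j h c n m ^ 2 * (w' n + w' m) else 0 := by
  have e2 : (∑ c, ∑ n, ∑ m, if Slice M j n then hop M j h c n m ^ 2 * (w' n + w' m) else 0)
      = ∑ n, ∑ m, if Slice M j n then ∑ c, hop M j h c n m ^ 2 * (w' n + w' m) else 0 := by
    rw [sum_comm]
    refine sum_congr rfl fun n _ => ?_
    rw [sum_comm]
    refine sum_congr rfl fun m _ => ?_
    split_ifs <;> simp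
  rw [e2, mul_sum]
  refine sum_le_sum fun n _ => ?_
  rw [mul_sum]
  refine sum_le_sum fun m _ => ?_
  split_ifs
  · have q1 := pow_le_pow_left₀ (norm_nonneg _) (hS n m) 2
    have q2 := sum_four_sq_le fun c => hop M j h c n m
    have q3 : ‖S n m‖ ^ 2 ≤ l ^ 2 * (4 * ∑ c, hop M j h c n m ^ 2) := by
      rw [mul_pow] at q1
      exact q1.trans (mul_le_mul_of_nonneg_left q2 (sq_nonneg _))
    rw [← sum_mul]
    calc _ ≤ l ^ 2 * (4 * ∑ c, hop M j h c n m ^ 2) * (w' n + w' m) :=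
          mul_le_mul q3 (add_le_add (hw _) (hw _)) (add_nonneg (hw0 _) (hw0 _))
            ((sq_nonneg _).trans q3)
      _ = _ := by ring
  · simp

theorem cubicSum_le {S : Op N} {j : ℕ} {h : Fin 4 → Mode N → Mode N → ℝ} {l : ℝ}
    (hS : ∀ n m, ‖S n m‖ ≤ l * ∑ c, hop M j h c n m) :
    cubicSum (Slice M j) S ≤ l ^ 3 * ∑ c₁, ∑ c₂, ∑ c₃, triple M j h c₁ c₂ c₃ := by
  have e : ∑ c₁, ∑ c₂, ∑ c₃, triple M j h c₁ c₂ c₃ = ∑ n, ∑ m, ∑ k, if Slice M j n then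
      (∑ c, hop M j h c n m) * ((∑ c, hop M j h c m k) * (∑ c, hop M j h c k n)) else 0 := by
    simp only [triple]
    have t3 : ∀ c₁ c₂ : Fin 4, (∑ c₃, ∑ n, ∑ m, ∑ k, if Slice M j n then hop M j h c₁ n m *
        (hop M j h c₂ m k * hop M j h c₃ k n) else 0) = ∑ n, ∑ m, ∑ k, if Slice M j n then
        hop M j h c₁ n m * (hop M j h c₂ m k * ∑ c, hop M j h c k n) else 0 := by
      intro c₁ c₂
      rw [sum_comm]; refine sum_congr rfl fun n _ => ?_
      rw [sum_comm]; refine sum_congr rfl fun m _ => ?_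
      rw [sum_comm]; refine sum_congr rfl fun k _ => ?_
      split_ifs <;> simp [mul_sum]
    simp only [t3]
    have t2 : ∀ c₁ : Fin 4, (∑ c₂, ∑ n, ∑ m, ∑ k, if Slice M j n then hop M j h c₁ n m *
        (hop M j h c₂ m k * ∑ c, hop M j h c k n) else 0) = ∑ n, ∑ m, ∑ k, if Slice M j n then
        hop M j h c₁ n m * ((∑ c, hop M j h c m k) * ∑ c, hop M j h c k n) else 0 := by
      intro c₁
      rw [sum_comm]; refine sum_congr rfl fun n _ => ?_
      rw [sum_comm]; refine sum_congr rfl fun m _ => ?_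
      rw [sum_comm]; refine sum_congr rfl fun k _ => ?_
      split_ifs
      · rw [← mul_sum, ← sum_mul]
      · simp
    simp only [t2]
    rw [sum_comm]; refine sum_congr rfl fun n _ => ?_
    rw [sum_comm]; refine sum_congr rfl fun m _ => ?_
    rw [sum_comm]; refine sum_congr rfl fun k _ => ?_
    split_ifs
    · rw [← sum_mul]
    · simp
  rw [e, mul_sum]
  refine sum_le_sum fun n _ => ?_
  rw [mul_sum]
  refine sum_le_sum fun m _ => ?_
  rw [mul_sum]
  refine sum_le_sum fun k _ => ?_
  split_ifs
  · calc _ ≤ (l * ∑ c, hop M j h c n m) * ((l * ∑ c, hop M j h c m k) * (l * ∑ c, hop M j h c k n)) :=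
        mul_le_mul (hS _ _) (mul_le_mul (hS _ _) (hS _ _) (norm_nonneg _)
          ((norm_nonneg _).trans (hS _ _))) (by positivity) ((norm_nonneg _).trans (hS _ _))
      _ = _ := by ring
  · simp

end Deterministic

section MainBounds

variable {N M : ℕ}

theorem exists_eighth_root (j : ℕ) (n : MultiMode N) : ∃ q : ℝ, 0 ≤ q ∧ q ≤ 1 ∧
    cutProp M j (sqNorm n) = q ^ 8 ∧ cutProp M j (sqNorm n) ^ (1 / 2 : ℝ) = q ^ 4 ∧
    cutProp M j (sqNorm n) ^ (7 / 8 : ℝ) = q ^ 7 ∧ cutProp M j (sqNorm n) ^ (3 / 2 : ℝ) = q ^ 12 ∧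
    cutProp M j (sqNorm n) ^ (2 : ℝ) = q ^ 16 := by
  have h0 := cutProp_nonneg' M j n
  refine ⟨cutProp M j (sqNorm n) ^ (1 / 8 : ℝ), rpow_nonneg h0 _,
    rpow_le_one h0 (cutProp_le_one' _ _ _) (by norm_num), ?_, ?_, ?_, ?_, ?_⟩ <;>
  · rw [← rpow_natCast, ← rpow_mul h0]; norm_num

set_option maxHeartbeats 4000000 in
/-- The deterministic bounds on `V^{≥ 3}_j`. -/
theorem exists_norm_VGe3_le (hM : 2 ≤ M) : ∃ ρ₀ K : ℝ, 0 < ρ₀ ∧ ρ₀ ≤ 1 ∧ 0 < K ∧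
    ∀ ρ : ℝ, 0 < ρ → ρ ≤ ρ₀ → ∀ g ∈ cardioid ρ, ∀ (N j : ℕ) (σ : MatField N),
      (∀ c, (σ c).IsHermitian) →
      (∀ s ∈ Icc (0 : ℝ) 1, ∀ t ∈ Icc (0 : ℝ) 1,
        IsUnit (1 - (t : ℂ) • path (Slice M j) (U M j g σ) s)) ∧
      ‖VGe3 M j g σ‖ ≤ K * ρ ^ (3 / 2 : ℝ) * ((1 + yq ((M : ℝ) ^ j) fun c a b => ‖σ c a b‖) *
        (1 + gq ((M : ℝ) ^ j) fun c a b => ‖σ c a b‖)) ∧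
      ‖VGe3 M j g σ‖ ≤ K * ρ * (((M : ℝ) ^ j) ^ (3 / 2 : ℝ) *
        (1 + yq ((M : ℝ) ^ j) fun c a b => ‖σ c a b‖)) := by
  obtain ⟨κ, hκ, hd⟩ := exists_norm_dFun_le
  obtain ⟨Ks, hKs, Hs⟩ := exists_quartic_same_le hM
  obtain ⟨Kd, hKd, Hd⟩ := exists_quartic_diff_le hM
  obtain ⟨Ke, hKe, He⟩ := exists_edge_fine_le hM
  obtain ⟨Kc, hKc, Hc⟩ := exists_edge_crude_le hM
  obtain ⟨Kt, hKt, Ht⟩ := exists_triple_le hM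
  obtain ⟨Kg, hKg, Hg⟩ := exists_slice_diag_le hM
  obtain ⟨K1, hK1, H1⟩ := exists_slice_sum_le hM (β := 1) (by norm_num)
  obtain ⟨K3, hK3, H3⟩ := exists_slice_sum_le hM (β := 3 / 2) (by norm_num)
  obtain ⟨K2, hK2, H2⟩ := exists_slice_sum_le hM (β := 2) (by norm_num)
  set a := 4 * √Kc with ha
  set b := 2 * κ * √K1 with hb
  set c' := 4 * κ ^ 2 * √K2 with hc'
  have ha0 : 0 ≤ a := by positivity
  have hb0 : 0 ≤ b := by positivity
  have hc0 : 0 ≤ c' := by positivity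
  set KI := 4 * (768 * (Ks + Kd) + 24 * 16 * κ ^ 2 * Ke + 48 * κ ^ 4 * K2) + 64 * Kt + 16 * κ * Ke
    + 16 * κ ^ 2 * Kg + (2 * κ ^ 3 + κ ^ 4) * K2 with hKI
  set KII := 3 * (2 * a ^ 2 + 3 * (a * b) + (a + b) * c') + 32 * κ * Kc + (2 * κ ^ 3 + κ ^ 4) * K3
    with hKII
  have hKI0 : 0 ≤ KI := by positivity
  have hKII0 : 0 ≤ KII := by positivity
  refine ⟨min 1 (1 / (4 * κ)), KI + KII + 1, by positivity, min_le_left _ _, by positivity, ?_⟩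
  intro ρ hρ hρ0 g hg N j σ hσ
  have hρ1 : ρ ≤ 1 := hρ0.trans (min_le_left _ _)
  have hρκ : ρ ≤ 1 / (4 * κ) := hρ0.trans (min_le_right _ _)
  obtain ⟨cs, hcs0, hcs1, hre, hx⟩ := cardioid_lam hρ hg
  set x := ‖lam g‖ with hxdef
  have hx0 : 0 ≤ x := norm_nonneg _
  have hcs2 : cs ^ 2 ≤ cs := pow_le_of_le_one hcs0.le hcs1 two_ne_zero
  have hx2 : x ^ 2 ≤ ρ := hx.trans (mul_le_of_le_one_right hρ.le (pow_le_one₀ hcs0.le hcs1))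
  have hx1 : x ≤ 1 := (sq_le_one_iff₀ hx0).1 (hx2.trans hρ1)
  set h : Fin 4 → Mode N → Mode N → ℝ := fun c a b => ‖σ c a b‖ with hh
  have h0 : ∀ c a b, 0 ≤ h c a b := fun c a b => norm_nonneg _
  have hs : ∀ c a b, h c a b = h c b a := fun c a b => by
    simp only [hh]; rw [← (hσ c).apply a b, norm_star]
  have hR := one_le_scale hM j
  have e1 := H1 N j
  have e2 := H2 N j
  have e3 := H3 N j
  have eg := Hg N j h h0
  have es := Hs N j h
  have ed := Hd N j h
  have ee := He N j h
  have ec := Hc N j h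
  have et := Ht N j h h0 hs
  obtain ⟨R, hRdef⟩ : ∃ R, R = (M : ℝ) ^ j := ⟨_, rfl⟩
  rw [← hRdef] at hR e1 e2 e3 eg es ed ee ec et ⊢
  have hR0 : 0 < R := by linarith
  have hy0 := yq_nonneg h hR
  have hg0 := gq_nonneg h hR
  set y := yq R h with hy
  set gg := gq R h with hgg
  set S := Sig M j g σ with hS
  set d1 := d1Fun (N := N) M j g with hd1
  set d2 := d2Fun (N := N) M j g with hd2
  have hSs : ∀ n m, ‖S n m‖ = ‖S m n‖ := norm_Sig_symm j g hσ
  have hSl : ∀ n m, ‖S n m‖ ≤ x * ∑ c, hop M j h c n m := norm_Sig_le j g σ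
  -- bounds on the diagonal entries
  set δ : MultiMode N → ℝ := fun n => 2 * κ * x ^ 2 * cutProp M j (sqNorm n) ^ (1 / 2 : ℝ) with hδ
  have x42 : x ^ 4 ≤ x ^ 2 := pow_le_pow_of_le_one hx0 hx1 (by norm_num)
  have hδ0 : ∀ n, 0 ≤ δ n := fun n =>
    mul_nonneg (by positivity) (rpow_nonneg (cutProp_nonneg' _ _ _) _)
  have hdδ : ∀ n, ‖d1 n + d2 n‖ ≤ δ n := fun n => by
    obtain ⟨q, q0, q1, -, r2, r3, -, -⟩ := exists_eighth_root (M := M) j n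
    obtain ⟨u1, u2⟩ := hd N M j g n
    simp only [hδ]
    rw [r2] at u1 ⊢
    rw [r3] at u2
    refine (norm_add_le _ _).trans ((add_le_add u1 u2).trans ?_)
    have v1 : q ^ 7 ≤ q ^ 4 := pow_le_pow_of_le_one q0 q1 (by norm_num)
    have v2 : κ * x ^ 4 * q ^ 7 ≤ κ * x ^ 2 * q ^ 4 := by gcongr
    linarith
  have hδcs : ∀ n, ‖d1 n + d2 n‖ ≤ cs / 2 := fun n => by
    refine (hdδ n).trans ?_
    have v1 : cutProp M j (sqNorm n) ^ (1 / 2 : ℝ) ≤ 1 :=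
      rpow_le_one (cutProp_nonneg' _ _ _) (cutProp_le_one' _ _ _) (by norm_num)
    have v2 : 2 * κ * x ^ 2 ≤ cs / 2 := by
      have : κ * x ^ 2 ≤ κ * (1 / (4 * κ) * cs) := by
        refine mul_le_mul_of_nonneg_left (hx.trans ?_) hκ.le
        exact mul_le_mul hρκ hcs2 (by positivity) (by positivity)
      have e : κ * (1 / (4 * κ) * cs) = cs / 4 := by field_simp
      linarith
    exact (mul_le_of_le_one_right (by positivity) v1).trans v2
  have hu : ∀ s ∈ Icc (0 : ℝ) 1, ∀ t ∈ Icc (0 : ℝ) 1,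
      IsUnit (1 - (t : ℂ) • path (Slice M j) (S + diagonal (fun n => d1 n + d2 n)) s) ∧
      OpBound (1 - (t : ℂ) • path (Slice M j) (S + diagonal (fun n => d1 n + d2 n)) s)⁻¹
        (2 / cs) := fun s hs' t ht =>
    isUnit_and_opBound_path (sqrtC_sigmaOp_isHermitian j hσ) hcs0 hcs1 hre hδcs hs' ht
  have hUeq : U M j g σ = S + diagonal (fun n => d1 n + d2 n) := by
    rw [U, D1_eq, D2_eq, add_assoc, diagonal_add]
  have hVeq := VGe3_eq hM j g σ
  rw [hUeq, hVeq]
  refine ⟨fun s hs' t ht => (hu s hs' t ht).1, ?_, ?_⟩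
  · -- fine bound
    have hfine := norm_vAbs_sub_le_fine (sl := Slice M j) hSs d1 d2 (by positivity) hu
    refine hfine.trans ?_
    set W := (1 + y) * (1 + gg) with hW
    have yg0 : 0 ≤ y * gg := mul_nonneg hy0 hg0
    have hW1 : 1 ≤ W := by rw [hW]; linarith
    have hWy : y ≤ W := by rw [hW]; linarith
    have hWyg : y * gg ≤ W := by rw [hW]; linarith
    have hWy1g : y * (1 + gg) ≤ W := by rw [hW]; linarith
    have hWg : 1 + gg ≤ W := by rw [hW]; linarith
    set r := ρ ^ (3 / 2 : ℝ) with hr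
    have hr0 : 0 ≤ r := by positivity
    have hx3 : x ^ 3 ≤ r := by
      have : x ^ 3 = (x ^ 2) ^ (3 / 2 : ℝ) := by rw [← rpow_natCast x 2, ← rpow_mul hx0]; norm_num
      rw [this]
      exact rpow_le_rpow (by positivity) hx2 (by norm_num)
    have hx4 : x ^ 4 / cs ≤ r := by
      rw [div_le_iff₀ hcs0]
      have h2 : ρ ^ 2 ≤ r := by
        rw [hr, ← rpow_natCast]
        exact rpow_le_rpow_of_exponent_ge hρ hρ1 (by norm_num)
      calc x ^ 4 = (x ^ 2) * (x ^ 2) := by ring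
        _ ≤ ρ * (ρ * cs ^ 2) := mul_le_mul hx2 hx (by positivity) hρ.le
        _ ≤ ρ * (ρ * cs) := by gcongr
        _ = ρ ^ 2 * cs := by ring
        _ ≤ r * cs := by gcongr
    have xk : ∀ k : ℕ, 3 ≤ k → x ^ k ≤ r := fun k hk => (pow_le_pow_of_le_one hx0 hx1 hk).trans hx3
    have s2 : ∑ n : MultiMode N, (if Slice M j n then cutProp M j (sqNorm n) ^ (2 : ℝ) else 0) ≤ K2 := by
      refine e2.trans (le_of_eq ?_); norm_num
    have s2' : 0 ≤ ∑ n : MultiMode N, (if Slice M j n then cutProp M j (sqNorm n) ^ (2 : ℝ) else 0) :=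
      sum_nonneg fun n _ => by
        split_ifs
        · exact rpow_nonneg (cutProp_nonneg' _ _ _) _
        · exact le_rfl
    -- quartic part
    have t1 : 2 * (2 / cs) * quarticSum (Slice M j) (S + diagonal (fun n => d1 n + d2 n))
        ≤ 4 * (768 * (Ks + Kd) + 24 * 16 * κ ^ 2 * Ke + 48 * κ ^ 4 * K2) * (r * W) := by
      have hA : ∀ n m, ‖(S + diagonal (fun n => d1 n + d2 n)) n m‖
          ≤ x * (∑ c, hop M j h c n m) + if n = m then δ n else 0 := fun n m => by
        rw [Matrix.add_apply]
        refine (norm_add_le _ _).trans (add_le_add (hSl n m) ?_)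
        by_cases hnm : n = m
        · subst hnm; rw [diagonal_apply_eq, if_pos rfl]; exact hdδ n
        · rw [diagonal_apply_ne _ hnm, if_neg hnm, norm_zero]
      have hq := quarticSum_le h0 hx0 hδ0 hA
      have q1 : (∑ c, ∑ d, ∑ n, ∑ m,
          if Slice M j n then (∑ k, hop M j h c n k * hop M j h d k m) ^ 2 else 0)
          ≤ 16 * ((Ks + Kd) * W) := by
        have : ∀ c d : Fin 4, (∑ n, ∑ m,
            if Slice M j n then (∑ k, hop M j h c n k * hop M j h d k m) ^ 2 else 0)
            ≤ (Ks + Kd) * W := by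
          intro c d
          by_cases hcd : c = d
          · subst hcd
            refine (es c).trans ?_
            calc Ks * (y * gg) ≤ Ks * W := by gcongr
              _ ≤ _ := by rw [add_mul]; linarith [mul_nonneg hKd.le (by linarith : 0 ≤ W)]
          · refine (ed c d hcd).trans ?_
            calc Kd * (y * gg) ≤ Kd * W := by gcongr
              _ ≤ _ := by rw [add_mul]; linarith [mul_nonneg hKs.le (by linarith : 0 ≤ W)]
        calc _ ≤ ∑ _c : Fin 4, ∑ _d : Fin 4, (Ks + Kd) * W :=
              sum_le_sum fun c _ => sum_le_sum fun d _ => this c d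
          _ = _ := by simp; ring
      have q2 : (∑ c, ∑ n, ∑ m,
          if Slice M j n then hop M j h c n m ^ 2 * (δ n ^ 2 + δ m ^ 2) else 0)
          ≤ 16 * κ ^ 2 * x ^ 4 * (Ke * W) := by
        have hδ2 : ∀ n, δ n ^ 2 ≤ 4 * κ ^ 2 * x ^ 4 * cutProp M j (sqNorm n) ^ (1 / 2 : ℝ) := fun n => by
          obtain ⟨q, q0, q1, -, r2, r3, -, -⟩ := exists_eighth_root (M := M) j n
          simp only [hδ]
          rw [r2]
          have v1 : q ^ 8 ≤ q ^ 4 := pow_le_pow_of_le_one q0 q1 (by norm_num)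
          calc _ = 4 * κ ^ 2 * x ^ 4 * q ^ 8 := by ring
            _ ≤ _ := by gcongr
        have : ∀ c : Fin 4, (∑ n, ∑ m,
            if Slice M j n then hop M j h c n m ^ 2 * (δ n ^ 2 + δ m ^ 2) else 0)
            ≤ 4 * κ ^ 2 * x ^ 4 * (Ke * W) := by
          intro c
          calc _ ≤ 4 * κ ^ 2 * x ^ 4 * ∑ n, ∑ m, (if Slice M j n then hop M j h c n m ^ 2 *
                (cutProp M j (sqNorm n) ^ (1 / 2 : ℝ) + cutProp M j (sqNorm m) ^ (1 / 2 : ℝ)) else 0) := by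
                rw [mul_sum]
                refine sum_le_sum fun n _ => ?_
                rw [mul_sum]
                refine sum_le_sum fun m _ => ?_
                split_ifs
                · have := mul_le_mul_of_nonneg_left (add_le_add (hδ2 n) (hδ2 m))
                    (sq_nonneg (hop M j h c n m))
                  linarith
                · simp
            _ ≤ 4 * κ ^ 2 * x ^ 4 * (Ke * W) := by
                refine mul_le_mul_of_nonneg_left ((ee c).trans ?_) (by positivity)
                gcongr
        calc _ ≤ ∑ _c : Fin 4, 4 * κ ^ 2 * x ^ 4 * (Ke * W) := sum_le_sum fun c _ => this c
          _ = _ := by simp; ring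
      have q3 : (∑ n, if Slice M j n then δ n ^ 4 else 0) ≤ 16 * κ ^ 4 * x ^ 8 * K2 := by
        refine le_trans ?_ (mul_le_mul_of_nonneg_left s2 (by positivity))
        rw [mul_sum]
        refine sum_le_sum fun n _ => ?_
        split_ifs
        · obtain ⟨q, q0, q1, -, r2, -, -, r5⟩ := exists_eighth_root (M := M) j n
          simp only [hδ]
          rw [r2, r5]
          exact le_of_eq (by ring)
        · simp
      have hq' : quarticSum (Slice M j) (S + diagonal (fun n => d1 n + d2 n))
          ≤ x ^ 4 * ((768 * (Ks + Kd) + 24 * 16 * κ ^ 2 * Ke + 48 * κ ^ 4 * K2) * W) := by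
        have w1 := mul_le_mul_of_nonneg_left q1 (by positivity : 0 ≤ 48 * x ^ 4)
        have w2 := mul_le_mul_of_nonneg_left q2 (by positivity : 0 ≤ 24 * x ^ 2)
        have w2' : 24 * x ^ 2 * (16 * κ ^ 2 * x ^ 4 * (Ke * W)) ≤ 24 * 16 * κ ^ 2 * x ^ 4 * (Ke * W) := by
          have : x ^ 2 * (24 * 16 * κ ^ 2 * x ^ 4 * (Ke * W)) ≤ 24 * 16 * κ ^ 2 * x ^ 4 * (Ke * W) :=
            mul_le_of_le_one_left (by positivity) (pow_le_one₀ hx0 hx1)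
          linarith
        have w3 : 3 * (16 * κ ^ 4 * x ^ 8 * K2) ≤ 48 * κ ^ 4 * x ^ 4 * (K2 * W) := by
          have : x ^ 8 ≤ x ^ 4 := pow_le_pow_of_le_one hx0 hx1 (by norm_num)
          calc _ = 48 * κ ^ 4 * x ^ 8 * (K2 * 1) := by ring
            _ ≤ _ := by gcongr
        linarith
      calc _ ≤ 2 * (2 / cs) *
            (x ^ 4 * ((768 * (Ks + Kd) + 24 * 16 * κ ^ 2 * Ke + 48 * κ ^ 4 * K2) * W)) :=
            mul_le_mul_of_nonneg_left hq' (by positivity)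
        _ = x ^ 4 / cs * (4 * (768 * (Ks + Kd) + 24 * 16 * κ ^ 2 * Ke + 48 * κ ^ 4 * K2) * W) := by
            field_simp; ring
        _ ≤ r * (4 * (768 * (Ks + Kd) + 24 * 16 * κ ^ 2 * Ke + 48 * κ ^ 4 * K2) * W) := by gcongr
        _ = _ := by ring
    have t2 : cubicSum (Slice M j) S ≤ 64 * Kt * (r * W) := by
      refine (cubicSum_le hSl).trans ?_
      have : ∑ c₁, ∑ c₂, ∑ c₃, triple M j h c₁ c₂ c₃ ≤ 64 * (Kt * W) := by
        calc _ ≤ ∑ _c₁ : Fin 4, ∑ _c₂ : Fin 4, ∑ _c₃ : Fin 4, Kt * W :=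
              sum_le_sum fun c₁ _ => sum_le_sum fun c₂ _ => sum_le_sum fun c₃ _ =>
                (et c₁ c₂ c₃).trans (by gcongr)
          _ = _ := by simp; ring
      calc _ ≤ x ^ 3 * (64 * (Kt * W)) := mul_le_mul_of_nonneg_left this (by positivity)
        _ ≤ r * (64 * (Kt * W)) := by gcongr
        _ = _ := by ring
    have t3 : quadSum (Slice M j) S (fun n => ‖d2 n‖) ≤ 16 * κ * Ke * (r * W) := by
      have hw : ∀ n, ‖d2 n‖ ≤ κ * x ^ 4 * cutProp M j (sqNorm n) ^ (1 / 2 : ℝ) := fun n => by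
        obtain ⟨q, q0, q1, -, r2, r3, -, -⟩ := exists_eighth_root (M := M) j n
        have u2 := (hd N M j g n).2
        rw [r3] at u2
        rw [r2]
        have v1 : q ^ 7 ≤ q ^ 4 := pow_le_pow_of_le_one q0 q1 (by norm_num)
        exact u2.trans (by gcongr)
      refine (quadSum_le hSl (fun n => norm_nonneg _) hw).trans ?_
      have : ∀ c : Fin 4, (∑ n, ∑ m, if Slice M j n then hop M j h c n m ^ 2 *
          (κ * x ^ 4 * cutProp M j (sqNorm n) ^ (1 / 2 : ℝ) +
            κ * x ^ 4 * cutProp M j (sqNorm m) ^ (1 / 2 : ℝ)) else 0) ≤ κ * x ^ 4 * (Ke * W) := by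
        intro c
        calc _ = κ * x ^ 4 * ∑ n, ∑ m, (if Slice M j n then hop M j h c n m ^ 2 *
                (cutProp M j (sqNorm n) ^ (1 / 2 : ℝ) + cutProp M j (sqNorm m) ^ (1 / 2 : ℝ)) else 0) := by
                rw [mul_sum]
                refine sum_congr rfl fun n _ => ?_
                rw [mul_sum]
                refine sum_congr rfl fun m _ => ?_
                split_ifs <;> ring
          _ ≤ _ := mul_le_mul_of_nonneg_left ((ee c).trans (by gcongr)) (by positivity)
      calc _ ≤ 4 * x ^ 2 * ∑ _c : Fin 4, κ * x ^ 4 * (Ke * W) :=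
            mul_le_mul_of_nonneg_left (sum_le_sum fun c _ => this c) (by positivity)
        _ = x ^ 6 * (16 * κ * Ke * W) := by simp; ring
        _ ≤ r * (16 * κ * Ke * W) := by gcongr; exact xk 6 (by norm_num)
        _ = _ := by ring
    have t4 : (∑ n, if Slice M j n then ‖S n n‖ * ‖d1 n + d2 n‖ ^ 2 else 0)
        ≤ 16 * κ ^ 2 * Kg * (r * W) := by
      calc _ ≤ ∑ n, ∑ c, 4 * κ ^ 2 * x ^ 5 *
            (if Slice M j n then hop M j h c n n * cutProp M j (sqNorm n) else 0) := by
            refine sum_le_sum fun n _ => ?_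
            rw [← mul_sum]
            split_ifs
            · obtain ⟨q, q0, q1, r1, r2, -, -, -⟩ := exists_eighth_root (M := M) j n
              have v1 := pow_le_pow_left₀ (norm_nonneg _) (hdδ n) 2
              simp only [hδ] at v1
              rw [r2] at v1
              calc _ ≤ x * (∑ c, hop M j h c n n) * (2 * κ * x ^ 2 * q ^ 4) ^ 2 :=
                    mul_le_mul (hSl n n) v1 (by positivity) ((norm_nonneg _).trans (hSl n n))
                _ = 4 * κ ^ 2 * x ^ 5 * ((∑ c, hop M j h c n n) * q ^ 8) := by ring
                _ = _ := by rw [r1, sum_mul]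
            · simp
        _ = 4 * κ ^ 2 * x ^ 5 * ∑ c, ∑ n,
            (if Slice M j n then hop M j h c n n * cutProp M j (sqNorm n) else 0) := by
            rw [sum_comm]; simp only [mul_sum]
        _ ≤ 4 * κ ^ 2 * x ^ 5 * ∑ _c : Fin 4, Kg * W :=
            mul_le_mul_of_nonneg_left (sum_le_sum fun c _ => (eg c).trans (by gcongr))
              (by positivity)
        _ = x ^ 5 * (16 * κ ^ 2 * Kg * W) := by simp; ring
        _ ≤ r * (16 * κ ^ 2 * Kg * W) := by gcongr; exact xk 5 (by norm_num)
        _ = _ := by ring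
    have t5 : (∑ n, if Slice M j n then ‖d1 n‖ * ‖d2 n‖ ^ 2 + ‖d2 n‖ ^ 3 + ‖d1 n‖ ^ 4 else 0)
        ≤ (2 * κ ^ 3 + κ ^ 4) * K2 * (r * W) := by
      calc _ ≤ (2 * κ ^ 3 + κ ^ 4) * r * ∑ n : MultiMode N,
            (if Slice M j n then cutProp M j (sqNorm n) ^ (2 : ℝ) else 0) := by
            rw [mul_sum]
            refine sum_le_sum fun n _ => ?_
            split_ifs
            · obtain ⟨q, q0, q1, -, r2, r3, -, r5⟩ := exists_eighth_root (M := M) j n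
              obtain ⟨u1, u2⟩ := hd N M j g n
              rw [r2] at u1
              rw [r3] at u2
              rw [r5]
              have qk : ∀ k : ℕ, 16 ≤ k → q ^ k ≤ q ^ 16 := fun k hk => pow_le_pow_of_le_one q0 q1 hk
              have w1 : ‖d1 n‖ * ‖d2 n‖ ^ 2 ≤ κ ^ 3 * r * q ^ 16 := by
                calc _ ≤ (κ * x ^ 2 * q ^ 4) * (κ * x ^ 4 * q ^ 7) ^ 2 :=
                      mul_le_mul u1 (pow_le_pow_left₀ (norm_nonneg _) u2 2) (by positivity)
                        (by positivity)
                  _ = κ ^ 3 * x ^ 10 * q ^ 18 := by ring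
                  _ ≤ _ := by
                    have := qk 18 (by norm_num); have := xk 10 (by norm_num)
                    gcongr
              have w2 : ‖d2 n‖ ^ 3 ≤ κ ^ 3 * r * q ^ 16 := by
                calc _ ≤ (κ * x ^ 4 * q ^ 7) ^ 3 := pow_le_pow_left₀ (norm_nonneg _) u2 3
                  _ = κ ^ 3 * x ^ 12 * q ^ 21 := by ring
                  _ ≤ _ := by
                    have := qk 21 (by norm_num); have := xk 12 (by norm_num)
                    gcongr
              have w3 : ‖d1 n‖ ^ 4 ≤ κ ^ 4 * r * q ^ 16 := by
                calc _ ≤ (κ * x ^ 2 * q ^ 4) ^ 4 := pow_le_pow_left₀ (norm_nonneg _) u1 4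
                  _ = κ ^ 4 * x ^ 8 * q ^ 16 := by ring
                  _ ≤ _ := by
                    have := xk 8 (by norm_num)
                    gcongr
              linarith
            · simp
        _ ≤ (2 * κ ^ 3 + κ ^ 4) * r * (K2 * W) := by
            refine mul_le_mul_of_nonneg_left (s2.trans ?_) (by positivity)
            exact le_mul_of_one_le_right hK2.le hW1
        _ = _ := by ring
    have hsum := add_le_add (add_le_add (add_le_add (add_le_add t1 t2) t3) t4) t5
    refine hsum.trans ?_
    have hrW : 0 ≤ r * W := by positivity
    calc _ = KI * (r * W) := by rw [hKI]; ring
      _ ≤ (KI + KII + 1) * (r * W) := by gcongr; linarith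
      _ = _ := by ring
  · -- crude bound
    set P := R ^ (3 / 2 : ℝ) * (1 + y) with hP
    have hRR : R ≤ R ^ (3 / 2 : ℝ) := by
      conv_lhs => rw [← rpow_one R]
      exact rpow_le_rpow_of_exponent_le hR (by norm_num)
    have hR32 : R ^ (3 / 2 : ℝ) = √R * R := by rw [sqrt_eq_rpow, ← rpow_add_one hR0.ne']; norm_num
    have hsy : √y ≤ 1 + y :=
      sqrt_le_iff.2 ⟨by linarith, by linarith only [hy0, sq_nonneg y]⟩
    have hsR : √R ≤ R := sqrt_le_iff.2 ⟨hR0.le, le_self_pow₀ hR two_ne_zero⟩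
    have hP1 : R ≤ P := hRR.trans (le_mul_of_one_le_right (by positivity) (by linarith))
    have hP2 : R * y ≤ P := by rw [hP]; exact mul_le_mul hRR (by linarith) hy0 (by positivity)
    have hP3 : √R * R * √y ≤ P := by rw [hP, hR32]; gcongr
    have hP4 : √R * √y ≤ P := by
      refine le_trans ?_ hP3
      have : 1 * (√R * √y) ≤ R * (√R * √y) := by gcongr
      linarith
    have hP0 : 0 ≤ P := by linarith
    have sH : ∀ c : Fin 4, ∑ n, ∑ m, (if Slice M j n then hop M j h c n m ^ 2 else 0) ≤ Kc * (R * y) := ec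
    have fS : √(fro (proj (Slice M j) * S)) ≤ x * a * √R * √y := by
      rw [sqrt_le_left (by positivity)]
      have e : (x * a * √R * √y) ^ 2 = 16 * x ^ 2 * (Kc * (R * y)) := by
        have : (x * a * √R * √y) ^ 2 = x ^ 2 * (16 * (√Kc) ^ 2) * (√R) ^ 2 * (√y) ^ 2 := by
          rw [ha]; ring
        rw [this, sq_sqrt hKc.le, sq_sqrt hR0.le, sq_sqrt hy0]; ring
      rw [e]
      calc fro (proj (Slice M j) * S) ≤ ∑ n, ∑ m, 4 * x ^ 2 *
            ∑ c, (if Slice M j n then hop M j h c n m ^ 2 else 0) := by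
            refine sum_le_sum fun n _ => sum_le_sum fun m _ => ?_
            rw [proj_mul_apply]
            split_ifs
            · have q1 := pow_le_pow_left₀ (norm_nonneg _) (hSl n m) 2
              have q2 := sum_four_sq_le fun c => hop M j h c n m
              rw [mul_pow] at q1
              have := mul_le_mul_of_nonneg_left q2 (sq_nonneg x)
              linarith
            · simp
        _ = 4 * x ^ 2 * ∑ c, ∑ n, ∑ m, (if Slice M j n then hop M j h c n m ^ 2 else 0) := by
            simp only [← mul_sum]
            congr 1
            rw [sum_comm (s := (univ : Finset (Fin 4)))]
            refine sum_congr rfl fun n _ => ?_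
            rw [sum_comm]
        _ ≤ 4 * x ^ 2 * ∑ _c : Fin 4, Kc * (R * y) :=
            mul_le_mul_of_nonneg_left (sum_le_sum fun c _ => sH c) (by positivity)
        _ = _ := by simp; ring
    have froD : ∀ f : MultiMode N → ℂ, fro (proj (Slice M j) * diagonal f)
        = ∑ n, if Slice M j n then ‖f n‖ ^ 2 else 0 := fun f => by
      refine sum_congr rfl fun n _ => ?_
      rw [sum_eq_single n (fun m _ hm => by
        rw [proj_mul_apply, diagonal_apply_ne _ hm.symm]; simp) (by simp), proj_mul_apply,
        diagonal_apply_eq]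
      split_ifs <;> simp
    have fD : √(fro (proj (Slice M j) * diagonal (fun n => d1 n + d2 n))) ≤ x ^ 2 * b * R := by
      rw [sqrt_le_left (by positivity), froD]
      have e : (x ^ 2 * b * R) ^ 2 = 4 * κ ^ 2 * x ^ 4 * (K1 * R ^ (4 - 2 * 1 : ℝ)) := by
        have : (x ^ 2 * b * R) ^ 2 = 4 * κ ^ 2 * x ^ 4 * ((√K1) ^ 2 * R ^ 2) := by rw [hb]; ring
        rw [this, sq_sqrt hK1.le, show (4 - 2 * 1 : ℝ) = 2 by norm_num, rpow_two]
      rw [e]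
      refine le_trans ?_ (mul_le_mul_of_nonneg_left e1 (by positivity))
      rw [mul_sum]
      refine sum_le_sum fun n _ => ?_
      split_ifs
      · obtain ⟨q, q0, q1, r1, r2, -, -, -⟩ := exists_eighth_root (M := M) j n
        have v1 := pow_le_pow_left₀ (norm_nonneg _) (hdδ n) 2
        simp only [hδ] at v1
        rw [r2] at v1
        rw [rpow_one, r1]
        exact v1.trans (le_of_eq (by ring))
      · simp
    have fDD : √(fro (proj (Slice M j) * (diagonal (fun n => d1 n + d2 n) *
        diagonal (fun n => d1 n + d2 n)))) ≤ x ^ 2 * c' := by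
      rw [sqrt_le_left (by positivity), diagonal_mul_diagonal, froD]
      have e : (x ^ 2 * c') ^ 2 = 16 * κ ^ 4 * x ^ 4 * (K2 * R ^ (4 - 2 * 2 : ℝ)) := by
        have : (x ^ 2 * c') ^ 2 = 16 * κ ^ 4 * x ^ 4 * (√K2) ^ 2 := by rw [hc']; ring
        rw [this, sq_sqrt hK2.le, show (4 - 2 * 2 : ℝ) = 0 by norm_num, rpow_zero, mul_one]
      rw [e]
      refine le_trans ?_ (mul_le_mul_of_nonneg_left e2 (by positivity))
      rw [mul_sum]
      refine sum_le_sum fun n _ => ?_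
      split_ifs
      · obtain ⟨q, q0, q1, r1, r2, -, -, r5⟩ := exists_eighth_root (M := M) j n
        have v1 := pow_le_pow_left₀ (norm_nonneg _) (hdδ n) 4
        simp only [hδ] at v1
        rw [r2] at v1
        rw [r5, norm_mul]
        have : x ^ 8 ≤ x ^ 4 := pow_le_pow_of_le_one hx0 hx1 (by norm_num)
        calc _ = ‖d1 n + d2 n‖ ^ 4 := by ring
          _ ≤ _ := v1
          _ = 16 * κ ^ 4 * x ^ 8 * q ^ 16 := by ring
          _ ≤ _ := by gcongr
      · simp
    have hcr := norm_vAbs_sub_le_crude (sl := Slice M j) hSs d1 d2 (by positivity) hu fS fD fDD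
    refine hcr.trans ?_
    have t1 : (2 / cs + 1) * (2 * (x * a * √R * √y) ^ 2 + 3 * (x * a * √R * √y * (x ^ 2 * b * R))
        + (x * a * √R * √y + x ^ 2 * b * R) * (x ^ 2 * c'))
        ≤ 3 * (2 * a ^ 2 + 3 * (a * b) + (a + b) * c') * (ρ * P) := by
      have x3 : x ^ 3 ≤ x ^ 2 := pow_le_pow_of_le_one hx0 hx1 (by norm_num)
      have v1 : 2 * (x * a * √R * √y) ^ 2 = x ^ 2 * (2 * a ^ 2 * (R * y)) := by
        have : 2 * (x * a * √R * √y) ^ 2 = x ^ 2 * (2 * a ^ 2 * ((√R) ^ 2 * (√y) ^ 2)) := by ring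
        rw [this, sq_sqrt hR0.le, sq_sqrt hy0]
      have v2 : 3 * (x * a * √R * √y * (x ^ 2 * b * R)) ≤ x ^ 2 * (3 * (a * b) * (√R * R * √y)) := by
        calc _ = x ^ 3 * (3 * (a * b) * (√R * R * √y)) := by ring
          _ ≤ _ := by gcongr
      have v3 : (x * a * √R * √y + x ^ 2 * b * R) * (x ^ 2 * c')
          ≤ x ^ 2 * (a * c' * (√R * √y) + b * c' * R) := by
        calc _ = x ^ 3 * (a * c' * (√R * √y)) + x ^ 4 * (b * c' * R) := by ring
          _ ≤ x ^ 2 * (a * c' * (√R * √y)) + x ^ 2 * (b * c' * R) := by gcongr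
          _ = _ := by ring
      have v4 : 2 * (x * a * √R * √y) ^ 2 + 3 * (x * a * √R * √y * (x ^ 2 * b * R))
          + (x * a * √R * √y + x ^ 2 * b * R) * (x ^ 2 * c')
          ≤ x ^ 2 * ((2 * a ^ 2 + 3 * (a * b) + (a + b) * c') * P) := by
        calc _ ≤ x ^ 2 * (2 * a ^ 2 * (R * y)) + x ^ 2 * (3 * (a * b) * (√R * R * √y))
              + x ^ 2 * (a * c' * (√R * √y) + b * c' * R) := by
              rw [v1]; exact add_le_add (add_le_add le_rfl v2) v3
          _ ≤ x ^ 2 * (2 * a ^ 2 * P) + x ^ 2 * (3 * (a * b) * P)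
              + x ^ 2 * (a * c' * P + b * c' * P) := by gcongr
          _ = _ := by ring
      have v5 : (2 / cs + 1) * x ^ 2 ≤ 3 * ρ := by
        have : 2 / cs + 1 ≤ 3 / cs := by rw [div_add_one hcs0.ne']; gcongr; linarith
        calc _ ≤ 3 / cs * (ρ * cs ^ 2) := mul_le_mul this hx (by positivity) (by positivity)
          _ = 3 * ρ * cs := by field_simp
          _ ≤ 3 * ρ := mul_le_of_le_one_right (by positivity) hcs1
      calc _ ≤ (2 / cs + 1) * (x ^ 2 * ((2 * a ^ 2 + 3 * (a * b) + (a + b) * c') * P)) :=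
            mul_le_mul_of_nonneg_left v4 (by positivity)
        _ = (2 / cs + 1) * x ^ 2 * ((2 * a ^ 2 + 3 * (a * b) + (a + b) * c') * P) := by ring
        _ ≤ 3 * ρ * ((2 * a ^ 2 + 3 * (a * b) + (a + b) * c') * P) := by gcongr
        _ = _ := by ring
    have t2 : quadSum (Slice M j) S (fun n => ‖d1 n‖) ≤ 32 * κ * Kc * (ρ * P) := by
      have hw : ∀ n, ‖d1 n‖ ≤ κ * x ^ 2 := fun n => (hd N M j g n).1.trans
        (mul_le_of_le_one_right (by positivity)
          (rpow_le_one (cutProp_nonneg' _ _ _) (cutProp_le_one' _ _ _) (by norm_num)))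
      refine (quadSum_le hSl (fun n => norm_nonneg _) hw).trans ?_
      have : ∀ c : Fin 4, (∑ n, ∑ m, if Slice M j n then hop M j h c n m ^ 2 *
          (κ * x ^ 2 + κ * x ^ 2) else 0) ≤ 2 * κ * x ^ 2 * (Kc * P) := by
        intro c
        calc _ = 2 * κ * x ^ 2 * ∑ n, ∑ m, (if Slice M j n then hop M j h c n m ^ 2 else 0) := by
                rw [mul_sum]
                refine sum_congr rfl fun n _ => ?_
                rw [mul_sum]
                refine sum_congr rfl fun m _ => ?_
                split_ifs <;> ring
          _ ≤ _ := mul_le_mul_of_nonneg_left ((sH c).trans (by gcongr)) (by positivity)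
      calc _ ≤ 4 * x ^ 2 * ∑ _c : Fin 4, 2 * κ * x ^ 2 * (Kc * P) :=
            mul_le_mul_of_nonneg_left (sum_le_sum fun c _ => this c) (by positivity)
        _ = x ^ 4 * (32 * κ * Kc * P) := by simp; ring
        _ ≤ ρ * (32 * κ * Kc * P) := by
            have := x42.trans hx2
            gcongr
        _ = _ := by ring
    have t3 : (∑ n, if Slice M j n then ‖d1 n‖ ^ 3 + ‖d1 n‖ ^ 2 * ‖d2 n‖ + ‖d1 n‖ ^ 4 else 0)
        ≤ (2 * κ ^ 3 + κ ^ 4) * K3 * (ρ * P) := by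
      have xk : ∀ k : ℕ, 2 ≤ k → x ^ k ≤ ρ := fun k hk => (pow_le_pow_of_le_one hx0 hx1 hk).trans hx2
      calc _ ≤ (2 * κ ^ 3 + κ ^ 4) * ρ * ∑ n : MultiMode N,
            (if Slice M j n then cutProp M j (sqNorm n) ^ (3 / 2 : ℝ) else 0) := by
            rw [mul_sum]
            refine sum_le_sum fun n _ => ?_
            split_ifs
            · obtain ⟨q, q0, q1, -, r2, r3, r4, -⟩ := exists_eighth_root (M := M) j n
              obtain ⟨u1, u2⟩ := hd N M j g n
              rw [r2] at u1
              rw [r3] at u2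
              rw [r4]
              have qk : ∀ k : ℕ, 12 ≤ k → q ^ k ≤ q ^ 12 := fun k hk => pow_le_pow_of_le_one q0 q1 hk
              have w1 : ‖d1 n‖ ^ 2 * ‖d2 n‖ ≤ κ ^ 3 * ρ * q ^ 12 := by
                calc _ ≤ (κ * x ^ 2 * q ^ 4) ^ 2 * (κ * x ^ 4 * q ^ 7) :=
                      mul_le_mul (pow_le_pow_left₀ (norm_nonneg _) u1 2) u2 (by positivity)
                        (by positivity)
                  _ = κ ^ 3 * x ^ 8 * q ^ 15 := by ring
                  _ ≤ _ := by
                    have := qk 15 (by norm_num); have := xk 8 (by norm_num)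
                    gcongr
              have w2 : ‖d1 n‖ ^ 3 ≤ κ ^ 3 * ρ * q ^ 12 := by
                calc _ ≤ (κ * x ^ 2 * q ^ 4) ^ 3 := pow_le_pow_left₀ (norm_nonneg _) u1 3
                  _ = κ ^ 3 * x ^ 6 * q ^ 12 := by ring
                  _ ≤ _ := by
                    have := xk 6 (by norm_num)
                    gcongr
              have w3 : ‖d1 n‖ ^ 4 ≤ κ ^ 4 * ρ * q ^ 12 := by
                calc _ ≤ (κ * x ^ 2 * q ^ 4) ^ 4 := pow_le_pow_left₀ (norm_nonneg _) u1 4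
                  _ = κ ^ 4 * x ^ 8 * q ^ 16 := by ring
                  _ ≤ _ := by
                    have := qk 16 (by norm_num); have := xk 8 (by norm_num)
                    gcongr
              linarith
            · simp
        _ ≤ (2 * κ ^ 3 + κ ^ 4) * ρ * (K3 * P) := by
            refine mul_le_mul_of_nonneg_left (e3.trans ?_) (by positivity)
            rw [show (4 - 2 * (3 / 2) : ℝ) = 1 by norm_num, rpow_one]
            gcongr
        _ = _ := by ring
    have hsum := add_le_add (add_le_add t1 t2) t3
    refine hsum.trans ?_
    have hrW : 0 ≤ ρ * P := by positivity
    calc _ = KII * (ρ * P) := by rw [hKII]; ring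
      _ ≤ (KI + KII + 1) * (ρ * P) := by gcongr; linarith
      _ = _ := by ring

end MainBounds

/-- Configurations of the field, in real coordinates. -/
abbrev Config (N : ℕ) := EuclideanSpace ℝ (Coord N)

/-! ### Exponential moments of Gaussian quadratic forms -/

section Gauss

theorem inv_one_sub_le_exp {u : ℝ} (hu : |u| ≤ 1 / 2) : (1 - u)⁻¹ ≤ exp (u + u ^ 2) := by
  obtain ⟨h1, h2⟩ := abs_le.1 hu
  have hpos : 0 < 1 - u := by linarith
  rw [inv_le_iff_one_le_mul₀ hpos]
  rcases le_total 0 u with h | h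
  · have := quadratic_le_exp_of_nonneg (x := u + u ^ 2) (by positivity)
    have hp : 1 ≤ (1 + (u + u ^ 2) + (u + u ^ 2) ^ 2 / 2) * (1 - u) := by
      have : 2 * u ≤ (1 - u) * (1 + u) ^ 2 := by nlinarith [mul_nonneg h h]
      nlinarith [mul_nonneg (mul_nonneg h h) (sub_nonneg.2 this)]
    exact hp.trans (mul_le_mul_of_nonneg_right this hpos.le)
  · have := add_one_le_exp (u + u ^ 2)
    have hp : 1 ≤ (u + u ^ 2 + 1) * (1 - u) := by
      have : 0 ≤ (-u) ^ 3 := by have := neg_nonneg.2 h; positivity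
      nlinarith
    exact hp.trans (mul_le_mul_of_nonneg_right this hpos.le)

theorem integral_exp_quadratic_real_le {a : ℝ} (ha : |a| ≤ 1 / 4) (b : ℝ) :
    Integrable (fun x => exp (a * (x ^ 2 - 1) + b * x)) (gaussianReal 0 1) ∧
    ∫ x, exp (a * (x ^ 2 - 1) + b * x) ∂(gaussianReal 0 1) ≤ exp (2 * a ^ 2 + b ^ 2) := by
  obtain ⟨h1, h2⟩ := abs_le.1 ha
  have hpos : 0 < 1 - 2 * a := by linarith
  set v : NNReal := ⟨(1 - 2 * a)⁻¹, (inv_pos.2 hpos).le⟩ with hv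
  have hvc : (v : ℝ) = (1 - 2 * a)⁻¹ := rfl
  have hv0 : v ≠ 0 := fun h => (inv_pos.2 hpos).ne' (by rw [← hvc, h]; rfl)
  have hvp : (0 : ℝ) < v := inv_pos.2 hpos
  have hkey : ∀ x : ℝ, gaussianPDFReal 0 1 x * exp (a * (x ^ 2 - 1) + b * x)
      = (√v * exp (b ^ 2 * v / 2 - a)) * gaussianPDFReal (b * v) v x := by
    intro x
    have hs : √(v : ℝ) ≠ 0 := (sqrt_pos.2 hvp).ne'
    have hav : a = (1 - (v : ℝ)⁻¹) / 2 := by rw [hvc, inv_inv]; ring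
    simp only [gaussianPDFReal, NNReal.coe_one, mul_one, sub_zero]
    rw [sqrt_mul (x := 2 * Real.pi) (by positivity) (v : ℝ), mul_inv (√(2 * Real.pi)),
      mul_assoc, ← exp_add]
    have : √(v : ℝ) * exp (b ^ 2 * v / 2 - a) * ((√(2 * Real.pi))⁻¹ * (√(v : ℝ))⁻¹ *
        exp (-(x - b * v) ^ 2 / (2 * v))) = (√(2 * Real.pi))⁻¹ *
        (exp (b ^ 2 * v / 2 - a) * exp (-(x - b * v) ^ 2 / (2 * v))) := by
      field_simp
    rw [this, ← exp_add]
    congr 2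
    rw [hav]
    field_simp
    ring
  have hi : Integrable (fun x => (√v * exp (b ^ 2 * v / 2 - a)) * gaussianPDFReal (b * v) v x) :=
    (integrable_gaussianPDFReal _ _).const_mul _
  constructor
  · rw [gaussianReal_of_var_ne_zero _ one_ne_zero,
      integrable_withDensity_iff_integrable_smul₀' (by fun_prop)
        (Eventually.of_forall fun _ => gaussianPDF_lt_top)]
    refine hi.congr (Eventually.of_forall fun x => ?_)
    simp only [toReal_gaussianPDF, smul_eq_mul]
    exact (hkey x).symm
  · rw [integral_gaussianReal_eq_integral_smul one_ne_zero]
    simp only [smul_eq_mul, hkey]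
    rw [integral_const_mul, integral_gaussianPDFReal_eq_one _ hv0, mul_one]
    have hsq : √(v : ℝ) ≤ exp (a + 2 * a ^ 2) := by
      rw [sqrt_le_left (exp_pos _).le, ← exp_nat_mul, hvc]
      refine (inv_one_sub_le_exp (u := 2 * a) ?_).trans_eq (congrArg _ (by push_cast; ring))
      rw [abs_mul, abs_of_pos two_pos]; linarith
    have hv2 : (v : ℝ) ≤ 2 := by rw [hvc, inv_le_comm₀ hpos two_pos]; linarith
    calc _ ≤ exp (a + 2 * a ^ 2) * exp (b ^ 2 * v / 2 - a) := by gcongr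
      _ = exp (2 * a ^ 2 + b ^ 2 * v / 2) := by rw [← exp_add]; congr 1; ring
      _ ≤ _ := exp_le_exp.2 (by nlinarith [sq_nonneg b])

variable {ι : Type*} [Fintype ι] [DecidableEq ι]

open Matrix in
theorem abs_eigenvalues_le {A : Matrix ι ι ℝ} (hA : A.IsHermitian) {r : ℝ}
    (hr : ∀ i, ∑ j, |A i j| ≤ r) (k : ι) : |hA.eigenvalues k| ≤ r := by
  set u : ι → ℝ := ⇑(hA.eigenvectorBasis k) with hu
  have hne : u ≠ 0 := by
    intro h
    have := hA.eigenvectorBasis.orthonormal.ne_zero k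
    exact this (by ext i; exact congrFun h i)
  obtain ⟨i, -, hi⟩ := exists_max_image univ (fun i => |u i|)
    ⟨(Function.ne_iff.1 hne).choose, mem_univ _⟩
  have hip : 0 < |u i| := by
    obtain ⟨l, hl⟩ := Function.ne_iff.1 hne
    exact (abs_pos.2 hl).trans_le (hi l (mem_univ _))
  have hm := congrFun (hA.mulVec_eigenvectorBasis k) i
  have : |hA.eigenvalues k| * |u i| ≤ r * |u i| := by
    rw [← abs_mul]
    have e : hA.eigenvalues k * u i = ∑ j, A i j * u j := by
      rw [Pi.smul_apply, smul_eq_mul] at hm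
      exact hm.symm
    rw [e]
    calc |∑ j, A i j * u j| ≤ ∑ j, |A i j * u j| := abs_sum_le_sum_abs _ _
      _ ≤ ∑ j, |A i j| * |u i| := sum_le_sum fun j _ => by
          rw [abs_mul]; exact mul_le_mul_of_nonneg_left (hi j (mem_univ _)) (abs_nonneg _)
      _ = (∑ j, |A i j|) * |u i| := by rw [sum_mul]
      _ ≤ _ := mul_le_mul_of_nonneg_right (hr i) hip.le
  exact le_of_mul_le_mul_right this hip

open Matrix in
/-- Exponential moment of a Wick-ordered quadratic form plus a linear form. -/
theorem integral_exp_quadratic_le {A : Matrix ι ι ℝ} (hA : A.IsHermitian) {r : ℝ} (hr4 : r ≤ 1 / 4)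
    (hr : ∀ i, ∑ j, |A i j| ≤ r) (b : ι → ℝ) :
    Integrable (fun x : EuclideanSpace ℝ ι =>
      exp (∑ i, ∑ j, A i j * (x i * x j) - A.trace + ∑ i, b i * x i))
      (stdGaussian (EuclideanSpace ℝ ι)) ∧
    ∫ x : EuclideanSpace ℝ ι, exp (∑ i, ∑ j, A i j * (x i * x j) - A.trace + ∑ i, b i * x i)
      ∂(stdGaussian (EuclideanSpace ℝ ι))
      ≤ exp (2 * (r * ∑ i, ∑ j, |A i j|) + ∑ i, b i ^ 2) := by
  set B := hA.eigenvectorBasis with hB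
  set μ := hA.eigenvalues with hμ
  set b' : ι → ℝ := fun k => ∑ i, b i * B k i with hb'
  have hev : ∀ k i, ∑ j, A i j * B k j = μ k * B k i := fun k i => by
    have hm := congrFun (hA.mulVec_eigenvectorBasis k) i
    rw [Pi.smul_apply, smul_eq_mul] at hm
    exact hm
  have horth : ∀ k l, ∑ i, B k i * B l i = if k = l then 1 else 0 := fun k l => by
    have := (orthonormal_iff_ite.1 B.orthonormal) l k
    rw [PiLp.inner_apply] at this
    simp only [RCLike.inner_apply, conj_trivial] at this
    rw [this]; simp [eq_comm]
  have hpt : ∀ y : ι → ℝ, ∑ i, ∑ j, A i j * ((∑ k, y k • B k) i * (∑ k, y k • B k) j) - A.trace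
      + ∑ i, b i * (∑ k, y k • B k) i = ∑ k, (μ k * (y k ^ 2 - 1) + b' k * y k) := by
    intro y
    have hx : ∀ i, (∑ k, y k • B k) i = ∑ k, y k * B k i := fun i => by simp
    have h1 : ∀ i, ∑ j, A i j * (∑ k, y k * B k j) = ∑ k, y k * (μ k * B k i) := fun i => by
      simp_rw [mul_sum]
      rw [sum_comm]
      refine sum_congr rfl fun k _ => ?_
      rw [← hev k i, mul_sum]
      exact sum_congr rfl fun j _ => by ring
    have h2 : ∑ i, ∑ j, A i j * ((∑ k, y k * B k i) * (∑ k, y k * B k j)) = ∑ k, μ k * y k ^ 2 := by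
      calc _ = ∑ i, (∑ k, y k * B k i) * ∑ j, A i j * (∑ k, y k * B k j) :=
            sum_congr rfl fun i _ => by rw [mul_sum]; exact sum_congr rfl fun j _ => by ring
        _ = ∑ i, ∑ k, ∑ l, y k * (y l * μ l) * (B k i * B l i) :=
            sum_congr rfl fun i _ => by
              rw [h1, sum_mul_sum]
              exact sum_congr rfl fun k _ => sum_congr rfl fun l _ => by ring
        _ = ∑ k, ∑ l, y k * (y l * μ l) * ∑ i, B k i * B l i := by
            rw [sum_comm]
            refine sum_congr rfl fun k _ => ?_
            rw [sum_comm]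
            exact sum_congr rfl fun l _ => by rw [mul_sum]
        _ = _ := sum_congr rfl fun k _ => by
            simp only [horth, mul_ite, mul_one, mul_zero, sum_ite_eq, mem_univ, if_true]
            ring
    have h3 : A.trace = ∑ k, μ k := by have := hA.trace_eq_sum_eigenvalues; simpa using this
    have h4 : ∑ i, b i * (∑ k, y k * B k i) = ∑ k, b' k * y k := by
      simp_rw [mul_sum, hb', sum_mul]
      rw [sum_comm]
      exact sum_congr rfl fun k _ => sum_congr rfl fun i _ => by ring
    simp only [hx]
    rw [h2, h3, h4, ← sum_sub_distrib, ← sum_add_distrib]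
    exact sum_congr rfl fun k _ => by ring
  have hlam : ∀ k, |μ k| ≤ r := abs_eigenvalues_le hA hr
  have h1d := fun k => integral_exp_quadratic_real_le ((hlam k).trans hr4) (b' k)
  have hmeas : Measurable fun y : ι → ℝ => ∑ k, y k • B k := by fun_prop
  have hprod : ∀ y : ι → ℝ, exp (∑ i, ∑ j, A i j * ((∑ k, y k • B k) i * (∑ k, y k • B k) j)
      - A.trace + ∑ i, b i * (∑ k, y k • B k) i)
      = ∏ k, exp (μ k * (y k ^ 2 - 1) + b' k * y k) := fun y => by
    rw [hpt, exp_sum]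
  have hsm : StronglyMeasurable (fun x : EuclideanSpace ℝ ι =>
      exp (∑ i, ∑ j, A i j * (x i * x j) - A.trace + ∑ i, b i * x i)) :=
    Measurable.stronglyMeasurable (by fun_prop)
  have hrow : ∑ k, μ k ^ 2 ≤ r * ∑ i, ∑ j, |A i j| := by
    have e1 : ∀ i, ∑ k, (∑ j, A i j * B k j) ^ 2 = ∑ j, A i j ^ 2 := fun i => by
      have := B.sum_sq_inner_right (WithLp.toLp 2 (A i))
      rw [EuclideanSpace.real_norm_sq_eq] at this
      simp only [PiLp.inner_apply, RCLike.inner_apply, conj_trivial] at this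
      exact this
    calc ∑ k, μ k ^ 2 = ∑ k, ∑ i, (μ k * B k i) ^ 2 := sum_congr rfl fun k _ => by
          have := horth k k
          simp only [if_true] at this
          simp_rw [mul_pow]
          rw [← mul_sum]
          simp_rw [pow_two (B k _)]
          rw [this, mul_one]
      _ = ∑ i, ∑ k, (∑ j, A i j * B k j) ^ 2 := by rw [sum_comm]; simp only [hev]
      _ = ∑ i, ∑ j, A i j ^ 2 := by simp only [e1]
      _ ≤ ∑ i, ∑ j, r * |A i j| := by
          refine sum_le_sum fun i _ => sum_le_sum fun j _ => ?_
          rw [← sq_abs, pow_two]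
          refine mul_le_mul_of_nonneg_right ?_ (abs_nonneg _)
          exact (single_le_sum (f := fun j => |A i j|) (fun _ _ => abs_nonneg _)
            (mem_univ j)).trans (hr i)
      _ = _ := by simp_rw [← mul_sum]
  have hlin : ∑ k, b' k ^ 2 = ∑ i, b i ^ 2 := by
    have := B.sum_sq_inner_right (WithLp.toLp 2 b)
    rw [EuclideanSpace.real_norm_sq_eq] at this
    simp only [PiLp.inner_apply, RCLike.inner_apply, conj_trivial] at this
    exact this
  rw [stdGaussian_eq_map_pi_orthonormalBasis B]
  constructor
  · rw [integrable_map_measure hsm.aestronglyMeasurable hmeas.aemeasurable]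
    refine (Integrable.fintype_prod (f := fun k x => exp (μ k * (x ^ 2 - 1) + b' k * x))
      fun k => (h1d k).1).congr (Eventually.of_forall fun y => (hprod y).symm)
  · rw [integral_map hmeas.aemeasurable hsm.aestronglyMeasurable]
    simp only [hprod]
    rw [integral_fintype_prod_eq_prod (f := fun k x => exp (μ k * (x ^ 2 - 1) + b' k * x))]
    calc _ ≤ ∏ k, exp (2 * μ k ^ 2 + b' k ^ 2) :=
          prod_le_prod (fun k _ => integral_nonneg fun _ => (exp_pos _).le) fun k _ => (h1d k).2
      _ = exp (2 * ∑ k, μ k ^ 2 + ∑ k, b' k ^ 2) := by rw [← exp_sum, sum_add_distrib, mul_sum]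
      _ ≤ _ := by rw [hlin]; gcongr

omit [DecidableEq ι] in
/-- The diagonal case. -/
theorem integral_exp_diagonal_le (w : ι → ℝ) (hw : ∀ i, |w i| ≤ 1 / 4) :
    Integrable (fun x : EuclideanSpace ℝ ι => exp (∑ i, w i * (x i ^ 2 - 1)))
      (stdGaussian (EuclideanSpace ℝ ι)) ∧
    ∫ x : EuclideanSpace ℝ ι, exp (∑ i, w i * (x i ^ 2 - 1))
      ∂(stdGaussian (EuclideanSpace ℝ ι)) ≤ exp (2 * ∑ i, w i ^ 2) := by
  have h1d := fun k => integral_exp_quadratic_real_le (hw k) 0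
  simp only [zero_mul, add_zero, ne_eq, OfNat.ofNat_ne_zero, not_false_eq_true, zero_pow] at h1d
  have hsm : StronglyMeasurable (fun x : EuclideanSpace ℝ ι =>
      exp (∑ i, w i * (x i ^ 2 - 1))) := Measurable.stronglyMeasurable (by fun_prop)
  have hmeas : Measurable (WithLp.toLp 2 : (ι → ℝ) → EuclideanSpace ℝ ι) := by fun_prop
  rw [← map_pi_eq_stdGaussian]
  constructor
  · rw [integrable_map_measure hsm.aestronglyMeasurable hmeas.aemeasurable]
    refine (Integrable.fintype_prod (f := fun k x => exp (w k * (x ^ 2 - 1)))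
      fun k => (h1d k).1).congr (Eventually.of_forall fun y => ?_)
    simp [exp_sum]
  · rw [integral_map hmeas.aemeasurable hsm.aestronglyMeasurable]
    simp only [exp_sum]
    rw [integral_fintype_prod_eq_prod (f := fun k x => exp (w k * (x ^ 2 - 1)))]
    rw [mul_sum, exp_sum]
    exact prod_le_prod (fun k _ => integral_nonneg fun _ => (exp_pos _).le) fun k _ => (h1d k).2

omit [DecidableEq ι] in
theorem integrable_coord (i : ι) :
    Integrable (fun x : EuclideanSpace ℝ ι => x i) (stdGaussian (EuclideanSpace ℝ ι)) :=
  (EuclideanSpace.proj i : EuclideanSpace ℝ ι →L[ℝ] ℝ).integrable_comp IsGaussian.integrable_id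

omit [DecidableEq ι] in
theorem integral_coord (i : ι) :
    ∫ x : EuclideanSpace ℝ ι, x i ∂(stdGaussian (EuclideanSpace ℝ ι)) = 0 :=
  integral_strongDual_stdGaussian (EuclideanSpace.proj i : EuclideanSpace ℝ ι →L[ℝ] ℝ)

omit [DecidableEq ι] in
theorem memLp_coord (i : ι) :
    MemLp (fun x : EuclideanSpace ℝ ι => x i) 2 (stdGaussian (EuclideanSpace ℝ ι)) :=
  (EuclideanSpace.proj i : EuclideanSpace ℝ ι →L[ℝ] ℝ).comp_memLp' IsGaussian.memLp_two_id

omit [DecidableEq ι] in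
theorem integrable_coord_mul (i j : ι) :
    Integrable (fun x : EuclideanSpace ℝ ι => x i * x j) (stdGaussian (EuclideanSpace ℝ ι)) :=
  (memLp_coord i).integrable_mul (memLp_coord j)

theorem integral_coord_mul (i j : ι) :
    ∫ x : EuclideanSpace ℝ ι, x i * x j ∂(stdGaussian (EuclideanSpace ℝ ι))
      = if i = j then 1 else 0 := by
  have h := covariance_eval_multivariateGaussian (μ := (0 : EuclideanSpace ℝ ι))
    (Matrix.PosSemidef.one (n := ι) (R := ℝ)) i j
  rw [multivariateGaussian_zero_one, covariance_eq_sub (memLp_coord i) (memLp_coord j),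
    integral_coord, zero_mul, sub_zero] at h
  rw [Matrix.one_apply] at h
  exact h

end Gauss

theorem integrable_exp_of_le {Ω : Type*} [MeasurableSpace Ω] {μ : Measure Ω} {f F : Ω → ℝ}
    (hf : Measurable f) (hF : Integrable F μ) (h : ∀ x, exp (f x) ≤ F x) :
    Integrable (fun x => exp (f x)) μ ∧ ∫ x, exp (f x) ∂μ ≤ ∫ x, F x ∂μ := by
  have hi : Integrable (fun x => exp (f x)) μ :=
    hF.mono' (measurable_exp.comp hf).aestronglyMeasurable
      (Eventually.of_forall fun x => by rw [norm_of_nonneg (exp_pos _).le]; exact h x)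
  exact ⟨hi, integral_mono hi hF h⟩

theorem sq_le_rpow_three_halves {ρ : ℝ} (hρ : 0 < ρ) (h1 : ρ ≤ 1) : ρ ^ 2 ≤ ρ ^ (3 / 2 : ℝ) := by
  rw [← rpow_natCast]
  exact rpow_le_rpow_of_exponent_ge hρ h1 (by norm_num)

/-! ### Quadratic forms of the field in coordinates -/

section Forms

variable {N M : ℕ}

theorem norm_toField_sq (x : Coord N → ℝ) (c : Fin 4) (a b : Mode N) :
    ‖toField x c a b‖ ^ 2 = (x (c, a, b) ^ 2 + x (c, b, a) ^ 2) / 2 := by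
  rw [← Complex.normSq_eq_norm_sq, Complex.normSq_apply]
  simp only [toField, of_apply, Complex.add_re, Complex.mul_re, Complex.add_im,
    Complex.mul_im, sub_re, Complex.sub_im, ofReal_re, ofReal_im,
    div_ofNat_re, Complex.div_ofNat_im, Complex.one_re, Complex.one_im, Complex.I_re,
    Complex.I_im]
  ring

theorem toField_self (x : Coord N → ℝ) (c : Fin 4) (a : Mode N) :
    toField x c a a = (x (c, a, a) : ℂ) := by
  simp only [toField, of_apply]; ring

/-- The coefficients in coordinates of a diagonal quadratic form. -/
noncomputable def symW (w : Fin 4 → Mode N → Mode N → ℝ) (s : Coord N) : ℝ :=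
  (w s.1 s.2.1 s.2.2 + w s.1 s.2.2 s.2.1) / 2

theorem sum_coord (f : Coord N → ℝ) : ∑ s, f s = ∑ c, ∑ a, ∑ b, f (c, a, b) := by
  rw [Fintype.sum_prod_type]
  exact sum_congr rfl fun c _ => Fintype.sum_prod_type _

theorem sum_mul_toField_sq (w : Fin 4 → Mode N → Mode N → ℝ) (x : Coord N → ℝ) :
    ∑ c, ∑ a, ∑ b, w c a b * ‖toField x c a b‖ ^ 2 = ∑ s, symW w s * x s ^ 2 := by
  rw [sum_coord]
  refine sum_congr rfl fun c _ => ?_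
  simp only [norm_toField_sq, symW]
  have h : ∑ a, ∑ b, w c a b * (x (c, b, a) ^ 2 / 2) = ∑ a, ∑ b, w c b a * (x (c, a, b) ^ 2 / 2) :=
    sum_comm
  calc _ = ∑ a, ∑ b, w c a b * (x (c, a, b) ^ 2 / 2) + ∑ a, ∑ b, w c a b * (x (c, b, a) ^ 2 / 2) := by
        simp only [← sum_add_distrib]
        exact sum_congr rfl fun a _ => sum_congr rfl fun b _ => by ring
    _ = _ := by
        rw [h]
        simp only [← sum_add_distrib]
        exact sum_congr rfl fun a _ => sum_congr rfl fun b _ => by ring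

theorem sum_symW (w : Fin 4 → Mode N → Mode N → ℝ) : ∑ s, symW w s = ∑ c, ∑ a, ∑ b, w c a b := by
  rw [sum_coord]
  refine sum_congr rfl fun c _ => ?_
  simp only [symW, add_div, sum_add_distrib]
  rw [sum_comm (f := fun a b => w c b a / 2), ← sum_add_distrib]
  refine sum_congr rfl fun a _ => ?_
  rw [← sum_add_distrib]
  exact sum_congr rfl fun b _ => by ring

theorem exists_form_of_weights {w : Fin 4 → Mode N → Mode N → ℝ} {m T : ℝ}
    (h0 : ∀ c a b, 0 ≤ w c a b) (hm : ∀ c a b, w c a b ≤ m) (hT : ∑ c, ∑ a, ∑ b, w c a b ≤ T) :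
    ∃ v : Coord N → ℝ, (∀ s, 0 ≤ v s) ∧ (∀ s, v s ≤ m) ∧ ∑ s, v s ≤ T ∧
      ∀ x : Coord N → ℝ, ∑ c, ∑ a, ∑ b, w c a b * ‖toField x c a b‖ ^ 2 = ∑ s, v s * x s ^ 2 :=
  ⟨symW w, fun s => div_nonneg (add_nonneg (h0 _ _ _) (h0 _ _ _)) two_pos.le,
    fun s => by unfold symW; linarith [hm s.1 s.2.1 s.2.2, hm s.1 s.2.2 s.2.1],
    (sum_symW w).trans_le hT, sum_mul_toField_sq w⟩

/-- The form `yq` evaluated on the field of coordinates `x`. -/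
noncomputable def yF (M j : ℕ) (x : Coord N → ℝ) : ℝ :=
  yq ((M : ℝ) ^ j) fun c a b => ‖toField x c a b‖

/-- The form `gq` evaluated on the field of coordinates `x`. -/
noncomputable def gF (M j : ℕ) (x : Coord N → ℝ) : ℝ :=
  gq ((M : ℝ) ^ j) fun c a b => ‖toField x c a b‖

theorem exists_yF_form (hM : 2 ≤ M) : ∃ K : ℝ, 0 < K ∧ ∀ N j : ℕ, ∃ v : Coord N → ℝ,
    (∀ s, 0 ≤ v s) ∧ (∀ s, v s ≤ ((M : ℝ) ^ j) ^ (-(7 / 4) : ℝ)) ∧ ∑ s, v s ≤ K ∧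
      ∀ x : Coord N → ℝ, yF M j x = ∑ s, v s * x s ^ 2 := by
  obtain ⟨K0, hK0, h0⟩ := exists_sum_bw_le (α := 0) le_rfl (by norm_num)
  obtain ⟨K1, hK1, h1⟩ := exists_sum_bw_le (α := 1 / 4) (by norm_num) (by norm_num)
  refine ⟨4 * (K0 * K1), by positivity, fun N j => ?_⟩
  have hR := one_le_scale hM j
  set R := (M : ℝ) ^ j with hRdef
  have hR0 : 0 < R := by linarith
  have hRp : 0 ≤ R ^ (-(7 / 4) : ℝ) := rpow_nonneg hR0.le _
  obtain ⟨v, hv0, hvm, hvT, hv⟩ := exists_form_of_weights (N := N)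
    (w := fun _ a b => R ^ (-(7 / 4) : ℝ) * (bw R 0 a * bw R (1 / 4) b))
    (m := R ^ (-(7 / 4) : ℝ)) (T := 4 * (K0 * K1))
    (fun _ a b => mul_nonneg hRp (mul_nonneg (bw_nonneg _ _) (bw_nonneg _ _)))
    (fun _ a b => mul_le_of_le_one_right hRp
      (mul_le_one₀ (bw_le_one le_rfl _) (bw_nonneg _ _) (bw_le_one (by norm_num) _))) (by
      simp only [← mul_sum, sum_const, card_univ, Fintype.card_fin, nsmul_eq_mul, ← sum_mul]
      push_cast
      have hs := mul_le_mul (h0 N R hR) (h1 N R hR) (sum_nonneg fun a _ => bw_nonneg _ _)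
        (by positivity)
      have e : R ^ (-(7 / 4) : ℝ) * (R ^ (1 - 0 : ℝ) * R ^ (1 - 1 / 4 : ℝ)) = 1 := by
        rw [← rpow_add hR0, ← rpow_add hR0]; norm_num
      have := mul_le_mul_of_nonneg_left hs hRp
      have e' : R ^ (-(7 / 4) : ℝ) * (K0 * R ^ (1 - 0 : ℝ) * (K1 * R ^ (1 - 1 / 4 : ℝ)))
        = K0 * K1 := by linear_combination K0 * K1 * e
      linarith)
  refine ⟨v, hv0, hvm, hvT, fun x => ?_⟩
  rw [← hv x, yF, yq]
  simp only [yCol, mul_sum]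
  exact sum_congr rfl fun c _ => sum_congr rfl fun a _ => sum_congr rfl fun b _ => by ring

theorem exists_gF_form (hM : 2 ≤ M) : ∃ K : ℝ, 0 < K ∧ ∀ N j : ℕ, ∃ v : Coord N → ℝ,
    (∀ s, 0 ≤ v s) ∧ (∀ s, v s ≤ 2 * ((M : ℝ) ^ j) ^ (-(1 / 4) : ℝ)) ∧ ∑ s, v s ≤ K ∧
      ∀ x : Coord N → ℝ, gF M j x = ∑ s, v s * x s ^ 2 := by
  obtain ⟨K0, hK0, h0⟩ := exists_sum_bw_le (α := 0) le_rfl (by norm_num)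
  obtain ⟨K1, hK1, h1⟩ := exists_sum_bw_le (α := 7 / 8) (by norm_num) (by norm_num)
  refine ⟨4 * (K1 * K1 + K0), by positivity, fun N j => ?_⟩
  have hR := one_le_scale hM j
  set R := (M : ℝ) ^ j with hRdef
  have hR0 : 0 < R := by linarith
  have hRp : 0 ≤ R ^ (-(1 / 4) : ℝ) := rpow_nonneg hR0.le _
  have hRi : R⁻¹ ≤ R ^ (-(1 / 4) : ℝ) := by
    rw [← rpow_neg_one]; exact rpow_le_rpow_of_exponent_le hR (by norm_num)
  obtain ⟨v, hv0, hvm, hvT, hv⟩ := exists_form_of_weights (N := N)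
    (w := fun _ a b => R ^ (-(1 / 4) : ℝ) * (bw R (7 / 8) a * bw R (7 / 8) b)
      + if a = b then R⁻¹ * bw R 0 a else 0)
    (m := 2 * R ^ (-(1 / 4) : ℝ)) (T := 4 * (K1 * K1 + K0))
    (fun _ a b => add_nonneg (mul_nonneg hRp (mul_nonneg (bw_nonneg _ _) (bw_nonneg _ _))) (by
      split_ifs; exacts [mul_nonneg (inv_nonneg.2 hR0.le) (bw_nonneg _ _), le_rfl]))
    (fun _ a b => by
      have t1 : R ^ (-(1 / 4) : ℝ) * (bw R (7 / 8) a * bw R (7 / 8) b) ≤ R ^ (-(1 / 4) : ℝ) :=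
        mul_le_of_le_one_right hRp
          (mul_le_one₀ (bw_le_one (by norm_num) _) (bw_nonneg _ _) (bw_le_one (by norm_num) _))
      have t2 : (if a = b then R⁻¹ * bw R 0 a else 0) ≤ R ^ (-(1 / 4) : ℝ) := by
        split_ifs
        · exact (mul_le_of_le_one_right (inv_nonneg.2 hR0.le) (bw_le_one le_rfl _)).trans hRi
        · exact hRp
      linarith) (by
      simp only [sum_add_distrib, sum_ite_eq, mem_univ, if_true,
        ← mul_sum, sum_const, card_univ, Fintype.card_fin,
        nsmul_eq_mul, ← sum_mul]
      push_cast
      have hs := mul_le_mul (h1 N R hR) (h1 N R hR) (sum_nonneg fun a _ => bw_nonneg _ _)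
        (by positivity)
      have e : R ^ (-(1 / 4) : ℝ) * (R ^ (1 - 7 / 8 : ℝ) * R ^ (1 - 7 / 8 : ℝ)) = 1 := by
        rw [← rpow_add hR0, ← rpow_add hR0]; norm_num
      have e0 : R⁻¹ * R ^ (1 - 0 : ℝ) = 1 := by
        rw [sub_zero, rpow_one]; exact inv_mul_cancel₀ hR0.ne'
      have t1 := mul_le_mul_of_nonneg_left hs hRp
      have t2 := mul_le_mul_of_nonneg_left (h0 N R hR) (inv_nonneg.2 hR0.le)
      have e1 : R ^ (-(1 / 4) : ℝ) * (K1 * R ^ (1 - 7 / 8 : ℝ) * (K1 * R ^ (1 - 7 / 8 : ℝ)))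
        = K1 * K1 := by linear_combination K1 * K1 * e
      have e2 : R⁻¹ * (K0 * R ^ (1 - 0 : ℝ)) = K0 := by linear_combination K0 * e0
      linarith)
  refine ⟨v, hv0, hvm, hvT, fun x => ?_⟩
  rw [← hv x, gF, gq]
  simp only [gCol, dCol, mul_sum, add_mul, ite_mul, zero_mul, sum_add_distrib,
    sum_ite_eq, mem_univ, if_true]
  congr 1
  · exact sum_congr rfl fun c _ => sum_congr rfl fun a _ => sum_congr rfl fun b _ => by ring
  · exact sum_congr rfl fun c _ => sum_congr rfl fun a _ => by ring

/-- Exponential moment of a nonnegative diagonal quadratic form. -/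
theorem integral_exp_sum_sq_le {ι : Type*} [Fintype ι] {v : ι → ℝ} (h0 : ∀ s, 0 ≤ v s)
    (h1 : ∀ s, v s ≤ 1 / 4) :
    Integrable (fun x : EuclideanSpace ℝ ι => exp (∑ s, v s * x s ^ 2))
      (stdGaussian (EuclideanSpace ℝ ι)) ∧
    ∫ x : EuclideanSpace ℝ ι, exp (∑ s, v s * x s ^ 2) ∂(stdGaussian (EuclideanSpace ℝ ι))
      ≤ exp (2 * ∑ s, v s) := by
  obtain ⟨hi, hle⟩ := integral_exp_diagonal_le v fun s => abs_le.2 ⟨by linarith [h0 s], h1 s⟩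
  have e : ∀ x : EuclideanSpace ℝ ι, exp (∑ s, v s * x s ^ 2)
      = exp (∑ s, v s) * exp (∑ s, v s * (x s ^ 2 - 1)) := fun x => by
    rw [← exp_add, ← sum_add_distrib]
    congr 1; exact sum_congr rfl fun s _ => by ring
  simp only [e]
  refine ⟨hi.const_mul _, ?_⟩
  rw [integral_const_mul]
  calc _ ≤ exp (∑ s, v s) * exp (2 * ∑ s, v s ^ 2) := by gcongr
    _ ≤ _ := by
      rw [← exp_add]
      refine exp_le_exp.2 ?_
      have : ∑ s, v s ^ 2 ≤ ∑ s, v s * (1 / 4) :=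
        sum_le_sum fun s _ => by rw [pow_two]; exact mul_le_mul_of_nonneg_left (h1 s) (h0 s)
      rw [← sum_mul] at this
      have := sum_nonneg fun s (_ : s ∈ univ) => h0 s
      linarith

theorem exists_integral_exp_yF_le (hM : 2 ≤ M) : ∃ K : ℝ, 0 < K ∧ ∀ (N j : ℕ) (t : ℝ), 0 ≤ t →
    t ≤ ((M : ℝ) ^ j) ^ (7 / 4 : ℝ) / 4 →
    Integrable (fun x : Config N => exp (t * yF M j x)) (nuStd N) ∧
    ∫ x : Config N, exp (t * yF M j x) ∂(nuStd N) ≤ exp (K * t) := by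
  obtain ⟨K, hK, h⟩ := exists_yF_form hM
  refine ⟨2 * K, by positivity, fun N j t ht0 ht => ?_⟩
  obtain ⟨v, hv0, hvm, hvT, hv⟩ := h N j
  have hR0 : 0 < (M : ℝ) ^ j := by linarith [one_le_scale hM j]
  have := integral_exp_sum_sq_le (v := fun s => t * v s) (fun s => mul_nonneg ht0 (hv0 s))
    fun s => (mul_le_mul ht (hvm s) (hv0 s) (by positivity)).trans_eq (by
      rw [div_mul_eq_mul_div, ← rpow_add hR0]; norm_num)
  have e : ∀ x : Config N, t * yF M j x = ∑ s, t * v s * x s ^ 2 := fun x => by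
    rw [hv, mul_sum]; exact sum_congr rfl fun s _ => by ring
  simp only [e]
  refine ⟨this.1, this.2.trans (exp_le_exp.2 ?_)⟩
  rw [← mul_sum]
  nlinarith

theorem exists_integral_exp_gF_le (hM : 2 ≤ M) : ∃ K : ℝ, 0 < K ∧ ∀ (N j : ℕ) (t : ℝ), 0 ≤ t →
    t ≤ ((M : ℝ) ^ j) ^ (1 / 4 : ℝ) / 8 →
    Integrable (fun x : Config N => exp (t * gF M j x)) (nuStd N) ∧
    ∫ x : Config N, exp (t * gF M j x) ∂(nuStd N) ≤ exp (K * t) := by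
  obtain ⟨K, hK, h⟩ := exists_gF_form hM
  refine ⟨2 * K, by positivity, fun N j t ht0 ht => ?_⟩
  obtain ⟨v, hv0, hvm, hvT, hv⟩ := h N j
  have hR0 : 0 < (M : ℝ) ^ j := by linarith [one_le_scale hM j]
  have := integral_exp_sum_sq_le (v := fun s => t * v s) (fun s => mul_nonneg ht0 (hv0 s))
    fun s => (mul_le_mul ht (hvm s) (hv0 s) (by positivity)).trans_eq (by
      have : ((M : ℝ) ^ j) ^ (1 / 4 : ℝ) * ((M : ℝ) ^ j) ^ (-(1 / 4) : ℝ) = 1 := by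
        rw [← rpow_add hR0]; norm_num
      linear_combination this / 4)
  have e : ∀ x : Config N, t * gF M j x = ∑ s, t * v s * x s ^ 2 := fun x => by
    rw [hv, mul_sum]; exact sum_congr rfl fun s _ => by ring
  simp only [e]
  refine ⟨this.1, this.2.trans (exp_le_exp.2 ?_)⟩
  rw [← mul_sum]
  nlinarith

theorem yF_nonneg (hM : 2 ≤ M) (j : ℕ) (x : Coord N → ℝ) : 0 ≤ yF M j x :=
  yq_nonneg _ (one_le_scale hM j)

theorem gF_nonneg (hM : 2 ≤ M) (j : ℕ) (x : Coord N → ℝ) : 0 ≤ gF M j x :=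
  gq_nonneg _ (one_le_scale hM j)

end Forms

/-! ### The form `Q₀` -/

section Q0

variable {N M : ℕ}

theorem q0Le_eq (M j : ℕ) (c : Fin 4) (a b : Mode N) : q0Le M j a b = ∑ p : Fin 3 → Mode N,
    cutProp M j (sqNorm (c.insertNth a p : MultiMode N)) *
      cutProp M j (sqNorm (c.insertNth b p : MultiMode N)) := by
  simp only [sqNorm_insertNth]; rfl

theorem q0_eq (M j : ℕ) (a b : Mode N) : q0 M j a b = ∑ p : Fin 3 → Mode N,
    (cutProp M j (sqNorm ((0 : Fin 4).insertNth a p : MultiMode N)) *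
      cutProp M j (sqNorm ((0 : Fin 4).insertNth b p : MultiMode N)) -
    cutProp M (j - 1) (sqNorm ((0 : Fin 4).insertNth a p : MultiMode N)) *
      cutProp M (j - 1) (sqNorm ((0 : Fin 4).insertNth b p : MultiMode N))) := by
  rw [q0, q0Le_eq M j 0, q0Le_eq M (j - 1) 0, ← sum_sub_distrib]

theorem q0_symm (M j : ℕ) (a b : Mode N) : q0 M j a b = q0 M j b a := by
  rw [q0_eq, q0_eq]
  exact sum_congr rfl fun p _ => by ring

theorem q0_nonneg (hM : 2 ≤ M) (j : ℕ) (a b : Mode N) : 0 ≤ q0 M j a b := by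
  rw [q0_eq]
  refine sum_nonneg fun p _ => sub_nonneg.2 ?_
  exact mul_le_mul (cutProp_mono hM (Nat.sub_le _ _) (sqNorm_nonneg _))
    (cutProp_mono hM (Nat.sub_le _ _) (sqNorm_nonneg _)) (cutProp_nonneg' _ _ _)
    (cutProp_nonneg' _ _ _)

theorem exists_sum_cutProp_insertNth_le (M : ℕ) (hM : 2 ≤ M) : ∃ K : ℝ, 0 < K ∧
    ∀ (N j : ℕ) (c : Fin 4) (a : Mode N),
      ∑ p : Fin 3 → Mode N, cutProp M j (sqNorm (c.insertNth a p : MultiMode N))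
        ≤ K * (M : ℝ) ^ j * bw ((M : ℝ) ^ j) 0 a := by
  obtain ⟨K, hK, h⟩ := exists_sum_bw_le (α := 2 / 3) (by norm_num) (by norm_num)
  refine ⟨K ^ 3, by positivity, fun N j c a => ?_⟩
  have hR := one_le_scale hM j
  have := sum_cutProp_rpow_le (M := M) (j := j) (β := 1) (α := 0) (e := 2 / 3) one_pos le_rfl
    (by norm_num) (by norm_num) a
  simp only [rpow_one] at this
  simp only [sqNorm_insertNth]
  refine this.trans ?_
  rw [mul_comm]
  refine mul_le_mul_of_nonneg_right ?_ (bw_nonneg _ _)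
  calc _ ≤ (K * ((M : ℝ) ^ j) ^ (1 - 2 / 3 : ℝ)) ^ 3 :=
        pow_le_pow_left₀ (sum_nonneg fun _ _ => bw_nonneg _ _) (h N _ hR) 3
    _ = _ := by
        rw [mul_pow, ← rpow_natCast (_ ^ (1 - 2 / 3 : ℝ)), ← rpow_mul (by positivity)]
        norm_num

theorem exists_q0_le (hM : 2 ≤ M) : ∃ K : ℝ, 0 < K ∧ ∀ (N j : ℕ) (a b : Mode N),
    q0 M j a b ≤ K * ((M : ℝ) ^ j)⁻¹ * (bw ((M : ℝ) ^ j) 0 a * bw ((M : ℝ) ^ j) 0 b) := by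
  obtain ⟨K, hK, h⟩ := exists_sum_cutProp_insertNth_le M hM
  have hM0 : (0 : ℝ) < (M : ℝ) ^ 2 := by
    have : (0 : ℝ) < M := by exact_mod_cast (by omega : 0 < M)
    positivity
  refine ⟨2 * ((M : ℝ) ^ 2 * K), by positivity, fun N j a b => ?_⟩
  have hR := one_le_scale hM j
  set R := (M : ℝ) ^ j with hRdef
  have hR0 : 0 < R := by linarith
  have hd : ∀ (a : Mode N) (p : Fin 3 → Mode N),
      dProp M j (sqNorm ((0 : Fin 4).insertNth a p : MultiMode N)) ≤ (M : ℝ) ^ 2 * R⁻¹ ^ 2 * bw R 0 a :=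
    fun a p => by simpa using dProp_le_bw hM j ((0 : Fin 4).insertNth a p : MultiMode N) 0
  have hC : ∀ (a : Mode N) (p : Fin 3 → Mode N),
      0 ≤ cutProp M j (sqNorm ((0 : Fin 4).insertNth a p : MultiMode N)) :=
    fun a p => cutProp_nonneg' _ _ _
  calc q0 M j a b ≤ ∑ p : Fin 3 → Mode N,
        ((M : ℝ) ^ 2 * R⁻¹ ^ 2 * bw R 0 a * cutProp M j (sqNorm ((0 : Fin 4).insertNth b p : MultiMode N))
        + (M : ℝ) ^ 2 * R⁻¹ ^ 2 * bw R 0 b *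
          cutProp M j (sqNorm ((0 : Fin 4).insertNth a p : MultiMode N))) := by
        rw [q0_eq]
        refine sum_le_sum fun p _ => ?_
        have h1 := mul_le_mul_of_nonneg_right (hd a p) (hC b p)
        have h2 := mul_le_mul_of_nonneg_right (hd b p) (hC a p)
        have h3 := mul_nonneg (dProp_nonneg hM j (sqNorm_nonneg ((0 : Fin 4).insertNth a p : MultiMode N)))
          (dProp_nonneg hM j (sqNorm_nonneg ((0 : Fin 4).insertNth b p : MultiMode N)))
        unfold dProp at h1 h2 h3
        linarith
    _ ≤ (M : ℝ) ^ 2 * R⁻¹ ^ 2 * bw R 0 a * (K * R * bw R 0 b)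
        + (M : ℝ) ^ 2 * R⁻¹ ^ 2 * bw R 0 b * (K * R * bw R 0 a) := by
        rw [sum_add_distrib, ← mul_sum, ← mul_sum]
        have := bw_nonneg (R := R) 0 a
        have := bw_nonneg (R := R) 0 b
        gcongr
        · exact h N j 0 b
        · exact h N j 0 a
    _ = _ := by field_simp; ring

theorem sum_half_pow_dist_le (s : Finset ℕ) (n : ℕ) :
    ∑ k ∈ s, (1 / 2 : ℝ) ^ ((k - n) + (n - k)) ≤ 4 := by
  classical
  have key : ∀ (u : Finset ℕ) (f : ℕ → ℕ), Set.InjOn f u → ∑ k ∈ u, (1 / 2 : ℝ) ^ f k ≤ 2 := by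
    intro u f hf
    rw [← sum_image (f := fun i => (1 / 2 : ℝ) ^ i) hf]
    refine (sum_le_sum_of_subset_of_nonneg (t := range ((u.image f).sup id + 1)) ?_
      fun _ _ _ => by positivity).trans (sum_geometric_two_le _)
    intro i hi
    exact mem_range.2 (Nat.lt_succ_of_le (le_sup (f := id) hi))
  rw [← sum_filter_add_sum_filter_not s (fun k => n ≤ k)]
  have h1 := key (s.filter fun k => n ≤ k) (fun k => k - n + (n - k)) (by
    intro a ha b hb hab
    have := (mem_filter.1 ha).2; have := (mem_filter.1 hb).2
    simp only at hab; omega)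
  have h2 := key (s.filter fun k => ¬ n ≤ k) (fun k => k - n + (n - k)) (by
    intro a ha b hb hab
    have := (mem_filter.1 ha).2; have := (mem_filter.1 hb).2
    simp only at hab; omega)
  linarith

/-- The coefficients of `Q_{0,j}` in coordinates. -/
noncomputable def qF (M j : ℕ) (s : Coord N) : ℝ := q0 M j s.2.1 s.2.2

theorem qF_nonneg (hM : 2 ≤ M) (j : ℕ) (s : Coord N) : 0 ≤ qF M j s := q0_nonneg hM _ _ _

theorem quadQ0_toField (j : ℕ) (x : Coord N → ℝ) :
    quadQ0 M j (toField x) = ∑ s, qF M j s * x s ^ 2 := by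
  rw [quadQ0, sum_mul_toField_sq (fun _ a b => q0 M j a b)]
  refine sum_congr rfl fun s _ => ?_
  rw [symW, q0_symm M j s.2.2 s.2.1, qF]; ring

theorem traceQ0Q0_eq (j k : ℕ) : traceQ0Q0 N M j k = ∑ s : Coord N, qF M j s * qF M k s := by
  rw [sum_coord]; rfl

theorem traceQ0Q0_nonneg (hM : 2 ≤ M) (j k : ℕ) : 0 ≤ traceQ0Q0 N M j k := by
  rw [traceQ0Q0_eq]
  exact sum_nonneg fun s _ => mul_nonneg (qF_nonneg hM _ _) (qF_nonneg hM _ _)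

theorem integrable_sum_sq {ι : Type*} [Fintype ι] (v : ι → ℝ) :
    Integrable (fun x : EuclideanSpace ℝ ι => ∑ s, v s * x s ^ 2) (stdGaussian (EuclideanSpace ℝ ι)) :=
  integrable_finsetSum _ fun s _ => by
    simp only [pow_two]
    exact (by classical exact integrable_coord_mul s s : Integrable (fun x : EuclideanSpace ℝ ι =>
      x s * x s) (stdGaussian (EuclideanSpace ℝ ι))).const_mul _

theorem integral_sum_sq {ι : Type*} [Fintype ι] (v : ι → ℝ) :
    ∫ x : EuclideanSpace ℝ ι, ∑ s, v s * x s ^ 2 ∂(stdGaussian (EuclideanSpace ℝ ι)) = ∑ s, v s := by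
  classical
  rw [integral_finsetSum _ fun s _ => by
    simp only [pow_two]; exact (integrable_coord_mul s s).const_mul _]
  refine sum_congr rfl fun s _ => ?_
  rw [integral_const_mul]
  simp only [pow_two, integral_coord_mul, if_true, mul_one]

theorem wick_quadQ0_toField (j : ℕ) (x : Coord N → ℝ) :
    wick (quadQ0 M j) (toField x) = ∑ s, qF M j s * (x s ^ 2 - 1) := by
  rw [wick]
  simp only [quadQ0_toField]
  rw [nuStd, integral_sum_sq, ← sum_sub_distrib]
  exact sum_congr rfl fun s _ => by ring

theorem exists_qF_bounds (hM : 2 ≤ M) : ∃ K : ℝ, 0 < K ∧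
    (∀ (N j : ℕ) (s : Coord N), qF M j s ≤ K * (1 / 2) ^ j) ∧
    (∀ N j k : ℕ, traceQ0Q0 N M j k ≤ K * (1 / 2) ^ ((j - k) + (k - j))) := by
  obtain ⟨K, hK, h⟩ := exists_q0_le hM
  obtain ⟨K0, hK0, h0⟩ := exists_sum_bw_le (α := 0) le_rfl (by norm_num)
  have hMinv : (M : ℝ)⁻¹ ≤ 1 / 2 := by rw [one_div]; exact inv_anti₀ two_pos (by exact_mod_cast hM)
  have hMinv0 : (0 : ℝ) ≤ (M : ℝ)⁻¹ := by positivity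
  have hpow : ∀ i : ℕ, ((M : ℝ) ^ i)⁻¹ ≤ (1 / 2) ^ i := fun i => by
    rw [← inv_pow]; exact pow_le_pow_left₀ hMinv0 hMinv i
  have hq : ∀ (N j : ℕ) (s : Coord N), qF M j s ≤ K * ((M : ℝ) ^ j)⁻¹ := fun N j s => by
    refine (h N j s.2.1 s.2.2).trans (mul_le_of_le_one_right (by positivity) ?_)
    exact mul_le_one₀ (bw_le_one le_rfl _) (bw_nonneg _ _) (bw_le_one le_rfl _)
  have hsum : ∀ N j, ∑ s : Coord N, qF M j s ≤ 4 * K * K0 ^ 2 * (M : ℝ) ^ j := by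
    intro N j
    have hR := one_le_scale hM j
    have hS := h0 N _ hR
    rw [sub_zero, rpow_one] at hS
    have hSn : 0 ≤ ∑ a : Mode N, bw ((M : ℝ) ^ j) 0 a := sum_nonneg fun _ _ => bw_nonneg _ _
    calc ∑ s : Coord N, qF M j s ≤ ∑ _c : Fin 4, ∑ a : Mode N, ∑ b : Mode N, K * ((M : ℝ) ^ j)⁻¹ *
          (bw ((M : ℝ) ^ j) 0 a * bw ((M : ℝ) ^ j) 0 b) := by
          rw [sum_coord]
          exact sum_le_sum fun c _ => sum_le_sum fun a _ => sum_le_sum fun b _ => h N j a b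
      _ = 4 * (K * ((M : ℝ) ^ j)⁻¹ * ((∑ a : Mode N, bw ((M : ℝ) ^ j) 0 a) *
          ∑ a : Mode N, bw ((M : ℝ) ^ j) 0 a)) := by
          simp only [← mul_sum, sum_const, card_univ, Fintype.card_fin, nsmul_eq_mul, ← sum_mul]
          push_cast; ring
      _ ≤ 4 * (K * ((M : ℝ) ^ j)⁻¹ * ((K0 * (M : ℝ) ^ j) * (K0 * (M : ℝ) ^ j))) := by gcongr
      _ = _ := by
          have : (0 : ℝ) < (M : ℝ) ^ j := by linarith
          field_simp
  have htr : ∀ N j k : ℕ, j ≤ k → traceQ0Q0 N M j k ≤ 4 * K ^ 2 * K0 ^ 2 * (1 / 2) ^ (k - j) := by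
    intro N j k hjk
    have hj : (0 : ℝ) < (M : ℝ) ^ j := by linarith [one_le_scale hM j]
    rw [traceQ0Q0_eq]
    calc _ ≤ ∑ s : Coord N, qF M j s * (K * ((M : ℝ) ^ k)⁻¹) :=
          sum_le_sum fun s _ => mul_le_mul_of_nonneg_left (hq N k s) (qF_nonneg hM _ _)
      _ ≤ (4 * K * K0 ^ 2 * (M : ℝ) ^ j) * (K * ((M : ℝ) ^ k)⁻¹) := by
          rw [← sum_mul]
          exact mul_le_mul_of_nonneg_right (hsum N j) (by positivity)
      _ = 4 * K ^ 2 * K0 ^ 2 * ((M : ℝ) ^ (k - j))⁻¹ := by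
          have hk : (M : ℝ) ^ k = (M : ℝ) ^ j * (M : ℝ) ^ (k - j) := by
            rw [← pow_add]; congr 1; omega
          rw [hk]; field_simp
      _ ≤ _ := mul_le_mul_of_nonneg_left (hpow _) (by positivity)
  refine ⟨K + 4 * K ^ 2 * K0 ^ 2, by positivity, fun N j s => ?_, fun N j k => ?_⟩
  · refine (hq N j s).trans (mul_le_mul ?_ (hpow j) (by positivity) (by positivity))
    have : 0 ≤ 4 * K ^ 2 * K0 ^ 2 := by positivity
    linarith
  · rcases le_total j k with hjk | hjk
    · refine (htr N j k hjk).trans (mul_le_mul (by linarith) (le_of_eq ?_) (by positivity)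
        (by positivity))
      congr 1; omega
    · have e : traceQ0Q0 N M j k = traceQ0Q0 N M k j := by
        rw [traceQ0Q0_eq, traceQ0Q0_eq]; exact sum_congr rfl fun s _ => mul_comm _ _
      rw [e]
      refine (htr N k j hjk).trans (mul_le_mul (by linarith) (le_of_eq ?_) (by positivity)
        (by positivity))
      congr 1; omega

theorem exists_block_qF_bounds (hM : 2 ≤ M) : ∃ K : ℝ, 0 < K ∧
    ∀ {B : Type} [Fintype B] (N : ℕ) (j : B → ℕ), Function.Injective j →
      (∀ s : Coord N, ∑ b, qF M (j b) s ≤ K) ∧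
      (∑ a, ∑ b, traceQ0Q0 N M (j a) (j b) ≤ K * Fintype.card B) := by
  classical
  obtain ⟨K, hK, h1, h2⟩ := exists_qF_bounds hM
  refine ⟨4 * K, by positivity, fun {B} _ N j hj => ⟨fun s => ?_, ?_⟩⟩
  · calc _ ≤ ∑ b, K * (1 / 2 : ℝ) ^ (j b - 0 + (0 - j b)) :=
          sum_le_sum fun b _ => by simpa using h1 N (j b) s
      _ = K * ∑ k ∈ univ.image j, (1 / 2 : ℝ) ^ (k - 0 + (0 - k)) := by
          rw [sum_image fun a _ b _ h => hj h, mul_sum]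
      _ ≤ K * 4 := mul_le_mul_of_nonneg_left (sum_half_pow_dist_le _ 0) hK.le
      _ = _ := mul_comm _ _
  · have : ∀ a, ∑ b, traceQ0Q0 N M (j a) (j b) ≤ 4 * K := fun a => by
      calc _ ≤ ∑ b, K * (1 / 2 : ℝ) ^ (j b - j a + (j a - j b)) :=
            sum_le_sum fun b _ => (h2 N (j a) (j b)).trans_eq (by rw [add_comm])
        _ = K * ∑ k ∈ univ.image j, (1 / 2 : ℝ) ^ (k - j a + (j a - k)) := by
            rw [sum_image fun a _ b _ h => hj h, mul_sum]
        _ ≤ K * 4 := mul_le_mul_of_nonneg_left (sum_half_pow_dist_le _ _) hK.le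
        _ = _ := mul_comm _ _
    calc _ ≤ ∑ _a : B, 4 * K := sum_le_sum fun a _ => this a
      _ = _ := by rw [sum_const, card_univ, nsmul_eq_mul, mul_comm]

end Q0

/-! ### The quadratic interaction of degree at most two -/

section Tilde

variable {N M : ℕ}

/-- The weight of the diagonal quadratic form. -/
noncomputable def sliceSq (M j : ℕ) (n : MultiMode N) : ℝ :=
  if Slice M j n then cutProp M j (sqNorm n) ^ 2 else 0

/-- The sum of the renormalized amplitudes `a₂`. -/
noncomputable def am2 (n : MultiMode N) : ℝ := ∑ c, (a2Same (n c) + 3 * a2Other (n c))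

/-- `∑_n w_n ∑_{c ≠ c'} σ_c(n_c, n_c) σ_{c'}(n_{c'}, n_{c'})`. -/
noncomputable def diagForm (M j : ℕ) (x : Coord N → ℝ) : ℝ :=
  ∑ n : MultiMode N, sliceSq M j n *
    ∑ c, ∑ c', if c = c' then 0 else x (c, n c, n c) * x (c', n c', n c')

/-- The linear form coming from `Tr [D₂ Σ]`. -/
noncomputable def diagLin (M j : ℕ) (x : Coord N → ℝ) : ℝ :=
  ∑ n : MultiMode N, sliceSq M j n * am2 n * ∑ c, x (c, n c, n c)

/-- `Tr [D₁ Σ²]` in the slice `j`. -/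
noncomputable def yErr (M j : ℕ) (g : ℂ) (x : Coord N → ℝ) : ℂ :=
  (D1 N M j g * Sig M j g (toField x) ^ 2).trace
    - (D1 N M (j - 1) g * Sig M (j - 1) g (toField x) ^ 2).trace

theorem agree_self (c : Fin 4) (n : MultiMode N) : Agree c n n := fun _ _ => rfl

theorem eq_of_agree_agree {c c' : Fin 4} (h : c ≠ c') {n m : MultiMode N} (h1 : Agree c n m)
    (h2 : Agree c' n m) : n = m := by
  funext x
  by_cases hx : x = c
  · subst hx; exact h2 x h
  · exact h1 x hx

theorem sigmaOp_apply (σ : MatField N) (n m : MultiMode N) :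
    sigmaOp σ n m = ∑ c, if Agree c n m then σ c (n c) (m c) else 0 :=
  sum_congr rfl fun c _ => by
    by_cases h : Agree c n m
    · rw [if_pos h]; exact if_pos h
    · rw [if_neg h]; exact if_neg h

theorem sigmaOp_mul_symm (x : Coord N → ℝ) (n m : MultiMode N) :
    sigmaOp (toField x) n m * sigmaOp (toField x) m n
      = (((∑ c, if Agree c n m then ‖toField x c (n c) (m c)‖ ^ 2 else 0)
        + if n = m then ∑ c, ∑ c', (if c = c' then 0 else x (c, n c, n c) * x (c', n c', n c'))
          else 0 : ℝ) : ℂ) := by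
  have hsq : ∀ c a b, toField x c a b * toField x c b a = ((‖toField x c a b‖ ^ 2 : ℝ) : ℂ) := by
    intro c a b
    rw [← (toField_isHermitian x c).apply b a, ← Complex.normSq_eq_norm_sq]
    exact Complex.mul_conj _
  have hag : ∀ c, Agree c m n ↔ Agree c n m := fun c => ⟨Agree.symm, Agree.symm⟩
  rw [sigmaOp_apply, sigmaOp_apply, sum_mul_sum]
  simp only [hag]
  have hterm : ∀ c c' : Fin 4, (if Agree c n m then toField x c (n c) (m c) else 0) *
      (if Agree c' n m then toField x c' (m c') (n c') else 0)
      = (if c = c' then (if Agree c n m then ((‖toField x c (n c) (m c)‖ ^ 2 : ℝ) : ℂ) else 0) else 0)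
        + if n = m then (if c = c' then 0 else ((x (c, n c, n c) * x (c', n c', n c') : ℝ) : ℂ))
          else 0 := by
    intro c c'
    by_cases hc : c = c'
    · subst hc
      by_cases ha : Agree c n m
      · simp [ha, hsq]
      · simp [ha]
    · by_cases hn : n = m
      · subst hn
        simp [hc, agree_self, toField_self]
      · by_cases h1 : Agree c n m
        · have h2 : ¬ Agree c' n m := fun h2 => hn (eq_of_agree_agree hc h1 h2)
          simp [hc, hn, h2]
        · simp [hc, hn, h1]
  simp only [hterm, sum_add_distrib, sum_ite_eq, mem_univ, if_true]
  push_cast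
  congr 1
  · refine sum_congr rfl fun c _ => ?_
    split_ifs <;> push_cast <;> rfl
  · split_ifs
    · push_cast
      refine sum_congr rfl fun c _ => sum_congr rfl fun c' _ => ?_
      split_ifs <;> push_cast <;> rfl
    · simp

theorem Sig_mul_symm (j : ℕ) (g : ℂ) (σ : MatField N) (n m : MultiMode N) :
    Sig M j g σ n m * Sig M j g σ m n = -(lam g ^ 2) *
      (((cutProp M j (sqNorm n) * cutProp M j (sqNorm m) : ℝ) : ℂ)
        * (sigmaOp σ n m * sigmaOp σ m n)) := by
  have hs : ∀ n : MultiMode N, ((√(cutProp M j (sqNorm n)) : ℝ) : ℂ) ^ 2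
      = ((cutProp M j (sqNorm n) : ℝ) : ℂ) := fun n => by
    rw [← ofReal_pow, sq_sqrt (cutProp_nonneg' M j n)]
  rw [Sig_apply, Sig_apply, ofReal_mul, ← hs n, ← hs m]
  linear_combination (lam g ^ 2 * ((√(cutProp M j (sqNorm n)) : ℝ) : ℂ) ^ 2
    * ((√(cutProp M j (sqNorm m)) : ℝ) : ℂ) ^ 2 * (sigmaOp σ n m * sigmaOp σ m n)) * Complex.I_sq

theorem sum_agree_cutProp (j : ℕ) (x : Coord N → ℝ) :
    ∑ n : MultiMode N, ∑ m, cutProp M j (sqNorm n) * cutProp M j (sqNorm m) *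
      (∑ c, if Agree c n m then ‖toField x c (n c) (m c)‖ ^ 2 else 0)
      = ∑ c, ∑ a, ∑ b, q0Le M j a b * ‖toField x c a b‖ ^ 2 := by
  have h1 : ∀ n : MultiMode N, ∑ m, cutProp M j (sqNorm n) * cutProp M j (sqNorm m) *
      (∑ c, if Agree c n m then ‖toField x c (n c) (m c)‖ ^ 2 else 0)
      = ∑ c, ∑ b, cutProp M j (sqNorm n) * cutProp M j (sqNorm (update n c b)) *
        ‖toField x c (n c) b‖ ^ 2 := by
    intro n
    simp only [mul_sum]
    rw [sum_comm]
    refine sum_congr rfl fun c _ => ?_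
    have := sum_agree c n fun m => cutProp M j (sqNorm n) * cutProp M j (sqNorm m) *
      ‖toField x c (n c) (m c)‖ ^ 2
    simp only [update_self] at this
    rw [← this]
    exact sum_congr rfl fun m _ => by split_ifs <;> simp
  simp only [h1]
  rw [sum_comm]
  refine sum_congr rfl fun c _ => ?_
  rw [sum_multiMode c]
  refine sum_congr rfl fun a _ => ?_
  rw [sum_comm]
  refine sum_congr rfl fun b _ => ?_
  rw [q0Le_eq M j c, sum_mul]
  refine sum_congr rfl fun p _ => ?_
  have : update (c.insertNth a p : MultiMode N) c b = c.insertNth b p := by simp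
  rw [this]; simp

theorem trace_Sig_sq (j : ℕ) (g : ℂ) (x : Coord N → ℝ) :
    (Sig M j g (toField x) ^ 2).trace = -(lam g ^ 2) *
      ((∑ c, ∑ a, ∑ b, q0Le M j a b * ‖toField x c a b‖ ^ 2
        + ∑ n : MultiMode N, cutProp M j (sqNorm n) ^ 2 *
          ∑ c, ∑ c', (if c = c' then 0 else x (c, n c, n c) * x (c', n c', n c')) : ℝ) : ℂ) := by
  have h := trace_diagonal_mul_sq (fun _ => (1 : ℂ)) (Sig M j g (toField x))
  rw [show diagonal (fun _ : MultiMode N => (1 : ℂ)) = 1 from diagonal_one, one_mul] at h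
  rw [h, ← sum_agree_cutProp]
  simp only [one_mul, Sig_mul_symm, sigmaOp_mul_symm, ← mul_sum]
  congr 1
  simp only [← ofReal_mul, ← ofReal_sum]
  congr 1
  rw [← sum_add_distrib]
  refine sum_congr rfl fun n _ => ?_
  simp only [mul_add, sum_add_distrib, mul_ite, mul_zero, sum_ite_eq, mem_univ, if_true]
  rw [pow_two]

theorem lamSqQ1_toField (hM : 2 ≤ M) (j : ℕ) (g : ℂ) (x : Coord N → ℝ) :
    lamSqQ1 M j g (toField x) = lam g ^ 2 * (diagForm M j x : ℂ) - 2 * yErr M j g x := by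
  have htr : ∀ i : ℕ, lamSqQLe M i g (toField x) = -(Sig M i g (toField x) ^ 2).trace
      - 2 * (D1 N M i g * Sig M i g (toField x) ^ 2).trace := by
    intro i
    rw [lamSqQLe, mul_add, mul_one, trace_add, mul_smul_comm, trace_smul,
      trace_mul_comm, nsmul_eq_mul]
    push_cast; ring
  have hd : diagForm M j x = ∑ n : MultiMode N, cutProp M j (sqNorm n) ^ 2 *
        (∑ c, ∑ c', (if c = c' then 0 else x (c, n c, n c) * x (c', n c', n c')))
      - ∑ n : MultiMode N, cutProp M (j - 1) (sqNorm n) ^ 2 *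
        ∑ c, ∑ c', (if c = c' then 0 else x (c, n c, n c) * x (c', n c', n c')) := by
    rw [← sum_sub_distrib]
    refine sum_congr rfl fun n _ => ?_
    rw [cutProp_pred hM, sliceSq]
    split_ifs <;> simp
  have hq : quadQ0 M j (toField x) = ∑ c, ∑ a, ∑ b, q0Le M j a b * ‖toField x c a b‖ ^ 2
      - ∑ c, ∑ a, ∑ b, q0Le M (j - 1) a b * ‖toField x c a b‖ ^ 2 := by
    simp only [quadQ0, q0, sub_mul, sum_sub_distrib]
  rw [lamSqQ1, htr, htr, trace_Sig_sq, trace_Sig_sq, hd, hq, yErr]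
  push_cast; ring

theorem trace_D2_mul_Sig_sub (hM : 2 ≤ M) (j : ℕ) (g : ℂ) (x : Coord N → ℝ) :
    (D2 N M j g * Sig M j g (toField x)).trace - (D2 N M (j - 1) g * Sig M (j - 1) g (toField x)).trace
      = Complex.I * lam g ^ 5 * (diagLin M j x : ℂ) := by
  have htr : ∀ i : ℕ, (D2 N M i g * Sig M i g (toField x)).trace = ∑ n : MultiMode N,
      Complex.I * lam g ^ 5 *
        ((cutProp M i (sqNorm n) ^ 2 * am2 n * ∑ c, x (c, n c, n c) : ℝ) : ℂ) := by
    intro i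
    rw [D2_eq, Matrix.trace]
    refine sum_congr rfl fun n _ => ?_
    rw [diag_apply, diagonal_mul, Sig_apply, sigmaOp_apply, d2Fun]
    have hs : ((√(cutProp M i (sqNorm n)) : ℝ) : ℂ) ^ 2 = ((cutProp M i (sqNorm n) : ℝ) : ℂ) := by
      rw [← ofReal_pow, sq_sqrt (cutProp_nonneg' M i n)]
    simp only [agree_self, if_true, toField_self]
    rw [show (∑ c, (a2Same (n c) + 3 * a2Other (n c))) = am2 n from rfl]
    push_cast
    linear_combination (Complex.I * lam g ^ 5 * ((cutProp M i (sqNorm n) : ℝ) : ℂ) * (am2 n : ℂ)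
      * ∑ c, (x (c, n c, n c) : ℂ)) * hs
  rw [htr, htr, ← mul_sum, ← mul_sum, ← mul_sub, ← sum_sub_distrib]
  congr 1
  rw [diagLin, ofReal_sum]
  refine sum_congr rfl fun n _ => ?_
  rw [cutProp_pred hM, sliceSq, ← ofReal_sub]
  congr 1
  split_ifs <;> simp

theorem exists_norm_yErr_le (hM : 2 ≤ M) : ∃ K : ℝ, 0 < K ∧ ∀ (N j : ℕ) (g : ℂ) (x : Coord N → ℝ),
    ‖yErr M j g x‖ ≤ K * ‖lam g‖ ^ 4 * yF M j x := by
  obtain ⟨κ, hκ, hd⟩ := exists_norm_dFun_le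
  obtain ⟨K, hK, h⟩ := exists_edge_fine_le hM
  refine ⟨16 * κ * K, by positivity, fun N j g x => ?_⟩
  have hσ := toField_isHermitian x
  have h1 := norm_trace_diagonal_mul_sq_sub_le (sl := Slice M j) (norm_Sig_symm (M := M) j g hσ)
    (d1Fun M j g)
  have e : yErr M j g x = (diagonal (d1Fun M j g) * Sig M j g (toField x) ^ 2).trace
      - (compr (Slice M j) (diagonal (d1Fun M j g)) *
        compr (Slice M j) (Sig M j g (toField x)) ^ 2).trace := by
    rw [yErr, D1_eq, D1_eq, Sig_pred hM, d1Fun_pred hM, compr_diagonal]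
  rw [e]
  refine h1.trans ((quadSum_le (norm_Sig_le j g (toField x)) (fun n => norm_nonneg _)
    (fun n => (hd N M j g n).1)).trans ?_)
  have e2 : ∀ c : Fin 4, (∑ n : MultiMode N, ∑ m : MultiMode N, if Slice M j n then
      hop M j (fun c a b => ‖toField x c a b‖) c n m ^ 2 *
        (κ * ‖lam g‖ ^ 2 * cutProp M j (sqNorm n) ^ (1 / 2 : ℝ)
          + κ * ‖lam g‖ ^ 2 * cutProp M j (sqNorm m) ^ (1 / 2 : ℝ)) else 0)
      ≤ κ * ‖lam g‖ ^ 2 * (K * yF M j x) := by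
    intro c
    refine le_trans (le_of_eq ?_) (mul_le_mul_of_nonneg_left (h N j _ c) (by positivity))
    simp only [mul_sum]
    exact sum_congr rfl fun n _ => sum_congr rfl fun m _ => by split_ifs <;> ring
  calc _ ≤ 4 * ‖lam g‖ ^ 2 * ∑ _c : Fin 4, κ * ‖lam g‖ ^ 2 * (K * yF M j x) :=
        mul_le_mul_of_nonneg_left (sum_le_sum fun c _ => e2 c) (by positivity)
    _ = _ := by rw [sum_const, card_univ, Fintype.card_fin, nsmul_eq_mul]; push_cast; ring

theorem continuous_toField : Continuous fun x : Coord N → ℝ => toField x := by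
  refine continuous_pi fun c => continuous_matrix fun a b => ?_
  simp only [toField, of_apply]
  fun_prop

theorem continuous_Sig (j : ℕ) (g : ℂ) : Continuous fun x : Coord N → ℝ => Sig M j g (toField x) := by
  refine continuous_matrix fun n m => ?_
  simp only [Sig_apply, sigmaOp_apply]
  refine continuous_const.mul ((continuous_const.mul (continuous_finsetSum _ fun c _ => ?_)).mul
    continuous_const)
  split_ifs
  · exact ((continuous_apply c).comp continuous_toField).matrix_elem _ _
  · exact continuous_const

theorem continuous_yErr (j : ℕ) (g : ℂ) : Continuous (yErr (N := N) M j g) := by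
  unfold yErr
  exact (((continuous_const.matrix_mul ((continuous_Sig j g).pow 2)).matrix_trace).sub
    ((continuous_const.matrix_mul ((continuous_Sig (j - 1) g).pow 2)).matrix_trace))

end Tilde

section TildeGauss

variable {N M : ℕ}

/-- The indicator of the diagonal coordinate of colour `c` of `n`. -/
noncomputable def diagInd (n : MultiMode N) (c : Fin 4) (s : Coord N) : ℝ :=
  if s = (c, n c, n c) then 1 else 0

/-- The image of a weight on multi-momenta on diagonal coordinates. -/
noncomputable def diagMass (v : MultiMode N → ℝ) (s : Coord N) : ℝ := ∑ n, v n * ∑ c, diagInd n c s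

theorem diagInd_nonneg (n : MultiMode N) (c : Fin 4) (s : Coord N) : 0 ≤ diagInd n c s := by
  unfold diagInd; split_ifs <;> norm_num

theorem sum_diagInd_mul (n : MultiMode N) (c : Fin 4) (x : Coord N → ℝ) :
    ∑ s, diagInd n c s * x s = x (c, n c, n c) := by
  simp [diagInd]

theorem sum_diagInd (n : MultiMode N) (c : Fin 4) : ∑ s : Coord N, diagInd n c s = 1 := by
  simp [diagInd]

theorem diagMass_nonneg {v : MultiMode N → ℝ} (hv : ∀ n, 0 ≤ v n) (s : Coord N) : 0 ≤ diagMass v s :=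
  sum_nonneg fun n _ => mul_nonneg (hv n) (sum_nonneg fun _ _ => diagInd_nonneg _ _ _)

theorem sum_diagMass (v : MultiMode N → ℝ) : ∑ s, diagMass v s = 4 * ∑ n, v n := by
  unfold diagMass
  rw [sum_comm]
  simp only [← mul_sum]
  rw [mul_sum]
  refine sum_congr rfl fun n _ => ?_
  rw [sum_comm]
  simp only [sum_diagInd, sum_const, card_univ, Fintype.card_fin, nsmul_eq_mul]
  push_cast; ring

theorem diagMass_le {v : MultiMode N → ℝ} (hv : ∀ n, 0 ≤ v n) (s : Coord N) :
    diagMass v s ≤ ∑ p : Fin 3 → Mode N, v (s.1.insertNth s.2.1 p) := by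
  have h1 : ∀ n : MultiMode N, v n * ∑ c, diagInd n c s ≤ if n s.1 = s.2.1 then v n else 0 := by
    intro n
    have : ∑ c, diagInd n c s = diagInd n s.1 s := by
      refine sum_eq_single _ (fun c _ hc => ?_) (by simp)
      exact if_neg fun h => hc (by rw [h])
    rw [this, diagInd]
    by_cases h : n s.1 = s.2.1
    · rw [if_pos h]; refine mul_le_of_le_one_right (hv n) ?_; split_ifs <;> norm_num
    · rw [if_neg h, if_neg fun h' => h (by rw [h']), mul_zero]
  refine (sum_le_sum fun n _ => h1 n).trans (le_of_eq ?_)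
  rw [sum_multiMode s.1]
  simp

theorem exists_diagMass_slice_le (hM : 2 ≤ M) {β : ℝ} (hβ : 1 ≤ β) : ∃ K : ℝ, 0 < K ∧ ∀ N j : ℕ,
    (∀ s : Coord N, diagMass (fun n => if Slice M j n then cutProp M j (sqNorm n) ^ β else 0) s
      ≤ K * ((M : ℝ) ^ j) ^ (3 - 2 * β)) ∧
    ∑ s : Coord N, diagMass (fun n => if Slice M j n then cutProp M j (sqNorm n) ^ β else 0) s
      ≤ K * ((M : ℝ) ^ j) ^ (4 - 2 * β) := by
  obtain ⟨K1, hK1, h1⟩ := exists_sum_cutProp_insertNth_le M hM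
  obtain ⟨K2, hK2, h2⟩ := exists_slice_sum_le hM (β := β) (by linarith)
  have hM0 : (0 : ℝ) < (M : ℝ) ^ 2 := by
    have : (0 : ℝ) < M := by exact_mod_cast (by omega : 0 < M)
    positivity
  refine ⟨((M : ℝ) ^ 2) ^ (β - 1) * K1 + 4 * K2, by positivity, fun N j => ⟨fun s => ?_, ?_⟩⟩
  · have hR0 : 0 < (M : ℝ) ^ j := by linarith [one_le_scale hM j]
    have hv : ∀ n : MultiMode N, 0 ≤ (if Slice M j n then cutProp M j (sqNorm n) ^ β else 0) := fun n => by
      split_ifs; exacts [rpow_nonneg (cutProp_nonneg' _ _ _) _, le_rfl]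
    refine (diagMass_le hv s).trans ?_
    have hle : ∀ n : MultiMode N, (if Slice M j n then cutProp M j (sqNorm n) ^ β else 0)
        ≤ ((M : ℝ) ^ 2) ^ (β - 1) * ((M : ℝ) ^ j) ^ (-2 * (β - 1)) * cutProp M j (sqNorm n) := by
      intro n
      have hc := cutProp_nonneg' M j n
      split_ifs with hs
      · calc cutProp M j (sqNorm n) ^ β
            = cutProp M j (sqNorm n) ^ (β - 1) * cutProp M j (sqNorm n) := by
              nth_rewrite 3 [← rpow_one (cutProp M j (sqNorm n))]
              rw [← rpow_add_of_nonneg hc (by linarith) zero_le_one]; congr 1; ring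
          _ ≤ _ := mul_le_mul_of_nonneg_right (cutProp_rpow_le_of_slice hM hs (by linarith)) hc
      · positivity
    refine (sum_le_sum fun p _ => hle _).trans ?_
    rw [← mul_sum]
    calc _ ≤ ((M : ℝ) ^ 2) ^ (β - 1) * ((M : ℝ) ^ j) ^ (-2 * (β - 1)) * (K1 * (M : ℝ) ^ j * 1) := by
          refine mul_le_mul_of_nonneg_left ((h1 N j _ _).trans ?_) (by positivity)
          exact mul_le_mul_of_nonneg_left (bw_le_one le_rfl _) (by positivity)
      _ = ((M : ℝ) ^ 2) ^ (β - 1) * K1 * ((M : ℝ) ^ j) ^ (3 - 2 * β) := by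
          rw [show (3 - 2 * β) = -2 * (β - 1) + 1 by ring, rpow_add hR0, rpow_one]; ring
      _ ≤ _ := mul_le_mul_of_nonneg_right (by linarith) (by positivity)
  · rw [sum_diagMass]
    have hR0 : 0 < (M : ℝ) ^ j := by linarith [one_le_scale hM j]
    have hp : 0 ≤ ((M : ℝ) ^ 2) ^ (β - 1) * K1 * ((M : ℝ) ^ j) ^ (4 - 2 * β) := by positivity
    have := h2 N j
    nlinarith

theorem exists_abs_am2_le : ∃ κ : ℝ, 0 < κ ∧ ∀ (N M j : ℕ) (n : MultiMode N),
    |cutProp M j (sqNorm n) * am2 n| ≤ κ * cutProp M j (sqNorm n) ^ (7 / 8 : ℝ) := by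
  obtain ⟨κ, hκ, h⟩ := exists_norm_dFun_le
  refine ⟨κ, hκ, fun N M j n => ?_⟩
  have := (h N M j 1 n).2
  have hl : lam 1 = 1 := by simp [lam]
  rw [d2Fun, hl] at this
  simp only [one_pow, one_mul, norm_one, mul_one, norm_real, norm_eq_abs] at this
  exact this

/-- Matrix of the form `diagForm`. -/
noncomputable def diagMat (N M j : ℕ) : Matrix (Coord N) (Coord N) ℝ := fun s t =>
  ∑ n : MultiMode N, sliceSq M j n * ∑ c, ∑ c', if c = c' then 0 else diagInd n c s * diagInd n c' t

theorem sliceSq_nonneg (n : MultiMode N) (j : ℕ) : 0 ≤ sliceSq M j n := by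
  unfold sliceSq; split_ifs <;> positivity

theorem diagMat_nonneg (j : ℕ) (s t : Coord N) : 0 ≤ diagMat N M j s t :=
  sum_nonneg fun n _ => mul_nonneg (sliceSq_nonneg _ _) (sum_nonneg fun c _ =>
    sum_nonneg fun c' _ => by
      split_ifs; exacts [le_rfl, mul_nonneg (diagInd_nonneg _ _ _) (diagInd_nonneg _ _ _)])

theorem diagMat_isHermitian (j : ℕ) : (diagMat N M j).IsHermitian := by
  ext s t
  rw [conjTranspose_apply, star_trivial, diagMat, diagMat]
  refine sum_congr rfl fun n _ => congrArg _ ?_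
  rw [sum_comm]
  refine sum_congr rfl fun c _ => sum_congr rfl fun c' _ => ?_
  by_cases h : c = c'
  · rw [if_pos h, if_pos h.symm]
  · rw [if_neg h, if_neg fun h' => h h'.symm, mul_comm]

theorem diagMat_diag (j : ℕ) (s : Coord N) : diagMat N M j s s = 0 := by
  refine sum_eq_zero fun n _ => ?_
  rw [sum_eq_zero fun c _ => sum_eq_zero fun c' _ => ?_, mul_zero]
  split_ifs with h
  · rfl
  · rw [diagInd, diagInd]
    by_cases h1 : s = (c, n c, n c)
    · rw [if_neg (c := s = (c', n c', n c')) fun h2 => h (by rw [h1] at h2; exact congrArg Prod.fst h2),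
        mul_zero]
    · rw [if_neg h1, zero_mul]

theorem sum_diagMat (j : ℕ) (x : Coord N → ℝ) :
    ∑ s, ∑ t, diagMat N M j s t * (x s * x t) = diagForm M j x := by
  unfold diagMat diagForm
  calc _ = ∑ n : MultiMode N, sliceSq M j n * ∑ c, ∑ c', ∑ s, ∑ t,
        (if c = c' then 0 else diagInd n c s * diagInd n c' t) * (x s * x t) := by
        simp only [sum_mul, mul_sum]
        refine ((sum_congr rfl fun s _ => sum_comm).trans sum_comm).trans (sum_congr rfl fun n _ => ?_)
        refine ((sum_congr rfl fun s _ => sum_comm).trans sum_comm).trans (sum_congr rfl fun c _ => ?_)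
        refine ((sum_congr rfl fun s _ => sum_comm).trans sum_comm).trans ?_
        exact sum_congr rfl fun c' _ => sum_congr rfl fun s _ => sum_congr rfl fun t _ => by ring
    _ = _ := by
        refine sum_congr rfl fun n _ => congrArg _ (sum_congr rfl fun c _ =>
          sum_congr rfl fun c' _ => ?_)
        by_cases h : c = c'
        · simp [h]
        · simp only [h, if_false]
          rw [← sum_diagInd_mul n c x, ← sum_diagInd_mul n c' x, sum_mul_sum]
          exact sum_congr rfl fun s _ => sum_congr rfl fun t _ => by ring

theorem sum_diagMat_row_le (j : ℕ) (s : Coord N) :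
    ∑ t, diagMat N M j s t ≤ 4 * diagMass (fun n => sliceSq M j n) s := by
  have e : ∑ t, diagMat N M j s t = ∑ n : MultiMode N, sliceSq M j n *
      ∑ c, ∑ c', if c = c' then 0 else diagInd n c s := by
    unfold diagMat
    rw [sum_comm]
    refine sum_congr rfl fun n _ => ?_
    rw [← mul_sum, sum_comm]
    refine congrArg _ (sum_congr rfl fun c _ => ?_)
    rw [sum_comm]
    refine sum_congr rfl fun c' _ => ?_
    split_ifs
    · simp
    · rw [← mul_sum, sum_diagInd, mul_one]
  rw [e, diagMass, mul_sum]
  refine sum_le_sum fun n _ => ?_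
  rw [mul_left_comm]
  refine mul_le_mul_of_nonneg_left ?_ (sliceSq_nonneg _ _)
  rw [mul_sum]
  refine sum_le_sum fun c _ => ?_
  calc _ ≤ ∑ _c' : Fin 4, diagInd n c s := sum_le_sum fun c' _ => by
        split_ifs; exacts [diagInd_nonneg _ _ _, le_rfl]
    _ = _ := by rw [sum_const, card_univ, Fintype.card_fin, nsmul_eq_mul]; push_cast; ring

theorem diagLin_eq (j : ℕ) (x : Coord N → ℝ) :
    diagLin M j x = ∑ s, diagMass (fun n => sliceSq M j n * am2 n) s * x s := by
  simp only [diagMass, sum_mul]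
  rw [sum_comm]
  refine sum_congr rfl fun n _ => ?_
  simp only [mul_assoc, ← mul_sum]
  refine congrArg _ (congrArg _ ?_)
  simp only [sum_mul]
  rw [sum_comm]
  exact sum_congr rfl fun c _ => (sum_diagInd_mul n c x).symm

/-- Exponential moment of the quadratic and linear parts supported by the diagonal entries. -/
theorem exists_integral_exp_diag_le (hM : 2 ≤ M) : ∃ K : ℝ, 0 < K ∧ ∀ (N j : ℕ) (t u : ℝ),
    K * |t| ≤ (M : ℝ) ^ j →
    Integrable (fun x : Config N => exp (t * diagForm M j x + u * diagLin M j x))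
      (nuStd N) ∧
    ∫ x : Config N, exp (t * diagForm M j x + u * diagLin M j x) ∂(nuStd N)
      ≤ exp (K * (t ^ 2 + u ^ 2) * ((M : ℝ) ^ j) ^ (-(1 / 2) : ℝ)) := by
  obtain ⟨K1, hK1, h1⟩ := exists_diagMass_slice_le hM (β := 2) (by norm_num)
  obtain ⟨K2, hK2, h2⟩ := exists_diagMass_slice_le hM (β := 15 / 8) (by norm_num)
  obtain ⟨κ, hκ, ha⟩ := exists_abs_am2_le
  set K := 16 * K1 + 32 * K1 ^ 2 + κ ^ 2 * K2 ^ 2 with hKdef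
  refine ⟨K, by positivity, fun N j t u ht => ?_⟩
  have hR := one_le_scale hM j
  obtain ⟨h1a, h1b⟩ := h1 N j
  obtain ⟨h2a, h2b⟩ := h2 N j
  set R := (M : ℝ) ^ j with hRdef
  have hR0 : 0 < R := by linarith
  have hsq : (fun n : MultiMode N => if Slice M j n then cutProp M j (sqNorm n) ^ (2 : ℝ) else 0)
      = fun n => sliceSq M j n := by
    funext n; unfold sliceSq; norm_cast
  rw [hsq] at h1a h1b
  rw [show (3 - 2 * 2 : ℝ) = -1 by norm_num, rpow_neg_one] at h1a
  rw [show (4 - 2 * 2 : ℝ) = 0 by norm_num, rpow_zero, mul_one] at h1b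
  set w : MultiMode N → ℝ := fun n => if Slice M j n then cutProp M j (sqNorm n) ^ (15 / 8 : ℝ) else 0
    with hw
  have hlw : ∀ n : MultiMode N, |sliceSq M j n * am2 n| ≤ κ * w n := by
    intro n
    simp only [sliceSq, hw]
    split_ifs
    · have hC := cutProp_nonneg' M j n
      rw [pow_two, mul_assoc, abs_mul, abs_of_nonneg hC]
      calc _ ≤ cutProp M j (sqNorm n) * (κ * cutProp M j (sqNorm n) ^ (7 / 8 : ℝ)) :=
            mul_le_mul_of_nonneg_left (ha N M j n) hC
        _ = κ * (cutProp M j (sqNorm n) ^ (1 : ℝ) * cutProp M j (sqNorm n) ^ (7 / 8 : ℝ)) := by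
            rw [rpow_one]; ring
        _ = _ := by rw [← rpow_add_of_nonneg hC zero_le_one (by norm_num)]; norm_num
    · simp
  have hl : ∀ s : Coord N, |diagMass (fun n => sliceSq M j n * am2 n) s| ≤ κ * diagMass w s := by
    intro s
    unfold diagMass
    rw [mul_sum]
    refine (abs_sum_le_sum_abs _ _).trans (sum_le_sum fun n _ => ?_)
    rw [abs_mul, abs_of_nonneg (sum_nonneg fun c _ => diagInd_nonneg _ _ _), ← mul_assoc]
    exact mul_le_mul_of_nonneg_right (hlw n) (sum_nonneg fun c _ => diagInd_nonneg _ _ _)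
  have hw0 : ∀ s : Coord N, 0 ≤ diagMass w s := diagMass_nonneg fun n => by
    simp only [hw]
    split_ifs; exacts [rpow_nonneg (cutProp_nonneg' _ _ _) _, le_rfl]
  set r := |t| * (4 * (K1 * R⁻¹)) with hr
  have hr0 : 0 ≤ r := by positivity
  have hr4 : r ≤ 1 / 4 := by
    have : 16 * K1 * |t| ≤ R := le_trans (mul_le_mul_of_nonneg_right (by
      rw [hKdef]; have : 0 ≤ 32 * K1 ^ 2 + κ ^ 2 * K2 ^ 2 := by positivity
      linarith) (abs_nonneg t)) ht
    have e : r = (16 * K1 * |t|) / R / 4 := by rw [hr]; field_simp; ring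
    rw [e, div_le_div_iff_of_pos_right (by norm_num), div_le_one hR0]
    exact this
  have hrow : ∀ s : Coord N, ∑ s', |(t • diagMat N M j) s s'| ≤ r := by
    intro s
    simp only [Matrix.smul_apply, smul_eq_mul, abs_mul, abs_of_nonneg (diagMat_nonneg j s _)]
    rw [← mul_sum]
    refine mul_le_mul_of_nonneg_left ((sum_diagMat_row_le j s).trans ?_) (abs_nonneg t)
    exact mul_le_mul_of_nonneg_left (h1a s) (by norm_num)
  have hT : ∑ s, ∑ s', |(t • diagMat N M j) s s'| ≤ |t| * (4 * K1) := by
    simp only [Matrix.smul_apply, smul_eq_mul, abs_mul, abs_of_nonneg (diagMat_nonneg j _ _)]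
    simp only [← mul_sum]
    refine mul_le_mul_of_nonneg_left ?_ (abs_nonneg t)
    refine (sum_le_sum fun s _ => sum_diagMat_row_le j s).trans ?_
    rw [← mul_sum]
    exact mul_le_mul_of_nonneg_left h1b (by norm_num)
  have hA : (t • diagMat N M j).IsHermitian := by
    rw [Matrix.IsHermitian, Matrix.conjTranspose_smul, star_trivial, (diagMat_isHermitian j).eq]
  have hmain := integral_exp_quadratic_le hA hr4 hrow
    fun s => u * diagMass (fun n => sliceSq M j n * am2 n) s
  have htr : (t • diagMat N M j).trace = 0 := by
    rw [trace_smul, Matrix.trace, sum_eq_zero (f := (diagMat N M j).diag) fun s _ => diagMat_diag j s, smul_zero]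
  have e : ∀ x : Config N,
      ∑ s, ∑ s', (t • diagMat N M j) s s' * (x s * x s') - (t • diagMat N M j).trace
        + ∑ s, u * diagMass (fun n => sliceSq M j n * am2 n) s * x s
      = t * diagForm M j x + u * diagLin M j x := by
    intro x
    rw [htr, sub_zero, ← sum_diagMat, diagLin_eq, mul_sum, mul_sum]
    simp only [Matrix.smul_apply, smul_eq_mul, mul_sum, mul_assoc]
  simp only [e] at hmain
  refine ⟨hmain.1, hmain.2.trans (exp_le_exp.2 ?_)⟩
  have hRi : R⁻¹ ≤ R ^ (-(1 / 2) : ℝ) := by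
    rw [← rpow_neg_one]; exact rpow_le_rpow_of_exponent_le hR (by norm_num)
  have hp : 0 ≤ R ^ (-(1 / 2) : ℝ) := by positivity
  have hq : 2 * (r * ∑ s, ∑ s', |(t • diagMat N M j) s s'|)
      ≤ 32 * K1 ^ 2 * t ^ 2 * R ^ (-(1 / 2) : ℝ) := by
    calc _ ≤ 2 * (r * (|t| * (4 * K1))) := by gcongr
      _ = 32 * K1 ^ 2 * |t| ^ 2 * R⁻¹ := by rw [hr]; ring
      _ ≤ _ := by rw [sq_abs]; gcongr
  have hb : ∑ s : Coord N, (u * diagMass (fun n => sliceSq M j n * am2 n) s) ^ 2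
      ≤ κ ^ 2 * K2 ^ 2 * u ^ 2 * R ^ (-(1 / 2) : ℝ) := by
    calc _ ≤ ∑ s, u ^ 2 * (κ ^ 2 * (K2 * R ^ (3 - 2 * (15 / 8) : ℝ) * diagMass w s)) :=
          sum_le_sum fun s _ => by
            rw [mul_pow]
            refine mul_le_mul_of_nonneg_left ?_ (sq_nonneg u)
            rw [← sq_abs]
            calc _ ≤ (κ * diagMass w s) ^ 2 := pow_le_pow_left₀ (abs_nonneg _) (hl s) 2
              _ = κ ^ 2 * (diagMass w s * diagMass w s) := by ring
              _ ≤ _ := mul_le_mul_of_nonneg_left (mul_le_mul_of_nonneg_right (h2a s) (hw0 s))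
                  (by positivity)
      _ = u ^ 2 * κ ^ 2 * (K2 * R ^ (3 - 2 * (15 / 8) : ℝ)) * ∑ s, diagMass w s := by
          rw [mul_sum]; exact sum_congr rfl fun s _ => by ring
      _ ≤ u ^ 2 * κ ^ 2 * (K2 * R ^ (3 - 2 * (15 / 8) : ℝ)) * (K2 * R ^ (4 - 2 * (15 / 8) : ℝ)) :=
          mul_le_mul_of_nonneg_left h2b (by positivity)
      _ = κ ^ 2 * K2 ^ 2 * u ^ 2 * (R ^ (3 - 2 * (15 / 8) : ℝ) * R ^ (4 - 2 * (15 / 8) : ℝ)) := by ring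
      _ = _ := by rw [← rpow_add hR0]; norm_num
  have h3 : 0 ≤ 16 * K1 * (t ^ 2 + u ^ 2) * R ^ (-(1 / 2) : ℝ) := by positivity
  have h4 : 0 ≤ 32 * K1 ^ 2 * u ^ 2 * R ^ (-(1 / 2) : ℝ) := by positivity
  have h5 : 0 ≤ κ ^ 2 * K2 ^ 2 * t ^ 2 * R ^ (-(1 / 2) : ℝ) := by positivity
  rw [hKdef]
  linarith

end TildeGauss

/-! ### Exponential moments of the interaction of degree at least three -/

section Moments

variable {N M : ℕ}

instance : IsProbabilityMeasure (nuStd N) := isProbabilityMeasure_stdGaussian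

theorem stronglyMeasurable_trLogOneSub {X : Type*} [TopologicalSpace X] [MeasurableSpace X]
    [OpensMeasurableSpace X] [SecondCountableTopology X] {A : X → Op N} (hA : Continuous A) :
    StronglyMeasurable fun x => trLogOneSub (A x) := by
  have h1 : Continuous fun z : X × ℝ => (1 - (z.2 : ℂ) • A z.1) := by fun_prop
  have h2 : StronglyMeasurable (Function.uncurry fun (x : X) (t : ℝ) =>
      (A x * (1 - (t : ℂ) • A x)⁻¹).trace) := by
    have e : (Function.uncurry fun (x : X) (t : ℝ) => (A x * (1 - (t : ℂ) • A x)⁻¹).trace)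
        = fun z : X × ℝ => (1 - (z.2 : ℂ) • A z.1).det⁻¹ *
          (A z.1 * (1 - (z.2 : ℂ) • A z.1).adjugate).trace := by
      funext z
      rw [Function.uncurry, Matrix.inv_def, Ring.inverse_eq_inv', mul_smul_comm, trace_smul,
        smul_eq_mul]
    rw [e]
    have m1 : Measurable fun z : X × ℝ => (1 - (z.2 : ℂ) • A z.1).det := h1.matrix_det.measurable
    have m2 : Measurable fun z : X × ℝ => (A z.1 * (1 - (z.2 : ℂ) • A z.1).adjugate).trace :=
      (((hA.comp continuous_fst).matrix_mul h1.matrix_adjugate).matrix_trace).measurable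
    exact (m1.inv.mul m2).stronglyMeasurable
  have h3 := StronglyMeasurable.integral_prod_right (ν := volume.restrict (Set.Ioc (0 : ℝ) 1)) h2
  simp only [trLogOneSub, intervalIntegral.integral_of_le zero_le_one]
  exact h3.neg

theorem measurable_VGe3 (j : ℕ) (g : ℂ) :
    Measurable fun x : Coord N → ℝ => VGe3 M j g (toField x) := by
  have h : ∀ i : ℕ, Measurable fun x : Coord N → ℝ => VGe3Le M i g (toField x) := by
    intro i
    have hS : Continuous fun x : Coord N → ℝ => Sig M i g (toField x) := continuous_Sig i g
    have hU : Continuous fun x : Coord N → ℝ => U M i g (toField x) :=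
      (hS.add continuous_const).add continuous_const
    have h1 := (stronglyMeasurable_trLogOneSub hU).measurable
    have h2 := hU.matrix_trace.measurable
    have h3 := (hU.pow 2).matrix_trace.measurable
    have h4 := (continuous_const.matrix_mul (hS.pow 2) : Continuous fun x => D1 N M i g *
      Sig M i g (toField x) ^ 2).matrix_trace.measurable
    unfold VGe3Le trLog3
    exact ((((h2.add (h3.const_mul _)).add h1).add h4).add measurable_const)
  exact (h j).sub (h (j - 1))

theorem continuous_yF (j : ℕ) : Continuous (yF (N := N) M j) := by
  unfold yF yq yCol
  have h : ∀ c a b, Continuous fun x : Coord N → ℝ => ‖toField x c a b‖ := fun c a b =>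
    (((continuous_apply c).comp continuous_toField).matrix_elem a b).norm
  fun_prop

theorem continuous_gF (j : ℕ) : Continuous (gF (N := N) M j) := by
  unfold gF gq gCol dCol
  have h : ∀ c a b, Continuous fun x : Coord N → ℝ => ‖toField x c a b‖ := fun c a b =>
    (((continuous_apply c).comp continuous_toField).matrix_elem a b).norm
  fun_prop

theorem measurable_ofLp_comp {A : Type*} [MeasurableSpace A] {f : (Coord N → ℝ) → A}
    (hf : Measurable f) : Measurable fun x : Config N => f fun s => x s :=
  hf.comp (by fun_prop)

theorem one_add_pow_four_le {y : ℝ} (hy : 0 ≤ y) :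
    (1 + y) ^ 4 ≤ 24 * 8 ^ 4 * exp (1 / 8) * exp (1 / 8 * y) := by
  have := pow_div_factorial_le_exp (x := (1 + y) / 8) (by positivity) 4
  rw [mul_assoc, ← exp_add, show (1 / 8 + 1 / 8 * y : ℝ) = (1 + y) / 8 by ring]
  rw [div_pow, show ((Nat.factorial 4 : ℕ) : ℝ) = 24 by norm_num [Nat.factorial]] at this
  rw [div_div, div_le_iff₀ (by norm_num)] at this
  linarith

theorem exists_integral_polynomial_le (hM : 2 ≤ M) : ∃ K : ℝ, 0 < K ∧ ∀ N j : ℕ,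
    Integrable (fun x : Config N => ((1 + yF M j x) * (1 + gF M j x)) ^ 2) (nuStd N) ∧
    ∫ x : Config N, ((1 + yF M j x) * (1 + gF M j x)) ^ 2 ∂(nuStd N) ≤ K := by
  obtain ⟨K1, hK1, h1⟩ := exists_integral_exp_yF_le hM
  obtain ⟨K2, hK2, h2⟩ := exists_integral_exp_gF_le hM
  set c : ℝ := 24 * 8 ^ 4 * exp (1 / 8) with hc
  have hc0 : 0 < c := by positivity
  refine ⟨c * exp (K1 * (1 / 8)) + c * exp (K2 * (1 / 8)), by positivity, fun N j => ?_⟩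
  have hR := one_le_scale hM j
  obtain ⟨i1, e1⟩ := h1 N j (1 / 8) (by norm_num) (by
    have := one_le_rpow hR (show (0 : ℝ) ≤ 7 / 4 by norm_num); linarith)
  obtain ⟨i2, e2⟩ := h2 N j (1 / 8) (by norm_num) (by
    have := one_le_rpow hR (show (0 : ℝ) ≤ 1 / 4 by norm_num); linarith)
  have hdom : ∀ x : Config N, ((1 + yF M j x) * (1 + gF M j x)) ^ 2
      ≤ c * exp (1 / 8 * yF M j x) + c * exp (1 / 8 * gF M j x) := by
    intro x
    have p1 := one_add_pow_four_le (yF_nonneg hM j x)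
    have p2 := one_add_pow_four_le (gF_nonneg hM j x)
    have : ((1 + yF M j x) * (1 + gF M j x)) ^ 2 ≤ (1 + yF M j x) ^ 4 + (1 + gF M j x) ^ 4 := by
      nlinarith [sq_nonneg ((1 + yF M j x) ^ 2 - (1 + gF M j x) ^ 2),
        sq_nonneg ((1 + yF M j x) ^ 2), sq_nonneg ((1 + gF M j x) ^ 2)]
    exact this.trans (add_le_add p1 p2)
  have hi := (i1.const_mul c).add (i2.const_mul c)
  have hint : Integrable (fun x : Config N => ((1 + yF M j x) * (1 + gF M j x)) ^ 2)
      (nuStd N) := by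
    refine hi.mono' ?_ (Eventually.of_forall fun x => ?_)
    · exact (measurable_ofLp_comp (((measurable_const.add (continuous_yF j).measurable).mul
        (measurable_const.add (continuous_gF j).measurable)).pow_const 2)).aestronglyMeasurable
    · rw [norm_of_nonneg (sq_nonneg _)]; exact hdom x
  refine ⟨hint, (integral_mono hint hi hdom).trans ?_⟩
  rw [integral_add' (i1.const_mul c) (i2.const_mul c), integral_const_mul, integral_const_mul]
  gcongr

set_option maxHeartbeats 1000000 in
/-- Exponential moments of `V^{≥ 3}`, of an order growing with the scale. -/
theorem exists_integral_exp_VGe3_le (hM : 2 ≤ M) {κ : ℝ} (hκ : 0 < κ) : ∃ ρ₁ K : ℝ, 0 < ρ₁ ∧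
    ρ₁ ≤ 1 ∧ 0 < K ∧ ∀ ρ : ℝ, 0 < ρ → ρ ≤ ρ₁ → ∀ g ∈ cardioid ρ, ∀ (N j : ℕ) (p : ℝ), 0 ≤ p →
      p ≤ κ * ((M : ℝ) ^ j) ^ (1 / 4 : ℝ) →
      Integrable (fun x : Config N =>
        exp (4 * p * ‖VGe3 M j g (toField fun s => x s)‖)) (nuStd N) ∧
      ∫ x : Config N, exp (4 * p * ‖VGe3 M j g (toField fun s => x s)‖)
        ∂(nuStd N) ≤ exp (K * p * ρ ^ (3 / 2 : ℝ)) := by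
  obtain ⟨ρ₀, K, hρ₀, hρ₀1, hK, hV⟩ := exists_norm_VGe3_le hM
  obtain ⟨Ky, hKy, hy⟩ := exists_integral_exp_yF_le hM
  obtain ⟨Kg, hKg, hg⟩ := exists_integral_exp_gF_le hM
  obtain ⟨C, hC, hP⟩ := exists_integral_polynomial_le hM
  set Y : ℝ := 1 / 2 + 3 / 2 * Ky with hY
  have hY0 : 0 < Y := by positivity
  set K' : ℝ := 8 * K * (1 + Y) * (1 + Kg) with hK'
  have hK'0 : 0 < K' := by positivity
  refine ⟨min ρ₀ (min (1 / (64 * κ * K * (1 + Y))) (1 / (256 * κ * K))), K' + 2 * K * C + 4 * K,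
    by positivity, (min_le_left _ _).trans hρ₀1, by positivity, fun ρ hρ hρ1 g hgc N j p hp0 hp => ?_⟩
  have hρ0 : ρ ≤ ρ₀ := hρ1.trans (min_le_left _ _)
  have hρa : ρ * (64 * κ * K * (1 + Y)) ≤ 1 :=
    (le_div_iff₀ (by positivity)).1 (hρ1.trans ((min_le_right _ _).trans (min_le_left _ _)))
  have hρb : ρ * (256 * κ * K) ≤ 1 :=
    (le_div_iff₀ (by positivity)).1 (hρ1.trans ((min_le_right _ _).trans (min_le_right _ _)))
  have hρone : ρ ≤ 1 := hρ0.trans hρ₀1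
  have hR := one_le_scale hM j
  have hb : ∀ x : Config N,
      ‖VGe3 M j g (toField fun s => x s)‖ ≤ K * ρ ^ (3 / 2 : ℝ) * ((1 + yF M j x) * (1 + gF M j x)) ∧
      ‖VGe3 M j g (toField fun s => x s)‖ ≤ K * ρ * (((M : ℝ) ^ j) ^ (3 / 2 : ℝ) * (1 + yF M j x)) :=
    fun x => (hV ρ hρ hρ0 g hgc N j _ (toField_isHermitian _)).2
  obtain ⟨iP, eP⟩ := hP N j
  set R := (M : ℝ) ^ j with hRdef
  have hR0 : 0 < R := by linarith
  have hR74 : 1 ≤ R ^ (7 / 4 : ℝ) := one_le_rpow hR (by norm_num)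
  set r := ρ ^ (3 / 2 : ℝ) with hr
  have hr0 : 0 < r := by positivity
  have hrρ : r ≤ ρ := by
    calc r ≤ ρ ^ (1 : ℝ) := rpow_le_rpow_of_exponent_ge hρ hρone (by norm_num)
      _ = ρ := rpow_one _
  set v : Config N → ℝ := fun x => ‖VGe3 M j g (toField fun s => x s)‖ with hv
  have hvm : Measurable v := (measurable_ofLp_comp (measurable_VGe3 j g)).norm
  -- exponential moment of twice the order
  set tg := 8 * p * K * r * (1 + Y) with htg
  have htg0 : 0 ≤ tg := by positivity
  obtain ⟨ig, eg⟩ := hg N j tg htg0 (by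
    calc tg ≤ 8 * (κ * R ^ (1 / 4 : ℝ)) * K * ρ * (1 + Y) := by rw [htg]; gcongr
      _ = (ρ * (64 * κ * K * (1 + Y))) * R ^ (1 / 4 : ℝ) / 8 := by ring
      _ ≤ 1 * R ^ (1 / 4 : ℝ) / 8 := by gcongr
      _ = _ := by rw [one_mul])
  set s := R ^ (7 / 4 : ℝ) / 8 with hs
  have hs0 : 0 < s := by positivity
  obtain ⟨iy, ey⟩ := hy N j (3 / 4 * s) (by positivity) (by rw [hs]; linarith)
  have hdom : ∀ x, exp (8 * p * v x) ≤ exp tg * exp (tg * gF M j x)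
      + exp (s / 4 - s * Y / 2) * exp (3 / 4 * s * yF M j x) := by
    intro x
    have hy0 := yF_nonneg hM j x
    have hg0 := gF_nonneg hM j x
    rw [← exp_add, ← exp_add]
    rcases le_or_gt (yF M j x) Y with h | h
    · refine le_add_of_le_of_nonneg (exp_le_exp.2 ?_) (exp_pos _).le
      calc 8 * p * v x ≤ 8 * p * (K * r * ((1 + Y) * (1 + gF M j x))) := by
            refine mul_le_mul_of_nonneg_left ((hb x).1.trans ?_) (by positivity)
            gcongr
        _ = _ := by rw [htg]; ring
    · refine le_add_of_nonneg_of_le (exp_pos _).le (exp_le_exp.2 ?_)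
      have h1 : 8 * p * v x ≤ s / 4 * (1 + yF M j x) := by
        calc 8 * p * v x ≤ 8 * (κ * R ^ (1 / 4 : ℝ)) * (K * ρ * (R ^ (3 / 2 : ℝ) * (1 + yF M j x))) := by
              refine mul_le_mul (by gcongr) (hb x).2 (norm_nonneg _) (by positivity)
          _ = (ρ * (256 * κ * K)) * (R ^ (1 / 4 : ℝ) * R ^ (3 / 2 : ℝ)) / 32 * (1 + yF M j x) := by ring
          _ ≤ 1 * (R ^ (1 / 4 : ℝ) * R ^ (3 / 2 : ℝ)) / 32 * (1 + yF M j x) := by gcongr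
          _ = _ := by rw [← rpow_add hR0, hs, show (1 / 4 + 3 / 2 : ℝ) = 7 / 4 by norm_num]; ring
      linarith only [h1, mul_pos hs0 (sub_pos.2 h)]
  obtain ⟨i8, e8'⟩ := integrable_exp_of_le (hvm.const_mul _) ((ig.const_mul (exp tg)).add
    (iy.const_mul (exp (s / 4 - s * Y / 2)))) hdom
  have e8 : ∫ x, exp (8 * p * v x) ∂(nuStd N) ≤ 2 * exp (K' * (p * r)) := by
    refine e8'.trans ?_
    rw [integral_add' (ig.const_mul _) (iy.const_mul _), integral_const_mul, integral_const_mul]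
    have h1 : exp tg * ∫ x : Config N, exp (tg * gF M j x) ∂(nuStd N)
        ≤ exp (K' * (p * r)) := by
      refine (mul_le_mul_of_nonneg_left eg (exp_pos _).le).trans_eq ?_
      rw [← exp_add, htg, hK']; congr 1; ring
    have h2 : exp (s / 4 - s * Y / 2) *
        ∫ x : Config N, exp (3 / 4 * s * yF M j x) ∂(nuStd N) ≤ 1 := by
      refine (mul_le_mul_of_nonneg_left ey (exp_pos _).le).trans ?_
      rw [← exp_add]
      refine exp_le_one_iff.2 (le_of_eq ?_)
      rw [hY]; ring
    have h3 : 1 ≤ exp (K' * (p * r)) := one_le_exp (by positivity)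
    linarith
  have hle : ∀ x, exp (4 * p * v x) ≤ 1 + 2 * (p * (K * r)) *
      (((1 + yF M j x) * (1 + gF M j x)) ^ 2 + exp (8 * p * v x)) := by
    intro x
    have hv0 : 0 ≤ v x := norm_nonneg _
    have h1 : exp (4 * p * v x) ≤ 1 + 4 * p * v x * exp (4 * p * v x) := by
      have := one_sub_le_exp_neg (4 * p * v x)
      rw [exp_neg] at this
      have he := exp_pos (4 * p * v x)
      have := mul_le_mul_of_nonneg_right this he.le
      rw [inv_mul_cancel₀ he.ne'] at this
      linarith
    set P := (1 + yF M j x) * (1 + gF M j x) with hPd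
    have h2 : exp (8 * p * v x) = exp (4 * p * v x) ^ 2 := by
      rw [← exp_nat_mul]; congr 1; push_cast; ring
    rw [h2]
    set E := exp (4 * p * v x)
    have hE : 0 < E := exp_pos _
    have h3 : 4 * p * v x * E ≤ 4 * p * (K * r * P) * E := by
      have := (hb x).1
      gcongr
    have h4 : 2 * (P * E) ≤ P ^ 2 + E ^ 2 := by linarith only [sq_nonneg (P - E)]
    have h5 := mul_le_mul_of_nonneg_left h4 (show 0 ≤ 2 * (p * (K * r)) by positivity)
    linarith
  have hidom : Integrable (fun x : Config N => 1 + 2 * (p * (K * r)) *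
      (((1 + yF M j x) * (1 + gF M j x)) ^ 2 + exp (8 * p * v x))) (nuStd N) :=
    (integrable_const _).add ((iP.add i8).const_mul _)
  obtain ⟨i4, e4⟩ := integrable_exp_of_le (hvm.const_mul _) hidom hle
  refine ⟨i4, e4.trans ?_⟩
  rw [integral_add (integrable_const _) (by exact (iP.add i8).const_mul _), integral_const_mul,
    integral_add iP i8]
  simp only [integral_const, probReal_univ, smul_eq_mul, mul_one]
  set z := p * r with hz
  have hz0 : 0 ≤ z := by positivity
  have hE1 : 1 ≤ exp (K' * z) := one_le_exp (by positivity)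
  calc _ ≤ 1 + 2 * (p * (K * r)) * (C + 2 * exp (K' * z)) := by gcongr
    _ = 1 + 2 * K * z * (C + 2 * exp (K' * z)) := by rw [hz]; ring
    _ ≤ exp (K' * z) + 2 * K * z * (C * exp (K' * z) + 2 * exp (K' * z)) := by
        gcongr
        exact le_mul_of_one_le_right hC.le hE1
    _ = exp (K' * z) * ((2 * K * C + 4 * K) * z + 1) := by ring
    _ ≤ exp (K' * z) * exp ((2 * K * C + 4 * K) * z) :=
        mul_le_mul_of_nonneg_left (add_one_le_exp _) (exp_pos _).le
    _ = _ := by rw [← exp_add]; congr 1; rw [hz]; ring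

end Moments

/-! ### Exponential moments of the interaction of degree at most two -/

section TildeMoments

variable {N M : ℕ}

theorem integrable_diagForm (j : ℕ) :
    Integrable (fun x : Config N => diagForm M j x) (nuStd N) ∧
    ∫ x : Config N, diagForm M j x ∂(nuStd N) = 0 := by
  have hi : ∀ s t : Coord N, Integrable (fun x : Config N =>
      diagMat N M j s t * (x s * x t)) (nuStd N) := fun s t => (integrable_coord_mul s t).const_mul _
  simp only [← sum_diagMat]
  refine ⟨integrable_finsetSum _ fun s _ => integrable_finsetSum _ fun t _ => hi s t, ?_⟩
  rw [integral_finsetSum _ fun s _ => integrable_finsetSum _ fun t _ => hi s t]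
  refine sum_eq_zero fun s _ => ?_
  rw [integral_finsetSum _ fun t _ => hi s t]
  refine sum_eq_zero fun t _ => ?_
  rw [integral_const_mul, nuStd, integral_coord_mul]
  split_ifs with h
  · rw [h, diagMat_diag, zero_mul]
  · rw [mul_zero]

theorem integrable_diagLin (j : ℕ) :
    Integrable (fun x : Config N => diagLin M j x) (nuStd N) ∧
    ∫ x : Config N, diagLin M j x ∂(nuStd N) = 0 := by
  have hi : ∀ s : Coord N, Integrable (fun x : Config N =>
      diagMass (fun n => sliceSq M j n * am2 n) s * x s) (nuStd N) :=
    fun s => (integrable_coord s).const_mul _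
  simp only [diagLin_eq]
  refine ⟨integrable_finsetSum _ fun s _ => hi s, ?_⟩
  rw [integral_finsetSum _ fun s _ => hi s]
  refine sum_eq_zero fun s _ => ?_
  rw [integral_const_mul, nuStd, integral_coord, mul_zero]

theorem exists_integral_yF_le (hM : 2 ≤ M) : ∃ K : ℝ, 0 < K ∧ ∀ N j : ℕ,
    Integrable (fun x : Config N => yF M j x) (nuStd N) ∧
    ∫ x : Config N, yF M j x ∂(nuStd N) ≤ K := by
  obtain ⟨K, hK, h⟩ := exists_yF_form hM
  refine ⟨K, hK, fun N j => ?_⟩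
  obtain ⟨v, -, -, hT, hv⟩ := h N j
  simp only [hv]
  exact ⟨integrable_sum_sq v, (integral_sum_sq v).trans_le hT⟩

theorem integrable_yErr (hM : 2 ≤ M) (j : ℕ) (g : ℂ) :
    Integrable (fun x : Config N => yErr M j g fun s => x s) (nuStd N) := by
  obtain ⟨K, -, h⟩ := exists_norm_yErr_le hM
  obtain ⟨Ky, -, hy⟩ := exists_integral_yF_le hM
  exact ((hy N j).1.const_mul _).mono'
    (measurable_ofLp_comp (continuous_yErr j g).measurable).aestronglyMeasurable
    (Eventually.of_forall fun x => h N j g _)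

theorem VTildeLe2_toField (hM : 2 ≤ M) (j : ℕ) (g : ℂ) (x : Coord N → ℝ) :
    VTildeLe2 M j g (toField x) = lam g ^ 2 / 2 * (diagForm M j x : ℂ)
      - (yErr M j g x - ∫ z : Config N, yErr M j g (fun s => z s) ∂(nuStd N))
      - Complex.I * lam g ^ 5 * (diagLin M j x : ℂ) := by
  have hE : ∫ z : Config N, lamSqQ1 M j g (toField fun s => z s) ∂(nuStd N)
      = -(2 * ∫ z : Config N, yErr M j g (fun s => z s) ∂(nuStd N)) := by
    simp only [lamSqQ1_toField hM]
    rw [integral_sub (by exact (integrable_diagForm j).1.ofReal.const_mul _)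
      (by exact (integrable_yErr hM j g).const_mul _), integral_const_mul, integral_const_mul,
      integral_complex_ofReal, (integrable_diagForm j).2]
    simp
  rw [VTildeLe2, trace_D2_mul_Sig_sub hM, wick, hE, lamSqQ1_toField hM]
  ring

theorem continuous_diagForm (j : ℕ) : Continuous (diagForm (N := N) M j) := by
  unfold diagForm
  refine continuous_finsetSum _ fun n _ => continuous_const.mul (continuous_finsetSum _ fun c _ =>
    continuous_finsetSum _ fun c' _ => ?_)
  split_ifs
  · exact continuous_const
  · fun_prop

theorem continuous_diagLin (j : ℕ) : Continuous (diagLin (N := N) M j) := by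
  unfold diagLin; fun_prop

theorem measurable_VTildeLe2 (hM : 2 ≤ M) (j : ℕ) (g : ℂ) :
    Measurable fun x : Coord N → ℝ => VTildeLe2 M j g (toField x) := by
  simp only [VTildeLe2_toField hM]
  have h1 := continuous_diagForm (N := N) (M := M) j
  have h2 := continuous_diagLin (N := N) (M := M) j
  have h3 := continuous_yErr (N := N) (M := M) j g
  refine Continuous.measurable ?_
  fun_prop

theorem exp_add_le_half (a b : ℝ) : exp (a + b) ≤ (exp (2 * a) + exp (2 * b)) / 2 := by
  have h1 : exp (2 * a) = exp a ^ 2 := by rw [← exp_nat_mul]; norm_cast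
  have h2 : exp (2 * b) = exp b ^ 2 := by rw [← exp_nat_mul]; norm_cast
  rw [exp_add, h1, h2]
  nlinarith [sq_nonneg (exp a - exp b)]

theorem norm_lam_sq_le {ρ : ℝ} (hρ : 0 < ρ) {g : ℂ} (hg : g ∈ cardioid ρ) : ‖lam g‖ ^ 2 ≤ ρ := by
  obtain ⟨cs, h0, h1, -, h⟩ := cardioid_lam hρ hg
  exact h.trans (mul_le_of_le_one_right hρ.le (pow_le_one₀ h0.le h1))

/-- The error term, the quadratic and the linear coefficients are small. -/
theorem exists_norm_yErr_sub_le (hM : 2 ≤ M) : ∃ K : ℝ, 0 < K ∧ ∀ ρ : ℝ, 0 < ρ → ρ ≤ 1 →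
    ∀ g ∈ cardioid ρ, ‖lam g ^ 2‖ ≤ ρ ∧ ‖Complex.I * lam g ^ 5‖ ≤ ρ ∧
      ∀ (N j : ℕ) (x : Coord N → ℝ),
        ‖yErr M j g x - ∫ z : Config N, yErr M j g (fun s => z s) ∂(nuStd N)‖
          ≤ K * ρ ^ 2 * (1 + yF M j x) := by
  obtain ⟨K, hK, h⟩ := exists_norm_yErr_le hM
  obtain ⟨Ky, hKy, hy⟩ := exists_integral_yF_le hM
  refine ⟨K * (1 + Ky), by positivity, fun ρ hρ hρ1 g hg => ?_⟩
  have hl2 := norm_lam_sq_le hρ hg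
  have hl1 : ‖lam g‖ ≤ 1 := by exact (sq_le_one_iff₀ (norm_nonneg _)).1 (hl2.trans hρ1)
  have hl4 : ‖lam g‖ ^ 4 ≤ ρ ^ 2 := by
    calc ‖lam g‖ ^ 4 = (‖lam g‖ ^ 2) ^ 2 := by ring
      _ ≤ _ := pow_le_pow_left₀ (by positivity) hl2 2
  refine ⟨by rwa [norm_pow], ?_, fun N j x => ?_⟩
  · rw [norm_mul, norm_I, one_mul, norm_pow]
    calc ‖lam g‖ ^ 5 ≤ ‖lam g‖ ^ 2 := pow_le_pow_of_le_one (norm_nonneg _) hl1 (by norm_num)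
      _ ≤ ρ := hl2
  · have hx := yF_nonneg hM j x
    have h1 := h N j g x
    have h2 : ‖∫ z : Config N, yErr M j g (fun s => z s) ∂(nuStd N)‖
        ≤ K * ‖lam g‖ ^ 4 * Ky := by
      refine (norm_integral_le_of_norm_le ((hy N j).1.const_mul (K * ‖lam g‖ ^ 4))
        (Eventually.of_forall fun z => h N j g _)).trans ?_
      rw [integral_const_mul]
      exact mul_le_mul_of_nonneg_left (hy N j).2 (by positivity)
    calc _ ≤ K * ‖lam g‖ ^ 4 * yF M j x + K * ‖lam g‖ ^ 4 * Ky :=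
          (norm_sub_le _ _).trans (add_le_add h1 h2)
      _ = K * ‖lam g‖ ^ 4 * (Ky + yF M j x) := by ring
      _ ≤ K * ρ ^ 2 * ((1 + Ky) * (1 + yF M j x)) := by
          refine mul_le_mul (mul_le_mul_of_nonneg_left hl4 hK.le) ?_ (by positivity) (by positivity)
          nlinarith
      _ = _ := by ring

set_option maxHeartbeats 1000000 in
/-- Exponential moments of `Ṽ^{≤ 2}`, of an order growing with the scale. -/
theorem exists_integral_exp_VTilde_le (hM : 2 ≤ M) {κ : ℝ} (hκ : 0 < κ) : ∃ ρ₁ K : ℝ, 0 < ρ₁ ∧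
    ρ₁ ≤ 1 ∧ 0 < K ∧ ∀ ρ : ℝ, 0 < ρ → ρ ≤ ρ₁ → ∀ g ∈ cardioid ρ, ∀ (N j : ℕ) (p : ℝ), 0 ≤ p →
      p ≤ κ * ((M : ℝ) ^ j) ^ (1 / 4 : ℝ) →
      Integrable (fun x : Config N =>
        exp (-4 * p * (VTildeLe2 M j g (toField fun s => x s)).re)) (nuStd N) ∧
      ∫ x : Config N, exp (-4 * p * (VTildeLe2 M j g (toField fun s => x s)).re)
        ∂(nuStd N) ≤ exp (K * p * ρ ^ (3 / 2 : ℝ)) := by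
  obtain ⟨K, hK, hb⟩ := exists_norm_yErr_sub_le hM
  obtain ⟨Ky, hKy, hy⟩ := exists_integral_exp_yF_le hM
  obtain ⟨Kd, hKd, hd⟩ := exists_integral_exp_diag_le hM
  refine ⟨min 1 (min (1 / (4 * κ * Kd)) (1 / (32 * κ * K))), Kd * (80 * κ) + 8 * K * (1 + Ky),
    by positivity, min_le_left _ _, by positivity, fun ρ hρ hρ1 g hg N j p hp0 hp => ?_⟩
  have hρone : ρ ≤ 1 := hρ1.trans (min_le_left _ _)
  have hρa : ρ * (4 * κ * Kd) ≤ 1 :=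
    (le_div_iff₀ (by positivity)).1 (hρ1.trans ((min_le_right _ _).trans (min_le_left _ _)))
  have hρb : ρ * (32 * κ * K) ≤ 1 :=
    (le_div_iff₀ (by positivity)).1 (hρ1.trans ((min_le_right _ _).trans (min_le_right _ _)))
  have hR := one_le_scale hM j
  obtain ⟨hl2, hl5, hY⟩ := hb ρ hρ hρone g hg
  set R := (M : ℝ) ^ j with hRdef
  have hR0 : 0 < R := by linarith
  have hR1 : R ^ (1 / 4 : ℝ) ≤ R := by
    calc _ ≤ R ^ (1 : ℝ) := rpow_le_rpow_of_exponent_le hR (by norm_num)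
      _ = R := rpow_one R
  have hR2 : R ^ (1 / 4 : ℝ) ≤ R ^ (7 / 4 : ℝ) := rpow_le_rpow_of_exponent_le hR (by norm_num)
  have hρsq : ρ ^ 2 ≤ ρ := pow_le_of_le_one hρ.le hρone two_ne_zero
  have hρ32 := sq_le_rpow_three_halves hρ hρone
  set t : ℝ := -4 * p * (lam g ^ 2).re with ht
  set u : ℝ := 8 * p * (Complex.I * lam g ^ 5).re with hu
  have hta : |t| ≤ 4 * p * ρ := by
    rw [ht, abs_mul, abs_mul, abs_of_nonneg hp0]; norm_num
    exact mul_le_mul_of_nonneg_left ((abs_re_le_norm _).trans hl2) (by positivity)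
  have hua : |u| ≤ 8 * p * ρ := by
    rw [hu, abs_mul, abs_mul, abs_of_nonneg hp0]
    rw [abs_of_nonneg (by norm_num : (0 : ℝ) ≤ 8)]
    exact mul_le_mul_of_nonneg_left ((abs_re_le_norm _).trans hl5) (by positivity)
  obtain ⟨iG, eG⟩ := hd N j t u (by
    calc Kd * |t| ≤ Kd * (4 * (κ * R ^ (1 / 4 : ℝ)) * ρ) := by
          refine mul_le_mul_of_nonneg_left (hta.trans ?_) hKd.le
          gcongr
      _ = (ρ * (4 * κ * Kd)) * R ^ (1 / 4 : ℝ) := by ring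
      _ ≤ 1 * R := by gcongr
      _ = R := one_mul R)
  set q := 8 * p * K * ρ ^ 2 with hq
  have hq0 : 0 ≤ q := by positivity
  obtain ⟨iZ, eZ⟩ := hy N j q hq0 (by
    calc q ≤ 8 * (κ * R ^ (1 / 4 : ℝ)) * K * ρ := by rw [hq]; gcongr
      _ = (ρ * (32 * κ * K)) * R ^ (1 / 4 : ℝ) / 4 := by ring
      _ ≤ 1 * R ^ (7 / 4 : ℝ) / 4 := by gcongr
      _ = _ := by rw [one_mul])
  have hdom : ∀ x : Config N,
      exp (-4 * p * (VTildeLe2 M j g (toField fun s => x s)).re)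
      ≤ (exp (t * diagForm M j x + u * diagLin M j x) + exp q * exp (q * yF M j x)) / 2 := by
    intro x
    set E := yErr M j g (fun s => x s)
      - ∫ z : Config N, yErr M j g (fun s => z s) ∂(nuStd N) with hE
    have e : -4 * p * (VTildeLe2 M j g (toField fun s => x s)).re
        = (t * diagForm M j x + u * diagLin M j x) / 2 + 4 * p * E.re := by
      rw [VTildeLe2_toField hM, ← hE]
      simp only [sub_re, re_mul_ofReal, div_ofNat_re]
      rw [ht, hu]; ring
    rw [e]
    refine (exp_add_le_half _ _).trans ?_
    rw [← exp_add]
    refine div_le_div_of_nonneg_right (add_le_add (exp_le_exp.2 (by linarith))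
      (exp_le_exp.2 ?_)) two_pos.le
    calc 2 * (4 * p * E.re) = 8 * p * E.re := by ring
      _ ≤ 8 * p * (K * ρ ^ 2 * (1 + yF M j x)) := by
          refine mul_le_mul_of_nonneg_left ?_ (by positivity)
          exact (re_le_norm _).trans (hY N j _)
      _ = _ := by rw [hq]; ring
  have hdi : Integrable (fun x : Config N =>
      (exp (t * diagForm M j x + u * diagLin M j x) + exp q * exp (q * yF M j x)) / 2) (nuStd N) :=
    (iG.add (iZ.const_mul _)).div_const 2
  obtain ⟨hi, he⟩ := integrable_exp_of_le ((Complex.measurable_re.comp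
    (measurable_ofLp_comp (measurable_VTildeLe2 hM j g))).const_mul _) hdi hdom
  refine ⟨hi, he.trans ?_⟩
  rw [integral_div, integral_add iG (iZ.const_mul _), integral_const_mul]
  have b1 : ∫ x : Config N, exp (t * diagForm M j x + u * diagLin M j x)
      ∂(nuStd N) ≤ exp ((Kd * (80 * κ) + 8 * K * (1 + Ky)) * p * ρ ^ (3 / 2 : ℝ)) := by
    refine eG.trans (exp_le_exp.2 ?_)
    have h1 : t ^ 2 + u ^ 2 ≤ 80 * p ^ 2 * ρ ^ 2 := by
      rw [← sq_abs t, ← sq_abs u]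
      have := pow_le_pow_left₀ (abs_nonneg t) hta 2
      have := pow_le_pow_left₀ (abs_nonneg u) hua 2
      nlinarith
    have h2 : p * R ^ (-(1 / 2) : ℝ) ≤ κ := by
      calc p * R ^ (-(1 / 2) : ℝ) ≤ κ * R ^ (1 / 4 : ℝ) * R ^ (-(1 / 2) : ℝ) := by gcongr
        _ = κ * R ^ (-(1 / 4) : ℝ) := by rw [mul_assoc, ← rpow_add hR0]; norm_num
        _ ≤ κ := mul_le_of_le_one_right hκ.le (rpow_le_one_of_one_le_of_nonpos hR (by norm_num))
    calc Kd * (t ^ 2 + u ^ 2) * R ^ (-(1 / 2) : ℝ)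
        ≤ Kd * (80 * p ^ 2 * ρ ^ 2) * R ^ (-(1 / 2) : ℝ) := by gcongr
      _ = Kd * 80 * (p * R ^ (-(1 / 2) : ℝ)) * p * ρ ^ 2 := by ring
      _ ≤ Kd * 80 * κ * p * ρ ^ (3 / 2 : ℝ) := by gcongr
      _ ≤ _ := by
          have : 0 ≤ 8 * K * (1 + Ky) * p * ρ ^ (3 / 2 : ℝ) := by positivity
          linarith
  have b2 : exp q * ∫ x : Config N, exp (q * yF M j x) ∂(nuStd N)
      ≤ exp ((Kd * (80 * κ) + 8 * K * (1 + Ky)) * p * ρ ^ (3 / 2 : ℝ)) := by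
    refine (mul_le_mul_of_nonneg_left eZ (exp_pos _).le).trans ?_
    rw [← exp_add]
    refine exp_le_exp.2 ?_
    calc q + Ky * q = 8 * K * (1 + Ky) * p * ρ ^ 2 := by rw [hq]; ring
      _ ≤ 8 * K * (1 + Ky) * p * ρ ^ (3 / 2 : ℝ) := by gcongr
      _ ≤ _ := by
          have : 0 ≤ Kd * (80 * κ) * p * ρ ^ (3 / 2 : ℝ) := by positivity
          linarith
  linarith

end TildeMoments

/-! ### The covariance of the replicas of a block -/

section Interp

variable {B : Type}

theorem le_foldr_min_iff {c : ℝ} {l : List ℝ} : c ≤ l.foldr min 1 ↔ c ≤ 1 ∧ ∀ x ∈ l, c ≤ x := by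
  induction l with
  | nil => simp
  | cons a l ih => simp only [List.foldr_cons, le_min_iff, ih, List.mem_cons, forall_eq_or_imp]; tauto

variable {T : SimpleGraph B} (hT : T.IsTree) (w : Sym2 B → ℝ)

theorem le_interpX_iff {c : ℝ} {a b : B} {p : T.Walk a b} (hp : p.IsPath) :
    c ≤ interpX hT w a b ↔ c ≤ 1 ∧ ∀ e ∈ p.edges, c ≤ w e := by
  have h := (hT.existsUnique_path a b).choose_spec
  rw [interpX, ← h.2 p hp, le_foldr_min_iff]
  simp

theorem interpX_self (a : B) : interpX hT w a a = 1 :=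
  le_antisymm ((le_interpX_iff hT w (p := .nil) .nil).1 le_rfl).1
    ((le_interpX_iff hT w (p := .nil) .nil).2 ⟨le_rfl, by simp⟩)

theorem interpX_le_one (a b : B) : interpX hT w a b ≤ 1 :=
  ((le_interpX_iff hT w (hT.existsUnique_path a b).choose_spec.1).1 le_rfl).1

theorem interpX_nonneg (hw : ∀ e ∈ T.edgeSet, w e ∈ Icc (0 : ℝ) 1) (a b : B) :
    0 ≤ interpX hT w a b :=
  (le_interpX_iff hT w (hT.existsUnique_path a b).choose_spec.1).2
    ⟨zero_le_one, fun e he => (hw e (SimpleGraph.Walk.edges_subset_edgeSet _ he)).1⟩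

theorem interpX_symm (a b : B) : interpX hT w a b = interpX hT w b a := by
  have hp := (hT.existsUnique_path a b).choose_spec.1
  have h : ∀ c, c ≤ interpX hT w a b ↔ c ≤ interpX hT w b a := fun c => by
    rw [le_interpX_iff hT w hp, le_interpX_iff hT w hp.reverse, SimpleGraph.Walk.edges_reverse]
    simp
  exact le_antisymm ((h _).1 le_rfl) ((h _).2 le_rfl)

theorem le_interpX_trans [DecidableEq B] {t : ℝ} {a b c : B} (h1 : t ≤ interpX hT w a b)
    (h2 : t ≤ interpX hT w b c) : t ≤ interpX hT w a c := by
  have hp := (hT.existsUnique_path a b).choose_spec.1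
  have hq := (hT.existsUnique_path b c).choose_spec.1
  rw [le_interpX_iff hT w hp] at h1
  rw [le_interpX_iff hT w hq] at h2
  rw [le_interpX_iff hT w (SimpleGraph.Walk.bypass_isPath
    ((hT.existsUnique_path a b).choose.append (hT.existsUnique_path b c).choose))]
  refine ⟨h1.1, fun e he => ?_⟩
  have := SimpleGraph.Walk.edges_bypass_subset_edges _ he
  rw [SimpleGraph.Walk.edges_append, List.mem_append] at this
  exact this.elim (h1.2 e) (h2.2 e)

variable [Fintype B]

theorem sum_equivalence_nonneg {r : B → B → Prop} [DecidableRel r] (hr : Equivalence r) (v : B → ℝ) :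
    0 ≤ ∑ a, ∑ b, if r a b then v a * v b else 0 := by
  classical
  let S : Setoid B := ⟨r, hr⟩
  have : ∑ a, ∑ b, (if r a b then v a * v b else 0)
      = ∑ q : Quotient S, (∑ a, if (⟦a⟧ : Quotient S) = q then v a else 0) ^ 2 := by
    simp only [pow_two, sum_mul_sum]
    refine Eq.trans (sum_congr rfl fun a _ => ?_) sum_comm
    refine Eq.trans (sum_congr rfl fun b _ => ?_) sum_comm
    have e : r a b ↔ (⟦b⟧ : Quotient S) = ⟦a⟧ :=
      ⟨fun h => (Quotient.sound (hr.symm h)), fun h => hr.symm (Quotient.exact h)⟩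
    rw [sum_eq_single (⟦a⟧ : Quotient S) (fun q _ hq => by rw [if_neg hq.symm, zero_mul])
      (fun h => absurd (mem_univ _) h), if_pos rfl]
    by_cases h : r a b
    · rw [if_pos h, if_pos (e.1 h)]
    · rw [if_neg h, if_neg fun h' => h (e.2 h'), mul_zero]
  rw [this]
  exact sum_nonneg fun q _ => sq_nonneg _

theorem interpX_posSemidef [DecidableEq B] (hw : ∀ e ∈ T.edgeSet, w e ∈ Icc (0 : ℝ) 1) :
    (interpX hT w).PosSemidef := by
  classical
  refine Matrix.PosSemidef.of_dotProduct_mulVec_nonneg ?_ fun v => ?_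
  · ext a b; rw [conjTranspose_apply, star_trivial, interpX_symm]
  have hX : ∀ a b, interpX hT w a b
      = ∫ t in Set.Ioc (0 : ℝ) 1, (Set.Iic (interpX hT w a b)).indicator (fun _ => (1 : ℝ)) t := by
    intro a b
    rw [setIntegral_indicator measurableSet_Iic, setIntegral_const, smul_eq_mul, mul_one,
      Set.Ioc_inter_Iic, min_eq_right (interpX_le_one hT w a b), volume_real_Ioc_of_le
      (interpX_nonneg hT w hw a b), sub_zero]
  have hi : ∀ a b, Integrable (fun t => v a * v b *
      (Set.Iic (interpX hT w a b)).indicator (fun _ => (1 : ℝ)) t) (volume.restrict (Set.Ioc (0 : ℝ) 1)) :=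
    fun a b => ((integrable_const 1).indicator measurableSet_Iic).const_mul _
  have e : star v ⬝ᵥ (interpX hT w).mulVec v = ∫ t in Set.Ioc (0 : ℝ) 1, ∑ a, ∑ b,
      v a * v b * (Set.Iic (interpX hT w a b)).indicator (fun _ => (1 : ℝ)) t := by
    rw [integral_finsetSum _ fun a _ => integrable_finsetSum _ fun b _ => hi a b]
    simp only [dotProduct, Matrix.mulVec, star_trivial, mul_sum]
    refine sum_congr rfl fun a _ => ?_
    rw [integral_finsetSum _ fun b _ => hi a b]
    refine sum_congr rfl fun b _ => ?_
    rw [integral_const_mul, ← hX]; ring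
  rw [e]
  refine setIntegral_nonneg measurableSet_Ioc fun t ht => ?_
  have := sum_equivalence_nonneg (r := fun a b => t ≤ interpX hT w a b)
    ⟨fun a => by rw [interpX_self]; exact ht.2, fun {a b} h => by rwa [interpX_symm],
      fun h1 h2 => le_interpX_trans hT w h1 h2⟩ v
  refine this.trans_eq (sum_congr rfl fun a _ => sum_congr rfl fun b _ => ?_)
  simp only [Set.indicator_apply, Set.mem_Iic, mul_ite, mul_one, mul_zero]

end Interp

section Pick

variable {B : Type} [Fintype B] [DecidableEq B] {N : ℕ}

/-- The field obtained by choosing a replica for each coordinate. -/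
noncomputable def pick (α : Coord N → B) (x : EuclideanSpace ℝ (B × Coord N)) :
    Config N := WithLp.toLp 2 fun s => x (α s, s)

instance (X : Matrix B B ℝ) : IsProbabilityMeasure (nuBlock N X) := by
  unfold nuBlock; infer_instance

theorem measurePreserving_pick {X : Matrix B B ℝ} (hX : X.PosSemidef) (h1 : ∀ a, X a a = 1)
    (α : Coord N → B) : MeasurePreserving (pick α) (nuBlock N X) (nuStd N) := by
  have hm : Measurable (pick (N := N) α) := by unfold pick; fun_prop
  refine ⟨hm, ?_⟩
  have : IsProbabilityMeasure ((nuBlock N X).map (pick α)) :=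
    Measure.isProbabilityMeasure_map hm.aemeasurable
  refine Measure.ext_of_charFun (funext fun t => ?_)
  set z : EuclideanSpace ℝ (B × Coord N) :=
    WithLp.toLp 2 fun i => if i.1 = α i.2 then t i.2 else 0 with hz
  have hin : ∀ x : EuclideanSpace ℝ (B × Coord N), inner ℝ (pick α x) t = inner ℝ x z := by
    intro x
    simp only [PiLp.inner_apply, RCLike.inner_apply, conj_trivial, pick, hz, ite_mul, zero_mul]
    refine Eq.trans (sum_congr rfl fun s _ => ?_) (Fintype.sum_prod_type_right _).symm
    simp
  have hS : (X ⊗ₖ (1 : Matrix (Coord N) (Coord N) ℝ)).PosSemidef := hX.kronecker .one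
  have hq : z ⬝ᵥ (X ⊗ₖ (1 : Matrix (Coord N) (Coord N) ℝ)).mulVec z = ‖t‖ ^ 2 := by
    rw [EuclideanSpace.real_norm_sq_eq]
    simp only [dotProduct, Matrix.mulVec, Matrix.kroneckerMap_apply, Matrix.one_apply, hz]
    refine (Fintype.sum_prod_type_right _).trans (sum_congr rfl fun s _ => ?_)
    simp only [ite_mul, zero_mul, sum_ite_eq', mem_univ, if_true]
    rw [Fintype.sum_prod_type_right (f := fun i : B × Coord N =>
      X (α s) i.1 * (if s = i.2 then (1 : ℝ) else 0) * (if i.1 = α i.2 then t i.2 else 0))]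
    simp [h1, pow_two]
  rw [charFun_apply, integral_map hm.aemeasurable (by fun_prop)]
  simp only [hin]
  rw [← charFun_apply, nuBlock, charFun_multivariateGaussian hS, hq, nuStd, charFun_stdGaussian]
  simp [neg_div]

end Pick

/-! ### Hölder's inequality with exponents growing with the scale -/

theorem exp_sum_mul_le {B : Type} [Fintype B] {θ : B → ℝ} (h0 : ∀ a, 0 ≤ θ a) (h1 : ∑ a, θ a ≤ 1)
    (z : B → ℝ) : exp (∑ a, θ a * z a) ≤ ∑ a, θ a * exp (z a) + (1 - ∑ a, θ a) := by
  set m := ∑ a, θ a * z a with hm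
  have ht : ∀ y : ℝ, exp m * (1 + y - m) ≤ exp y := fun y => by
    have h := add_one_le_exp (y - m)
    calc _ ≤ exp m * exp (y - m) := mul_le_mul_of_nonneg_left (by linarith) (exp_pos _).le
      _ = _ := by rw [← exp_add]; congr 1; ring
  have h2 : ∑ a, θ a * (exp m * (1 + z a - m)) ≤ ∑ a, θ a * exp (z a) :=
    sum_le_sum fun a _ => mul_le_mul_of_nonneg_left (ht _) (h0 a)
  have h3 := mul_le_mul_of_nonneg_left (ht 0) (sub_nonneg.2 h1)
  have h4 : ∑ a, θ a * (exp m * (1 + z a - m)) = exp m * ((∑ a, θ a) * (1 - m) + m) := by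
    calc _ = ∑ a, (θ a * (exp m * (1 - m)) + (θ a * z a) * exp m) :=
          sum_congr rfl fun a _ => by ring
      _ = _ := by rw [sum_add_distrib, ← sum_mul, ← sum_mul, ← hm]; ring
  rw [exp_zero] at h3
  rw [h4] at h2
  linarith

theorem integral_prod_exp_le {Ω : Type*} [MeasurableSpace Ω] {μ : Measure Ω} [IsProbabilityMeasure μ]
    {B : Type} [Fintype B] {f : B → Ω → ℝ} (hf : ∀ a, Measurable (f a)) {p : B → ℝ}
    (hp : ∀ a, 0 < p a) (hsum : ∑ a, (p a)⁻¹ ≤ 1) {c : ℝ}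
    (hi : ∀ a, Integrable (fun x => exp (p a * f a x)) μ)
    (hle : ∀ a, ∫ x, exp (p a * f a x) ∂μ ≤ exp (p a * c)) :
    Integrable (fun x => ∏ a, exp (f a x)) μ ∧
    ∫ x, ∏ a, exp (f a x) ∂μ ≤ exp (c * Fintype.card B) := by
  have hdom : ∀ x, ∏ a, exp (f a x) ≤ exp (c * Fintype.card B) *
      (∑ a, (p a)⁻¹ * (exp (-(p a * c)) * exp (p a * f a x)) + (1 - ∑ a, (p a)⁻¹)) := by
    intro x
    have h := exp_sum_mul_le (fun a => (inv_pos.2 (hp a)).le) hsum fun a => p a * (f a x - c)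
    have e : ∏ a, exp (f a x) = exp (c * Fintype.card B) *
        exp (∑ a, (p a)⁻¹ * (p a * (f a x - c))) := by
      rw [← exp_sum, ← exp_add]
      congr 1
      have : ∀ a, (p a)⁻¹ * (p a * (f a x - c)) = f a x - c := fun a => by
        rw [← mul_assoc, inv_mul_cancel₀ (hp a).ne', one_mul]
      simp only [this, sum_sub_distrib, sum_const, card_univ, nsmul_eq_mul]
      ring
    rw [e]
    refine mul_le_mul_of_nonneg_left (h.trans_eq ?_) (exp_pos _).le
    congr 1
    refine sum_congr rfl fun a _ => ?_
    rw [← exp_add]; congr 2; ring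
  have hS : Integrable (fun x => ∑ a, (p a)⁻¹ * (exp (-(p a * c)) * exp (p a * f a x))) μ :=
    integrable_finsetSum _ fun a _ => ((hi a).const_mul _).const_mul _
  have hI : Integrable (fun x => exp (c * Fintype.card B) *
      (∑ a, (p a)⁻¹ * (exp (-(p a * c)) * exp (p a * f a x)) + (1 - ∑ a, (p a)⁻¹))) μ :=
    (hS.add (integrable_const _)).const_mul _
  have hint : Integrable (fun x => ∏ a, exp (f a x)) μ := by
    refine hI.mono' (Measurable.aestronglyMeasurable ?_) (Eventually.of_forall fun x => ?_)
    · exact Finset.measurable_fun_prod _ fun a _ => measurable_exp.comp (hf a)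
    · rw [norm_of_nonneg (prod_nonneg fun a _ => (exp_pos _).le)]; exact hdom x
  refine ⟨hint, (integral_mono hint hI hdom).trans ?_⟩
  rw [integral_const_mul, integral_add hS (integrable_const _), integral_const, probReal_univ,
    one_smul, integral_finsetSum _ fun a _ => ((hi a).const_mul _).const_mul _]
  refine mul_le_of_le_one_right (exp_pos _).le ?_
  have : ∑ a, ∫ x, (p a)⁻¹ * (exp (-(p a * c)) * exp (p a * f a x)) ∂μ ≤ ∑ a, (p a)⁻¹ := by
    refine sum_le_sum fun a _ => ?_
    rw [integral_const_mul, integral_const_mul]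
    refine mul_le_of_le_one_right (inv_pos.2 (hp a)).le ?_
    calc _ ≤ exp (-(p a * c)) * exp (p a * c) := mul_le_mul_of_nonneg_left (hle a) (exp_pos _).le
      _ = 1 := by rw [← exp_add]; simp
  linarith

/-! ### The non-perturbative factor of a block -/

section Blocks

variable {M : ℕ}

theorem exp_sum_sum_le {B ι : Type} [Fintype B] [Nonempty B] [Fintype ι] [DecidableEq ι]
    {q : B → ι → ℝ} (hq : ∀ a s, 0 ≤ q a s) : ∃ θ : B → ι → ℝ, (∀ a s, 0 ≤ θ a s) ∧
    (∑ α : ι → B, ∏ s, θ (α s) s = 1) ∧ ∀ h : B → ι → ℝ,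
      exp (∑ a, ∑ s, q a s * h a s)
        ≤ ∑ α : ι → B, (∏ s, θ (α s) s) * exp (∑ s, (∑ a, q a s) * h (α s) s) := by
  classical
  have hcard : (Fintype.card B : ℝ) ≠ 0 := by exact_mod_cast Fintype.card_ne_zero
  set θ : B → ι → ℝ := fun a s => if ∑ b, q b s = 0 then (Fintype.card B : ℝ)⁻¹
    else q a s / ∑ b, q b s with hθ
  have hQ : ∀ s, 0 ≤ ∑ b, q b s := fun s => sum_nonneg fun b _ => hq b s
  have hθ0 : ∀ a s, 0 ≤ θ a s := fun a s => by
    simp only [hθ]; split_ifs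
    · positivity
    · exact div_nonneg (hq a s) (hQ s)
  have hθ1 : ∀ s, ∑ a, θ a s = 1 := fun s => by
    simp only [hθ]
    by_cases h : ∑ b, q b s = 0
    · simp only [h, if_true, sum_const, card_univ, nsmul_eq_mul]
      exact mul_inv_cancel₀ hcard
    · simp only [h, if_false]
      rw [← sum_div, div_self h]
  have hθq : ∀ a s, θ a s * ∑ b, q b s = q a s := fun a s => by
    simp only [hθ]
    by_cases h : ∑ b, q b s = 0
    · rw [if_pos h, h, mul_zero]
      exact ((sum_eq_zero_iff_of_nonneg fun b _ => hq b s).1 h a (mem_univ a)).symm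
    · rw [if_neg h, div_mul_cancel₀ _ h]
  refine ⟨θ, hθ0, ?_, fun h => ?_⟩
  · have := prod_univ_sum (fun _ : ι => (univ : Finset B)) fun s a => θ a s
    rw [Fintype.piFinset_univ] at this
    rw [← this]
    exact prod_eq_one fun s _ => hθ1 s
  · calc exp (∑ a, ∑ s, q a s * h a s)
        = ∏ s, exp (∑ a, θ a s * ((∑ b, q b s) * h a s)) := by
          rw [← exp_sum, sum_comm]
          congr 1
          refine sum_congr rfl fun s _ => sum_congr rfl fun a _ => ?_
          rw [← mul_assoc, hθq]
      _ ≤ ∏ s, ∑ a, θ a s * exp ((∑ b, q b s) * h a s) := by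
          refine prod_le_prod (fun s _ => (exp_pos _).le) fun s _ => ?_
          have := exp_sum_mul_le (fun a => hθ0 a s) (hθ1 s).le fun a => (∑ b, q b s) * h a s
          rwa [hθ1 s, sub_self, add_zero] at this
      _ = ∑ α : ι → B, ∏ s, θ (α s) s * exp ((∑ b, q b s) * h (α s) s) := by
          have := prod_univ_sum (fun _ : ι => (univ : Finset B))
            fun s a => θ a s * exp ((∑ b, q b s) * h a s)
          rwa [Fintype.piFinset_univ] at this
      _ = _ := sum_congr rfl fun α _ => by rw [prod_mul_distrib, exp_sum]

theorem norm_lam_pow_four_le {ρ : ℝ} (hρ : 0 < ρ) {g : ℂ} (hg : g ∈ cardioid ρ) :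
    ‖lam g ^ 4‖ ≤ ρ ^ 2 := by
  rw [norm_pow]
  calc ‖lam g‖ ^ 4 = (‖lam g‖ ^ 2) ^ 2 := by ring
    _ ≤ _ := pow_le_pow_left₀ (by positivity) (norm_lam_sq_le hρ hg) 2

set_option maxHeartbeats 1000000 in
theorem exists_expQ0_le (hM : 2 ≤ M) : ∃ ρ₁ K : ℝ, 0 < ρ₁ ∧ 0 < K ∧ ∀ ρ : ℝ, 0 < ρ → ρ ≤ ρ₁ →
    ∀ g ∈ cardioid ρ, ∀ (N : ℕ) (B : Type) [Fintype B] [DecidableEq B] [Nonempty B]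
      (X : Matrix B B ℝ), X.PosSemidef → (∀ a, X a a = 1) → ∀ j : B → ℕ, Function.Injective j →
      ∀ s ∈ ({1, -1} : Set ℝ), Integrable (expQ0 M g s j) (nuBlock N X) ∧
        ∫ x, expQ0 M g s j x ∂(nuBlock N X) ≤ exp (K * ρ ^ 2 * Fintype.card B) := by
  obtain ⟨K, hK, hb⟩ := exists_block_qF_bounds hM
  refine ⟨1 / (8 * K), 8 * K, by positivity, by positivity, ?_⟩
  intro ρ hρ hρ1 g hg N B _ _ _ X hX hX1 j hj s hs
  have hρa : ρ * (8 * K) ≤ 1 := (le_div_iff₀ (by positivity)).1 hρ1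
  obtain ⟨hb1, hb2⟩ := hb N j hj
  set t : ℝ := 2 * s * (lam g ^ 2).re with ht
  have hta : |t| ≤ 2 * ρ := by
    have h1 : |s| = 1 := by
      rcases hs with h | h
      · rw [h, abs_one]
      · rw [Set.mem_singleton_iff.1 h, abs_neg, abs_one]
    rw [ht, abs_mul, abs_mul, h1, abs_two, mul_one]
    refine mul_le_mul_of_nonneg_left ((abs_re_le_norm _).trans ?_) two_pos.le
    rw [norm_pow]; exact norm_lam_sq_le hρ hg
  set Q : Coord N → ℝ := fun i => ∑ a, qF M (j a) i with hQ
  have hQ0 : ∀ i, 0 ≤ Q i := fun i => sum_nonneg fun a _ => qF_nonneg hM _ _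
  have hw : ∀ i, |t * Q i| ≤ 1 / 4 := fun i => by
    rw [abs_mul, abs_of_nonneg (hQ0 i)]
    calc |t| * Q i ≤ 2 * ρ * K := mul_le_mul hta (hb1 i) (hQ0 i) (by positivity)
      _ ≤ 1 / 4 := by linarith
  obtain ⟨iS, eS⟩ := integral_exp_diagonal_le (fun i => t * Q i) hw
  obtain ⟨θ, hθ0, hθ1, hθ⟩ := exp_sum_sum_le (q := fun a (i : Coord N) => qF M (j a) i)
    fun a i => qF_nonneg hM _ _
  have hE : ∀ x : EuclideanSpace ℝ (B × Coord N), expQ0 M g s j x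
      = exp (∑ a, ∑ i, qF M (j a) i * (t * (x (a, i) ^ 2 - 1))) := by
    intro x
    rw [expQ0, ← exp_sum]
    congr 1
    refine sum_congr rfl fun a _ => ?_
    rw [replica, wick_quadQ0_toField, mul_sum]
    exact sum_congr rfl fun i _ => by rw [ht]; ring
  set F : Config N → ℝ := fun y => exp (∑ i, t * Q i * (y i ^ 2 - 1)) with hF
  have hFm : AEStronglyMeasurable F (nuStd N) := iS.aestronglyMeasurable
  have hiα : ∀ α : Coord N → B, Integrable (fun x => F (pick α x)) (nuBlock N X) := fun α =>
    (measurePreserving_pick hX hX1 α).integrable_comp_of_integrable iS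
  have heα : ∀ α : Coord N → B, ∫ x, F (pick α x) ∂(nuBlock N X) = ∫ y, F y ∂(nuStd N) := fun α => by
    have hmp := measurePreserving_pick hX hX1 α
    rw [← hmp.map_eq, integral_map hmp.measurable.aemeasurable (by rw [hmp.map_eq]; exact hFm)]
  have hdom : ∀ x : EuclideanSpace ℝ (B × Coord N), expQ0 M g s j x
      ≤ ∑ α : Coord N → B, (∏ i, θ (α i) i) * F (pick α x) := by
    intro x
    rw [hE]
    refine (hθ fun a i => t * (x (a, i) ^ 2 - 1)).trans_eq ?_
    refine sum_congr rfl fun α _ => ?_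
    rw [hF]
    congr 2
    exact sum_congr rfl fun i _ => by rw [hQ]; simp only [pick]; ring
  have hdi : Integrable (fun x => ∑ α : Coord N → B, (∏ i, θ (α i) i) * F (pick α x)) (nuBlock N X) :=
    integrable_finsetSum _ fun α _ => (hiα α).const_mul _
  have hi : Integrable (expQ0 M g s j) (nuBlock N X) := by
    refine hdi.mono' (Measurable.aestronglyMeasurable ?_) (Eventually.of_forall fun x => ?_)
    · rw [show expQ0 M g s j = _ from funext hE]; fun_prop
    · rw [norm_of_nonneg (by rw [hE]; exact (exp_pos _).le)]; exact hdom x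
  refine ⟨hi, (integral_mono hi hdi hdom).trans ?_⟩
  rw [integral_finsetSum _ fun α _ => (hiα α).const_mul _]
  simp only [integral_const_mul, heα]
  rw [← sum_mul, hθ1, one_mul]
  refine eS.trans (exp_le_exp.2 ?_)
  have hQ2 : ∑ i, Q i ^ 2 = ∑ a, ∑ b, traceQ0Q0 N M (j a) (j b) := by
    simp only [traceQ0Q0_eq, hQ, pow_two, sum_mul_sum]
    rw [sum_comm]
    exact sum_congr rfl fun a _ => sum_comm
  calc 2 * ∑ i, (t * Q i) ^ 2 = 2 * |t| ^ 2 * ∑ i, Q i ^ 2 := by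
        simp only [mul_pow, ← mul_sum, sq_abs, mul_assoc]
    _ ≤ 2 * (2 * ρ) ^ 2 * (K * Fintype.card B) := by
        rw [hQ2]
        refine mul_le_mul (by gcongr) hb2 (sum_nonneg fun a _ => sum_nonneg fun b _ =>
          traceQ0Q0_nonneg hM _ _) (by positivity)
    _ = _ := by ring

theorem exists_norm_exp_deltaN2_le (hM : 2 ≤ M) : ∃ K : ℝ, 0 < K ∧ ∀ ρ : ℝ, 0 < ρ →
    ∀ g ∈ cardioid ρ, ∀ (N : ℕ) (B : Type) [Fintype B] (X : Matrix B B ℝ),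
      (∀ a b, 0 ≤ X a b ∧ X a b ≤ 1) → ∀ j : B → ℕ, Function.Injective j →
      ‖deltaN2 N M g X j‖ ≤ K * ρ ^ 2 * Fintype.card B := by
  obtain ⟨K, hK, hb⟩ := exists_block_qF_bounds hM
  refine ⟨K, hK, ?_⟩
  intro ρ hρ g hg N B _ X hX j hj
  have hl := norm_lam_pow_four_le hρ hg
  have h0 : 0 ≤ ∑ a, ∑ b, X a b ^ 2 * traceQ0Q0 N M (j a) (j b) :=
    sum_nonneg fun a _ => sum_nonneg fun b _ => mul_nonneg (sq_nonneg _) (traceQ0Q0_nonneg hM _ _)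
  rw [deltaN2, norm_mul, norm_neg, norm_div, norm_real, norm_of_nonneg h0]
  have h1 : ∑ a, ∑ b, X a b ^ 2 * traceQ0Q0 N M (j a) (j b) ≤ K * Fintype.card B :=
    (sum_le_sum fun a _ => sum_le_sum fun b _ => mul_le_of_le_one_left
      (traceQ0Q0_nonneg hM _ _) (pow_le_one₀ (hX a b).1 (hX a b).2)).trans (hb N j hj).2
  have h2 : ‖lam g ^ 4‖ / ‖(4 : ℂ)‖ ≤ ρ ^ 2 := by
    rw [Complex.norm_ofNat]
    have := norm_nonneg (lam g ^ 4)
    linarith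
  calc _ ≤ ρ ^ 2 * (K * Fintype.card B) := mul_le_mul h2 h1 h0 (by positivity)
    _ = _ := by ring

/-- Exponents of the Hölder inequality. -/
theorem exists_holder_exponents (hM : 2 ≤ M) : ∃ κ : ℝ, 1 ≤ κ ∧ ∀ {B : Type} [Fintype B] (j : B → ℕ),
    Function.Injective j → ∑ a, (κ * ((M : ℝ) ^ j a) ^ (1 / 4 : ℝ))⁻¹ ≤ 1 := by
  classical
  have hM1 : (1 : ℝ) < M := by exact_mod_cast (by omega : 1 < M)
  set x : ℝ := ((M : ℝ) ^ (1 / 4 : ℝ))⁻¹ with hx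
  have hx0 : 0 ≤ x := by positivity
  have hx1 : x < 1 := inv_lt_one_of_one_lt₀ (one_lt_rpow hM1 (by norm_num))
  refine ⟨(1 - x)⁻¹, (one_le_inv₀ (by linarith)).2 (by linarith), fun {B} _ j hj => ?_⟩
  have e : ∀ k : ℕ, ((1 - x)⁻¹ * ((M : ℝ) ^ k) ^ (1 / 4 : ℝ))⁻¹ = (1 - x) * x ^ k := fun k => by
    rw [mul_inv, inv_inv, hx, inv_pow, ← rpow_natCast, ← rpow_natCast,
      ← rpow_mul (by linarith), ← rpow_mul (by linarith), mul_comm (k : ℝ)]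
  simp only [e]
  rw [← mul_sum, ← sum_image (f := fun k => x ^ k) fun a _ b _ h => hj h]
  have := Summable.sum_le_tsum (univ.image j) (fun k _ => pow_nonneg hx0 k)
    (summable_geometric_of_lt_one hx0 hx1)
  rw [tsum_geometric_of_lt_one hx0 hx1] at this
  calc _ ≤ (1 - x) * (1 - x)⁻¹ := mul_le_mul_of_nonneg_left this (by linarith)
    _ = 1 := mul_inv_cancel₀ (by linarith)

theorem integral_prod_replica_le {B : Type} [Fintype B] [DecidableEq B] {N : ℕ} {X : Matrix B B ℝ}
    (hX : X.PosSemidef) (h1 : ∀ a, X a a = 1) {f : B → (Coord N → ℝ) → ℝ}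
    (hf : ∀ a, Measurable (f a)) {p : B → ℝ} (hp : ∀ a, 0 < p a) (hsum : ∑ a, (p a)⁻¹ ≤ 1) {c : ℝ}
    (h : ∀ a, Integrable (fun x : Config N => exp (p a * f a fun s => x s))
      (nuStd N) ∧ ∫ x : Config N, exp (p a * f a fun s => x s) ∂(nuStd N)
        ≤ exp (p a * c)) :
    Integrable (fun x : EuclideanSpace ℝ (B × Coord N) => ∏ a, exp (f a fun s => x (a, s)))
      (nuBlock N X) ∧
    ∫ x : EuclideanSpace ℝ (B × Coord N), ∏ a, exp (f a fun s => x (a, s)) ∂(nuBlock N X)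
      ≤ exp (c * Fintype.card B) := by
  refine integral_prod_exp_le
    (f := fun a (x : EuclideanSpace ℝ (B × Coord N)) => f a fun s => x (a, s))
    (fun a => (hf a).comp (by fun_prop)) hp hsum (fun a => ?_) fun a => ?_
  · exact (measurePreserving_pick hX h1 fun _ => a).integrable_comp_of_integrable (h a).1
  · have hmp := measurePreserving_pick (N := N) hX h1 fun _ => a
    refine le_trans (le_of_eq ?_) (h a).2
    conv_rhs => rw [← hmp.map_eq]
    rw [integral_map hmp.measurable.aemeasurable (by rw [hmp.map_eq]; exact (h a).1.aestronglyMeasurable)]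
    rfl

theorem exists_INP_le (hM : 2 ≤ M) : ∃ ρ₁ K : ℝ, 0 < ρ₁ ∧ 0 < K ∧ ∀ ρ : ℝ, 0 < ρ → ρ ≤ ρ₁ →
    ∀ g ∈ cardioid ρ, ∀ (N : ℕ) (B : Type) [Fintype B] [DecidableEq B] (T : SimpleGraph B)
      (hT : T.IsTree) (w : Sym2 B → ℝ) (j : B → ℕ), (∀ e ∈ T.edgeSet, w e ∈ Icc (0 : ℝ) 1) →
      Function.Injective j → ∀ s ∈ ({1, -1} : Set ℝ),
        Integrable (expVGe3 M g j) (nuBlock N (interpX hT w)) ∧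
        Integrable (expQ0 M g s j) (nuBlock N (interpX hT w)) ∧
        Integrable (expVTilde M g j) (nuBlock N (interpX hT w)) ∧
        INP N M g s (interpX hT w) j ≤ exp (K * ρ ^ (3 / 2 : ℝ) * Fintype.card B) := by
  obtain ⟨κ, hκ, hH⟩ := exists_holder_exponents hM
  have hκ0 : 0 < κ := by linarith
  obtain ⟨ρa, Ka, hρa, hρa1, hKa, ha⟩ := exists_integral_exp_VGe3_le hM hκ0
  obtain ⟨ρb, Kb, hρb, hρb1, hKb, hb⟩ := exists_integral_exp_VTilde_le hM hκ0
  obtain ⟨ρc, Kc, hρc, hKc, hc⟩ := exists_expQ0_le hM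
  obtain ⟨Kd, hKd, hd⟩ := exists_norm_exp_deltaN2_le hM
  refine ⟨min ρa (min ρb ρc), Kd + Ka + Kc + Kb, by positivity, by positivity, ?_⟩
  intro ρ hρ hρ1 g hg N B _ _ T hT w j hw hj s hs
  have h1 : ρ ≤ ρa := hρ1.trans (min_le_left _ _)
  have h2 : ρ ≤ ρb := hρ1.trans ((min_le_right _ _).trans (min_le_left _ _))
  have h3 : ρ ≤ ρc := hρ1.trans ((min_le_right _ _).trans (min_le_right _ _))
  have hρone : ρ ≤ 1 := h1.trans hρa1
  have : Nonempty B := hT.connected.nonempty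
  have hX := interpX_posSemidef hT w hw
  have hX1 := interpX_self hT w
  set X := interpX hT w with hXd
  have hp0 : ∀ a, 0 < κ * ((M : ℝ) ^ j a) ^ (1 / 4 : ℝ) := fun a => by
    have := one_le_scale hM (j a); positivity
  have hA := integral_prod_replica_le (N := N) hX hX1 (c := Ka * ρ ^ (3 / 2 : ℝ))
    (f := fun a x => 4 * ‖VGe3 M (j a) g (toField x)‖)
    (fun a => (measurable_VGe3 (j a) g).norm.const_mul 4) hp0 (hH j hj) fun a => by
      obtain ⟨i, e⟩ := ha ρ hρ h1 g hg N (j a) _ (hp0 a).le le_rfl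
      have e1 : ∀ y : ℝ, κ * ((M : ℝ) ^ j a) ^ (1 / 4 : ℝ) * (4 * y)
        = 4 * (κ * ((M : ℝ) ^ j a) ^ (1 / 4 : ℝ)) * y := fun y => by ring
      simp only [e1]
      exact ⟨i, e.trans_eq (by congr 1; ring)⟩
  have hB := integral_prod_replica_le (N := N) hX hX1 (c := Kb * ρ ^ (3 / 2 : ℝ))
    (f := fun a x => -4 * (VTildeLe2 M (j a) g (toField x)).re)
    (fun a => (Complex.measurable_re.comp (measurable_VTildeLe2 hM (j a) g)).const_mul (-4))
    hp0 (hH j hj) fun a => by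
      obtain ⟨i, e⟩ := hb ρ hρ h2 g hg N (j a) _ (hp0 a).le le_rfl
      have e1 : ∀ y : ℝ, κ * ((M : ℝ) ^ j a) ^ (1 / 4 : ℝ) * (-4 * y)
        = -4 * (κ * ((M : ℝ) ^ j a) ^ (1 / 4 : ℝ)) * y := fun y => by ring
      simp only [e1]
      exact ⟨i, e.trans_eq (by congr 1; ring)⟩
  have hC := hc ρ hρ h3 g hg N B X hX hX1 j hj s hs
  have hD := hd ρ hρ g hg N B X (fun a b => ⟨interpX_nonneg hT w hw a b, interpX_le_one hT w a b⟩) j hj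
  refine ⟨hA.1, hC.1, hB.1, ?_⟩
  have hρ32 := sq_le_rpow_three_halves hρ hρone
  have hn : (0 : ℝ) ≤ Fintype.card B := by positivity
  have hr : 0 ≤ ρ ^ (3 / 2 : ℝ) * Fintype.card B := by positivity
  have root : ∀ {I C : ℝ}, 0 ≤ I → 0 ≤ C → I ≤ exp C → I ^ (1 / 4 : ℝ) ≤ exp C := by
    intro I C hI hC0 h
    calc I ^ (1 / 4 : ℝ) ≤ exp C ^ (1 / 4 : ℝ) := rpow_le_rpow hI h (by norm_num)
      _ ≤ exp C ^ (1 : ℝ) := rpow_le_rpow_of_exponent_le (one_le_exp hC0) (by norm_num)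
      _ = _ := rpow_one _
  have t0 : ‖Complex.exp (deltaN2 N M g X j)‖ ≤ exp (Kd * (ρ ^ (3 / 2 : ℝ) * Fintype.card B)) := by
    rw [Complex.norm_exp]
    refine exp_le_exp.2 ((re_le_norm _).trans (hD.trans ?_))
    rw [mul_assoc]; gcongr
  have t1 := root (integral_nonneg fun x => prod_nonneg fun a _ => (exp_pos _).le)
    (by positivity) hA.2
  have t2 := root (integral_nonneg fun x => prod_nonneg fun a _ => (exp_pos _).le)
    (by positivity) hC.2
  have t3 := root (integral_nonneg fun x => prod_nonneg fun a _ => (exp_pos _).le)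
    (by positivity) hB.2
  have t2' : exp (Kc * ρ ^ 2 * Fintype.card B) ≤ exp (Kc * ρ ^ (3 / 2 : ℝ) * Fintype.card B) :=
    exp_le_exp.2 (by gcongr)
  have nn : ∀ {f : EuclideanSpace ℝ (B × Coord N) → ℝ}, (∀ x, 0 ≤ f x) →
      0 ≤ (∫ x, f x ∂(nuBlock N X)) ^ (1 / 4 : ℝ) := fun hf =>
    rpow_nonneg (integral_nonneg hf) _
  unfold INP
  calc _ ≤ exp (Kd * (ρ ^ (3 / 2 : ℝ) * Fintype.card B))
        * exp (Ka * ρ ^ (3 / 2 : ℝ) * Fintype.card B)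
        * exp (Kc * ρ ^ (3 / 2 : ℝ) * Fintype.card B)
        * exp (Kb * ρ ^ (3 / 2 : ℝ) * Fintype.card B) := by
        refine mul_le_mul (mul_le_mul (mul_le_mul t0 t1 ?_ (exp_pos _).le) (t2.trans t2') ?_
          (by positivity)) t3 ?_ (by positivity)
        · exact nn fun x => prod_nonneg fun a _ => (exp_pos _).le
        · exact nn fun x => prod_nonneg fun a _ => (exp_pos _).le
        · exact nn fun x => prod_nonneg fun a _ => (exp_pos _).le
    _ = _ := by rw [← exp_add, ← exp_add, ← exp_add]; congr 1; ring

end Blocks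

/-! ### An isolated node -/

section Single

variable {N M : ℕ}

theorem norm_exp_neg_sub_one_le (v : ℂ) : ‖Complex.exp (-v) - 1‖ ≤ ‖v‖ * exp ‖v‖ := by
  simpa using Complex.norm_exp_sub_sum_le_norm_mul_exp (-v) 1

theorem norm_exp_neg_sub_one_add_le (v : ℂ) : ‖Complex.exp (-v) - 1 + v‖ ≤ ‖v‖ ^ 2 * exp ‖v‖ := by
  have h := Complex.norm_exp_sub_sum_le_norm_mul_exp (-v) 2
  simp only [sum_range_succ, sum_range_zero, norm_neg] at h
  convert h using 2
  simp; ring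

/-- Second order expansion of `exp (-(v + W))` around `W = 0`, `v` being of higher order. -/
theorem norm_exp_neg_add_sub_one_add_le {v W : ℂ} {ρ r t P K Z : ℝ} (hρ : 0 < ρ) (hr : ρ ^ 2 ≤ r)
    (ht : 4 * ρ ≤ t) (hK : 0 ≤ K) (hZ : 0 ≤ Z) (hv : ‖v‖ ≤ K * r * P) (hW : ‖W‖ ≤ ρ * Z) :
    ‖Complex.exp (-(v + W)) - 1 + W‖
      ≤ r * (K * (P ^ 2 + exp (4 * ‖v‖)) + (K + 8 / t ^ 2) * exp (t * Z)) := by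
  have ht0 : 0 < t := by linarith
  have hr0 : 0 ≤ r := (sq_nonneg ρ).trans hr
  have e : Complex.exp (-(v + W)) - 1 + W
      = (Complex.exp (-v) - 1) * Complex.exp (-W) + (Complex.exp (-W) - 1 + W) := by
    rw [neg_add, Complex.exp_add]; ring
  have hWt : 4 * ‖W‖ ≤ t * Z := by nlinarith
  have hW2 : ‖W‖ ≤ t * Z / 2 := by linarith [norm_nonneg W]
  have h1 : ‖(Complex.exp (-v) - 1) * Complex.exp (-W)‖
      ≤ r * (K * (P ^ 2 + exp (4 * ‖v‖)) + K * exp (t * Z)) := by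
    have hX : exp ‖v‖ * exp ‖W‖ = exp (‖v‖ + ‖W‖) := (exp_add _ _).symm
    have hXX : exp (‖v‖ + ‖W‖) ^ 2 ≤ (exp (4 * ‖v‖) + exp (t * Z)) / 2 := by
      have h := exp_add_le_half (2 * ‖v‖) (2 * ‖W‖)
      rw [← exp_nat_mul]
      refine (le_of_eq (by congr 1; push_cast; ring)).trans (h.trans ?_)
      have : exp (2 * (2 * ‖W‖)) ≤ exp (t * Z) := exp_le_exp.2 (by linarith)
      rw [show 2 * (2 * ‖v‖) = 4 * ‖v‖ by ring]
      linarith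
    have h2 : P * exp (‖v‖ + ‖W‖) ≤ P ^ 2 + exp (4 * ‖v‖) + exp (t * Z) := by
      nlinarith [sq_nonneg (P - exp (‖v‖ + ‖W‖)), exp_pos (4 * ‖v‖), exp_pos (t * Z)]
    rw [norm_mul]
    calc _ ≤ (‖v‖ * exp ‖v‖) * exp ‖W‖ := by
          refine mul_le_mul (norm_exp_neg_sub_one_le v) ?_ (norm_nonneg _) (by positivity)
          rw [Complex.norm_exp]
          exact exp_le_exp.2 ((re_le_norm _).trans (norm_neg W).le)
      _ = ‖v‖ * exp (‖v‖ + ‖W‖) := by rw [mul_assoc, hX]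
      _ ≤ K * r * P * exp (‖v‖ + ‖W‖) := by gcongr
      _ = r * (K * (P * exp (‖v‖ + ‖W‖))) := by ring
      _ ≤ r * (K * (P ^ 2 + exp (4 * ‖v‖) + exp (t * Z))) := by gcongr
      _ = _ := by ring
  have h2 : ‖Complex.exp (-W) - 1 + W‖ ≤ r * (8 / t ^ 2 * exp (t * Z)) := by
    have hq : Z ^ 2 ≤ 8 / t ^ 2 * exp (t * Z / 2) := by
      have := quadratic_le_exp_of_nonneg (x := t * Z / 2) (by positivity)
      rw [div_mul_eq_mul_div, le_div_iff₀ (by positivity)]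
      have : 0 ≤ t * Z := by positivity
      nlinarith
    have hs : exp (t * Z / 2) * exp (t * Z / 2) = exp (t * Z) := by rw [← exp_add]; congr 1; ring
    calc _ ≤ ‖W‖ ^ 2 * exp ‖W‖ := norm_exp_neg_sub_one_add_le W
      _ ≤ (ρ * Z) ^ 2 * exp (t * Z / 2) := by gcongr
      _ = ρ ^ 2 * (Z ^ 2 * exp (t * Z / 2)) := by ring
      _ ≤ r * (8 / t ^ 2 * exp (t * Z / 2) * exp (t * Z / 2)) := by gcongr
      _ = _ := by rw [mul_assoc (8 / t ^ 2), hs]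
  rw [e]
  refine (norm_add_le _ _).trans ((add_le_add h1 h2).trans_eq (by ring))

theorem integrable_wick_quadQ0 (j : ℕ) :
    Integrable (fun x : Config N => wick (quadQ0 M j) (toField fun s => x s))
      (nuStd N) ∧
    ∫ x : Config N, wick (quadQ0 M j) (toField fun s => x s) ∂(nuStd N) = 0 := by
  simp only [wick_quadQ0_toField]
  have h0 := integrable_sum_sq (qF (N := N) M j)
  have e : ∀ x : Config N, ∑ s, qF M j s * (x s ^ 2 - 1)
      = ∑ s, qF M j s * x s ^ 2 - ∑ s, qF M j s := fun x => by
    rw [← sum_sub_distrib]; exact sum_congr rfl fun s _ => by ring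
  simp only [e]
  refine ⟨h0.sub (integrable_const _), ?_⟩
  rw [integral_sub (by exact h0) (integrable_const _), nuStd, integral_sum_sq, integral_const]
  simp

/-- The part of degree at most two of `V_j`. -/
noncomputable def VLe2 (M j : ℕ) (g : ℂ) (σ : MatField N) : ℂ :=
  lam g ^ 2 / 2 * ((wick (quadQ0 M j) σ : ℝ) : ℂ) + VTildeLe2 M j g σ

theorem integrable_VLe2 (hM : 2 ≤ M) (j : ℕ) (g : ℂ) :
    Integrable (fun x : Config N => VLe2 M j g (toField fun s => x s)) (nuStd N) ∧
    ∫ x : Config N, VLe2 M j g (toField fun s => x s) ∂(nuStd N) = 0 := by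
  simp only [VLe2, VTildeLe2_toField hM]
  have i1 := (integrable_wick_quadQ0 (N := N) (M := M) j).1.ofReal (𝕜 := ℂ)
  have i2 := (integrable_diagForm (N := N) (M := M) j).1.ofReal (𝕜 := ℂ)
  have i3 := integrable_yErr (N := N) hM j g
  have i4 := (integrable_diagLin (N := N) (M := M) j).1.ofReal (𝕜 := ℂ)
  have j3 := i3.sub (integrable_const
    (∫ z : Config N, yErr M j g (fun s => z s) ∂(nuStd N)))
  refine ⟨(i1.const_mul _).add (((i2.const_mul _).sub j3).sub (i4.const_mul _)), ?_⟩
  rw [integral_add (by exact i1.const_mul _) (by exact ((i2.const_mul _).sub j3).sub (i4.const_mul _)),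
    integral_sub (by exact (i2.const_mul _).sub j3) (by exact i4.const_mul _),
    integral_sub (by exact i2.const_mul _) (by exact j3), integral_sub (by exact i3) (integrable_const _),
    integral_const_mul, integral_const_mul, integral_const_mul, integral_complex_ofReal,
    integral_complex_ofReal, integral_complex_ofReal, (integrable_wick_quadQ0 j).2,
    (integrable_diagForm j).2, (integrable_diagLin j).2]
  simp

theorem measurable_wick_quadQ0 (j : ℕ) :
    Measurable fun x : Coord N → ℝ => wick (quadQ0 M j) (toField x) := by
  simp only [wick_quadQ0_toField]
  exact Continuous.measurable (by fun_prop)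

theorem integrable_exp_mul_abs {Ω : Type*} [MeasurableSpace Ω] {μ : Measure Ω} {f : Ω → ℝ} {C : ℝ}
    (hf : Measurable f) (t : ℝ)
    (h1 : Integrable (fun x => exp (t * f x)) μ ∧ ∫ x, exp (t * f x) ∂μ ≤ C)
    (h2 : Integrable (fun x => exp (-t * f x)) μ ∧ ∫ x, exp (-t * f x) ∂μ ≤ C) :
    Integrable (fun x => exp (t * |f x|)) μ ∧ ∫ x, exp (t * |f x|) ∂μ ≤ 2 * C := by
  have hd : ∀ x, exp (t * |f x|) ≤ exp (t * f x) + exp (-t * f x) := fun x => by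
    rcases abs_choice (f x) with h | h <;> rw [h]
    · linarith [exp_pos (-t * f x)]
    · rw [mul_neg, ← neg_mul]; linarith [exp_pos (t * f x)]
  obtain ⟨hi, he⟩ := integrable_exp_of_le ((continuous_abs.measurable.comp hf).const_mul t)
    (h1.1.add h2.1) hd
  refine ⟨hi, he.trans ?_⟩
  rw [integral_add' h1.1 h2.1]; linarith [h1.2, h2.2]

set_option maxHeartbeats 1000000 in
/-- `V_j^{≤ 2}` is of order `ρ`, with a small exponential moment. -/
theorem exists_norm_VLe2_le (hM : 2 ≤ M) : ∃ t C : ℝ, 0 < t ∧ 0 < C ∧ ∀ N j : ℕ,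
    ∃ Z : Config N → ℝ, (∀ x, 0 ≤ Z x) ∧
      (∀ ρ : ℝ, 0 < ρ → ρ ≤ 1 → ∀ g ∈ cardioid ρ, ∀ x,
        ‖VLe2 M j g (toField fun s => x s)‖ ≤ ρ * Z x) ∧
      Integrable (fun x => exp (t * Z x)) (nuStd N) ∧
      ∫ x, exp (t * Z x) ∂(nuStd N) ≤ C := by
  obtain ⟨K, hK, hb⟩ := exists_norm_yErr_sub_le hM
  obtain ⟨Ky, hKy, hy⟩ := exists_integral_exp_yF_le hM
  obtain ⟨Kd, hKd, hd⟩ := exists_integral_exp_diag_le hM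
  obtain ⟨Kq, hKq, hq1, hq2⟩ := exists_qF_bounds hM
  set L : ℝ := 1 + 16 * K + 4 * Kd + 8 * Kq with hL
  have hLpos : 0 < L := by positivity
  set t : ℝ := 1 / L with ht
  have ht0 : 0 < t := by positivity
  have htL : t * L = 1 := by rw [ht]; field_simp
  have ht1 : t ≤ 1 := by rw [ht, div_le_one hLpos]; linarith
  have htK : t * (16 * K) ≤ 1 := by rw [← htL]; gcongr; linarith
  have htd : t * (4 * Kd) ≤ 1 := by rw [← htL]; gcongr; linarith
  have htq : t * (8 * Kq) ≤ 1 := by rw [← htL]; gcongr; linarith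
  set C1 := exp (2 * (4 * Kq))
  set C2 := exp (Kd * 16)
  set C3 := exp (1 + Ky)
  refine ⟨t, 2 * C1 + 4 * C2 ^ 2 + C3, ht0, by positivity, fun N j => ?_⟩
  have hR := one_le_scale hM j
  set Z : Config N → ℝ := fun x => (|wick (quadQ0 M j) (toField fun s => x s)| / 2
    + |diagForm M j fun s => x s| / 2)
    + (|diagLin M j fun s => x s| + K * (1 + yF M j fun s => x s)) with hZ
  refine ⟨Z, fun x => ?_, ?_, ?_⟩
  · have := yF_nonneg hM j fun s => x s
    positivity
  · intro ρ hρ hρ1 g hg x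
    obtain ⟨a1, a2, a3⟩ := hb ρ hρ hρ1 g hg
    have h3 := a3 N j fun s => x s
    have hyn := yF_nonneg hM j fun s => x s
    have hρ2 : ρ ^ 2 ≤ ρ := by nlinarith
    simp only [hZ]
    rw [VLe2, VTildeLe2_toField hM]
    refine (norm_add_le _ _).trans ((add_le_add le_rfl ((norm_sub_le _ _).trans
      (add_le_add (norm_sub_le _ _) le_rfl))).trans ?_)
    rw [norm_mul, norm_mul, norm_mul _ (diagLin M j _ : ℂ), norm_real, norm_real,
      norm_real, norm_div, norm_eq_abs, norm_eq_abs, norm_eq_abs]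
    have e2 : ‖(2 : ℂ)‖ = 2 := by simp
    rw [e2]
    have c1 : ‖lam g ^ 2‖ / 2 * |wick (quadQ0 M j) (toField fun s => x s)|
        ≤ ρ / 2 * |wick (quadQ0 M j) (toField fun s => x s)| := by gcongr
    have c2 : ‖lam g ^ 2‖ / 2 * |diagForm M j fun s => x s|
        ≤ ρ / 2 * |diagForm M j fun s => x s| := by gcongr
    have c3 : ‖Complex.I * lam g ^ 5‖ * |diagLin M j fun s => x s|
        ≤ ρ * |diagLin M j fun s => x s| := by gcongr
    have c4 : K * ρ ^ 2 * (1 + yF M j fun s => x s) ≤ K * ρ * (1 + yF M j fun s => x s) := by gcongr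
    linarith
  have hwick : ∀ s : ℝ, |s| = 2 * t →
      Integrable (fun x : Config N =>
        exp (s * wick (quadQ0 M j) (toField fun s => x s))) (nuStd N) ∧
      ∫ x : Config N, exp (s * wick (quadQ0 M j) (toField fun s => x s))
        ∂(nuStd N) ≤ C1 := by
    intro s hs
    have hqb : ∀ c : Coord N, qF M j c ≤ Kq := fun c => by
      refine (hq1 N j c).trans (?_)
      exact mul_le_of_le_one_right hKq.le (pow_le_one₀ (by norm_num) (by norm_num))
    have h := integral_exp_diagonal_le (fun c : Coord N => s * qF M j c) fun c => by
      rw [abs_mul, hs, abs_of_nonneg (qF_nonneg hM j c)]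
      have := hqb c
      nlinarith
    have e : ∀ x : Config N, ∑ c, s * qF M j c * (x c ^ 2 - 1)
        = s * wick (quadQ0 M j) (toField fun s => x s) := fun x => by
      rw [wick_quadQ0_toField, mul_sum]; exact sum_congr rfl fun c _ => by ring
    simp only [e] at h
    refine ⟨h.1, h.2.trans (exp_le_exp.2 ?_)⟩
    have hs2 : ∀ c : Coord N, (s * qF M j c) ^ 2 = (2 * t) ^ 2 * (qF M j c * qF M j c) := fun c => by
      rw [← hs, sq_abs]; ring
    simp only [hs2]
    rw [← mul_sum, ← traceQ0Q0_eq]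
    have h2 : traceQ0Q0 N M j j ≤ Kq := by
      have := hq2 N j j
      simp only [Nat.sub_self, add_zero, pow_zero, mul_one] at this
      exact this
    have : (2 * t) ^ 2 ≤ 4 := by nlinarith
    have := traceQ0Q0_nonneg (N := N) hM j j
    gcongr
  have hdiag : ∀ a b : ℝ, |a| ≤ 2 * t → |b| ≤ 4 * t →
      Integrable (fun x : Config N =>
        exp (a * diagForm M j (fun s => x s) + b * diagLin M j (fun s => x s))) (nuStd N) ∧
      ∫ x : Config N, exp (a * diagForm M j (fun s => x s)
        + b * diagLin M j (fun s => x s)) ∂(nuStd N) ≤ C2 ^ 2 := by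
    intro a b ha hb
    obtain ⟨h1, h2⟩ := hd N j a b (by
      calc Kd * |a| ≤ Kd * (2 * t) := by gcongr
        _ ≤ 1 := by linarith [mul_pos ht0 hKd]
        _ ≤ _ := hR)
    refine ⟨h1, h2.trans ?_⟩
    rw [← exp_nat_mul]
    refine exp_le_exp.2 ?_
    have a2 : a ^ 2 ≤ 4 := by rw [← sq_abs]; nlinarith [abs_nonneg a]
    have b2 : b ^ 2 ≤ 16 := by rw [← sq_abs]; nlinarith [abs_nonneg b]
    calc Kd * (a ^ 2 + b ^ 2) * ((M : ℝ) ^ j) ^ (-(1 / 2) : ℝ) ≤ Kd * (4 + 16) * 1 := by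
          gcongr
          exact rpow_le_one_of_one_le_of_nonpos hR (by norm_num)
      _ ≤ _ := by push_cast; linarith
  obtain ⟨iW, eW⟩ := integrable_exp_mul_abs (measurable_ofLp_comp (measurable_wick_quadQ0 (M := M) j))
    (2 * t) (hwick _ (abs_of_pos (by positivity)))
    (hwick _ (by rw [abs_neg]; exact abs_of_pos (by positivity)))
  have hF := fun a ha => by simpa only [zero_mul, add_zero] using hdiag a 0 ha (by simp; positivity)
  have hL' := fun a => by simpa only [zero_mul, zero_add] using hdiag 0 a (by simp; positivity)
  obtain ⟨iF, eF⟩ := integrable_exp_mul_abs (μ := nuStd N)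
    (measurable_ofLp_comp (continuous_diagForm (M := M) j).measurable) (2 * t)
    (hF _ (abs_of_pos (by positivity)).le) (hF _ (by rw [abs_neg]; exact (abs_of_pos (by positivity)).le))
  obtain ⟨iL, eL⟩ := integrable_exp_mul_abs (μ := nuStd N)
    (measurable_ofLp_comp (continuous_diagLin (M := M) j).measurable) (4 * t)
    (hL' _ (abs_of_pos (by positivity)).le) (hL' _ (by rw [abs_neg]; exact (abs_of_pos (by positivity)).le))
  obtain ⟨iY, eY⟩ := hy N j (4 * t * K) (by positivity) (by
    have := one_le_rpow hR (by norm_num : (0 : ℝ) ≤ 7 / 4)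
    linarith)
  have eY' : exp (4 * t * K) * ∫ x : Config N,
      exp (4 * t * K * yF M j fun s => x s) ∂(nuStd N) ≤ C3 := by
    refine (mul_le_mul_of_nonneg_left eY (exp_pos _).le).trans ?_
    rw [← exp_add]
    refine exp_le_exp.2 ?_
    nlinarith
  have hdom : ∀ x : Config N, exp (t * Z x)
      ≤ (exp (2 * t * |wick (quadQ0 M j) (toField fun s => x s)|)
          + exp (2 * t * |diagForm M j fun s => x s|))
        + (exp (4 * t * |diagLin M j fun s => x s|)
          + exp (4 * t * K) * exp (4 * t * K * yF M j fun s => x s)) := by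
    intro x
    have key : ∀ a b c d : ℝ, exp (t * ((a / 2 + b / 2) + (c + d)))
        ≤ (exp (2 * t * a) + exp (2 * t * b))
          + (exp (4 * t * c) + exp (4 * t * d)) := fun a b c d => by
      have h1 := exp_add_le_half (t * (a / 2 + b / 2)) (t * (c + d))
      have h2 := exp_add_le_half (t * a) (t * b)
      have h3 := exp_add_le_half (2 * (t * c)) (2 * (t * d))
      rw [← mul_add] at h1
      rw [show 2 * (t * (a / 2 + b / 2)) = t * a + t * b by ring,
        show 2 * (t * (c + d)) = 2 * (t * c) + 2 * (t * d) by ring] at h1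
      rw [← mul_assoc 2 2, ← mul_assoc 2 2, show (2 : ℝ) * 2 = 4 by norm_num] at h3
      simp only [mul_assoc] at h1 h2 h3 ⊢
      linarith [exp_pos (2 * (t * a)), exp_pos (2 * (t * b)), exp_pos (4 * (t * c)),
        exp_pos (4 * (t * d))]
    refine (key _ _ _ _).trans_eq ?_
    rw [← exp_add (4 * t * K)]
    congr 3; ring
  have hdi := (iW.add iF).add (iL.add (iY.const_mul (exp (4 * t * K))))
  have hm : Measurable Z := by
    have m1 := measurable_ofLp_comp (measurable_wick_quadQ0 (N := N) (M := M) j)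
    have m2 := measurable_ofLp_comp (continuous_diagForm (N := N) (M := M) j).measurable
    have m3 := measurable_ofLp_comp (continuous_diagLin (N := N) (M := M) j).measurable
    have m4 := measurable_ofLp_comp (continuous_yF (N := N) (M := M) j).measurable
    exact (((continuous_abs.measurable.comp m1).div_const 2).add
      ((continuous_abs.measurable.comp m2).div_const 2)).add
      ((continuous_abs.measurable.comp m3).add ((m4.const_add 1).const_mul K))
  obtain ⟨hi, he⟩ := integrable_exp_of_le (hm.const_mul t) hdi hdom
  refine ⟨hi, he.trans ?_⟩
  rw [integral_add' (iW.add iF) (iL.add (iY.const_mul _)), integral_add' iW iF,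
    integral_add' iL (iY.const_mul _), integral_const_mul]
  linarith

set_option maxHeartbeats 1000000 in
/-- The amplitude of an isolated node. -/
theorem exists_integral_exp_V_le (hM : 2 ≤ M) : ∃ ρ₁ K : ℝ, 0 < ρ₁ ∧ ρ₁ ≤ 1 ∧ 0 < K ∧
    ∀ ρ : ℝ, 0 < ρ → ρ ≤ ρ₁ → ∀ g ∈ cardioid ρ, ∀ N j : ℕ,
      Integrable (fun x : Config N =>
        Complex.exp (-V M j g (toField fun s => x s)) - 1) (nuStd N) ∧
      ‖∫ x : Config N, (Complex.exp (-V M j g (toField fun s => x s)) - 1)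
        ∂(nuStd N)‖ ≤ K * ρ ^ (3 / 2 : ℝ) := by
  obtain ⟨ρ₀, K, hρ₀, hρ₀1, hK, hV⟩ := exists_norm_VGe3_le hM
  obtain ⟨ρ₂, K2, hρ₂, -, hK2, h2⟩ := exists_integral_exp_VGe3_le hM one_pos
  obtain ⟨Kp, hKp, hp⟩ := exists_integral_polynomial_le hM
  obtain ⟨t, C, ht, hC, hZ⟩ := exists_norm_VLe2_le hM
  refine ⟨min (min ρ₀ ρ₂) (t / 4), K * (Kp + exp K2) + (K + 8 / t ^ 2) * C, by positivity,
    (min_le_left _ _).trans ((min_le_left _ _).trans hρ₀1), by positivity,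
    fun ρ hρ hρ1 g hg N j => ?_⟩
  have hρ0 : ρ ≤ ρ₀ := hρ1.trans ((min_le_left _ _).trans (min_le_left _ _))
  have hρt : 4 * ρ ≤ t := by linarith [hρ1.trans (min_le_right _ _)]
  have hρone := hρ0.trans hρ₀1
  have hρ32 := sq_le_rpow_three_halves hρ hρone
  obtain ⟨Z, hZ0, hZW, iZ, eZ⟩ := hZ N j
  obtain ⟨iP, eP⟩ := hp N j
  obtain ⟨i3, e3⟩ := h2 ρ hρ (hρ1.trans ((min_le_left _ _).trans (min_le_right _ _))) g hg N j 1
    zero_le_one (by rw [one_mul]; exact one_le_rpow (one_le_scale hM j) (by norm_num))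
  simp only [mul_one] at i3 e3
  have e3' := e3.trans (exp_le_exp.2 (mul_le_of_le_one_right hK2.le
    (rpow_le_one hρ.le hρone (by norm_num))))
  obtain ⟨iW, eW⟩ := integrable_VLe2 (N := N) hM j g
  have hVV : ∀ σ : MatField N, V M j g σ = VGe3 M j g σ + VLe2 M j g σ := fun σ => by
    rw [V, VLe2, add_assoc]
  have hm : Measurable fun x : Coord N → ℝ => V M j g (toField x) := by
    have m := (Complex.measurable_ofReal.comp (measurable_wick_quadQ0 (N := N) (M := M) j)).const_mul
      (lam g ^ 2 / 2)
    exact ((measurable_VGe3 j g).add m).add (measurable_VTildeLe2 hM j g)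
  set D : Config N → ℂ := fun x => Complex.exp (-V M j g (toField fun s => x s)) - 1
    + VLe2 M j g (toField fun s => x s) with hD
  have hb : ∀ x, ‖D x‖ ≤ ρ ^ (3 / 2 : ℝ) * (K * (((1 + yF M j fun s => x s)
      * (1 + gF M j fun s => x s)) ^ 2 + exp (4 * ‖VGe3 M j g (toField fun s => x s)‖))
      + (K + 8 / t ^ 2) * exp (t * Z x)) := fun x => by
    simp only [hD, hVV]
    exact norm_exp_neg_add_sub_one_add_le hρ hρ32 hρt hK.le (hZ0 x)
      (hV ρ hρ hρ0 g hg N j _ (toField_isHermitian _)).2.1 (hZW ρ hρ hρone g hg x)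
  have iB := ((((iP.add i3).const_mul K).add (iZ.const_mul (K + 8 / t ^ 2))).const_mul
    (ρ ^ (3 / 2 : ℝ)))
  have mexp : AEStronglyMeasurable (fun x : Config N =>
      Complex.exp (-V M j g (toField fun s => x s)) - 1) (nuStd N) :=
    ((Complex.measurable_exp.comp (measurable_ofLp_comp hm).neg).sub_const 1).aestronglyMeasurable
  have iD : Integrable D (nuStd N) :=
    iB.mono' (mexp.add iW.aestronglyMeasurable) (Eventually.of_forall hb)
  have eD : ∀ x : Config N, Complex.exp (-V M j g (toField fun s => x s)) - 1
      = D x - VLe2 M j g (toField fun s => x s) := fun x => by rw [hD]; ring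
  simp only [eD]
  refine ⟨iD.sub iW, ?_⟩
  rw [integral_sub iD iW, eW, sub_zero]
  refine (norm_integral_le_of_norm_le iB (Eventually.of_forall hb)).trans ?_
  rw [integral_const_mul, integral_add' ((iP.add i3).const_mul K) (iZ.const_mul _),
    integral_const_mul, integral_const_mul, integral_add' iP i3, mul_comm]
  gcongr

/-- The amplitude of an isolated node, with a counterterm. -/
theorem exists_integral_exp_delta_V_le (hM : 2 ≤ M) : ∃ ρ₁ K : ℝ, 0 < ρ₁ ∧ 0 < K ∧
    ∀ ρ : ℝ, 0 < ρ → ρ ≤ ρ₁ → ∀ g ∈ cardioid ρ, ∀ N j : ℕ,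
      Integrable (fun x : Config N =>
        Complex.exp (-V M j g (toField fun s => x s)) - 1) (nuStd N) ∧
      ‖∫ x : Config N, (Complex.exp (-V M j g (toField fun s => x s)) - 1)
        ∂(nuStd N)‖ ≤ K * ρ ^ (3 / 2 : ℝ) ∧
      ‖∫ x : Config N, (Complex.exp (-(lam g ^ 4 / 4) * traceQ0Q0 N M j j
        - V M j g (toField fun s => x s)) - 1) ∂(nuStd N)‖ ≤ K * ρ ^ (3 / 2 : ℝ) := by
  obtain ⟨ρ₁, K, hρ₁, hρ₁1, hK, h⟩ := exists_integral_exp_V_le hM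
  obtain ⟨Kq, hKq, -, hq⟩ := exists_qF_bounds hM
  refine ⟨ρ₁, exp Kq * (K + Kq), hρ₁, by positivity, fun ρ hρ hρ1 g hg N j => ?_⟩
  have hρone := hρ1.trans hρ₁1
  have hρ32 := sq_le_rpow_three_halves hρ hρone
  obtain ⟨i1, e1⟩ := h ρ hρ hρ1 g hg N j
  have hE : 1 ≤ exp Kq := one_le_exp hKq.le
  have hr : 0 < ρ ^ (3 / 2 : ℝ) := rpow_pos_of_pos hρ _
  refine ⟨i1, e1.trans ?_, ?_⟩
  · gcongr
    nlinarith
  set d : ℂ := -(lam g ^ 4 / 4) * traceQ0Q0 N M j j with hd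
  have hdn : ‖d‖ ≤ Kq * ρ ^ 2 := by
    have h1 := norm_lam_pow_four_le hρ hg
    have h2 := hq N j j
    have h3 := traceQ0Q0_nonneg (N := N) hM j j
    simp only [Nat.sub_self, add_zero, pow_zero, mul_one] at h2
    rw [hd, norm_mul, norm_neg, norm_div, norm_real, norm_of_nonneg h3, mul_comm]
    refine mul_le_mul h2 ?_ (by positivity) hKq.le
    simp only [Complex.norm_ofNat]
    linarith [norm_nonneg (lam g ^ 4)]
  have hd1 : ‖d‖ ≤ Kq := hdn.trans (mul_le_of_le_one_right hKq.le (pow_le_one₀ hρ.le hρone))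
  have e : ∀ x : Config N, Complex.exp (d - V M j g (toField fun s => x s)) - 1
      = Complex.exp d * (Complex.exp (-V M j g (toField fun s => x s)) - 1)
        + (Complex.exp d - 1) := fun x => by rw [sub_eq_add_neg d, Complex.exp_add]; ring
  simp only [e]
  rw [integral_add (i1.const_mul _) (integrable_const _), integral_const_mul, integral_const]
  simp only [probReal_univ, one_smul]
  have hexp : ‖Complex.exp d‖ ≤ exp Kq := by
    rw [Complex.norm_exp]
    exact exp_le_exp.2 ((re_le_norm _).trans hd1)
  have hexp1 : ‖Complex.exp d - 1‖ ≤ Kq * ρ ^ (3 / 2 : ℝ) * exp Kq := by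
    have := norm_exp_neg_sub_one_le (-d)
    rw [neg_neg, norm_neg] at this
    refine this.trans (mul_le_mul (hdn.trans ?_) (exp_le_exp.2 hd1) (exp_pos _).le (by positivity))
    gcongr
  refine (norm_add_le _ _).trans ?_
  rw [norm_mul]
  refine (add_le_add (mul_le_mul hexp e1 (norm_nonneg _) (exp_pos _).le) hexp1).trans_eq ?_
  ring

end Single

end TensorT44

open TensorT44 in
theorem mainTheorem2 (M : ℕ) (hM : 2 ≤ M) :
    ∃ ρ₀ K₁ K₂ : ℝ, 0 < ρ₀ ∧ 0 < K₁ ∧ 0 < K₂ ∧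
      ∀ ρ : ℝ, 0 < ρ → ρ ≤ ρ₀ → ∀ g ∈ cardioid ρ, ∀ jmax : ℕ,
        -- blocks with at least two nodes
        (∀ (B : Type) [Fintype B] [DecidableEq B] (T : SimpleGraph B) (hT : T.IsTree)
          (w : Sym2 B → ℝ) (j : B → ℕ),
          2 ≤ Fintype.card B →
          (∀ e ∈ T.edgeSet, w e ∈ Set.Icc (0 : ℝ) 1) →
          Function.Injective j → (∀ a, 1 ≤ j a ∧ j a ≤ jmax) →
          ∀ s ∈ ({1, -1} : Set ℝ),
            Integrable (expVGe3 M g j) (nuBlock (M ^ jmax) (interpX hT w)) ∧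
            Integrable (expQ0 M g s j) (nuBlock (M ^ jmax) (interpX hT w)) ∧
            Integrable (expVTilde M g j) (nuBlock (M ^ jmax) (interpX hT w)) ∧
            INP (M ^ jmax) M g s (interpX hT w) j
              ≤ K₁ * Real.exp (K₂ * ρ ^ (3 / 2 : ℝ) * Fintype.card B)) ∧
        -- a single isolated node, without and with the counterterm left by the auxiliary field
        (∀ j : ℕ, 1 ≤ j → j ≤ jmax →
          Integrable (fun x => Complex.exp (-V M j g (toField fun s => x s)) - 1)
            (nuStd (M ^ jmax)) ∧
          ‖∫ x, (Complex.exp (-V M j g (toField fun s => x s)) - 1) ∂(nuStd (M ^ jmax))‖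
            ≤ K₁ * ρ ^ (3 / 2 : ℝ) ∧
          ‖∫ x, (Complex.exp (-(lam g ^ 4 / 4) * traceQ0Q0 (M ^ jmax) M j j
              - V M j g (toField fun s => x s)) - 1) ∂(nuStd (M ^ jmax))‖
            ≤ K₁ * ρ ^ (3 / 2 : ℝ)) := by
  obtain ⟨ρ₁, Ka, hρ₁, hKa, ha⟩ := exists_INP_le hM
  obtain ⟨ρ₂, Kb, hρ₂, hKb, hb⟩ := exists_integral_exp_delta_V_le hM
  refine ⟨min ρ₁ ρ₂, max 1 Kb, Ka, by positivity, by positivity, hKa,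
    fun ρ hρ hρ0 g hg jmax => ⟨?_, ?_⟩⟩
  · intro B _ _ T hT w j _ hw hj _ s hs
    obtain ⟨h1, h2, h3, h4⟩ := ha ρ hρ (hρ0.trans (min_le_left _ _)) g hg (M ^ jmax) B T hT w j
      hw hj s hs
    exact ⟨h1, h2, h3, h4.trans (le_mul_of_one_le_left (Real.exp_pos _).le (le_max_left _ _))⟩
  · intro j _ _
    obtain ⟨h1, h2, h3⟩ := hb ρ hρ (hρ0.trans (min_le_right _ _)) g hg (M ^ jmax) j
    have h : Kb * ρ ^ (3 / 2 : ℝ) ≤ max 1 Kb * ρ ^ (3 / 2 : ℝ) :=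
      mul_le_mul_of_nonneg_right (le_max_right _ _) (Real.rpow_nonneg hρ.le _)
    exact ⟨h1, h2.trans h, h3.trans h⟩
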